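/- A \emph{web} is a finite plane graph $\Gamma$ (considered up to isotopy of the plane; vertexless circles and the empty graph are allowed) whose edges carry a thickness in $\{1,2\}$ and whose vertices are trivalent with three $2$-edges ($222$-vertices), trivalent with one $2$-edge and two $1$-edges ($112$-vertices), or bivalent with two $2$-edges (\emph{defects}). A \emph{coloring} assigns to every $i$-edge an $i$-element subset of $\{1,2,3,4\}$ such that at a $112$-vertex the color of the $2$-edge is the union of the colors of the two $1$-edges, at a $222$-vertex the three colors are the three two-element subsets of a three-element set, and at a defect the two colors are complementary. The \emph{Tait number} $t_4(\Gamma)$ is the number of colorings. Consider the following relations for a function $f$ from webs to $\mathbb{Z}$. A local relation is between the values of $f$ on webs that agree outside a disc and whose parts in the disc are as described. "Legs" are the edges meeting the boundary of the disc. For four legs their ends are at the top left (TL), bottom left (BL), bottom right (BR) and top right (TR). $V$ (resp. $H$) means that TL and TR meet at a vertex, BL and BR meet at a vertex (resp. TL and BL, BR and TR), and these two vertices are joined by an edge; $\|$ means two disjoint arcs TL--BL, BR--TR, and $=$ means two disjoint arcs TL--TR, BL--BR. (A) $f(\emptyset)=1$ and $f(\Gamma_1\sqcup\Gamma_2)=f(\Gamma_1)f(\Gamma_2)$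 for every disjoint union of webs in the plane. A $1$-circle, a $2$-circle, and a $2$-circle with one defect have values $4$, $6$, $0$. A $1$-edge loop attached to a $2$-edge gives $0$. Two consecutive defects on a $2$-edge cancel. A defect on one leg of a $222$-vertex may be moved to another leg. A digon with two $1$-edges (resp. two $2$-edges) between two $2$-legs equals $2$ (resp. $4$) times a $2$-edge; a digon with a $1$-edge and a $2$-edge between two $1$-legs equals $3$ times a $1$-edge, and equals $0$ if its $2$-edge carries a defect. With four $1$-legs, $V$ and $H$ with a $2$-edge in the middle carrying one defect are equal. A triangle of $1$-edges (resp. $2$-edges) with three $2$-legs equals $1$ (resp. $2$) times a $222$-vertex; a triangle with sides $1,1,2$ (resp. $2,2,1$), with the $2$-side (resp. the $1$-side) opposite to the one $2$-leg, equals $1$ (resp. $2$) times a $112$-vertex. For square faces: (i) for legs TL, BL thin and BR, TR thick, the square with thick left side and three thin sides equals ($V$ with thin middle edge and a defect on both thick legs) $+$ $\|$; (ii) for the same legs, the square with thin left side and three thick sides equals the square of (i) $+$ ($V$ with thin middle edge, no defects); (iii) for four thin legs, the square with thick top and bottom and thin left and right sides equals $\|+2\,(=)$; (iv) for legs TL,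 BR thick and BL, TR thin, the square with thin left and top sides and thick right and bottom sides equals $H+V$, both with thin middle edge and a defect on both thick legs; (v) for four thick legs, the square with all sides thick equals $2\,[\,\|\,+\,(=)\,+\,\|'\,+\,(=)'\,]$, where the prime means that each of the two arcs carries one defect. (B) (1) For four thin legs, $V+(=)\;=\;H+\|$, where $V$ and $H$ have a thick middle edge. (2) For legs TL, BL thin and BR, TR thick: ($V$ with thin middle edge, no defects) $+$ ($V$ with thin middle edge and a defect on both thick legs) $=\ \|\ +$ ($H$ with thick middle edge, no defects). (3) For legs TL, BR thick and BL, TR thin: $H_{TL}+H_{BR}=V_{TL}+V_{BR}$, where the middle edges are thin and the index is the one leg that carries a defect. Theorem. The relations (A) and (B) hold for $t_4$ and determine it completely: if a function $f$ from webs to $\mathbb{Z}$ satisfies all relations (A) and (B), then $f(\Gamma)=t_4(\Gamma)$ for every web $\Gamma$. -/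

import Mathlib

open Equiv

/-! ### Plane maps -/

/-- A combinatorial description of a plane graph (up to isotopy of the plane).
`X` is the set of darts (half-edges); `rot x` is the next dart counterclockwise around the base
vertex of `x`; `opp x` is the other half of the edge of `x`.  `region` is an equivalence relation
on `Option X`: the class of `some x` is the connected component of the complement of the graph that
lies to the left of `x` (directed away from its base vertex), and the class of `none` is the
unbounded component.  So `region` records the outer region and how the connected components of
the graph are nested.  The data come from a graph drawn in the plane iff
* walking along the left side of an edge one stays in the same region,
* any two regions are linked through regions and connected components of the graph, and
* Euler's formula `V - E + R = 1 + C` holds (vertices, edges, regions, graph components). -/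
structure IsPlaneMap {X : Type} (rot opp : Perm X) (region : Setoid (Option X)) : Prop where
  face : ∀ x, region (some x) (some (rot.symm (opp x)))
  linked : ∀ a b : Option X, Relation.EqvGen
    (fun a b => region a b ∨ ∃ x, a = some x ∧ (b = some (rot x) ∨ b = some (opp x))) a b
  euler : (Nat.card (Quot fun x y : X => y = rot x) : ℤ)
      - Nat.card (Quot fun x y : X => y = opp x) + Nat.card (Quotient region)
    = 1 + Nat.card (Quot fun x y : X => y = rot x ∨ y = opp x)

/-! ### Webs -/

def IsBivalent {X : Type} (rot : Perm X) (d : X) : Prop :=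
  rot d ≠ d ∧ rot (rot d) = d

def IsTrivalent {X : Type} (rot : Perm X) (d : X) : Prop :=
  rot d ≠ d ∧ rot (rot (rot d)) = d

/-- The vertices that occur in a web diagram.  `thick x = true` means that the edge of `x` is a
`2`-edge, `false` that it is a `1`-edge.  A bivalent vertex is either a defect (`defect = true`,
between two `2`-edges) or just a marked ordinary point of an edge (`defect = false`);
a trivalent vertex is of type `222` or `112`. -/
def IsWebVertex {X : Type} (rot : Perm X) (thick defect : X → Bool) (d : X) : Prop :=
  (IsBivalent rot d ∧ defect (rot d) = defect d ∧ thick (rot d) = thick d ∧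
      (defect d = true → thick d = true)) ∨
  (IsTrivalent rot d ∧ defect d = false ∧
    ((thick d = true ∧ thick (rot d) = true ∧ thick (rot (rot d)) = true) ∨
     (thick d = true ∧ thick (rot d) = false ∧ thick (rot (rot d)) = false) ∨
     (thick d = false ∧ thick (rot d) = true ∧ thick (rot (rot d)) = false) ∨
     (thick d = false ∧ thick (rot d) = false ∧ thick (rot (rot d)) = true)))

instance {X : Type} [DecidableEq X] (rot : Perm X) (thick defect : X → Bool) (d : X) :
    Decidable (IsWebVertex rot thick defect d) := by
  unfold IsWebVertex IsBivalent IsTrivalent; infer_instance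

/-- A web diagram: a web in which finitely many ordinary points of edges may be marked as
additional bivalent vertices.  (Every vertexless circle carries at least one such point, so that
it has darts.)  A web is a diagram satisfying `IsPlane`, up to isomorphism and up to
adding or removing marked points. -/
structure WebDiagram where
  Dart : Type
  finite : Finite Dart
  rot : Perm Dart
  opp : Perm Dart
  region : Setoid (Option Dart)
  thick : Dart → Bool
  defect : Dart → Bool
  opp_opp : ∀ d, opp (opp d) = d
  opp_ne : ∀ d, opp d ≠ d
  thick_opp : ∀ d, thick (opp d) = thick d
  vertex : ∀ d, IsWebVertex rot thick defect d

namespace WebDiagram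

def IsPlane (Γ : WebDiagram) : Prop := IsPlaneMap Γ.rot Γ.opp Γ.region

/-- Two diagrams are isomorphic iff there is an orientation preserving homeomorphism of the plane
carrying one to the other. -/
def Isomorphic (Γ Γ' : WebDiagram) : Prop :=
  ∃ e : Γ.Dart ≃ Γ'.Dart,
    (∀ d, e (Γ.rot d) = Γ'.rot (e d)) ∧ (∀ d, e (Γ.opp d) = Γ'.opp (e d)) ∧
    (∀ d, Γ'.thick (e d) = Γ.thick d) ∧ (∀ d, Γ'.defect (e d) = Γ.defect d) ∧
    (∀ a b, Γ'.region (a.map e) (b.map e) ↔ Γ.region a b)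

open Classical in
/-- The edge involution after the edge of `d` has been subdivided; the new darts are `inr false`,
joined to `d`, and `inr true`, joined to `opp d`. -/
noncomputable def subdivideOpp (Γ : WebDiagram) (d : Γ.Dart) : Γ.Dart ⊕ Bool → Γ.Dart ⊕ Bool
  | .inl e => if e = d then .inr false else if e = Γ.opp d then .inr true else .inl (Γ.opp e)
  | .inr false => .inl d
  | .inr true => .inl (Γ.opp d)

theorem subdivideOpp_involutive (Γ : WebDiagram) (d : Γ.Dart) :
    Function.Involutive (Γ.subdivideOpp d) := by
  have hne := Γ.opp_ne d
  rintro (e | (_ | _))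
  · by_cases h1 : e = d
    · simp [subdivideOpp, h1]
    · by_cases h2 : e = Γ.opp d
      · simp [subdivideOpp, h2, hne]
      · have h3 : Γ.opp e ≠ d := fun h => h2 (by rw [← h, Γ.opp_opp])
        have h4 : Γ.opp e ≠ Γ.opp d := fun h => h1 (Γ.opp.injective h)
        simp [subdivideOpp, h1, h2, h3, Γ.opp_opp]
  · simp [subdivideOpp]
  · simp [subdivideOpp, hne]

/-- Mark one more ordinary point, on the edge of `d`. -/
noncomputable def subdivide (Γ : WebDiagram) (d : Γ.Dart) : WebDiagram where
  Dart := Γ.Dart ⊕ Bool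
  finite := by have := Γ.finite; infer_instance
  rot := Equiv.sumCongr Γ.rot Equiv.boolNot
  opp := (Γ.subdivideOpp_involutive d).toPerm
  region := Γ.region.comap
    (Option.map (Sum.elim id (fun b => if b then d else Γ.opp d)))
  thick := Sum.elim Γ.thick (fun _ => Γ.thick d)
  defect := Sum.elim Γ.defect (fun _ => false)
  opp_opp := Γ.subdivideOpp_involutive d
  opp_ne := by
    rintro (e | (_ | _))
    · simp only [Function.Involutive.coe_toPerm, subdivideOpp]
      split_ifs <;> simp [Γ.opp_ne]
    · simp [subdivideOpp]
    · simp [subdivideOpp]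
  thick_opp := by
    rintro (e | (_ | _))
    · simp only [Function.Involutive.coe_toPerm, subdivideOpp]
      split_ifs with h1 h2
      · simp [h1]
      · simp [h2, Γ.thick_opp]
      · simp [Γ.thick_opp]
    · simp [subdivideOpp]
    · simp [subdivideOpp, Γ.thick_opp]
  vertex := by
    rintro (e | b)
    · simpa [IsWebVertex, IsBivalent, IsTrivalent] using Γ.vertex e
    · left; simp [IsBivalent]

/-- The part of a diagram formed by a set `S` of darts which is a union of connected components.
When the other components are erased, all regions adjacent to such a component merge. -/
def restrict (Γ : WebDiagram) (S : Γ.Dart → Prop) (hrot : ∀ d, S (Γ.rot d) ↔ S d)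
    (hopp : ∀ d, S (Γ.opp d) ↔ S d) : WebDiagram where
  Dart := {d // S d}
  finite := by have := Γ.finite; infer_instance
  rot := Γ.rot.subtypePerm hrot
  opp := Γ.opp.subtypePerm hopp
  region := (Relation.EqvGen.setoid (fun a b => Γ.region a b ∨
      ∃ d, ¬ S d ∧ a = some d ∧ (b = some (Γ.rot d) ∨ b = some (Γ.opp d)))).comap
    (Option.map Subtype.val)
  thick d := Γ.thick d
  defect d := Γ.defect d
  opp_opp d := by ext; simp [Γ.opp_opp]
  opp_ne d := by
    intro h; exact Γ.opp_ne d (by simpa using congrArg Subtype.val h)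
  thick_opp d := by simp [Γ.thick_opp]
  vertex d := by
    simpa [IsWebVertex, IsBivalent, IsTrivalent, Subtype.ext_iff] using Γ.vertex d

/-- The empty web. -/
def empty : WebDiagram where
  Dart := Empty
  finite := inferInstance
  rot := 1
  opp := 1
  region := ⊤
  thick := Empty.elim
  defect := Empty.elim
  opp_opp := by rintro ⟨⟩
  opp_ne := by rintro ⟨⟩
  thick_opp := by rintro ⟨⟩
  vertex := by rintro ⟨⟩

/-- A circle of thickness `2` (if `th = true`) or `1`, with one marked point, which is a defect if
`df = true`. -/
def circle (th df : Bool) (h : df = true → th = true) : WebDiagram where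
  Dart := Bool
  finite := inferInstance
  rot := Equiv.boolNot
  opp := Equiv.boolNot
  region := Setoid.ker (fun a : Option Bool => a.getD true)
  thick _ := th
  defect _ := df
  opp_opp := by decide
  opp_ne := by decide
  thick_opp _ := rfl
  vertex d := by left; simpa [IsBivalent] using h

/-- A coloring by pigments in `Fin 4`: every `i`-edge gets an `i`-element set of pigments. -/
structure IsColoring (Γ : WebDiagram) (c : Γ.Dart → Finset (Fin 4)) : Prop where
  edge : ∀ d, c (Γ.opp d) = c d
  card : ∀ d, (c d).card = if Γ.thick d then 2 else 1
  ordinary : ∀ d, IsBivalent Γ.rot d → Γ.defect d = false → c (Γ.rot d) = c d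
  complementary : ∀ d, IsBivalent Γ.rot d → Γ.defect d = true → c (Γ.rot d) = (c d)ᶜ
  v112 : ∀ d, IsTrivalent Γ.rot d → Γ.thick d = true → Γ.thick (Γ.rot d) = false →
    c d = c (Γ.rot d) ∪ c (Γ.rot (Γ.rot d))
  v222 : ∀ d, IsTrivalent Γ.rot d → Γ.thick d = true → Γ.thick (Γ.rot d) = true →
    ∃ s : Finset (Fin 4), s.card = 3 ∧
      {c d, c (Γ.rot d), c (Γ.rot (Γ.rot d))} = s.powersetCard 2

/-- The Tait number. -/
noncomputable def t4 (Γ : WebDiagram) : ℕ := Nat.card {c // Γ.IsColoring c}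

end WebDiagram

/-! ### Tangles and gluing -/

/-- The part of a web diagram in a closed disc whose boundary circle meets it in `n` points, which
are numbered counterclockwise by `Fin n`; near the `i`-th point it is an edge of thickness `2` if
`bd i = true` and of thickness `1` otherwise.  The edge ends are the darts at the vertices inside
the disc (`inl`) and the boundary points (`inr`). -/
structure Tangle {n : ℕ} (bd : Fin n → Bool) where
  Dart : Type
  finite : Finite Dart
  rot : Perm Dart
  opp : Perm (Dart ⊕ Fin n)
  thick : Dart ⊕ Fin n → Bool
  defect : Dart → Bool
  opp_opp : ∀ x, opp (opp x) = x
  opp_ne : ∀ x, opp x ≠ x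
  thick_opp : ∀ x, thick (opp x) = thick x
  thick_bd : ∀ i, thick (Sum.inr i) = bd i
  vertex : ∀ d, IsWebVertex rot (fun d => thick (Sum.inl d)) defect d

/-- The complementary part of a web diagram, outside an open disc whose boundary circle meets
it in `n` points.  The points are still numbered counterclockwise around the disc.  Here we also
need to record the regions. -/
structure OuterTangle {n : ℕ} (bd : Fin n → Bool) extends Tangle bd where
  region : Setoid (Option (Dart ⊕ Fin n))

/-- An outer tangle is plane if shrinking the disc to a point, which becomes an `n`-valent vertex,
gives a plane map. -/
def OuterTangle.IsPlane {n : ℕ} {bd : Fin n → Bool} (O : OuterTangle bd) : Prop :=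
  IsPlaneMap (Equiv.sumCongr O.rot (finRotate n)) O.opp O.region

section Glue

variable {n : ℕ} {bd : Fin n → Bool}

/-- Rotation of the glued diagram: the `i`-th boundary point becomes a bivalent vertex. -/
def glueRot (O : OuterTangle bd) (A : Tangle bd) :
    Perm ((O.Dart ⊕ Fin n) ⊕ (A.Dart ⊕ Fin n)) where
  toFun
    | .inl (.inl d) => .inl (.inl (O.rot d))
    | .inl (.inr i) => .inr (.inr i)
    | .inr (.inl d) => .inr (.inl (A.rot d))
    | .inr (.inr i) => .inl (.inr i)
  invFun
    | .inl (.inl d) => .inl (.inl (O.rot.symm d))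
    | .inl (.inr i) => .inr (.inr i)
    | .inr (.inl d) => .inr (.inl (A.rot.symm d))
    | .inr (.inr i) => .inl (.inr i)
  left_inv := by rintro ((d | i) | (d | i)) <;> simp
  right_inv := by rintro ((d | i) | (d | i)) <;> simp

def glueOpp (O : OuterTangle bd) (A : Tangle bd) :
    Perm ((O.Dart ⊕ Fin n) ⊕ (A.Dart ⊕ Fin n)) :=
  Equiv.sumCongr O.opp A.opp

/-- The relation that generates the regions of the glued diagram: outside the disc the regions are
those of `O`; inside the disc the regions of `A` are traced by walking along the left side
of the edges of `A` and along the boundary circle (seen from a vertex outside the disc the boundary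
points appear in reversed order); finally the regions continue across the boundary circle, as one
sees by walking along the left side of the edges of the glued diagram. -/
inductive GlueRegion (O : OuterTangle bd) (A : Tangle bd) :
    Option ((O.Dart ⊕ Fin n) ⊕ (A.Dart ⊕ Fin n)) →
    Option ((O.Dart ⊕ Fin n) ⊕ (A.Dart ⊕ Fin n)) → Prop
  | outer (a b : Option (O.Dart ⊕ Fin n)) (h : O.region a b) :
      GlueRegion O A (a.map Sum.inl) (b.map Sum.inl)
  | inner (x : A.Dart ⊕ Fin n) :
      GlueRegion O A (some (Sum.inr x))
        (some (Sum.inr ((Equiv.sumCongr A.rot (finRotate n).symm).symm (A.opp x))))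
  | across (x : (O.Dart ⊕ Fin n) ⊕ (A.Dart ⊕ Fin n)) :
      GlueRegion O A (some x) (some ((glueRot O A).symm (glueOpp O A x)))

/-- Glue the tangle `A` into the hole of `O`. -/
def OuterTangle.glue (O : OuterTangle bd) (A : Tangle bd) : WebDiagram where
  Dart := (O.Dart ⊕ Fin n) ⊕ (A.Dart ⊕ Fin n)
  finite := by have := O.finite; have := A.finite; infer_instance
  rot := glueRot O A
  opp := glueOpp O A
  region := Relation.EqvGen.setoid (GlueRegion O A)
  thick := Sum.elim O.thick A.thick
  defect := Sum.elim (Sum.elim O.defect fun _ => false) (Sum.elim A.defect fun _ => false)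
  opp_opp := by rintro (x | x) <;> simp [glueOpp, O.opp_opp, A.opp_opp]
  opp_ne := by rintro (x | x) <;> simp [glueOpp, O.opp_ne, A.opp_ne]
  thick_opp := by rintro (x | x) <;> simp [glueOpp, O.thick_opp, A.thick_opp]
  vertex := by
    rintro ((d | i) | (d | i))
    · simpa [IsWebVertex, IsBivalent, IsTrivalent, glueRot] using O.vertex d
    · left; simp [IsBivalent, glueRot, O.thick_bd, A.thick_bd]
    · simpa [IsWebVertex, IsBivalent, IsTrivalent, glueRot] using A.vertex d
    · left; simp [IsBivalent, glueRot, O.thick_bd, A.thick_bd]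

end Glue

/-! ### Tangles given by a planar diagram code -/

section Code

variable {t b n : ℕ}

instance decidableExistsUniqueOfFintype {X : Type} [Fintype X] [DecidableEq X] (p : X → Prop)
    [DecidablePred p] : Decidable (∃! x, p x) :=
  inferInstanceAs (Decidable (∃ x, p x ∧ ∀ y, p y → y = x))

/-- Darts of a tangle with `t` trivalent vertices and `b` defects. -/
abbrev CodeDart (t b : ℕ) : Type := (Fin t × Fin 3) ⊕ (Fin b × Fin 2)

/-- The edge at each end, given the edges at each trivalent vertex (in counterclockwise order),
at each defect, and at the boundary points. -/
def codeEdge (tri : Fin t → Fin 3 → ℕ) (dfc : Fin b → Fin 2 → ℕ) (leg : Fin n → ℕ) :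
    CodeDart t b ⊕ Fin n → ℕ
  | .inl (.inl (v, j)) => tri v j
  | .inl (.inr (v, j)) => dfc v j
  | .inr i => leg i

/-- Counterclockwise rotation at each vertex. -/
def codeRot (t b : ℕ) : Perm (CodeDart t b) :=
  Equiv.sumCongr (Equiv.prodCongr (Equiv.refl _) (Equiv.addRight (1 : Fin 3)))
    (Equiv.prodCongr (Equiv.refl _) (Equiv.addRight (1 : Fin 2)))

def codeDefect (t b : ℕ) : CodeDart t b → Bool := Sum.elim (fun _ => false) (fun _ => true)

/-- For an edge labelling `e` which takes every value exactly twice (or never), the other end of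
the same edge. -/
def partner {X : Type} [Fintype X] [DecidableEq X] (e : X → ℕ)
    (h : ∀ x, ∃! y, y ≠ x ∧ e y = e x) (x : X) : X :=
  Fintype.choose (fun y => y ≠ x ∧ e y = e x) (h x)

theorem partner_spec {X : Type} [Fintype X] [DecidableEq X] (e : X → ℕ)
    (h : ∀ x, ∃! y, y ≠ x ∧ e y = e x) (x : X) : partner e h x ≠ x ∧ e (partner e h x) = e x :=
  Fintype.choose_spec (fun y => y ≠ x ∧ e y = e x) (h x)

theorem partner_involutive {X : Type} [Fintype X] [DecidableEq X] (e : X → ℕ)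
    (h : ∀ x, ∃! y, y ≠ x ∧ e y = e x) : Function.Involutive (partner e h) := fun x =>
  (h (partner e h x)).unique (partner_spec e h _)
    ⟨(partner_spec e h x).1.symm, (partner_spec e h x).2.symm⟩

/-- The tangle with a given planar diagram code: edges are named by natural numbers, those
in `thickEdges` are `2`-edges and the others are `1`-edges; `tri` lists the edges at every trivalent
vertex in counterclockwise order, `dfc` the edges at every defect, and `leg` the edges at the
boundary points in counterclockwise order. -/
def Tangle.ofCode (bd : Fin n → Bool) (tri : Fin t → Fin 3 → ℕ) (dfc : Fin b → Fin 2 → ℕ)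
    (leg : Fin n → ℕ) (thickEdges : List ℕ)
    (h : ∀ x, ∃! y, y ≠ x ∧ codeEdge tri dfc leg y = codeEdge tri dfc leg x)
    (hbd : ∀ i, decide (leg i ∈ thickEdges) = bd i)
    (hv : ∀ d, IsWebVertex (codeRot t b)
      (fun d => decide (codeEdge tri dfc leg (Sum.inl d) ∈ thickEdges)) (codeDefect t b) d) :
    Tangle bd where
  Dart := CodeDart t b
  finite := inferInstance
  rot := codeRot t b
  opp := (partner_involutive _ h).toPerm
  thick x := decide (codeEdge tri dfc leg x ∈ thickEdges)
  defect := codeDefect t b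
  opp_opp := partner_involutive _ h
  opp_ne x := (partner_spec _ h x).1
  thick_opp x := by
    simp only [Function.Involutive.coe_toPerm, (partner_spec _ h x).2]
  thick_bd := hbd
  vertex := hv

end Code

/-! ### The tangles in the local relations

Boundary points of tangles with four boundary points are, in counterclockwise order,
top left, bottom left, bottom right, top right. -/

namespace Tangle

set_option maxRecDepth 100000
set_option synthInstance.maxSize 2000

/-- A `1`-edge. -/
def edge1 : Tangle ![false, false] :=
  ofCode _ (t := 0) (b := 0) ![] ![] ![0, 0] [] (by decide) (by decide) (by decide)

/-- A `2`-edge. -/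
def edge2 : Tangle ![true, true] :=
  ofCode _ (t := 0) (b := 0) ![] ![] ![0, 0] [0] (by decide) (by decide) (by decide)

/-- A `2`-edge with two defects. -/
def edge2TwoDefects : Tangle ![true, true] :=
  ofCode _ (t := 0) (b := 2) ![] ![![0, 1], ![1, 2]] ![0, 2] [0, 1, 2]
    (by decide) (by decide) (by decide)

/-- A `1`-edge loop attached to a `2`-edge. -/
def lollipop : Tangle ![true] :=
  ofCode _ (t := 1) (b := 0) ![![0, 0, 1]] ![] ![1] [1] (by decide) (by decide) (by decide)

/-- A digon with edges of thickness `1`, `1`, between two `2`-edges. -/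
def digon11 : Tangle ![true, true] :=
  ofCode _ (t := 2) (b := 0) ![![0, 2, 3], ![1, 3, 2]] ![] ![0, 1] [0, 1]
    (by decide) (by decide) (by decide)

/-- A digon with edges of thickness `2`, `2`, between two `2`-edges. -/
def digon22 : Tangle ![true, true] :=
  ofCode _ (t := 2) (b := 0) ![![0, 2, 3], ![1, 3, 2]] ![] ![0, 1] [0, 1, 2, 3]
    (by decide) (by decide) (by decide)

/-- A digon with edges of thickness `1`, `2`, between two `1`-edges. -/
def digon12 : Tangle ![false, false] :=
  ofCode _ (t := 2) (b := 0) ![![0, 2, 3], ![1, 3, 2]] ![] ![0, 1] [2]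
    (by decide) (by decide) (by decide)

/-- The same with a defect on the thick side of the digon. -/
def digon12Defect : Tangle ![false, false] :=
  ofCode _ (t := 2) (b := 1) ![![0, 2, 3], ![1, 3, 4]] ![![2, 4]] ![0, 1] [2, 4]
    (by decide) (by decide) (by decide)

/-- A `222`-vertex. -/
def vertex222 : Tangle ![true, true, true] :=
  ofCode _ (t := 1) (b := 0) ![![0, 1, 2]] ![] ![0, 1, 2] [0, 1, 2]
    (by decide) (by decide) (by decide)

/-- A `222`-vertex with a defect on the leg `0`. -/
def vertex222Defect0 : Tangle ![true, true, true] :=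
  ofCode _ (t := 1) (b := 1) ![![3, 1, 2]] ![![0, 3]] ![0, 1, 2] [0, 1, 2, 3]
    (by decide) (by decide) (by decide)

/-- A `222`-vertex with a defect on the leg `1`. -/
def vertex222Defect1 : Tangle ![true, true, true] :=
  ofCode _ (t := 1) (b := 1) ![![0, 3, 2]] ![![1, 3]] ![0, 1, 2] [0, 1, 2, 3]
    (by decide) (by decide) (by decide)

/-- A `112`-vertex, with thick leg `0`. -/
def vertex112 : Tangle ![true, false, false] :=
  ofCode _ (t := 1) (b := 0) ![![0, 1, 2]] ![] ![0, 1, 2] [0]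
    (by decide) (by decide) (by decide)

/-- A triangle whose three sides are `1`-edges. -/
def triangle111 : Tangle ![true, true, true] :=
  ofCode _ (t := 3) (b := 0) ![![0, 3, 5], ![1, 4, 3], ![2, 5, 4]] ![] ![0, 1, 2] [0, 1, 2]
    (by decide) (by decide) (by decide)

/-- A triangle whose three sides are `2`-edges. -/
def triangle222 : Tangle ![true, true, true] :=
  ofCode _ (t := 3) (b := 0) ![![0, 3, 5], ![1, 4, 3], ![2, 5, 4]] ![] ![0, 1, 2]
    [0, 1, 2, 3, 4, 5] (by decide) (by decide) (by decide)

/-- A triangle with sides of thickness `1`, `1`, `2`, the `2`-edge opposite to the thick leg. -/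
def triangle112 : Tangle ![true, false, false] :=
  ofCode _ (t := 3) (b := 0) ![![0, 3, 5], ![1, 4, 3], ![2, 5, 4]] ![] ![0, 1, 2] [0, 4]
    (by decide) (by decide) (by decide)

/-- A triangle with sides of thickness `2`, `2`, `1`, the `1`-edge opposite to the thick leg. -/
def triangle221 : Tangle ![true, false, false] :=
  ofCode _ (t := 3) (b := 0) ![![0, 3, 5], ![1, 4, 3], ![2, 5, 4]] ![] ![0, 1, 2] [0, 3, 5]
    (by decide) (by decide) (by decide)

/-! Four `1`-edges on the boundary. -/

/-- Two vertical `1`-edges. -/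
def vertical11 : Tangle ![false, false, false, false] :=
  ofCode _ (t := 0) (b := 0) ![] ![] ![0, 0, 1, 1] [] (by decide) (by decide) (by decide)

/-- Two horizontal `1`-edges. -/
def horizontal11 : Tangle ![false, false, false, false] :=
  ofCode _ (t := 0) (b := 0) ![] ![] ![0, 1, 1, 0] [] (by decide) (by decide) (by decide)

/-- A vertical `2`-edge, whose upper end meets the two top `1`-edges and whose lower end
meets the two bottom ones. -/
def verticalDumbbell : Tangle ![false, false, false, false] :=
  ofCode _ (t := 2) (b := 0) ![![0, 4, 3], ![1, 2, 4]] ![] ![0, 1, 2, 3] [4]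
    (by decide) (by decide) (by decide)

/-- A horizontal `2`-edge, whose left end meets the two left `1`-edges and whose right end
meets the two right ones. -/
def horizontalDumbbell : Tangle ![false, false, false, false] :=
  ofCode _ (t := 2) (b := 0) ![![0, 1, 4], ![2, 3, 4]] ![] ![0, 1, 2, 3] [4]
    (by decide) (by decide) (by decide)

/-- `verticalDumbbell` with a defect on the `2`-edge. -/
def verticalDumbbellDefect : Tangle ![false, false, false, false] :=
  ofCode _ (t := 2) (b := 1) ![![0, 4, 3], ![1, 2, 5]] ![![4, 5]] ![0, 1, 2, 3] [4, 5]
    (by decide) (by decide) (by decide)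

/-- `horizontalDumbbell` with a defect on the `2`-edge. -/
def horizontalDumbbellDefect : Tangle ![false, false, false, false] :=
  ofCode _ (t := 2) (b := 1) ![![0, 1, 4], ![2, 3, 5]] ![![4, 5]] ![0, 1, 2, 3] [4, 5]
    (by decide) (by decide) (by decide)

/-- A square with `1`-edges on the left and right and `2`-edges at the top and bottom. -/
def square1212 : Tangle ![false, false, false, false] :=
  ofCode _ (t := 4) (b := 0) ![![0, 4, 7], ![1, 5, 4], ![2, 6, 5], ![3, 7, 6]] ![]
    ![0, 1, 2, 3] [5, 7] (by decide) (by decide) (by decide)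

/-! `1`-edges on the left and `2`-edges on the right boundary. -/

/-- A vertical `1`-edge on the left, a vertical `2`-edge on the right. -/
def vertical12 : Tangle ![false, false, true, true] :=
  ofCode _ (t := 0) (b := 0) ![] ![] ![0, 0, 1, 1] [1] (by decide) (by decide) (by decide)

/-- A square with a `2`-edge on the left and three `1`-edges. -/
def square2111 : Tangle ![false, false, true, true] :=
  ofCode _ (t := 4) (b := 0) ![![0, 4, 7], ![1, 5, 4], ![2, 6, 5], ![3, 7, 6]] ![]
    ![0, 1, 2, 3] [2, 3, 4] (by decide) (by decide) (by decide)

/-- A square with a `1`-edge on the left and three `2`-edges. -/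
def square1222 : Tangle ![false, false, true, true] :=
  ofCode _ (t := 4) (b := 0) ![![0, 4, 7], ![1, 5, 4], ![2, 6, 5], ![3, 7, 6]] ![]
    ![0, 1, 2, 3] [2, 3, 5, 6, 7] (by decide) (by decide) (by decide)

/-- A vertical `1`-edge, whose upper end meets the two top edges (of thickness `1` and `2`) and
whose lower end meets the two bottom ones. -/
def vertical12v12 : Tangle ![false, false, true, true] :=
  ofCode _ (t := 2) (b := 0) ![![0, 4, 3], ![1, 2, 4]] ![] ![0, 1, 2, 3] [2, 3]
    (by decide) (by decide) (by decide)

/-- `vertical12v12` with a defect on both thick legs. -/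
def vertical12v12Defects : Tangle ![false, false, true, true] :=
  ofCode _ (t := 2) (b := 2) ![![0, 4, 5], ![1, 6, 4]] ![![6, 2], ![5, 3]] ![0, 1, 2, 3]
    [2, 3, 5, 6] (by decide) (by decide) (by decide)

/-- A horizontal `2`-edge, whose left end meets the two left `1`-edges and whose right end
meets the two right `2`-edges. -/
def horizontal11v22 : Tangle ![false, false, true, true] :=
  ofCode _ (t := 2) (b := 0) ![![0, 1, 4], ![2, 3, 4]] ![] ![0, 1, 2, 3] [2, 3, 4]
    (by decide) (by decide) (by decide)

/-! `2`-edges at the top left and bottom right, `1`-edges at the bottom left and top right. -/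

/-- A square with left, bottom, right, top sides of thickness `1`, `2`, `2`, `1`. -/
def square1221 : Tangle ![true, false, true, false] :=
  ofCode _ (t := 4) (b := 0) ![![0, 4, 7], ![1, 5, 4], ![2, 6, 5], ![3, 7, 6]] ![]
    ![0, 1, 2, 3] [0, 2, 5, 6] (by decide) (by decide) (by decide)

/-- A vertical `1`-edge, whose upper end meets the two top edges and whose lower end meets the
two bottom ones, with a defect on both thick legs. -/
def vertical21v12Defects : Tangle ![true, false, true, false] :=
  ofCode _ (t := 2) (b := 2) ![![5, 4, 3], ![1, 6, 4]] ![![0, 5], ![2, 6]] ![0, 1, 2, 3]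
    [0, 2, 5, 6] (by decide) (by decide) (by decide)

/-- The same with a defect on the top left leg only. -/
def vertical21v12DefectTop : Tangle ![true, false, true, false] :=
  ofCode _ (t := 2) (b := 1) ![![5, 4, 3], ![1, 2, 4]] ![![0, 5]] ![0, 1, 2, 3]
    [0, 2, 5] (by decide) (by decide) (by decide)

/-- The same with a defect on the bottom right leg only. -/
def vertical21v12DefectBottom : Tangle ![true, false, true, false] :=
  ofCode _ (t := 2) (b := 1) ![![0, 4, 3], ![1, 6, 4]] ![![2, 6]] ![0, 1, 2, 3]
    [0, 2, 6] (by decide) (by decide) (by decide)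

/-- A horizontal `1`-edge, whose left end meets the two left edges and whose right end meets the
two right ones, with a defect on both thick legs. -/
def horizontal21v12Defects : Tangle ![true, false, true, false] :=
  ofCode _ (t := 2) (b := 2) ![![5, 1, 4], ![6, 3, 4]] ![![0, 5], ![2, 6]] ![0, 1, 2, 3]
    [0, 2, 5, 6] (by decide) (by decide) (by decide)

/-- The same with a defect on the top left leg only. -/
def horizontal21v12DefectTop : Tangle ![true, false, true, false] :=
  ofCode _ (t := 2) (b := 1) ![![5, 1, 4], ![2, 3, 4]] ![![0, 5]] ![0, 1, 2, 3]
    [0, 2, 5] (by decide) (by decide) (by decide)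

/-- The same with a defect on the bottom right leg only. -/
def horizontal21v12DefectBottom : Tangle ![true, false, true, false] :=
  ofCode _ (t := 2) (b := 1) ![![0, 1, 4], ![6, 3, 4]] ![![2, 6]] ![0, 1, 2, 3]
    [0, 2, 6] (by decide) (by decide) (by decide)

/-! Four `2`-edges on the boundary. -/

/-- A square with four `2`-edges. -/
def square2222 : Tangle ![true, true, true, true] :=
  ofCode _ (t := 4) (b := 0) ![![0, 4, 7], ![1, 5, 4], ![2, 6, 5], ![3, 7, 6]] ![]
    ![0, 1, 2, 3] [0, 1, 2, 3, 4, 5, 6, 7] (by decide) (by decide) (by decide)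

/-- Two vertical `2`-edges. -/
def vertical22 : Tangle ![true, true, true, true] :=
  ofCode _ (t := 0) (b := 0) ![] ![] ![0, 0, 1, 1] [0, 1] (by decide) (by decide) (by decide)

/-- Two horizontal `2`-edges. -/
def horizontal22 : Tangle ![true, true, true, true] :=
  ofCode _ (t := 0) (b := 0) ![] ![] ![0, 1, 1, 0] [0, 1] (by decide) (by decide) (by decide)

/-- Two vertical `2`-edges with a defect on each. -/
def vertical22Defects : Tangle ![true, true, true, true] :=
  ofCode _ (t := 0) (b := 2) ![] ![![0, 1], ![2, 3]] ![0, 1, 2, 3] [0, 1, 2, 3]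
    (by decide) (by decide) (by decide)

/-- Two horizontal `2`-edges with a defect on each. -/
def horizontal22Defects : Tangle ![true, true, true, true] :=
  ofCode _ (t := 0) (b := 2) ![] ![![0, 3], ![1, 2]] ![0, 1, 2, 3] [0, 1, 2, 3]
    (by decide) (by decide) (by decide)

end Tangle

/-! ### The relations -/

/-- `f` is an invariant of webs: it does not depend on the diagram chosen to represent a web. -/
structure IsWebInvariant (f : WebDiagram → ℤ) : Prop where
  isomorphic : ∀ Γ Γ' : WebDiagram, Γ.IsPlane → Γ'.IsPlane → Γ.Isomorphic Γ' → f Γ = f Γ'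
  subdivide : ∀ (Γ : WebDiagram) (d : Γ.Dart), Γ.IsPlane → f (Γ.subdivide d) = f Γ

/-- The first list of relations: multiplicativity and the local relations for circles, loops,
defects, digons, four-valent crossings with a defect, triangles and squares.  A local
relation is a linear relation between the values on webs which agree outside a disc. -/
structure SatisfiesWebRelations (f : WebDiagram → ℤ) : Prop where
  empty : f WebDiagram.empty = 1
  disjoint_union : ∀ (Γ : WebDiagram) (S : Γ.Dart → Prop)
    (hrot : ∀ d, S (Γ.rot d) ↔ S d) (hopp : ∀ d, S (Γ.opp d) ↔ S d), Γ.IsPlane →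
    f Γ = f (Γ.restrict S hrot hopp) *
      f (Γ.restrict (fun d => ¬ S d) (fun d => not_congr (hrot d)) (fun d => not_congr (hopp d)))
  circle1 : f (WebDiagram.circle false false (by decide)) = 4
  circle2 : f (WebDiagram.circle true false (by decide)) = 6
  lollipop : ∀ O : OuterTangle ![true], O.IsPlane → f (O.glue .lollipop) = 0
  circle2Defect : f (WebDiagram.circle true true (by decide)) = 0
  defects_cancel : ∀ O : OuterTangle ![true, true], O.IsPlane →
    f (O.glue .edge2TwoDefects) = f (O.glue .edge2)
  defect_moves : ∀ O : OuterTangle ![true, true, true], O.IsPlane →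
    f (O.glue .vertex222Defect0) = f (O.glue .vertex222Defect1)
  digon11 : ∀ O : OuterTangle ![true, true], O.IsPlane →
    f (O.glue .digon11) = 2 * f (O.glue .edge2)
  digon22 : ∀ O : OuterTangle ![true, true], O.IsPlane →
    f (O.glue .digon22) = 4 * f (O.glue .edge2)
  digon12 : ∀ O : OuterTangle ![false, false], O.IsPlane →
    f (O.glue .digon12) = 3 * f (O.glue .edge1)
  digon12Defect : ∀ O : OuterTangle ![false, false], O.IsPlane →
    f (O.glue .digon12Defect) = 0
  crossing : ∀ O : OuterTangle ![false, false, false, false], O.IsPlane →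
    f (O.glue .verticalDumbbellDefect) = f (O.glue .horizontalDumbbellDefect)
  triangle111 : ∀ O : OuterTangle ![true, true, true], O.IsPlane →
    f (O.glue .triangle111) = f (O.glue .vertex222)
  triangle222 : ∀ O : OuterTangle ![true, true, true], O.IsPlane →
    f (O.glue .triangle222) = 2 * f (O.glue .vertex222)
  triangle112 : ∀ O : OuterTangle ![true, false, false], O.IsPlane →
    f (O.glue .triangle112) = f (O.glue .vertex112)
  triangle221 : ∀ O : OuterTangle ![true, false, false], O.IsPlane →
    f (O.glue .triangle221) = 2 * f (O.glue .vertex112)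
  square2111 : ∀ O : OuterTangle ![false, false, true, true], O.IsPlane →
    f (O.glue .square2111) = f (O.glue .vertical12v12Defects) + f (O.glue .vertical12)
  square1222 : ∀ O : OuterTangle ![false, false, true, true], O.IsPlane →
    f (O.glue .square1222) = f (O.glue .square2111) + f (O.glue .vertical12v12)
  square1212 : ∀ O : OuterTangle ![false, false, false, false], O.IsPlane →
    f (O.glue .square1212) = f (O.glue .vertical11) + 2 * f (O.glue .horizontal11)
  square1221 : ∀ O : OuterTangle ![true, false, true, false], O.IsPlane →
    f (O.glue .square1221) =
      f (O.glue .horizontal21v12Defects) + f (O.glue .vertical21v12Defects)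
  square2222 : ∀ O : OuterTangle ![true, true, true, true], O.IsPlane →
    f (O.glue .square2222) = 2 * (f (O.glue .vertical22) + f (O.glue .horizontal22) +
      f (O.glue .vertical22Defects) + f (O.glue .horizontal22Defects))

/-- The second list of relations, of the kind considered by Tutte. -/
structure SatisfiesTutteRelations (f : WebDiagram → ℤ) : Prop where
  tutte1 : ∀ O : OuterTangle ![false, false, false, false], O.IsPlane →
    f (O.glue .verticalDumbbell) + f (O.glue .horizontal11) =
      f (O.glue .horizontalDumbbell) + f (O.glue .vertical11)
  tutte2 : ∀ O : OuterTangle ![false, false, true, true], O.IsPlane →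
    f (O.glue .vertical12v12) + f (O.glue .vertical12v12Defects) =
      f (O.glue .vertical12) + f (O.glue .horizontal11v22)
  tutte3 : ∀ O : OuterTangle ![true, false, true, false], O.IsPlane →
    f (O.glue .horizontal21v12DefectTop) + f (O.glue .horizontal21v12DefectBottom) =
      f (O.glue .vertical21v12DefectTop) + f (O.glue .vertical21v12DefectBottom)

/-!
The Tait number satisfies the relations because colorings are local.  Colors are added modulo two,
so that the condition at a trivalent vertex is a linear equation (`WebDiagram.isColoring_iff`), and
the Tait number of a web is a state sum over the colors on the boundary of a disc
(`OuterTangle.t4_glue`).  Hence each relation follows from an identity between the numbers of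
colorings of finitely many tangles with prescribed colors on the boundary
(`OuterTangle.t4_relation`).  These numbers are computed by a recursion
(`Tangle.ofCode_state`), which is evaluated in the kernel.

For uniqueness, two functions `f` and `g` that satisfy all relations are compared
(`WebDiagram.value_eq`), by lexicographic induction on the weight, in which a `222`-vertex counts
three times as much as a `112`-vertex, the number of `222`-vertices, and the number of darts.
Disconnected webs are products, and webs without trivalent vertices are circles
(`WebDiagram.value_eq_of_bivalent`).  Otherwise defects are cancelled in pairs and bivalent vertices
are suppressed, which leaves a trivalent graph, some of whose thick edges carry a defect
(`WebDiagram.exists_triWeb`).  There are three cases.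

* If there are vertices of both kinds, some thick edge joins a `112`-vertex to a `222`-vertex.  A
  defect on it can be moved away through the `222`-vertex, and the second Tutte relation expresses
  the web by webs of smaller weight (`TriWeb.agree_of_mixed`).
* If all vertices are `222`-vertices, one of them is replaced by a triangle with thin sides.  This
  preserves the weight and lowers the number of `222`-vertices (`TriWeb.agree_of_thick`).
* If all vertices are `112`-vertices, Euler's formula gives a bounded region with at most three
  thin sides (`TriWeb.IsThin.exists_small_region`).  Its thick sides can be flipped out of its
  boundary, by the first Tutte relation or by the crossing relation (`TriWeb.agree_of_flip`).  What
  remains is a loop, a digon or a triangle with thin sides, which is removed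
  (`TriWeb.agree_of_small_face`).  The triangle leaves a single `222`-vertex.  The number of vertices
  of a trivalent graph is even, so there is also a `112`-vertex, and the first case applies
  (`WebDiagram.value_eq_of_thickWeight_eq_three`).

The relations may only be applied to plane webs, so every change of a web has to preserve Euler's
formula.  To this end planarity is expressed through cycles modulo two
(`isPlaneMap_iff_isPlaneHom`), a form in which its behavior under contraction of edges
(`IsPlaneHom.contract`), passage to a part (`WebDiagram.IsPlane.restrict`) and the refilling of a
disc (`glue_isPlane`) can be read off.
-/

/-! ### Planarity through cycles modulo two -/

section Planarity

variable {X : Type}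

/-- The functions that are constant along a relation. -/
def invariantFunctions (r : X → X → Prop) : Submodule (ZMod 2) (X → ZMod 2) where
  carrier := {f | ∀ x y, r x y → f x = f y}
  add_mem' hf hg x y h := by simp [hf x y h, hg x y h]
  zero_mem' _ _ _ := rfl
  smul_mem' c f hf x y h := by simp [hf x y h]

theorem finrank_invariantFunctions [Finite X] (r : X → X → Prop) :
    Module.finrank (ZMod 2) (invariantFunctions r) = Nat.card (Quot r) := by
  have := Fintype.ofFinite (Quot r)
  let e : invariantFunctions r ≃ₗ[ZMod 2] (Quot r → ZMod 2) :=
    { toFun := fun f => Quot.lift f.1 f.2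
      invFun := fun g => ⟨fun x => g (Quot.mk r x), fun x y h => congrArg g (Quot.sound h)⟩
      map_add' := fun f g => by ext ⟨x⟩; rfl
      map_smul' := fun c f => by ext ⟨x⟩; rfl
      left_inv := fun f => rfl
      right_inv := fun g => by ext ⟨x⟩; rfl }
  rw [e.finrank_eq, Module.finrank_fintype_fun_eq_card, Nat.card_eq_fintype_card]

theorem zmod_two_add_self (a : ZMod 2) : a + a = 0 := CharTwo.add_self_eq_zero a

theorem zmod_two_add_eq_zero {a b : ZMod 2} : a + b = 0 ↔ a = b := CharTwo.add_eq_zero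

/-- The sum of a function over darts vanishes modulo two if the function is invariant under a
fixed point free involution. -/
theorem sum_eq_zero_of_involution [Fintype X] (τ : X → X) (hτ : ∀ x, τ (τ x) = x)
    (hne : ∀ x, τ x ≠ x) (z : X → ZMod 2) (hz : ∀ x, z (τ x) = z x) : ∑ x, z x = 0 :=
  Finset.sum_involution (fun x _ => τ x) (fun x _ => by rw [hz]; exact zmod_two_add_self _)
    (fun x _ _ => hne x) (fun x _ => Finset.mem_univ _) (fun x _ => hτ x)

/-- A cycle modulo two: a set of edges, given by its indicator function on darts, which meets every
vertex evenly.  The vertex condition is tested against functions on the set of vertices. -/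
structure IsCycle [Fintype X] (rot opp : Perm X) (z : X → ZMod 2) : Prop where
  opp : ∀ x, z (opp x) = z x
  vertex : ∀ h : X → ZMod 2, (∀ x, h (rot x) = h x) → ∑ x, h x * z x = 0

/-- The homological form of planarity: Euler's formula is replaced by the condition that every cycle
is the boundary of a set of regions. -/
structure IsPlaneHom [Fintype X] (rot opp : Perm X) (region : Setoid (Option X)) : Prop where
  face : ∀ x, region (some x) (some (rot.symm (opp x)))
  linked : ∀ ψ : Option X → ZMod 2, (∀ a b, region a b → ψ a = ψ b) →
    (∀ x, ψ (some (rot x)) = ψ (some x)) → (∀ x, ψ (some (opp x)) = ψ (some x)) →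
    ∀ a, ψ a = ψ none
  boundary : ∀ z, IsCycle rot opp z → ∃ φ : Option X → ZMod 2, (∀ a b, region a b → φ a = φ b) ∧
    ∀ x, z x = φ (some x) + φ (some (opp x))

/-- Linkedness can be tested by functions with values modulo two: the connected pieces of the
diagram together with its regions form one class exactly when every invariant function is
constant. -/
theorem linked_iff (rot opp : Perm X) (region : Setoid (Option X)) :
    (∀ a b : Option X, Relation.EqvGen
      (fun a b => region a b ∨ ∃ x, a = some x ∧ (b = some (rot x) ∨ b = some (opp x))) a b) ↔
    ∀ ψ : Option X → ZMod 2, (∀ a b, region a b → ψ a = ψ b) →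
      (∀ x, ψ (some (rot x)) = ψ (some x)) → (∀ x, ψ (some (opp x)) = ψ (some x)) →
      ∀ a, ψ a = ψ none := by
  classical
  constructor
  · intro H ψ h1 h2 h3 a
    suffices ∀ b c, Relation.EqvGen (fun a b => region a b ∨
        ∃ x, a = some x ∧ (b = some (rot x) ∨ b = some (opp x))) b c → ψ b = ψ c from
      this _ _ (H a none)
    intro b c hbc
    induction hbc with
    | rel a b h =>
      rcases h with h | ⟨x, rfl, rfl | rfl⟩
      · exact h1 _ _ h
      · exact (h2 x).symm
      · exact (h3 x).symm
    | refl => rfl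
    | symm _ _ _ ih => exact ih.symm
    | trans _ _ _ _ _ ih1 ih2 => exact ih1.trans ih2
  · intro H
    set r : Option X → Option X → Prop := fun a b =>
      region a b ∨ ∃ x, a = some x ∧ (b = some (rot x) ∨ b = some (opp x)) with hr
    have key : ∀ a, Relation.EqvGen r a none := by
      intro a
      -- the test function is the indicator function of the class of `none`
      have step : ∀ b c, r b c →
          ((if Relation.EqvGen r b none then 1 else 0 : ZMod 2)
            = if Relation.EqvGen r c none then 1 else 0) := by
        intro b c hbc
        have : Relation.EqvGen r b none ↔ Relation.EqvGen r c none :=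
          ⟨fun h => .trans _ _ _ (.symm _ _ (.rel _ _ hbc)) h, fun h => .trans _ _ _ (.rel _ _ hbc) h⟩
        simp [this]
      have := H (fun b => if Relation.EqvGen r b none then 1 else 0)
        (fun b c h => step b c (Or.inl h))
        (fun x => (step _ _ (Or.inr ⟨x, rfl, Or.inl rfl⟩)).symm)
        (fun x => (step _ _ (Or.inr ⟨x, rfl, Or.inr rfl⟩)).symm) a
      by_contra hcon
      simp [hcon, Relation.EqvGen.refl] at this
    exact fun a b => .trans _ _ _ (key a) (.symm _ _ (key b))

/-- The pairing of functions on the set of vertices and functions on the set of edges. -/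
noncomputable def vertexEdgePairing [Fintype X] (rot opp : Perm X) :
    invariantFunctions (fun x y : X => y = opp x) →ₗ[ZMod 2]
      Module.Dual (ZMod 2) (invariantFunctions (fun x y : X => y = rot x)) :=
  LinearMap.mk₂ (ZMod 2) (fun z h => ∑ x, h.1 x * z.1 x)
    (fun a b c => by simp [mul_add, Finset.sum_add_distrib])
    (fun c a b => by simp only [Submodule.coe_smul, Pi.smul_apply, smul_eq_mul, Finset.mul_sum];
                     exact Finset.sum_congr rfl fun x _ => by ring)
    (fun a b c => by simp [add_mul, Finset.sum_add_distrib])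
    (fun c a b => by simp only [Submodule.coe_smul, Pi.smul_apply, smul_eq_mul, Finset.mul_sum];
                     exact Finset.sum_congr rfl fun x _ => by ring)

/-- The cycle space has dimension `E - V + C`. -/
theorem finrank_cycles [Fintype X] (rot opp : Perm X) (hopp : ∀ x, opp (opp x) = x)
    (hne : ∀ x, opp x ≠ x) :
    Module.finrank (ZMod 2) (LinearMap.ker (vertexEdgePairing rot opp)) +
        Nat.card (Quot fun x y : X => y = rot x) =
      Nat.card (Quot fun x y : X => y = opp x) +
        Nat.card (Quot fun x y : X => y = rot x ∨ y = opp x) := by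
  classical
  have h1 := LinearMap.finrank_range_add_finrank_ker (vertexEdgePairing rot opp)
  have h2 := Subspace.finrank_add_finrank_dualCoannihilator_eq
    (LinearMap.range (vertexEdgePairing rot opp))
  rw [finrank_invariantFunctions] at h1 h2
  have h3 : Module.finrank (ZMod 2)
      (LinearMap.range (vertexEdgePairing rot opp)).dualCoannihilator
      = Nat.card (Quot fun x y : X => y = rot x ∨ y = opp x) := by
    rw [← finrank_invariantFunctions]
    have hmem : ∀ h : invariantFunctions (fun x y : X => y = rot x),
        h ∈ (LinearMap.range (vertexEdgePairing rot opp)).dualCoannihilator ↔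
          ∀ x, h.1 (opp x) = h.1 x := by
      intro h
      rw [Submodule.mem_dualCoannihilator]
      constructor
      · intro H x
        -- the test function is the indicator function of one edge
        have hz : (fun y => if y = x ∨ y = opp x then 1 else 0 : X → ZMod 2) ∈
            invariantFunctions (fun x y : X => y = opp x) := by
          rintro a b rfl
          have : (opp a = x ∨ opp a = opp x) ↔ (a = x ∨ a = opp x) := by
            rw [opp.injective.eq_iff, or_comm]
            exact or_congr Iff.rfl ⟨fun h => by rw [← h, hopp], fun h => by rw [h, hopp]⟩
          show (if _ then _ else _) = if _ then _ else _
          simp only [this]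
        have : ∑ y, h.1 y * (if y = x ∨ y = opp x then 1 else 0) = 0 := H _ ⟨⟨_, hz⟩, rfl⟩
        simp only [mul_ite, mul_one, mul_zero] at this
        rw [← Finset.sum_filter, show Finset.univ.filter (fun y => y = x ∨ y = opp x) = {x, opp x} by
          ext; simp, Finset.sum_pair (hne x).symm] at this
        exact (zmod_two_add_eq_zero.1 this).symm
      · rintro H φ ⟨z, rfl⟩
        exact sum_eq_zero_of_involution opp hopp hne _ fun x => by
          rw [H, z.2 x _ rfl]
    refine LinearEquiv.finrank_eq
      { toFun := fun h => ⟨h.1.1, ?_⟩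
        invFun := fun h => ⟨⟨h.1, fun x y hxy => h.2 x y (Or.inl hxy)⟩, (hmem _).2 fun x =>
          (h.2 x _ (Or.inr rfl)).symm⟩
        map_add' := fun _ _ => rfl
        map_smul' := fun _ _ => rfl
        left_inv := fun _ => rfl
        right_inv := fun _ => rfl }
    rintro x y (hxy | rfl)
    · exact h.1.2 x y hxy
    · exact ((hmem _).1 h.2 x).symm
  omega

/-- Planarity of a map is the vanishing of its homology modulo two: the boundaries of sets of
regions form a subspace of dimension `R - 1` of the cycle space, which has dimension
`E - V + C`, and Euler's formula says that the two dimensions agree. -/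
theorem isPlaneMap_iff_isPlaneHom [Fintype X] (rot opp : Perm X) (region : Setoid (Option X))
    (hopp : ∀ x, opp (opp x) = x) (hne : ∀ x, opp x ≠ x) :
    IsPlaneMap rot opp region ↔ IsPlaneHom rot opp region := by
  classical
  suffices main : (∀ x, region (some x) (some (rot.symm (opp x)))) →
      (∀ ψ : Option X → ZMod 2, (∀ a b, region a b → ψ a = ψ b) →
        (∀ x, ψ (some (rot x)) = ψ (some x)) → (∀ x, ψ (some (opp x)) = ψ (some x)) →
        ∀ a, ψ a = ψ none) →
      (((Nat.card (Quot fun x y : X => y = rot x) : ℤ)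
        - Nat.card (Quot fun x y : X => y = opp x) + Nat.card (Quotient region)
        = 1 + Nat.card (Quot fun x y : X => y = rot x ∨ y = opp x)) ↔
      (∀ z, IsCycle rot opp z → ∃ φ : Option X → ZMod 2, (∀ a b, region a b → φ a = φ b) ∧
        ∀ x, z x = φ (some x) + φ (some (opp x)))) by
    constructor
    · rintro ⟨h1, h2, h3⟩
      have h2' := (linked_iff _ _ _).1 h2
      exact ⟨h1, h2', (main h1 h2').1 h3⟩
    · rintro ⟨h1, h2, h3⟩
      exact ⟨h1, (linked_iff _ _ _).2 h2, (main h1 h2).2 h3⟩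
  intro hface hlinked
  -- `bd` sends a set of regions to the set of edges with exactly one side in it
  let bd : invariantFunctions (fun a b => region a b) →ₗ[ZMod 2]
      invariantFunctions (fun x y : X => y = opp x) :=
    { toFun := fun φ => ⟨fun x => φ.1 (some x) + φ.1 (some (opp x)), by
        rintro x y rfl; simp only [hopp]; exact add_comm _ _⟩
      map_add' := fun a b => by ext x; simp; ring
      map_smul' := fun c a => by ext x; simp; ring }
  -- boundaries are cycles
  have hle : LinearMap.range bd ≤ LinearMap.ker (vertexEdgePairing rot opp) := by
    rintro _ ⟨φ, rfl⟩
    rw [LinearMap.mem_ker]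
    ext h
    simp only [bd, vertexEdgePairing, LinearMap.mk₂_apply, LinearMap.coe_mk, AddHom.coe_mk,
      LinearMap.zero_apply]
    have h1 : ∀ x, φ.1 (some (opp x)) = φ.1 (some (rot.symm x)) := fun x => by
      have := φ.2 _ _ (hface (opp x))
      rwa [hopp] at this
    simp only [mul_add, h1, Finset.sum_add_distrib]
    rw [zmod_two_add_eq_zero]
    refine (Fintype.sum_equiv rot _ _ fun x => ?_)
    rw [rot.symm_apply_apply, h.2 x _ rfl]
  -- by linkedness only the empty and the full set of regions have empty boundary
  have hker : Module.finrank (ZMod 2) (LinearMap.ker bd) = 1 := by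
    rw [finrank_eq_one_iff']
    refine ⟨⟨⟨fun _ => 1, fun _ _ _ => rfl⟩, ?_⟩, ?_, ?_⟩
    · rw [LinearMap.mem_ker]; ext x; exact zmod_two_add_self 1
    · intro h
      have := congrFun (congrArg (fun f => f.1.1) h) none
      exact one_ne_zero this
    · rintro ⟨⟨ψ, h1⟩, h2⟩
      rw [LinearMap.mem_ker] at h2
      have h3 : ∀ x, ψ (some (opp x)) = ψ (some x) := fun x =>
        (zmod_two_add_eq_zero.1 (congrFun (congrArg Subtype.val h2) x)).symm
      have h4 : ∀ x, ψ (some (rot x)) = ψ (some x) := fun x => by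
        have := h1 _ _ (hface (opp (rot x)))
        rw [hopp, rot.symm_apply_apply, h3] at this
        exact this
      refine ⟨ψ none, ?_⟩
      ext a
      simp [hlinked ψ h1 h4 h3 a]
  have h1 := LinearMap.finrank_range_add_finrank_ker bd
  have h2 := finrank_cycles rot opp hopp hne
  rw [hker, finrank_invariantFunctions] at h1
  have h3 : Nat.card (Quot fun a b => region a b) = Nat.card (Quotient region) := rfl
  have h4 := Submodule.finrank_mono hle
  -- `IsCycle` describes the kernel of the pairing
  have h5 : (LinearMap.ker (vertexEdgePairing rot opp) ≤ LinearMap.range bd) ↔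
      (∀ z, IsCycle rot opp z → ∃ φ : Option X → ZMod 2, (∀ a b, region a b → φ a = φ b) ∧
        ∀ x, z x = φ (some x) + φ (some (opp x))) := by
    constructor
    · intro H z hz
      obtain ⟨φ, hφ⟩ := @H ⟨z, fun x y hxy => by subst hxy; exact (hz.opp x).symm⟩ (by
        rw [LinearMap.mem_ker]
        ext h
        exact hz.vertex h.1 fun x => (h.2 x _ rfl).symm)
      exact ⟨φ.1, φ.2, fun x => (congrFun (congrArg Subtype.val hφ) x).symm⟩
    · intro H z hz
      rw [LinearMap.mem_ker] at hz
      obtain ⟨φ, h1, h2⟩ := H z.1 ⟨fun x => (z.2 x _ rfl).symm, fun h hh => by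
        exact DFunLike.congr_fun hz ⟨h, fun x y hxy => by subst hxy; exact (hh x).symm⟩⟩
      exact ⟨⟨φ, h1⟩, by ext x; exact (h2 x).symm⟩
  rw [← h5]
  constructor
  · intro h
    exact (Submodule.eq_of_le_of_finrank_le hle (by omega)).ge
  · intro h
    have := le_antisymm hle h
    rw [this] at h1
    omega

end Planarity

/-! ### Operations that preserve planarity -/

section Subdivision

variable {X Y : Type}

/-- The map `(rot', opp')` on `Y` arises from the map `(rot, opp)` on `X` by adding bivalent
vertices.  Here `e` is the inclusion of the old darts, and `κ` sends a dart of `Y`, which is a piece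
of an old edge with a direction, to the old dart with the same edge and direction. -/
structure Subdivides (rot opp : Perm X) (rot' opp' : Perm Y) (e : X → Y) (κ : Y → X) : Prop where
  label : ∀ x, κ (e x) = x
  rot_incl : ∀ x, rot' (e x) = e (rot x)
  label_opp : ∀ y, κ (opp' y) = opp (κ y)
  bivalent : ∀ y, e (κ y) ≠ y → IsBivalent rot' y ∧ κ (rot' y) = opp (κ y)

variable {rot opp : Perm X} {rot' opp' : Perm Y} {e : X → Y} {κ : Y → X}

theorem Subdivides.injective (S : Subdivides rot opp rot' opp' e κ) : Function.Injective e :=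
  Function.LeftInverse.injective S.label

theorem Subdivides.new_rot (S : Subdivides rot opp rot' opp' e κ) {y : Y} (hy : e (κ y) ≠ y) :
    e (κ (rot' y)) ≠ rot' y := by
  intro h
  have h1 := S.rot_incl (κ (rot' y))
  rw [h, (S.bivalent y hy).1.2] at h1
  exact hy (by rw [h1, S.label])

/-- A sum over the darts of a subdivision of a function that takes equal values on both darts of
every new vertex can be computed on the old darts. -/
theorem Subdivides.sum_eq [Fintype X] [Fintype Y] (S : Subdivides rot opp rot' opp' e κ)
    (F : Y → ZMod 2) (hF : ∀ y, e (κ y) ≠ y → F (rot' y) = F y) :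
    ∑ y, F y = ∑ x, F (e x) := by
  classical
  rw [← Finset.sum_filter_add_sum_filter_not Finset.univ (fun y => e (κ y) = y)]
  have h1 : ∑ y ∈ Finset.univ.filter (fun y => ¬ e (κ y) = y), F y = 0 := by
    refine Finset.sum_involution (fun y _ => rot' y) ?_ ?_ ?_ ?_
    · intro y hy
      rw [hF y (by simpa using hy)]; exact zmod_two_add_self _
    · intro y hy _
      exact (S.bivalent y (by simpa using hy)).1.1
    · intro y hy
      simpa using S.new_rot (by simpa using hy)
    · intro y hy
      exact (S.bivalent y (by simpa using hy)).1.2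
  rw [h1, add_zero, Finset.sum_filter]
  symm
  refine Fintype.sum_of_injective e S.injective _ _ ?_ ?_
  · intro y hy
    rw [if_neg fun h => hy ⟨_, h⟩]
  · intro x
    simp [S.label]

/-- Forgetting bivalent vertices preserves planarity. -/
theorem Subdivides.isPlaneHom_of_subdivision [Fintype X] [Fintype Y]
    (S : Subdivides rot opp rot' opp' e κ) {region : Setoid (Option X)}
    {region' : Setoid (Option Y)}
    (hregion : ∀ a b, region' a b ↔ region (a.map κ) (b.map κ))
    (H : IsPlaneHom rot' opp' region') : IsPlaneHom rot opp region := by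
  have hmap : ∀ a : Option X, (a.map e).map κ = a := by
    rintro (_ | a) <;> simp [S.label]
  have hsame : ∀ y y', κ y = κ y' → region' (some y) (some y') := fun y y' h => by
    rw [hregion]; simp only [Option.map_some, h]; exact region.refl _
  refine ⟨fun x => ?_, fun ψ h1 h2 h3 a => ?_, fun z hz => ?_⟩
  · -- the last piece of the edge of `x`
    have hopp' : κ (opp'.symm (e (opp x))) = x := by
      have := S.label_opp (opp'.symm (e (opp x)))
      rw [opp'.apply_symm_apply, S.label] at this
      exact (opp.injective this).symm
    have h := (hregion _ _).1 (H.face (opp'.symm (e (opp x))))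
    have hr : rot'.symm (e (opp x)) = e (rot.symm (opp x)) := by
      rw [Equiv.symm_apply_eq, S.rot_incl, rot.apply_symm_apply]
    simpa [hopp', hr, S.label] using h
  -- an invariant function is pulled back along `κ`
  · have := H.linked (fun a => ψ (a.map κ)) (fun a b h => h1 _ _ ((hregion _ _).1 h)) (fun y => ?_)
      (fun y => by simp [S.label_opp, h3]) (a.map e)
    · simpa [hmap] using this
    · by_cases hy : e (κ y) = y
      · simp only [Option.map_some]
        conv_lhs => rw [← hy]
        rw [S.rot_incl, S.label, h2]
      · simp [(S.bivalent y hy).2, h3]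
  -- a cycle is spread over the pieces of each edge, and bounds there
  · obtain ⟨φ, h1, h2⟩ := H.boundary (fun y => z (κ y)) ⟨fun y => by rw [S.label_opp, hz.opp], fun h hh => by
      rw [S.sum_eq]
      · simp only [S.label]
        exact hz.vertex _ fun x => by rw [← S.rot_incl, hh]
      · intro y hy
        rw [hh, (S.bivalent y hy).2, hz.opp]⟩
    refine ⟨fun a => φ (a.map e), fun a b h => h1 _ _ ((hregion _ _).2 (by simpa [hmap] using h)),
      fun x => ?_⟩
    have := h2 (e x)
    rw [S.label] at this
    rw [this]
    simp only [Option.map_some]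
    rw [h1 _ _ (hsame (opp' (e x)) (e (opp x)) (by rw [S.label_opp, S.label, S.label]))]

/-- Adding bivalent vertices preserves planarity, provided that every piece of an edge can be
reached from an end of the edge (so that no circles are added). -/
theorem Subdivides.isPlaneHom_subdivision [Fintype X] [Fintype Y]
    (S : Subdivides rot opp rot' opp' e κ) {region : Setoid (Option X)}
    {region' : Setoid (Option Y)}
    (hopp : ∀ x, opp (opp x) = x)
    (hregion : ∀ a b, region' a b ↔ region (a.map κ) (b.map κ))
    (hpath : ∀ z : Y → ZMod 2, (∀ y, z (opp' y) = z y) →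
      (∀ y, e (κ y) ≠ y → z (rot' y) = z y) → ∀ y, z (e (κ y)) = z y)
    (H : IsPlaneHom rot opp region) : IsPlaneHom rot' opp' region' := by
  classical
  have hsame : ∀ y y', κ y = κ y' → region' (some y) (some y') := fun y y' h => by
    rw [hregion]; simp only [Option.map_some, h]; exact region.refl _
  refine ⟨fun y => ?_, fun ψ h1 h2 h3 a => ?_, fun z hz => ?_⟩
  · rw [hregion]
    simp only [Option.map_some]
    have hw := S.label_opp y
    generalize opp' y = w at hw
    by_cases h : e (κ w) = w
    · have : rot'.symm w = e (rot.symm (κ w)) := by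
        rw [Equiv.symm_apply_eq, S.rot_incl, rot.apply_symm_apply, h]
      rw [this, S.label, hw]
      exact H.face _
    · have h2 := S.bivalent _ h
      have : rot'.symm w = rot' w := by rw [Equiv.symm_apply_eq, h2.1.2]
      rw [this, h2.2, hw, hopp]
  · have hx : ∀ a : Option Y, ψ a = ψ ((a.map κ).map e) := fun a => h1 _ _ (by
      rw [hregion]
      rcases a with _ | y
      · exact region.refl _
      · simp only [Option.map_some, S.label]; exact region.refl _)
    rw [hx]
    have := H.linked (fun a => ψ (a.map e)) (fun a b h => h1 _ _ ((hregion _ _).2 ?_))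
      (fun x => ?_) (fun x => ?_) (a.map κ)
    · simpa using this
    · rcases a with _ | a <;> rcases b with _ | b <;> simpa [S.label] using h
    · simp only [Option.map_some]; rw [← S.rot_incl, h2]
    · simp only [Option.map_some]
      rw [h1 _ _ (hsame (e (opp x)) (opp' (e x)) (by rw [S.label_opp, S.label, S.label])), h3]
  -- a cycle takes the same value on both sides of a bivalent vertex, hence it is constant along
  -- each edge and comes from a cycle of the smaller map
  · have hbiv : ∀ y, e (κ y) ≠ y → z (rot' y) = z y := by
      intro y hy
      have hb := (S.bivalent y hy).1
      have h1 := hz.vertex (fun w => if w = y ∨ w = rot' y then 1 else 0) (fun w => by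
        have : (rot' w = y ∨ rot' w = rot' y) ↔ (w = y ∨ w = rot' y) := by
          rw [rot'.injective.eq_iff, or_comm]
          refine or_congr Iff.rfl ⟨fun h => ?_, fun h => by rw [h, hb.2]⟩
          rw [← rot'.injective.eq_iff, h, hb.2]
        simp only [this])
      simp only [ite_mul, one_mul, zero_mul] at h1
      rw [← Finset.sum_filter, show Finset.univ.filter (fun w => w = y ∨ w = rot' y) = {y, rot' y} by
        ext; simp, Finset.sum_pair hb.1.symm] at h1
      exact (zmod_two_add_eq_zero.1 h1).symm
    have hp := hpath z hz.opp hbiv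
    obtain ⟨φ, h1, h2⟩ := H.boundary (fun x => z (e x)) ⟨fun x => by
        have h := hp (opp' (e x))
        rw [S.label_opp, S.label, hz.opp] at h
        exact h, fun h hh => by
        have h3 := hz.vertex (fun y => if e (κ y) = y then h (κ y) else 0) (fun y => by
          by_cases hy : e (κ y) = y
          · have h4 := S.rot_incl (κ y)
            rw [hy] at h4
            rw [if_pos hy, h4, S.label, if_pos rfl, hh]
          · rw [if_neg hy, if_neg (S.new_rot hy)])
        rw [S.sum_eq] at h3
        · simpa [S.label] using h3
        · intro y hy
          rw [if_neg hy, if_neg (S.new_rot hy), zero_mul, zero_mul]⟩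
    refine ⟨fun a => φ (a.map κ), fun a b h => h1 _ _ ((hregion _ _).1 h), fun y => ?_⟩
    have := h2 (κ y)
    rw [hp] at this
    simpa [S.label_opp] using this

end Subdivision

section Contraction

variable {X Y : Type} {n : ℕ} [NeZero n]

/-- If the part of a plane map inside a disc is connected, then shrinking the disc to a vertex gives
a plane map.  The darts of the new map are embedded by `ι`; the dart `ι (inr i)` is the dart of the
part in the disc that leaves the disc at the `i`-th boundary point.  Connectedness enters through
`hleg`, `hinner` and `hflow`. -/
theorem IsPlaneHom.contract [Fintype X] [Fintype Y] {rot opp : Perm X}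
    {region : Setoid (Option X)} (H : IsPlaneHom rot opp region) (hopp : ∀ x, opp (opp x) = x)
    {ι : Y ⊕ Fin n → X} (hι : Function.Injective ι) {rot' : Perm Y} {opp' : Perm (Y ⊕ Fin n)}
    {region' : Setoid (Option (Y ⊕ Fin n))}
    (hrot' : ∀ y, rot (ι (.inl y)) = ι (.inl (rot' y))) (hopp' : ∀ w, opp (ι w) = ι (opp' w))
    (hregion : ∀ a b, region' a b ↔ region (a.map ι) (b.map ι))
    (hleg : ∀ i, region (some (ι (.inr i))) (some (opp (ι (.inr (finRotate n i))))))
    (hinner : ∀ x, (∀ w, ι w ≠ x) → (∃ i, region (some x) (some (ι (.inr i)))) ∨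
      ∀ a : Option (Y ⊕ Fin n), ¬ region (some x) (a.map ι))
    (hflow : ∀ b : Fin n → ZMod 2, ∑ i, b i = 0 → ∃ w : X → ZMod 2, (∀ i, w (ι (.inr i)) = b i) ∧
      (∀ x, (∀ w, ι w ≠ x) → w (opp x) = w x) ∧
      ∀ h : X → ZMod 2, (∀ x, h (rot x) = h x) → (∀ y, h (ι (.inl y)) = 0) →
        ∑ x, h x * w x = 0) :
    IsPlaneHom (Equiv.sumCongr rot' (finRotate n)) opp' region' := by
  classical
  have hrs : ∀ y, rot.symm (ι (.inl y)) = ι (.inl (rot'.symm y)) := fun y => by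
    rw [Equiv.symm_apply_eq, hrot', rot'.apply_symm_apply]
  have hout : ∀ x, (∀ w, ι w ≠ x) → ∀ w, ι w ≠ opp x := fun x hx w h =>
    hx (opp' w) (by rw [← hopp', h, hopp])
  have hK : ∀ x, (∃ y, ι (.inl y) = rot x) ↔ ∃ y, ι (.inl y) = x := fun x =>
    ⟨fun ⟨y, h⟩ => ⟨rot'.symm y, by rw [← hrs, h, rot.symm_apply_apply]⟩,
      fun ⟨y, h⟩ => ⟨rot' y, by rw [← hrot', h]⟩⟩
  refine ⟨fun w => ?_, fun ψ h1 h2 h3 => ?_, fun z hz => ?_⟩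
  · rw [hregion]
    have hw := hopp' w
    rcases hw' : opp' w with y | i
    · rw [hw'] at hw
      have := H.face (ι w)
      rw [hw, hrs] at this
      simpa using this
    · rw [hw'] at hw
      have := hleg ((finRotate n).symm i)
      rw [Equiv.apply_symm_apply, ← hw, hopp] at this
      exact region.symm this
  -- an invariant function is constant on the legs, with value `c`
  · have hc : ∀ i, ψ (some (.inr i)) = ψ (some (.inr (0 : Fin n))) := by
      have hs : ∀ i, ψ (some (.inr (finRotate n i))) = ψ (some (.inr i)) := fun i => h2 (.inr i)
      obtain ⟨m, rfl⟩ : ∃ m, n = m + 1 := ⟨n - 1, (Nat.succ_pred (NeZero.ne n)).symm⟩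
      intro i
      induction i using Fin.induction with
      | zero => rfl
      | succ i ih =>
        rw [← ih, ← hs i.castSucc]
        congr 3
        rw [finRotate_apply, Fin.coeSucc_eq_succ]
    set c := ψ (some (.inr (0 : Fin n)))
    -- `Ψ` extends `ψ` by the constant `c` inside the disc
    let Ψ : Option X → ZMod 2 := fun a =>
      if h : ∃ d : Option (Y ⊕ Fin n), region a (d.map ι) then ψ h.choose else c
    have hΨ : ∀ a (d : Option (Y ⊕ Fin n)), region a (d.map ι) → Ψ a = ψ d := by
      intro a d hd
      have h : ∃ d : Option (Y ⊕ Fin n), region a (d.map ι) := ⟨d, hd⟩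
      simp only [Ψ, dif_pos h]
      exact h1 _ _ ((hregion _ _).2 (region.trans (region.symm h.choose_spec) hd))
    have hΨι : ∀ w, Ψ (some (ι w)) = ψ (some w) := fun w => hΨ _ (some w) (region.refl _)
    have hΨin : ∀ x, (∀ w, ι w ≠ x) → Ψ (some x) = c := by
      intro x hx
      rcases hinner x hx with ⟨i, hi⟩ | hno
      · rw [hΨ _ (some (.inr i)) hi, hc]
      · simp only [Ψ]
        rw [dif_neg fun ⟨d, hd⟩ => hno d hd]
    have hΨK : ∀ x, (¬ ∃ y, ι (.inl y) = x) → Ψ (some x) = c := by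
      intro x hx
      by_cases h : ∃ w, ι w = x
      · obtain ⟨y | i, rfl⟩ := h
        · exact absurd ⟨y, rfl⟩ hx
        · rw [hΨι, hc]
      · exact hΨin x fun w hw => h ⟨w, hw⟩
    have hreg : ∀ a b, region a b → Ψ a = Ψ b := by
      intro a b hab
      by_cases h : ∃ d : Option (Y ⊕ Fin n), region b (d.map ι)
      · obtain ⟨d, hd⟩ := h
        rw [hΨ b d hd, hΨ a d (region.trans hab hd)]
      · have h' : ¬ ∃ d : Option (Y ⊕ Fin n), region a (d.map ι) :=
          fun ⟨d, hd⟩ => h ⟨d, region.trans (region.symm hab) hd⟩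
        simp only [Ψ, dif_neg h, dif_neg h']
    have hfin := H.linked Ψ hreg (fun x => ?_) (fun x => ?_)
    · intro a
      rw [← hΨ (a.map ι) a (region.refl _), hfin, ← hΨ none none (region.refl _)]
    · by_cases h : ∃ y, ι (.inl y) = x
      · obtain ⟨y, rfl⟩ := h
        rw [hrot', hΨι, hΨι]; exact h2 (.inl y)
      · rw [hΨK _ h, hΨK _ fun h' => h ((hK x).1 h')]
    · by_cases h : ∃ w, ι w = x
      · obtain ⟨w, rfl⟩ := h
        rw [hopp', hΨι, hΨι, h3]
      · have h' : ∀ w, ι w ≠ x := fun w hw => h ⟨w, hw⟩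
        rw [hΨin _ h', hΨin _ (hout x h')]
  -- a cycle of the contracted map sums to zero over the new vertex, so that it extends through
  -- the disc by `hflow`; a set of regions bounded by the extension restricts to the outside
  · have hsum : ∑ i, z (.inr i) = 0 := by
      have := hz.vertex (Sum.elim 0 1) (by rintro (y | i) <;> simp)
      simpa using this
    obtain ⟨w, hw1, hw2, hw3⟩ := hflow _ hsum
    have hZι : ∀ v, Function.extend ι z w (ι v) = z v := fun v => hι.extend_apply _ _ _
    have hZin : ∀ x, (∀ v, ι v ≠ x) → Function.extend ι z w x = w x := fun x hx =>
      Function.extend_apply' _ _ _ fun ⟨v, hv⟩ => hx v hv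
    obtain ⟨φ, h1, h2⟩ := H.boundary (Function.extend ι z w) ⟨fun x => by
        by_cases h : ∃ v, ι v = x
        · obtain ⟨v, rfl⟩ := h
          rw [hopp', hZι, hZι, hz.opp]
        · have h' : ∀ v, ι v ≠ x := fun v hv => h ⟨v, hv⟩
          rw [hZin _ h', hZin _ (hout x h'), hw2 x h'], fun h hh => by
        -- the sum over all darts is split into the darts outside and inside the disc
        have e1 : ∑ x, (if ∃ y, ι (.inl y) = x then h x else 0) * Function.extend ι z w x = 0 := by
          have := hz.vertex (Sum.elim (fun y => h (ι (.inl y))) 0) (by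
            rintro (y | i)
            · simp [← hrot', hh]
            · simp)
          refine Eq.trans ?_ this
          symm
          refine Fintype.sum_of_injective ι hι _ _ ?_ ?_
          · intro x hx
            rw [if_neg fun ⟨y, hy⟩ => hx ⟨_, hy⟩, zero_mul]
          · rintro (y | i)
            · rw [hZι, if_pos ⟨y, rfl⟩]; rfl
            · rw [if_neg fun ⟨y, hy⟩ => by simpa using hι hy]; simp
        have e2 : ∑ x, (if ∃ y, ι (.inl y) = x then 0 else h x) * Function.extend ι z w x = 0 := by
          refine Eq.trans ?_ (hw3 (fun x => if ∃ y, ι (.inl y) = x then 0 else h x) (fun x => by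
            simp only [hK, hh]) (fun y => if_pos ⟨y, rfl⟩))
          refine Finset.sum_congr rfl fun x _ => ?_
          by_cases hx : ∃ y, ι (.inl y) = x
          · simp [if_pos hx]
          · congr 1
            by_cases h' : ∃ v, ι v = x
            · obtain ⟨y | i, rfl⟩ := h'
              · exact absurd ⟨y, rfl⟩ hx
              · rw [hZι, hw1]
            · exact hZin x fun v hv => h' ⟨v, hv⟩
        refine Eq.trans ?_ ((congrArg₂ (· + ·) e1 e2).trans (add_zero 0))
        rw [← Finset.sum_add_distrib]
        refine Finset.sum_congr rfl fun x _ => ?_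
        by_cases hx : ∃ y, ι (.inl y) = x <;> simp [hx]⟩
    refine ⟨fun a => φ (a.map ι), fun a b hab => h1 _ _ ((hregion _ _).1 hab), fun v => ?_⟩
    have := h2 (ι v)
    rw [hZι, hopp'] at this
    exact this

end Contraction

namespace WebDiagram

/-- The homological form of planarity for web diagrams. -/
theorem isPlane_iff (Γ : WebDiagram) [Fintype Γ.Dart] :
    Γ.IsPlane ↔ IsPlaneHom Γ.rot Γ.opp Γ.region :=
  isPlaneMap_iff_isPlaneHom _ _ _ Γ.opp_opp Γ.opp_ne

theorem Isomorphic.isPlane {Γ Γ' : WebDiagram} (h : Γ.Isomorphic Γ') (H : Γ.IsPlane) :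
    Γ'.IsPlane := by
  have := Γ.finite; have := Γ'.finite
  let := Fintype.ofFinite Γ.Dart; let := Fintype.ofFinite Γ'.Dart
  obtain ⟨e, h1, h2, -, -, h5⟩ := h
  rw [isPlane_iff] at H ⊢
  have S : Subdivides Γ'.rot Γ'.opp Γ.rot Γ.opp e.symm e :=
    { label := fun x => e.apply_symm_apply x
      rot_incl := fun x => by rw [Equiv.eq_symm_apply, h1, e.apply_symm_apply]
      label_opp := h2
      bivalent := fun y hy => absurd (e.symm_apply_apply y) hy }
  exact S.isPlaneHom_of_subdivision (fun a b => (h5 a b).symm) H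

theorem Isomorphic.symm {Γ Γ' : WebDiagram} (h : Γ.Isomorphic Γ') : Γ'.Isomorphic Γ := by
  obtain ⟨e, h1, h2, h3, h4, h5⟩ := h
  have hm : ∀ a : Option Γ'.Dart, (a.map e.symm).map e = a := by rintro (_ | a) <;> simp
  refine ⟨e.symm, fun d => ?_, fun d => ?_, fun d => ?_, fun d => ?_, fun a b => ?_⟩
  · rw [Equiv.symm_apply_eq, h1, e.apply_symm_apply]
  · rw [Equiv.symm_apply_eq, h2, e.apply_symm_apply]
  · rw [← h3, e.apply_symm_apply]
  · rw [← h4, e.apply_symm_apply]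
  · rw [← h5, hm, hm]

/-- Erasing components of a plane diagram gives a plane diagram. -/
theorem IsPlane.restrict {Γ : WebDiagram} (H : Γ.IsPlane) (S : Γ.Dart → Prop)
    (hrot : ∀ d, S (Γ.rot d) ↔ S d) (hopp : ∀ d, S (Γ.opp d) ↔ S d) :
    (Γ.restrict S hrot hopp).IsPlane := by
  classical
  have := Γ.finite
  let := Fintype.ofFinite Γ.Dart
  have := (Γ.restrict S hrot hopp).finite
  let := Fintype.ofFinite (Γ.restrict S hrot hopp).Dart
  rw [isPlane_iff] at H ⊢
  -- the regions after deletion: those of `Γ`, merged across the deleted edges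
  set r : Option Γ.Dart → Option Γ.Dart → Prop := fun a b => Γ.region a b ∨
      ∃ d, ¬ S d ∧ a = some d ∧ (b = some (Γ.rot d) ∨ b = some (Γ.opp d)) with hr
  have hreg : ∀ a b, (Γ.restrict S hrot hopp).region a b ↔
      Relation.EqvGen r (a.map Subtype.val) (b.map Subtype.val) := fun a b => Iff.rfl
  refine ⟨fun d => ?_, fun ψ h1 h2 h3 => ?_, fun z hz => ?_⟩
  · rw [hreg]
    exact .rel _ _ (Or.inl (H.face d.1))
  · -- extend `ψ` to the regions of `Γ`
    let p : Option Γ.Dart → Prop := fun a => ∃ d : Option {d // S d},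
      Relation.EqvGen r a (d.map Subtype.val)
    have hp : ∀ a b, r a b → (p a ↔ p b) := fun a b hab =>
      ⟨fun ⟨d, hd⟩ => ⟨d, .trans _ _ _ (.symm _ _ (.rel _ _ hab)) hd⟩,
        fun ⟨d, hd⟩ => ⟨d, .trans _ _ _ (.rel _ _ hab) hd⟩⟩
    let Ψ : Option Γ.Dart → ZMod 2 := fun a => if h : p a then ψ h.choose else ψ none
    have hΨ : ∀ a (d : Option {d // S d}), Relation.EqvGen r a (d.map Subtype.val) → Ψ a = ψ d := by
      intro a d hd
      have h : p a := ⟨d, hd⟩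
      simp only [Ψ, dif_pos h]
      exact h1 _ _ ((hreg _ _).2 (.trans _ _ _ (.symm _ _ h.choose_spec) hd))
    have hΨs : ∀ x (hx : S x), Ψ (some x) = ψ (some ⟨x, hx⟩) := fun x hx =>
      hΨ (some x) (some ⟨x, hx⟩) (.refl _)
    have hΨr : ∀ a b, r a b → Ψ a = Ψ b := by
      intro a b hab
      by_cases h : p b
      · obtain ⟨d, hd⟩ := h
        rw [hΨ b d hd, hΨ a d (.trans _ _ _ (.rel _ _ hab) hd)]
      · simp only [Ψ, dif_neg h, dif_neg (mt (hp a b hab).1 h)]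
    have hfin := H.linked Ψ (fun a b h => hΨr _ _ (Or.inl h)) (fun x => ?_) (fun x => ?_)
    · intro a
      exact (hΨ (a.map Subtype.val) a (.refl _)).symm.trans ((hfin _).trans (hΨ none none (.refl _)))
    · by_cases hx : S x
      · rw [hΨs x hx, hΨs _ ((hrot x).2 hx)]
        exact h2 ⟨x, hx⟩
      · exact (hΨr _ _ (Or.inr ⟨x, hx, rfl, Or.inl rfl⟩)).symm
    · by_cases hx : S x
      · rw [hΨs x hx, hΨs _ ((hopp x).2 hx)]
        exact h3 ⟨x, hx⟩
      · exact (hΨr _ _ (Or.inr ⟨x, hx, rfl, Or.inr rfl⟩)).symm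
  · -- extend the cycle by zero
    let Z : Γ.Dart → ZMod 2 := fun d => if h : S d then z ⟨d, h⟩ else 0
    have hZ : ∀ d : {d // S d}, Z d.1 = z d := fun d => dif_pos d.2
    obtain ⟨φ, h1, h2⟩ := H.boundary Z ⟨fun d => by
        by_cases hd : S d
        · simp only [Z, dif_pos hd, dif_pos ((hopp d).2 hd)]; exact hz.opp ⟨d, hd⟩
        · simp only [Z, dif_neg hd, dif_neg (mt (hopp d).1 hd)], fun h hh => by
        refine Eq.trans ?_ (hz.vertex (fun d => h d.1) fun d => hh d.1)
        symm
        refine Fintype.sum_of_injective (ι := (Γ.restrict S hrot hopp).Dart) (fun d => d.1)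
          Subtype.val_injective _ _ ?_ ?_
        · intro d hd
          have : ¬ S d := fun h => hd ⟨⟨d, h⟩, rfl⟩
          simp only [Z, dif_neg this, mul_zero]
        · intro d
          exact congrArg (h d.1 * ·) (hZ d).symm⟩
    have hφopp : ∀ d, ¬ S d → φ (some (Γ.opp d)) = φ (some d) := fun d hd => by
      have := h2 d
      simp only [Z, dif_neg hd] at this
      exact (zmod_two_add_eq_zero.1 this.symm).symm
    have hφ : ∀ a b, Relation.EqvGen r a b → φ a = φ b := by
      intro a b hab
      induction hab with
      | rel a b h =>
        rcases h with h | ⟨d, hd, rfl, rfl | rfl⟩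
        · exact h1 _ _ h
        · have h3 := h1 _ _ (H.face (Γ.opp (Γ.rot d)))
          rw [Γ.opp_opp, Γ.rot.symm_apply_apply, hφopp _ (mt (hrot d).1 hd)] at h3
          exact h3.symm
        · exact (hφopp d hd).symm
      | refl => rfl
      | symm _ _ _ ih => exact ih.symm
      | trans _ _ _ _ _ ih1 ih2 => exact ih1.trans ih2
    exact ⟨fun a => φ (a.map Subtype.val), fun a b h => hφ _ _ h, fun d =>
      (hZ d).symm.trans (h2 d.1)⟩

end WebDiagram

section GluePlane

variable {n : ℕ} {bd : Fin n → Bool}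

/-- The successor of a dart of a tangle on the boundary of the region to its left, where the boundary
circle counts as part of the graph. -/
def Tangle.face (A : Tangle bd) (x : A.Dart ⊕ Fin n) : A.Dart ⊕ Fin n :=
  (Equiv.sumCongr A.rot (finRotate n).symm).symm (A.opp x)

/-- A tangle is plane, in the homological sense: there are no closed components, and
every set of edges meeting every vertex evenly bounds a set of regions of the disc. -/
structure Tangle.IsPlane (A : Tangle bd) [Fintype A.Dart] : Prop where
  linked : ∀ ψ : A.Dart ⊕ Fin n → ZMod 2, (∀ d, ψ (.inl (A.rot d)) = ψ (.inl d)) →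
    (∀ x, ψ (A.opp x) = ψ x) → (∀ i, ψ (.inr i) = 0) → ∀ x, ψ x = 0
  boundary : ∀ z : A.Dart ⊕ Fin n → ZMod 2, (∀ x, z (A.opp x) = z x) →
    (∀ h : A.Dart → ZMod 2, (∀ d, h (A.rot d) = h d) → ∑ d, h d * z (.inl d) = 0) →
    ∃ φ : A.Dart ⊕ Fin n → ZMod 2, (∀ x, φ (A.face x) = φ x) ∧ ∀ x, z x = φ x + φ (A.opp x)

theorem eq_of_finRotate_invariant [NeZero n] {α : Type} (g : Fin n → α)
    (h : ∀ i, g (finRotate n i) = g i) (i : Fin n) : g i = g 0 := by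
  obtain ⟨m, rfl⟩ : ∃ m, n = m + 1 := ⟨n - 1, (Nat.succ_pred (NeZero.ne n)).symm⟩
  induction i using Fin.induction with
  | zero => rfl
  | succ i ih =>
    rw [← ih, ← h i.castSucc]
    congr 1
    rw [finRotate_apply, Fin.coeSucc_eq_succ]

/-- Filling the hole of a plane outer tangle with a plane tangle gives a plane diagram. -/
theorem glue_isPlane [NeZero n] (O : OuterTangle bd) (A : Tangle bd) [Fintype A.Dart]
    (hO : O.IsPlane) (hA : A.IsPlane) : (O.glue A).IsPlane := by
  have := O.finite
  let := Fintype.ofFinite O.Dart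
  have HO := (isPlaneMap_iff_isPlaneHom _ _ _ O.opp_opp O.opp_ne).1 hO
  refine (isPlaneMap_iff_isPlaneHom (X := (O.Dart ⊕ Fin n) ⊕ (A.Dart ⊕ Fin n)) (glueRot O A)
    (glueOpp O A) (Relation.EqvGen.setoid (GlueRegion O A)) (O.glue A).opp_opp
    (O.glue A).opp_ne).2 ?_
  have hgen : ∀ ψ : Option ((O.Dart ⊕ Fin n) ⊕ (A.Dart ⊕ Fin n)) → ZMod 2,
      (∀ a b, GlueRegion O A a b → ψ a = ψ b) → ∀ a b, Relation.EqvGen (GlueRegion O A) a b → ψ a = ψ b := by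
    intro ψ h a b hab
    induction hab with
    | rel a b hab => exact h a b hab
    | refl => rfl
    | symm _ _ _ ih => exact ih.symm
    | trans _ _ _ _ _ ih1 ih2 => exact ih1.trans ih2
  have hrel : ∀ a b, GlueRegion O A a b → Relation.EqvGen (GlueRegion O A) a b := fun a b h => .rel _ _ h
  refine ⟨fun x => hrel _ _ (.across x), fun ψ h1 h2 h3 => ?_, fun z hz => ?_⟩
  -- an invariant function is constant on the boundary circle, hence by linkedness of `O` on the
  -- outside, and then by linkedness of `A` on the inside
  · have hb : ∀ i, ψ (some (.inr (.inr i))) = ψ (some (.inl (.inr i))) := fun i => h2 (.inl (.inr i))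
    have hstep : ∀ i, ψ (some (.inl (.inr (finRotate n i)))) = ψ (some (.inl (.inr i))) := by
      intro i
      have := h1 _ _ (hrel _ _ (GlueRegion.inner (A.opp (.inr i))))
      rw [A.opp_opp] at this
      rw [← hb, ← hb, ← h3 (.inr (.inr i))]
      exact this.symm
    have hOc := HO.linked (fun a => ψ (a.map Sum.inl)) (fun a b h => h1 _ _ (hrel _ _ (.outer a b h)))
      (by
        rintro (d | i)
        · exact h2 (.inl (.inl d))
        · exact hstep i) (fun x => h3 (.inl x))
    have hAc := hA.linked (fun x => ψ (some (.inr x)) + ψ none)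
      (fun d => by rw [← h2 (.inr (.inl d))]; rfl) (fun x => by rw [← h3 (.inr x)]; rfl)
      (fun i => by
        rw [hb]
        have := hOc (some (.inr i))
        simp only [Option.map_some, Option.map_none] at this
        rw [this]; exact zmod_two_add_self _)
    rintro (_ | (x | x))
    · rfl
    · exact hOc (some x)
    · exact zmod_two_add_eq_zero.1 (hAc x)
  -- a cycle restricts to cycles of `O` and of `A`, which bound by planarity
  · have hzO : ∀ x, z (.inl (O.opp x)) = z (.inl x) := fun x => hz.opp (.inl x)
    have hzA : ∀ x, z (.inr (A.opp x)) = z (.inr x) := fun x => hz.opp (.inr x)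
    -- the values on both sides of a boundary point agree
    have hzb : ∀ i, z (.inr (.inr i)) = z (.inl (.inr i)) := by
      intro i
      have := hz.vertex (Sum.elim (Sum.elim 0 (Pi.single i 1)) (Sum.elim 0 (Pi.single i 1))) (by
        rintro ((d | j) | (d | j)) <;> rfl)
      simp only [Fintype.sum_sum_type] at this
      simp only [Sum.elim_inl, Sum.elim_inr, Pi.zero_apply, zero_mul,
        Finset.sum_const_zero, zero_add, Pi.single_apply, ite_mul, one_mul, Finset.sum_ite_eq',
        Finset.mem_univ, if_true] at this
      exact (zmod_two_add_eq_zero.1 this).symm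
    obtain ⟨φO, hO1, hO2⟩ := HO.boundary (fun x => z (.inl x)) ⟨hzO, fun h hh => by
      have hc := eq_of_finRotate_invariant (fun i => h (.inr i)) (fun i => hh (.inr i))
      have h0 : ∑ x : A.Dart ⊕ Fin n, h (.inr (0 : Fin n)) * z (.inr x) = 0 :=
        sum_eq_zero_of_involution A.opp A.opp_opp A.opp_ne _ fun x => by rw [hzA]
      have := hz.vertex (Sum.elim h (fun _ => h (.inr (0 : Fin n)))) (by
        rintro ((d | j) | (d | j))
        · exact hh (.inl d)
        · exact (hc j).symm
        · rfl
        · exact hc j)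
      rw [Fintype.sum_sum_type] at this
      simp only [Sum.elim_inl, Sum.elim_inr] at this
      rwa [h0, add_zero] at this⟩
    obtain ⟨φA, hA1, hA2⟩ := hA.boundary (fun x => z (.inr x)) hzA (fun h hh => by
      have := hz.vertex (Sum.elim 0 (Sum.elim h 0)) (by
        rintro ((d | j) | (d | j))
        · rfl
        · rfl
        · exact hh d
        · rfl)
      rw [Fintype.sum_sum_type] at this
      simpa using this)
    -- the two potentials differ by a constant along the boundary circle
    have hα := eq_of_finRotate_invariant (n := n)
      (fun i => φO (some (O.opp (.inr i))) + φA (.inr i)) (fun i => by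
        have h1 := hO1 _ _ (HO.face (O.opp (.inr (finRotate n i))))
        have h2 := hA1 (A.opp (.inr i))
        have h3 := hO2 (.inr i)
        have h4 := hA2 (.inr i)
        rw [O.opp_opp] at h1
        have h1' : φO (some (O.opp (.inr (finRotate n i)))) = φO (some (.inr i)) := by
          rw [h1]; simp
        have h2' : φA (.inr (finRotate n i)) = φA (A.opp (.inr i)) := by
          rw [← h2, Tangle.face, A.opp_opp]; simp
        rw [h1', h2']
        rw [hzb, h3] at h4
        have h5 : ∀ a b c d : ZMod 2, a + b = c + d → a + d = b + c := by decide
        exact h5 _ _ _ _ h4)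
    set k := φO (some (O.opp (.inr (0 : Fin n)))) + φA (.inr (0 : Fin n))
    have hk : ∀ i, φO (some (O.opp (.inr i))) = φA (.inr i) + k := fun i => by
      have h5 : ∀ a b c : ZMod 2, a + b = c → a = b + c := by decide
      exact h5 _ _ _ (hα i)
    have hk' : ∀ i, φO (some (.inr i)) = φA (A.opp (.inr i)) + k := fun i => by
      have h3 := hO2 (.inr i)
      have h4 := hA2 (.inr i)
      rw [hzb, h3, hk] at h4
      have h5 : ∀ a b c d : ZMod 2, a + (b + d) = b + c → a = c + d := by decide
      exact h5 _ _ _ _ h4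
    refine ⟨fun a => a.elim (φO none) (Sum.elim (fun x => φO (some x)) (fun x => φA x + k)),
      hgen _ ?_, ?_⟩
    · rintro a b (⟨a, b, h⟩ | x | x)
      · have : ∀ a : Option (O.Dart ⊕ Fin n), (a.map Sum.inl).elim (φO none)
            (Sum.elim (fun x => φO (some x)) (fun x : A.Dart ⊕ Fin n => φA x + k)) = φO a := by
          rintro (_ | a) <;> rfl
        rw [this, this]; exact hO1 _ _ h
      · exact congrArg (· + k) (hA1 x).symm
      · rcases x with x | x
        · have h := hO1 _ _ (HO.face x)
          rcases hx : O.opp x with d | i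
          · rw [hx] at h
            have e : (glueRot O A).symm (glueOpp O A (.inl x)) = .inl (.inl (O.rot.symm d)) := by
              simp only [glueOpp, Equiv.sumCongr_apply, Sum.map_inl, hx]; rfl
            rw [e]; exact h
          · have e : (glueRot O A).symm (glueOpp O A (.inl x)) = .inr (.inr i) := by
              simp only [glueOpp, Equiv.sumCongr_apply, Sum.map_inl, hx]; rfl
            rw [e]
            have : x = O.opp (.inr i) := by rw [← hx, O.opp_opp]
            rw [this]; exact hk i
        · rcases hx : A.opp x with d | i
          · have h := hA1 x
            rw [Tangle.face, hx] at h
            have e : (glueRot O A).symm (glueOpp O A (.inr x)) = .inr (.inl (A.rot.symm d)) := by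
              simp only [glueOpp, Equiv.sumCongr_apply, Sum.map_inr, hx]; rfl
            rw [e]; exact congrArg (· + k) h.symm
          · have e : (glueRot O A).symm (glueOpp O A (.inr x)) = .inl (.inr i) := by
              simp only [glueOpp, Equiv.sumCongr_apply, Sum.map_inr, hx]; rfl
            rw [e]
            have : x = A.opp (.inr i) := by rw [← hx, A.opp_opp]
            rw [this]; exact (hk' i).symm
    · have h5 : ∀ a b c : ZMod 2, a + c + (b + c) = a + b := by decide
      rintro (x | x)
      · exact hO2 x
      · exact (hA2 x).trans (h5 _ _ _).symm

end GluePlane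

/-! ### Components and vertex counts -/

theorem IsBivalent.rot {X : Type} {rot : Perm X} {d : X} (h : IsBivalent rot d) :
    IsBivalent rot (rot d) :=
  ⟨fun h' => h.1 (rot.injective h'), by rw [h.2]⟩

theorem IsBivalent.symm_eq {X : Type} {rot : Perm X} {d : X} (h : IsBivalent rot d) :
    rot.symm d = rot d := by rw [Equiv.symm_apply_eq, h.2]

theorem IsTrivalent.not_isBivalent {X : Type} {rot : Perm X} {d : X} (h : IsTrivalent rot d) :
    ¬ IsBivalent rot d := fun h' => h.1 (by have := h.2; rwa [h'.2] at this)

theorem IsTrivalent.rot {X : Type} {rot : Perm X} {d : X} (h : IsTrivalent rot d) :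
    IsTrivalent rot (rot d) :=
  ⟨fun h' => h.1 (rot.injective h'), by rw [h.2]⟩

theorem IsTrivalent.rot_rot_ne {X : Type} {rot : Perm X} {d : X} (h : IsTrivalent rot d) :
    rot (rot d) ≠ d := fun h' => h.not_isBivalent ⟨h.1, h'⟩

namespace WebDiagram

variable {Γ Γ' : WebDiagram}

theorem not_isBivalent_iff (Γ : WebDiagram) (d : Γ.Dart) :
    ¬ IsBivalent Γ.rot d ↔ IsTrivalent Γ.rot d := by
  refine ⟨fun h => ?_, fun h => h.not_isBivalent⟩
  rcases Γ.vertex d with h' | h'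
  · exact absurd h'.1 h
  · exact h'.1

theorem not_isTrivalent_iff (Γ : WebDiagram) (d : Γ.Dart) :
    ¬ IsTrivalent Γ.rot d ↔ IsBivalent Γ.rot d := by
  rw [← Γ.not_isBivalent_iff, not_not]

theorem thick_rot_of_bivalent {d : Γ.Dart} (h : IsBivalent Γ.rot d) : Γ.thick (Γ.rot d) = Γ.thick d := by
  rcases Γ.vertex d with h' | h'
  · exact h'.2.2.1
  · exact absurd h h'.1.not_isBivalent

theorem defect_rot_of_bivalent {d : Γ.Dart} (h : IsBivalent Γ.rot d) :
    Γ.defect (Γ.rot d) = Γ.defect d := by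
  rcases Γ.vertex d with h' | h'
  · exact h'.2.1
  · exact absurd h h'.1.not_isBivalent

theorem thick_of_defect {d : Γ.Dart} (h : Γ.defect d = true) : Γ.thick d = true := by
  rcases Γ.vertex d with h' | h'
  · exact h'.2.2.2 h
  · exact absurd h'.2.1 (by simp [h])

theorem isBivalent_of_defect {d : Γ.Dart} (h : Γ.defect d = true) : IsBivalent Γ.rot d := by
  rcases Γ.vertex d with h' | h'
  · exact h'.1
  · exact absurd h'.2.1 (by simp [h])

/-- A diagram is connected if no proper nonempty set of darts is a union of components. -/
def Connected (Γ : WebDiagram) : Prop :=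
  ∀ S : Γ.Dart → Prop, (∀ d, S (Γ.rot d) ↔ S d) → (∀ d, S (Γ.opp d) ↔ S d) →
    (∀ d, S d) ∨ ∀ d, ¬ S d

open Classical in
/-- A sum over the darts at trivalent vertices of a number that depends on the thickness of the
edges at the vertex. -/
noncomputable def count (Γ : WebDiagram) (w : Bool → Bool → Bool → ℕ) : ℕ :=
  ∑ᶠ d, if IsTrivalent Γ.rot d then w (Γ.thick d) (Γ.thick (Γ.rot d)) (Γ.thick (Γ.rot (Γ.rot d)))
    else 0

/-- Two labellings of darts that name the same regions define the same pullback of regions. -/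
theorem region_map_iff {Y : Type} (Γ : WebDiagram) {e ρ : Y → Γ.Dart}
    (h : ∀ y, Γ.region (some (e y)) (some (ρ y))) (a b : Option Y) :
    Γ.region (a.map e) (b.map e) ↔ Γ.region (a.map ρ) (b.map ρ) := by
  have h' : ∀ a : Option Y, Γ.region (a.map e) (a.map ρ) := by
    rintro (_ | a)
    · exact Γ.region.refl _
    · exact h a
  exact ⟨fun H => Γ.region.trans (Γ.region.symm (h' a)) (Γ.region.trans H (h' b)),
    fun H => Γ.region.trans (h' a) (Γ.region.trans H (Γ.region.symm (h' b)))⟩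

/-! ### Subdividing an edge -/

theorem subdivide_subdivides (Γ : WebDiagram) (d : Γ.Dart) :
    Subdivides Γ.rot Γ.opp (Γ.subdivide d).rot (Γ.subdivide d).opp Sum.inl
      (Sum.elim id (fun b => if b then d else Γ.opp d)) where
  label _ := rfl
  rot_incl _ := rfl
  label_opp := by
    rintro (x | (_ | _))
    · change Sum.elim id _ (Γ.subdivideOpp d (.inl x)) = Γ.opp x
      simp only [subdivideOpp]
      split_ifs with h1 h2
      · simp [h1]
      · simp [h2, Γ.opp_opp]
      · simp
    · change Sum.elim id _ (Γ.subdivideOpp d (.inr false)) = _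
      simp [subdivideOpp, Γ.opp_opp]
    · change Sum.elim id _ (Γ.subdivideOpp d (.inr true)) = _
      simp [subdivideOpp]
  bivalent := by
    rintro (x | b) h
    · exact absurd rfl h
    · constructor
      · constructor
        · change Sum.inr (!b) ≠ Sum.inr b
          cases b <;> simp
        · change Sum.inr (!(!b)) = Sum.inr b
          simp
      · change Sum.elim id _ (Sum.inr (!b)) = _
        cases b <;> simp [Γ.opp_opp]

theorem IsPlane.subdivide (H : Γ.IsPlane) (d : Γ.Dart) : (Γ.subdivide d).IsPlane := by
  have := Γ.finite
  have := (Γ.subdivide d).finite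
  let := Fintype.ofFinite Γ.Dart
  let := Fintype.ofFinite (Γ.subdivide d).Dart
  rw [isPlane_iff] at H ⊢
  refine (Γ.subdivide_subdivides d).isPlaneHom_subdivision Γ.opp_opp (fun a b => Iff.rfl) ?_ H
  intro z h1 h2
  have hrot : z (.inr true) = z (.inr false) := h2 (.inr false) Sum.inl_ne_inr
  have ho1 : z (.inl d) = z (.inr false) := h1 (.inr false)
  have ho2 : z (.inl (Γ.opp d)) = z (.inr true) := h1 (.inr true)
  rintro (x | (_ | _))
  · rfl
  · exact ho2.trans hrot
  · exact ho1.trans hrot.symm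

theorem isTrivalent_incl_iff {X : Type} {rot opp : Perm X} {e : X → Γ.Dart} {κ : Γ.Dart → X}
    (S : Subdivides rot opp Γ.rot Γ.opp e κ) (x : X) :
    IsTrivalent Γ.rot (e x) ↔ IsTrivalent rot x := by
  simp only [IsTrivalent, S.rot_incl, ne_eq, S.injective.eq_iff]

theorem count_eq_of_subdivides {X : Type} {rot opp : Perm X} {e : X → Γ.Dart} {κ : Γ.Dart → X}
    (S : Subdivides rot opp Γ.rot Γ.opp e κ) (w : Bool → Bool → Bool → ℕ) [Fintype X]
    [DecidablePred (IsTrivalent rot)] :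
    Γ.count w = ∑ x, if IsTrivalent rot x then w (Γ.thick (e x)) (Γ.thick (e (rot x)))
      (Γ.thick (e (rot (rot x)))) else 0 := by
  classical
  have := Γ.finite
  let := Fintype.ofFinite Γ.Dart
  rw [count, finsum_eq_sum_of_fintype]
  symm
  refine Fintype.sum_of_injective e S.injective _ _ ?_ ?_
  · intro y hy
    have := (S.bivalent y fun h => hy ⟨_, h⟩).1
    rw [if_neg fun h => h.not_isBivalent this]
  · intro x
    simp only [isTrivalent_incl_iff S, S.rot_incl]

theorem count_eq_sum (Γ : WebDiagram) (w : Bool → Bool → Bool → ℕ) [Fintype Γ.Dart]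
    [DecidablePred (IsTrivalent Γ.rot)] : Γ.count w = ∑ d, if IsTrivalent Γ.rot d then
      w (Γ.thick d) (Γ.thick (Γ.rot d)) (Γ.thick (Γ.rot (Γ.rot d))) else 0 := by
  rw [count, finsum_eq_sum_of_fintype]
  exact Finset.sum_congr rfl fun d _ => by by_cases h : IsTrivalent Γ.rot d <;> simp [h]

/-! ### Removing a bivalent vertex -/

open Classical in
/-- The edge involution after the bivalent vertex of `d` has been erased. -/
noncomputable def smoothOpp (Γ : WebDiagram) (d x : Γ.Dart) : Γ.Dart :=
  if Γ.opp x = d then Γ.opp (Γ.rot d) else if Γ.opp x = Γ.rot d then Γ.opp d else Γ.opp x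

theorem smoothOpp_involutive (Γ : WebDiagram) {d : Γ.Dart} (hd : IsBivalent Γ.rot d) (hc : Γ.opp d ≠ Γ.rot d) {x : Γ.Dart}
    (hx : x ≠ d ∧ x ≠ Γ.rot d) : Γ.smoothOpp d (Γ.smoothOpp d x) = x := by
  unfold smoothOpp
  by_cases h1 : Γ.opp x = d
  · rw [if_pos h1, if_neg (by rw [Γ.opp_opp]; exact hd.1), if_pos (by rw [Γ.opp_opp]), ← h1, Γ.opp_opp]
  · by_cases h2 : Γ.opp x = Γ.rot d
    · rw [if_neg h1, if_pos h2, if_pos (by rw [Γ.opp_opp]), ← h2, Γ.opp_opp]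
    · rw [if_neg h1, if_neg h2, Γ.opp_opp, if_neg hx.1, if_neg hx.2]

theorem smoothOpp_mem (Γ : WebDiagram) {d : Γ.Dart} (hc : Γ.opp d ≠ Γ.rot d) {x : Γ.Dart}
    (hx : x ≠ d ∧ x ≠ Γ.rot d) : Γ.smoothOpp d x ≠ d ∧ Γ.smoothOpp d x ≠ Γ.rot d := by
  have hc' : Γ.opp (Γ.rot d) ≠ d := fun h => hc (by rw [← h, Γ.opp_opp, h])
  unfold smoothOpp
  split_ifs with h1 h2
  · exact ⟨hc', Γ.opp_ne _⟩
  · exact ⟨Γ.opp_ne _, hc⟩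
  · exact ⟨h1, h2⟩

/-- Erase a bivalent vertex that is not the only vertex of a circle.  (If the vertex is a defect,
this changes the web.) -/
noncomputable def smooth (Γ : WebDiagram) (d : Γ.Dart) (hd : IsBivalent Γ.rot d)
    (hc : Γ.opp d ≠ Γ.rot d) : WebDiagram where
  Dart := {x // x ≠ d ∧ x ≠ Γ.rot d}
  finite := by have := Γ.finite; infer_instance
  rot := Γ.rot.subtypePerm fun x => by
    have h1 : Γ.rot x = d ↔ x = Γ.rot d := by
      rw [← Γ.rot.injective.eq_iff, ← hd.2, Γ.rot.injective.eq_iff, Γ.rot.injective.eq_iff, hd.2]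
    rw [ne_eq, ne_eq, h1, Γ.rot.injective.eq_iff]
    tauto
  opp := Function.Involutive.toPerm (fun x => ⟨Γ.smoothOpp d x.1, Γ.smoothOpp_mem hc x.2⟩)
    fun x => Subtype.ext (Γ.smoothOpp_involutive hd hc x.2)
  region := Γ.region.comap (Option.map Subtype.val)
  thick x := Γ.thick x
  defect x := Γ.defect x
  opp_opp x := Subtype.ext (Γ.smoothOpp_involutive hd hc x.2)
  opp_ne x h := by
    have h' : Γ.smoothOpp d x.1 = x.1 := congrArg Subtype.val h
    unfold smoothOpp at h'
    split_ifs at h' with h1 h2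
    · rw [← h', Γ.opp_opp] at h1; exact hd.1 h1
    · rw [← h', Γ.opp_opp] at h2; exact hd.1 h2.symm
    · exact Γ.opp_ne _ h'
  thick_opp x := by
    change Γ.thick (Γ.smoothOpp d x.1) = Γ.thick x.1
    unfold smoothOpp
    split_ifs with h1 h2
    · exact (Γ.thick_opp _).trans ((thick_rot_of_bivalent hd).trans
        ((congrArg Γ.thick h1).symm.trans (Γ.thick_opp _)))
    · exact (Γ.thick_opp _).trans ((thick_rot_of_bivalent hd).symm.trans
        ((congrArg Γ.thick h2).symm.trans (Γ.thick_opp _)))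
    · exact Γ.thick_opp _
  vertex x := by
    simpa [IsWebVertex, IsBivalent, IsTrivalent, Subtype.ext_iff] using Γ.vertex x.1

section Smooth

variable {d : Γ.Dart} (hd : IsBivalent Γ.rot d) (hc : Γ.opp d ≠ Γ.rot d)

/-- The inclusion of the remaining darts. -/
def smoothIncl (x : (Γ.smooth d hd hc).Dart) : Γ.Dart := Subtype.val x

theorem smoothIncl_injective : Function.Injective (smoothIncl hd hc) := Subtype.val_injective

theorem smoothLabel_mem (hc : Γ.opp d ≠ Γ.rot d) {x y : Γ.Dart} (h : (x = d ∧ y = Γ.opp (Γ.rot d)) ∨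
    (x = Γ.rot d ∧ y = Γ.opp d) ∨ (x ≠ d ∧ x ≠ Γ.rot d ∧ y = x)) : y ≠ d ∧ y ≠ Γ.rot d := by
  have hc' : Γ.opp (Γ.rot d) ≠ d := fun h => hc (by rw [← h, Γ.opp_opp, h])
  rcases h with ⟨-, rfl⟩ | ⟨-, rfl⟩ | ⟨h1, h2, rfl⟩
  exacts [⟨hc', Γ.opp_ne _⟩, ⟨Γ.opp_ne _, hc⟩, ⟨h1, h2⟩]

open Classical in
/-- The dart that runs along the same edge in the same direction after smoothing. -/
noncomputable def smoothLabel (x : Γ.Dart) : (Γ.smooth d hd hc).Dart :=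
  ⟨if x = d then Γ.opp (Γ.rot d) else if x = Γ.rot d then Γ.opp d else x, by
    refine smoothLabel_mem (x := x) hc ?_
    split_ifs <;> tauto⟩

theorem smoothLabel_self : smoothIncl hd hc (smoothLabel hd hc d) = Γ.opp (Γ.rot d) := if_pos rfl

theorem smoothLabel_rot : smoothIncl hd hc (smoothLabel hd hc (Γ.rot d)) = Γ.opp d :=
  (if_neg hd.1).trans (if_pos rfl)

theorem smoothLabel_of_ne {x : Γ.Dart} (h1 : x ≠ d) (h2 : x ≠ Γ.rot d) :
    smoothIncl hd hc (smoothLabel hd hc x) = x := (if_neg h1).trans (if_neg h2)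

theorem smoothIncl_opp (x : (Γ.smooth d hd hc).Dart) :
    smoothIncl hd hc ((Γ.smooth d hd hc).opp x) = Γ.smoothOpp d (smoothIncl hd hc x) := rfl

theorem smoothIncl_ne (x : (Γ.smooth d hd hc).Dart) :
    smoothIncl hd hc x ≠ d ∧ smoothIncl hd hc x ≠ Γ.rot d := x.2

theorem smoothLabel_incl (x : (Γ.smooth d hd hc).Dart) :
    smoothLabel hd hc (smoothIncl hd hc x) = x :=
  smoothIncl_injective hd hc (smoothLabel_of_ne hd hc (smoothIncl_ne hd hc x).1
    (smoothIncl_ne hd hc x).2)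

theorem smooth_subdivides : Subdivides (Γ.smooth d hd hc).rot (Γ.smooth d hd hc).opp Γ.rot Γ.opp
    (smoothIncl hd hc) (smoothLabel hd hc) where
  label := smoothLabel_incl hd hc
  rot_incl _ := rfl
  label_opp y := by
    apply smoothIncl_injective hd hc
    rw [smoothIncl_opp]
    have hc' : Γ.opp (Γ.rot d) ≠ d := fun h => hc (by rw [← h, Γ.opp_opp, h])
    by_cases h1 : y = d
    · rw [h1, smoothLabel_self, smoothLabel_of_ne hd hc (Γ.opp_ne _) hc]
      simp [smoothOpp, Γ.opp_opp, hd.1]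
    · by_cases h2 : y = Γ.rot d
      · rw [h2, smoothLabel_rot, smoothLabel_of_ne hd hc hc' (Γ.opp_ne _)]
        simp [smoothOpp, Γ.opp_opp]
      · rw [smoothLabel_of_ne hd hc h1 h2]
        unfold smoothOpp
        split_ifs with h3 h4
        · rw [h3, smoothLabel_self]
        · rw [h4, smoothLabel_rot]
        · rw [smoothLabel_of_ne hd hc h3 h4]
  bivalent y hy := by
    by_cases h1 : y = d
    · subst h1
      refine ⟨hd, smoothIncl_injective hd hc ?_⟩
      rw [smoothIncl_opp, smoothLabel_rot, smoothLabel_self]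
      simp [smoothOpp, Γ.opp_opp, hd.1]
    · by_cases h2 : y = Γ.rot d
      · subst h2
        refine ⟨hd.rot, smoothIncl_injective hd hc ?_⟩
        rw [smoothIncl_opp, smoothLabel_rot, hd.2, smoothLabel_self]
        simp [smoothOpp, Γ.opp_opp]
      · exact absurd (smoothLabel_of_ne hd hc h1 h2) hy

theorem region_smoothLabel (H : Γ.IsPlane) (y : Γ.Dart) :
    Γ.region (some y) (some (smoothIncl hd hc (smoothLabel hd hc y))) := by
  by_cases h1 : y = d
  · have := H.face (Γ.opp (Γ.rot d))
    rw [Γ.opp_opp, Γ.rot.symm_apply_apply] at this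
    rw [h1, smoothLabel_self]
    exact Γ.region.symm this
  · by_cases h2 : y = Γ.rot d
    · have := H.face (Γ.opp d)
      rw [Γ.opp_opp, hd.symm_eq] at this
      rw [h2, smoothLabel_rot]
      exact Γ.region.symm this
    · rw [smoothLabel_of_ne hd hc h1 h2]

theorem region_iff_smooth (H : Γ.IsPlane) (a b : Option Γ.Dart) :
    Γ.region a b ↔
      (Γ.smooth d hd hc).region (a.map (smoothLabel hd hc)) (b.map (smoothLabel hd hc)) := by
  have := Γ.region_map_iff (e := id) (ρ := fun y => smoothIncl hd hc (smoothLabel hd hc y))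
    (region_smoothLabel hd hc H) a b
  simp only [Option.map_id, id] at this
  rw [this]
  change _ ↔ Γ.region ((Option.map (smoothLabel hd hc) a).map (smoothIncl hd hc))
    ((Option.map (smoothLabel hd hc) b).map (smoothIncl hd hc))
  rw [Option.map_map, Option.map_map]
  rfl

theorem IsPlane.smooth (H : Γ.IsPlane) : (Γ.smooth d hd hc).IsPlane := by
  have := Γ.finite
  have := (Γ.smooth d hd hc).finite
  let := Fintype.ofFinite Γ.Dart
  let := Fintype.ofFinite (Γ.smooth d hd hc).Dart
  have H' := (isPlane_iff _).1 H
  rw [isPlane_iff]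
  exact (smooth_subdivides hd hc).isPlaneHom_of_subdivision (region_iff_smooth hd hc H) H'

theorem smooth_count (w : Bool → Bool → Bool → ℕ) : (Γ.smooth d hd hc).count w = Γ.count w := by
  classical
  have := (Γ.smooth d hd hc).finite
  let := Fintype.ofFinite (Γ.smooth d hd hc).Dart
  rw [count_eq_of_subdivides (smooth_subdivides hd hc), count_eq_sum]
  rfl

theorem Connected.smooth (H : Γ.Connected) : (Γ.smooth d hd hc).Connected := by
  intro S hr ho
  have hS := smooth_subdivides hd hc
  have := H (fun x => S (smoothLabel hd hc x)) (fun x => ?_) (fun x => by rw [hS.label_opp, ho])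
  · rcases this with h | h
    · exact Or.inl fun x => by simpa [smoothLabel_incl] using h (smoothIncl hd hc x)
    · exact Or.inr fun x => by simpa [smoothLabel_incl] using h (smoothIncl hd hc x)
  · by_cases hx : smoothIncl hd hc (smoothLabel hd hc x) = x
    · have h := hS.rot_incl (smoothLabel hd hc x)
      rw [hx] at h
      rw [h, hS.label, hr]
    · rw [(hS.bivalent x hx).2, ho]

/-- Erasing a marked point and marking it again gives the original diagram. -/
theorem subdivide_smooth_isomorphic (H : Γ.IsPlane) (hm : Γ.defect d = false) :
    ((Γ.smooth d hd hc).subdivide (smoothLabel hd hc (Γ.opp d))).Isomorphic Γ := by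
  have hc' : Γ.opp (Γ.rot d) ≠ d := fun h => hc (by rw [← h, Γ.opp_opp, h])
  have hα : smoothIncl hd hc (smoothLabel hd hc (Γ.opp d)) = Γ.opp d :=
    smoothLabel_of_ne hd hc (Γ.opp_ne _) hc
  have hαo : smoothIncl hd hc ((Γ.smooth d hd hc).opp (smoothLabel hd hc (Γ.opp d))) =
      Γ.opp (Γ.rot d) := by
    rw [smoothIncl_opp, hα]
    simp [smoothOpp, Γ.opp_opp]
  generalize hg : smoothLabel hd hc (Γ.opp d) = α at hα hαo
  -- the two darts of the new vertex go to `d` and `Γ.rot d`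
  let j : (Γ.smooth d hd hc).Dart ⊕ Bool → Γ.Dart :=
    Sum.elim (smoothIncl hd hc) (fun b => if b then Γ.rot d else d)
  have j0 : j (.inr false) = d := rfl
  have j1 : j (.inr true) = Γ.rot d := rfl
  have jl : ∀ x, j (.inl x) = smoothIncl hd hc x := fun _ => rfl
  have hj : Function.Bijective j := by
    constructor
    · rintro (x | (_ | _)) (y | (_ | _)) h <;> simp only [j0, j1, jl] at h
      · rw [smoothIncl_injective hd hc h]
      · exact absurd h (smoothIncl_ne hd hc x).1
      · exact absurd h (smoothIncl_ne hd hc x).2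
      · exact absurd h.symm (smoothIncl_ne hd hc y).1
      · rfl
      · exact absurd h.symm hd.1
      · exact absurd h.symm (smoothIncl_ne hd hc y).2
      · exact absurd h hd.1
      · rfl
    · intro x
      by_cases h1 : x = d
      · exact ⟨.inr false, by rw [j0, h1]⟩
      · by_cases h2 : x = Γ.rot d
        · exact ⟨.inr true, by rw [j1, h2]⟩
        · exact ⟨.inl (smoothLabel hd hc x), smoothLabel_of_ne hd hc h1 h2⟩
  refine ⟨Equiv.ofBijective j hj, ?_, ?_, ?_, ?_, ?_⟩
  · rintro (x | (_ | _))
    · rfl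
    · change j (.inr true) = Γ.rot (j (.inr false)); rfl
    · change j (.inr false) = Γ.rot (j (.inr true)); exact hd.2.symm
  · rintro (x | (_ | _))
    · change j ((Γ.smooth d hd hc).subdivideOpp α (.inl x)) = Γ.opp (smoothIncl hd hc x)
      simp only [subdivideOpp]
      split_ifs with h1 h2
      · rw [h1, hα, Γ.opp_opp]; exact j0
      · rw [h2, hαo, Γ.opp_opp]; exact j1
      · have h3 : Γ.opp (smoothIncl hd hc x) ≠ d := fun h => h1 (smoothIncl_injective hd hc
          ((Γ.opp_opp _).symm.trans ((congrArg Γ.opp h).trans hα.symm)))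
        have h4 : Γ.opp (smoothIncl hd hc x) ≠ Γ.rot d := fun h => h2 (smoothIncl_injective hd hc
          ((Γ.opp_opp _).symm.trans ((congrArg Γ.opp h).trans hαo.symm)))
        rw [jl, smoothIncl_opp]
        simp [smoothOpp, h3, h4]
    · exact hα
    · exact hαo
  · rintro (x | (_ | _))
    · rfl
    · change Γ.thick d = Γ.thick (smoothIncl hd hc α)
      rw [hα, Γ.thick_opp]
    · change Γ.thick (Γ.rot d) = Γ.thick (smoothIncl hd hc α)
      rw [hα, Γ.thick_opp, thick_rot_of_bivalent hd]
  · rintro (x | (_ | _))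
    · rfl
    · exact hm
    · exact (defect_rot_of_bivalent hd).trans hm
  · intro a b
    -- regions are compared on the darts that survive smoothing
    have hρ := Γ.region_map_iff (e := j)
      (ρ := fun y => smoothIncl hd hc
        (Sum.elim id (fun b => if b then α else (Γ.smooth d hd hc).opp α) y)) (by
        rintro (x | (_ | _))
        · exact Γ.region.refl _
        · have := region_smoothLabel hd hc H d
          rw [smoothLabel_self, ← hαo] at this
          exact this
        · have := region_smoothLabel hd hc H (Γ.rot d)
          rw [smoothLabel_rot, ← hα] at this
          exact this) a b
    refine hρ.trans ?_
    change _ ↔ Γ.region (Option.map (smoothIncl hd hc) (Option.map _ a))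
      (Option.map (smoothIncl hd hc) (Option.map _ b))
    rcases a with _ | a <;> rcases b with _ | b <;> exact Iff.rfl

end Smooth

end WebDiagram

/-! ### Comparing plane maps on the same graph -/

section RegionEq

variable {X : Type} [Fintype X] {rot opp : Perm X}

/-- The boundary of a set of faces is a cycle. -/
theorem isCycle_boundary (hopp : ∀ x, opp (opp x) = x) (ψ : X → ZMod 2)
    (hψ : ∀ x, ψ (rot.symm (opp x)) = ψ x) : IsCycle rot opp fun x => ψ x + ψ (opp x) where
  opp x := by rw [hopp, add_comm]
  vertex h hh := by
    have h1 : ∑ x, h x * ψ (opp x) = ∑ x, h x * ψ x := by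
      rw [← Equiv.sum_comp rot]
      refine Finset.sum_congr rfl fun x _ => ?_
      rw [hh, ← hψ (opp (rot x)), hopp, Equiv.symm_apply_apply]
    simp only [mul_add, Finset.sum_add_distrib, h1]
    exact zmod_two_add_self _

/-- A function on regions that is invariant under crossing edges is constant around vertices. -/
theorem IsPlaneHom.rot_eq_of_opp_eq {region : Setoid (Option X)} (H : IsPlaneHom rot opp region)
    (hopp : ∀ x, opp (opp x) = x) {χ : Option X → ZMod 2} (h1 : ∀ a b, region a b → χ a = χ b)
    (h2 : ∀ x, χ (some (opp x)) = χ (some x)) (x : X) : χ (some (rot x)) = χ (some x) := by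
  have := h1 _ _ (H.face (opp (rot x)))
  rw [hopp, Equiv.symm_apply_apply, h2] at this
  exact this

/-- A plane graph has no proper refinement of its set of regions. -/
theorem IsPlaneHom.region_iff_of_le {r r' : Setoid (Option X)} (H : IsPlaneHom rot opp r)
    (H' : IsPlaneHom rot opp r') (hopp : ∀ x, opp (opp x) = x) (hle : ∀ a b, r a b → r' a b)
    (a b : Option X) : r a b ↔ r' a b := by
  classical
  refine ⟨hle a b, fun hab => ?_⟩
  -- the boundary of the smaller region of `a` bounds, by planarity of the coarser structure, a set
  -- `φ` of coarser regions; `ψ + φ` has empty boundary, hence is constant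
  let ψ : Option X → ZMod 2 := fun c => if r a c then 1 else 0
  have hψ : ∀ c c', r c c' → ψ c = ψ c' := fun c c' h => by
    have : r a c ↔ r a c' := ⟨fun h' => r.trans h' h, fun h' => r.trans h' (r.symm h)⟩
    simp only [ψ, this]
  obtain ⟨φ, hφ, hz⟩ := H'.boundary _ (isCycle_boundary hopp (fun x => ψ (some x))
    fun x => (hψ _ _ (H.face x)).symm)
  have h1 : ∀ c c', r c c' → ψ c + φ c = ψ c' + φ c' := fun c c' h => by
    rw [hψ _ _ h, hφ _ _ (hle _ _ h)]
  have h2 : ∀ x, ψ (some (opp x)) + φ (some (opp x)) = ψ (some x) + φ (some x) := fun x => by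
    rw [← zmod_two_add_eq_zero]
    linear_combination hz x + zmod_two_add_self (φ (some x)) + zmod_two_add_self (φ (some (opp x)))
  have h3 := H.linked (fun c => ψ c + φ c) h1 (H.rot_eq_of_opp_eq hopp h1 h2) h2
  have h4 : ψ a = ψ b := by
    have := (h3 a).trans (h3 b).symm
    rw [hφ a b hab] at this
    exact add_right_cancel this
  have h5 : ψ a = 1 := if_pos (r.refl a)
  by_contra h
  have h6 : ψ b = 0 := if_neg h
  rw [h5, h6] at h4
  exact one_ne_zero h4

end RegionEq

namespace WebDiagram

/-- For plane diagrams, an isomorphism of labelled maps is an isomorphism of diagrams as soon as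
regions are sent into regions. -/
theorem isomorphic_of_equiv {Γ Γ' : WebDiagram} (H : Γ.IsPlane) (H' : Γ'.IsPlane)
    (e : Γ.Dart ≃ Γ'.Dart) (hrot : ∀ d, e (Γ.rot d) = Γ'.rot (e d))
    (hopp : ∀ d, e (Γ.opp d) = Γ'.opp (e d)) (hthick : ∀ d, Γ'.thick (e d) = Γ.thick d)
    (hdefect : ∀ d, Γ'.defect (e d) = Γ.defect d)
    (hregion : ∀ a b, Γ.region a b → Γ'.region (a.map e) (b.map e)) : Γ.Isomorphic Γ' := by
  have := Γ.finite
  let := Fintype.ofFinite Γ.Dart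
  let Γ₁ : WebDiagram := { Γ with region := Γ'.region.comap (Option.map e) }
  have h1 : Γ₁.Isomorphic Γ' := ⟨e, hrot, hopp, hthick, hdefect, fun a b => Iff.rfl⟩
  have h2 : Γ₁.IsPlane := h1.symm.isPlane H'
  have h3 := (isPlaneMap_iff_isPlaneHom _ _ _ Γ.opp_opp Γ.opp_ne).1 h2
  have h4 := (Γ.isPlane_iff).1 H
  exact ⟨e, hrot, hopp, hthick, hdefect,
    fun a b => (h4.region_iff_of_le h3 Γ.opp_opp hregion a b).symm⟩

/-- A criterion for a diagram to be the result of gluing. -/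
theorem glue_isomorphic {n : ℕ} {bd : Fin n → Bool} {O : OuterTangle bd} {A : Tangle bd}
    {Γ : WebDiagram} (H : (O.glue A).IsPlane) (H' : Γ.IsPlane)
    (e : (O.Dart ⊕ Fin n) ⊕ (A.Dart ⊕ Fin n) ≃ Γ.Dart)
    (hrot : ∀ x, e (glueRot O A x) = Γ.rot (e x)) (hopp : ∀ x, e (glueOpp O A x) = Γ.opp (e x))
    (hthick : ∀ x, Γ.thick (e x) = (O.glue A).thick x)
    (hdefect : ∀ x, Γ.defect (e x) = (O.glue A).defect x)
    (houter : ∀ a b, O.region a b →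
      Γ.region (a.map fun x => e (.inl x)) (b.map fun x => e (.inl x)))
    (hinner : ∀ i, Γ.region (some (e (.inl (.inr i)))) (some (e (.inr (.inr (finRotate n i)))))) :
    (O.glue A).Isomorphic Γ := by
  have hface : ∀ x, Γ.region (some (e x)) (some (e ((glueRot O A).symm (glueOpp O A x)))) := by
    intro x
    have h1 : e ((glueRot O A).symm (glueOpp O A x)) = Γ.rot.symm (Γ.opp (e x)) := by
      rw [Equiv.eq_symm_apply, ← hrot, Equiv.apply_symm_apply, hopp]
    have h2 := H'.face (e x)
    rwa [← h1] at h2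
  refine isomorphic_of_equiv H H' e hrot hopp hthick hdefect fun a b hab => ?_
  change Relation.EqvGen (GlueRegion O A) a b at hab
  induction hab with
  | rel a b h =>
    cases h with
    | outer a b h =>
      have := houter a b h
      rcases a with _ | a <;> rcases b with _ | b <;> exact this
    | inner x =>
      have h1 := hface (.inr x)
      change Γ.region _ (some (e ((glueRot O A).symm (.inr (A.opp x))))) at h1
      rcases h2 : A.opp x with y | i
      · rw [h2] at h1
        exact h1
      · rw [h2] at h1
        exact Γ.region.trans h1 (hinner i)
    | across x => exact hface x
  | refl a => exact Γ.region.refl _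
  | symm a b _ ih => exact Γ.region.symm ih
  | trans a b c _ _ ih1 ih2 => exact Γ.region.trans ih1 ih2

end WebDiagram

/-! ### Cancelling adjacent defects -/

namespace WebDiagram

variable {Γ : WebDiagram} {d : Γ.Dart}

/-- The four darts at the ends of an edge that joins two bivalent vertices. -/
def BesideEdge (Γ : WebDiagram) (d x : Γ.Dart) : Prop :=
  x = d ∨ x = Γ.rot d ∨ x = Γ.opp d ∨ x = Γ.rot (Γ.opp d)

theorem besideEdge_rot (hd : IsBivalent Γ.rot d) (hd' : IsBivalent Γ.rot (Γ.opp d)) (x : Γ.Dart) :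
    Γ.BesideEdge d (Γ.rot x) ↔ Γ.BesideEdge d x := by
  have h1 : ∀ y, IsBivalent Γ.rot y → (Γ.rot x = y ↔ x = Γ.rot y) := fun y hy => by
    rw [← hy.2, Γ.rot.injective.eq_iff, hy.2]
  simp only [BesideEdge, Γ.rot.injective.eq_iff, h1 _ hd, h1 _ hd']
  tauto

open Classical in
/-- Replace the defects at the two ends of an edge by marked points. -/
noncomputable def undefect (Γ : WebDiagram) (d : Γ.Dart) (hd : Γ.defect d = true)
    (hd' : Γ.defect (Γ.opp d) = true) : WebDiagram :=
  { Γ with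
    defect := fun x => if Γ.BesideEdge d x then false else Γ.defect x
    vertex := fun x => by
      have h := Γ.vertex x
      simp only [IsWebVertex, besideEdge_rot (isBivalent_of_defect hd)
        (isBivalent_of_defect hd')] at h ⊢
      split_ifs
      · rcases h with h | h
        · exact Or.inl ⟨h.1, rfl, h.2.2.1, by simp⟩
        · exact Or.inr ⟨h.1, rfl, h.2.2⟩
      · exact h }

section Undefect

variable (hd : Γ.defect d = true) (hd' : Γ.defect (Γ.opp d) = true)

theorem isPlane_undefect : (Γ.undefect d hd hd').IsPlane ↔ Γ.IsPlane := Iff.rfl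

/-- The darts that are seen from outside a disc which contains the edge of `d`. -/
def pairIncl (d : Γ.Dart) : {x // ¬ Γ.BesideEdge d x} ⊕ Fin 2 → Γ.Dart :=
  Sum.elim Subtype.val ![Γ.rot d, Γ.rot (Γ.opp d)]

theorem besideEdge_ne (hd : Γ.defect d = true) (hd' : Γ.defect (Γ.opp d) = true)
    (hne : Γ.opp d ≠ Γ.rot d) :
    Γ.rot d ≠ d ∧ Γ.opp d ≠ d ∧ Γ.rot (Γ.opp d) ≠ d ∧ Γ.rot (Γ.opp d) ≠ Γ.rot d ∧
      Γ.rot (Γ.opp d) ≠ Γ.opp d := by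
  have h1 := isBivalent_of_defect hd
  have h2 := isBivalent_of_defect hd'
  exact ⟨h1.1, Γ.opp_ne _, fun h => hne (by rw [← h2.2, h]), fun h =>
    Γ.opp_ne _ (Γ.rot.injective h), h2.1⟩

theorem pairIncl_injective (hd : Γ.defect d = true) (hd' : Γ.defect (Γ.opp d) = true)
    (hne : Γ.opp d ≠ Γ.rot d) : Function.Injective (Γ.pairIncl d) := by
  obtain ⟨-, -, -, h4, -⟩ := besideEdge_ne hd hd' hne
  have hm : ∀ i : Fin 2, Γ.BesideEdge d (Γ.pairIncl d (.inr i)) := by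
    rintro i; fin_cases i <;> simp [BesideEdge, pairIncl]
  rintro (x | i) (y | j) h
  · exact congrArg Sum.inl (Subtype.ext h)
  · exact absurd (hm j) (by rw [← h]; exact x.2)
  · exact absurd (hm i) (by rw [h]; exact y.2)
  · fin_cases i <;> fin_cases j <;> first | rfl | exact absurd h.symm h4 | exact absurd h h4

theorem pairIncl_range (hd : Γ.defect d = true) (hd' : Γ.defect (Γ.opp d) = true)
    (hne : Γ.opp d ≠ Γ.rot d) (x : Γ.Dart) : (∃ w, Γ.pairIncl d w = x) ↔ x ≠ d ∧ x ≠ Γ.opp d := by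
  obtain ⟨h1, h2, h3, h4, h5⟩ := besideEdge_ne hd hd' hne
  constructor
  · rintro ⟨x | i, rfl⟩
    · have := x.2
      simp only [BesideEdge, not_or] at this
      exact ⟨this.1, this.2.2.1⟩
    · fin_cases i
      · exact ⟨h1, hne.symm⟩
      · exact ⟨h3, h5⟩
  · rintro ⟨h6, h7⟩
    by_cases h8 : x = Γ.rot d
    · exact ⟨.inr 0, h8.symm⟩
    by_cases h9 : x = Γ.rot (Γ.opp d)
    · exact ⟨.inr 1, h9.symm⟩
    exact ⟨.inl ⟨x, by simp [BesideEdge, h6, h7, h8, h9]⟩, rfl⟩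

theorem exists_pairOpp (hd : Γ.defect d = true) (hd' : Γ.defect (Γ.opp d) = true)
    (hne : Γ.opp d ≠ Γ.rot d)
    (w : {x // ¬ Γ.BesideEdge d x} ⊕ Fin 2) :
    ∃ w', Γ.pairIncl d w' = Γ.opp (Γ.pairIncl d w) := by
  rw [pairIncl_range hd hd' hne]
  have := (pairIncl_range hd hd' hne _).1 ⟨w, rfl⟩
  exact ⟨fun h => this.2 ((Γ.opp_opp _).symm.trans (congrArg Γ.opp h)), fun h => this.1 (Γ.opp.injective h)⟩

variable (hne : Γ.opp d ≠ Γ.rot d)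

/-- The edge involution on the darts seen from outside the disc. -/
noncomputable def pairOpp (w : {x // ¬ Γ.BesideEdge d x} ⊕ Fin 2) :
    {x // ¬ Γ.BesideEdge d x} ⊕ Fin 2 :=
  (exists_pairOpp hd hd' hne w).choose

theorem pairIncl_pairOpp (w : {x // ¬ Γ.BesideEdge d x} ⊕ Fin 2) :
    Γ.pairIncl d (pairOpp hd hd' hne w) = Γ.opp (Γ.pairIncl d w) :=
  (exists_pairOpp hd hd' hne w).choose_spec

theorem pairOpp_involutive : Function.Involutive (pairOpp hd hd' hne) := fun w =>
  pairIncl_injective hd hd' hne (by rw [pairIncl_pairOpp, pairIncl_pairOpp, Γ.opp_opp])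

/-- The part of a diagram outside a disc that contains an edge between two defects. -/
noncomputable def outsidePair : OuterTangle ![true, true] where
  Dart := {x // ¬ Γ.BesideEdge d x}
  finite := by have := Γ.finite; infer_instance
  rot := Γ.rot.subtypePerm fun x =>
    not_congr (besideEdge_rot (isBivalent_of_defect hd) (isBivalent_of_defect hd') x)
  opp := (pairOpp_involutive hd hd' hne).toPerm
  thick w := Γ.thick (Γ.pairIncl d w)
  defect x := Γ.defect x
  opp_opp := pairOpp_involutive hd hd' hne
  opp_ne w h := Γ.opp_ne (Γ.pairIncl d w)
    ((pairIncl_pairOpp hd hd' hne w).symm.trans (congrArg (Γ.pairIncl d) h))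
  thick_opp w := (congrArg Γ.thick (pairIncl_pairOpp hd hd' hne w)).trans (Γ.thick_opp _)
  thick_bd i := by
    fin_cases i
    · exact (thick_rot_of_bivalent (isBivalent_of_defect hd)).trans (thick_of_defect hd)
    · exact (thick_rot_of_bivalent (isBivalent_of_defect hd')).trans (thick_of_defect hd')
  vertex x := by
    have h := Γ.vertex x.1
    simp only [IsWebVertex, IsBivalent, IsTrivalent, ne_eq, Subtype.ext_iff] at h ⊢
    exact h
  region := Γ.region.comap (Option.map (Γ.pairIncl d))

theorem pairIncl_opp (w : {x // ¬ Γ.BesideEdge d x} ⊕ Fin 2) :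
    Γ.pairIncl d ((outsidePair hd hd' hne).opp w) = Γ.opp (Γ.pairIncl d w) :=
  pairIncl_pairOpp hd hd' hne w

/-- The outside of an edge between two defects is plane: the edge with its two ends is connected,
so that `IsPlaneHom.contract` applies. -/
theorem outsidePair_isPlane (H : Γ.IsPlane) : (outsidePair hd hd' hne).IsPlane := by
  classical
  have := Γ.finite
  let := Fintype.ofFinite Γ.Dart
  have := (outsidePair hd hd' hne).finite
  let := Fintype.ofFinite (outsidePair hd hd' hne).Dart
  have hb := isBivalent_of_defect hd
  have hb' := isBivalent_of_defect hd'
  have H' := (Γ.isPlane_iff).1 H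
  have hout : ∀ x, (∀ w, Γ.pairIncl d w ≠ x) → x = d ∨ x = Γ.opp d := fun x hx => by
    by_contra h
    rw [not_or] at h
    obtain ⟨w, hw⟩ := (pairIncl_range hd hd' hne x).2 h
    exact hx w hw
  -- the two regions on both sides of the edge of `d`
  have f1 : Γ.region (some d) (some (Γ.rot (Γ.opp d))) := by
    have := H.face d; rwa [hb'.symm_eq] at this
  have f2 : Γ.region (some (Γ.opp d)) (some (Γ.rot d)) := by
    have := H.face (Γ.opp d); rwa [Γ.opp_opp, hb.symm_eq] at this
  refine (isPlaneMap_iff_isPlaneHom _ _ _ (outsidePair hd hd' hne).opp_opp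
    (outsidePair hd hd' hne).opp_ne).2 ?_
  refine H'.contract (Y := (outsidePair hd hd' hne).Dart) (ι := Γ.pairIncl d)
    (rot' := (outsidePair hd hd' hne).rot) (opp' := (outsidePair hd hd' hne).opp)
    (region' := (outsidePair hd hd' hne).region) Γ.opp_opp (pairIncl_injective hd hd' hne)
    (fun y => rfl) (fun w => (pairIncl_opp hd hd' hne w).symm) (fun a b => Iff.rfl) ?_ ?_ ?_
  · intro i
    fin_cases i
    · have := H.face (Γ.opp (Γ.rot (Γ.opp d)))
      rw [Γ.opp_opp, Γ.rot.symm_apply_apply] at this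
      exact Γ.region.trans (Γ.region.symm f2) (Γ.region.symm this)
    · have := H.face (Γ.opp (Γ.rot d))
      rw [Γ.opp_opp, Γ.rot.symm_apply_apply] at this
      exact Γ.region.trans (Γ.region.symm f1) (Γ.region.symm this)
  · intro x hx
    rcases hout x hx with rfl | rfl
    · exact Or.inl ⟨1, f1⟩
    · exact Or.inl ⟨0, f2⟩
  -- the flow through the disc is constant
  · intro b hb0
    rw [Fin.sum_univ_two, zmod_two_add_eq_zero] at hb0
    refine ⟨fun _ => b 0, fun i => ?_, fun _ _ => rfl, fun h hr h0 => ?_⟩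
    · fin_cases i
      · rfl
      · exact hb0
    · rw [← Finset.sum_mul]
      refine mul_eq_zero_of_left ?_ _
      -- an invariant function cancels in pairs at each of the two bivalent vertices
      refine Finset.sum_involution (fun x _ => if Γ.BesideEdge d x then Γ.rot x else x) ?_ ?_
        (fun _ _ => Finset.mem_univ _) ?_
      · intro x _
        split_ifs
        · rw [hr]; exact zmod_two_add_self _
        · exact zmod_two_add_self _
      · intro x _ hx
        split_ifs with h1
        · rcases h1 with rfl | rfl | rfl | rfl
          exacts [hb.1, hb.rot.1, hb'.1, hb'.rot.1]
        · exact absurd (h0 ⟨x, h1⟩) hx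
      · intro x _
        by_cases h1 : Γ.BesideEdge d x
        · simp only [h1, if_true, besideEdge_rot hb hb']
          rcases h1 with rfl | rfl | rfl | rfl
          exacts [hb.2, hb.rot.2, hb'.2, hb'.rot.2]
        · simp only [h1, if_false]

end Undefect

end WebDiagram

/-! ### Planarity of the tangles -/

theorem partner_eq {X : Type} [Fintype X] [DecidableEq X] (e : X → ℕ)
    (h : ∀ x, ∃! y, y ≠ x ∧ e y = e x) {x y : X} (h1 : y ≠ x) (h2 : e y = e x) :
    partner e h x = y :=
  (h x).unique (partner_spec e h x) ⟨h1, h2⟩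

theorem glue_isPlane_of_tangle {n : ℕ} [NeZero n] {bd : Fin n → Bool} (O : OuterTangle bd)
    (A : Tangle bd) (hO : O.IsPlane) 
    (hA : ∀ inst : Fintype A.Dart, @Tangle.IsPlane _ _ A inst) : (O.glue A).IsPlane := by
  have := A.finite
  let := Fintype.ofFinite A.Dart
  exact glue_isPlane O A hO (hA _)

namespace Tangle

section OfCode

variable {t b n : ℕ} {bd : Fin n → Bool} {tri : Fin t → Fin 3 → ℕ}
    {dfc : Fin b → Fin 2 → ℕ} {leg : Fin n → ℕ} {thickEdges : List ℕ}
    {h : ∀ x, ∃! y, y ≠ x ∧ codeEdge tri dfc leg y = codeEdge tri dfc leg x}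
    {hbd : ∀ i, decide (leg i ∈ thickEdges) = bd i}
    {hv : ∀ d, IsWebVertex (codeRot t b)
      (fun d => decide (codeEdge tri dfc leg (Sum.inl d) ∈ thickEdges)) (codeDefect t b) d}

theorem ofCode_opp_eq {x y : CodeDart t b ⊕ Fin n} (h1 : y ≠ x)
    (h2 : codeEdge tri dfc leg y = codeEdge tri dfc leg x) :
    (ofCode bd tri dfc leg thickEdges h hbd hv).opp x = y :=
  partner_eq _ h h1 h2

/-- A function that is constant on edges takes the same value on ends with the same edge name. -/
theorem ofCode_eq_of_edge_eq {α : Type} {z : CodeDart t b ⊕ Fin n → α}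
    (hz : ∀ x, z ((ofCode bd tri dfc leg thickEdges h hbd hv).opp x) = z x)
    {x y : CodeDart t b ⊕ Fin n} (h2 : codeEdge tri dfc leg y = codeEdge tri dfc leg x) :
    z y = z x := by
  by_cases h1 : y = x
  · rw [h1]
  · rw [← hz x, ofCode_opp_eq h1 h2]

open Classical in
/-- A function that is constant on edges comes from a function of edge names. -/
theorem exists_edge_function {α : Type} [Zero α] {z : CodeDart t b ⊕ Fin n → α}
    (hz : ∀ x, z ((ofCode bd tri dfc leg thickEdges h hbd hv).opp x) = z x) :
    ∃ u : ℕ → α, ∀ x, z x = u (codeEdge tri dfc leg x) := by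
  refine ⟨fun k => if hk : ∃ x, codeEdge tri dfc leg x = k then z hk.choose else 0, fun x => ?_⟩
  have hk : ∃ y, codeEdge tri dfc leg y = codeEdge tri dfc leg x := ⟨x, rfl⟩
  exact ((dif_pos hk).trans (ofCode_eq_of_edge_eq hz hk.choose_spec)).symm

/-- Planarity of a tangle given by a code is certified by naming the region to the left (`tF`, `dF`,
`lF`) and to the right (`tG`, `dG`, `lG`) of every end, and by expressing a cycle `u` as the
boundary of the set of regions with indicator `g u`. -/
theorem ofCode_isPlane (tF : Fin t → Fin 3 → ℕ) (dF : Fin b → Fin 2 → ℕ) (lF : Fin n → ℕ)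
    (tG : Fin t → Fin 3 → ℕ) (dG : Fin b → Fin 2 → ℕ) (lG : Fin n → ℕ)
    (g : (ℕ → ZMod 2) → List (ZMod 2))
    (hopp : ∀ x : CodeDart t b ⊕ Fin n, codeEdge tF dF lF (partner _ h x) = codeEdge tG dG lG x)
    (hface : ∀ x : CodeDart t b ⊕ Fin n, codeEdge tF dF lF
      ((Equiv.sumCongr (codeRot t b) (finRotate n).symm).symm (partner _ h x)) =
        codeEdge tF dF lF x)
    (hg : ∀ u : ℕ → ZMod 2, (∀ v, u (tri v 0) + u (tri v 1) + u (tri v 2) = 0) →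
      (∀ v, u (dfc v 0) = u (dfc v 1)) →
      (∀ v j, u (tri v j) = (g u).getD (tF v j) 0 + (g u).getD (tG v j) 0) ∧
      (∀ v j, u (dfc v j) = (g u).getD (dF v j) 0 + (g u).getD (dG v j) 0) ∧
      ∀ i, u (leg i) = (g u).getD (lF i) 0 + (g u).getD (lG i) 0)
    (hl : ∀ u : ℕ → ZMod 2, (∀ v, u (tri v 0) = u (tri v 1) ∧ u (tri v 0) = u (tri v 2)) →
      (∀ v, u (dfc v 0) = u (dfc v 1)) → (∀ i, u (leg i) = 0) →
      (∀ v, u (tri v 0) = 0) ∧ ∀ v, u (dfc v 0) = 0)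
    (inst : Fintype (ofCode bd tri dfc leg thickEdges h hbd hv).Dart) :
    @Tangle.IsPlane _ _ (ofCode bd tri dfc leg thickEdges h hbd hv) inst := by
  have H : @Tangle.IsPlane _ _ (ofCode bd tri dfc leg thickEdges h hbd hv)
      (instFintypeSum (Fin t × Fin 3) (Fin b × Fin 2)) := by
    clear inst
    refine @Tangle.IsPlane.mk _ _ (ofCode bd tri dfc leg thickEdges h hbd hv)
      (instFintypeSum (Fin t × Fin 3) (Fin b × Fin 2)) ?_ ?_
    · intro (ψ : CodeDart t b ⊕ Fin n → ZMod 2) h1 h2 h3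
      have hr : ∀ x : CodeDart t b, ψ (.inl (codeRot t b x)) = ψ (.inl x) := h1
      -- linkedness: an invariant function is a function `u` of edge names
      obtain ⟨u, hu⟩ := exists_edge_function h2
      have ht : ∀ v, u (tri v 0) = u (tri v 1) ∧ u (tri v 0) = u (tri v 2) := fun v => by
        have e1 : ψ (.inl (.inl (v, 1))) = ψ (.inl (.inl (v, 0))) := hr (.inl (v, 0))
        have e2 : ψ (.inl (.inl (v, 2))) = ψ (.inl (.inl (v, 1))) := hr (.inl (v, 1))
        rw [hu, hu] at e1 e2
        exact ⟨e1.symm, (e2.trans e1).symm⟩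
      have hd : ∀ v, u (dfc v 0) = u (dfc v 1) := fun v => by
        have e1 : ψ (.inl (.inr (v, 1))) = ψ (.inl (.inr (v, 0))) := hr (.inr (v, 0))
        rw [hu, hu] at e1
        exact e1.symm
      have hb : ∀ i, u (leg i) = 0 := fun i => (hu (.inr i)).symm.trans (h3 i)
      obtain ⟨r1, r2⟩ := hl u ht hd hb
      intro (x : CodeDart t b ⊕ Fin n)
      rw [hu]
      rcases x with (⟨v, j⟩ | ⟨v, j⟩) | i
      · fin_cases j
        · exact r1 v
        · exact (ht v).1.symm.trans (r1 v)
        · exact (ht v).2.symm.trans (r1 v)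
      · fin_cases j
        · exact r2 v
        · exact (hd v).symm.trans (r2 v)
      · exact hb i
    · intro (z : CodeDart t b ⊕ Fin n → ZMod 2) h1 h2
      have hs : ∀ f : CodeDart t b → ZMod 2, (∀ x, f (codeRot t b x) = f x) →
        ∑ x, f x * z (.inl x) = 0 := h2
      -- a cycle is a function `u` of edge names that sums to zero at each vertex, as is seen by
      -- pairing it with the indicator functions of the vertices
      obtain ⟨u, hu⟩ := exists_edge_function h1
      have ht : ∀ v, u (tri v 0) + u (tri v 1) + u (tri v 2) = 0 := fun v => by
        have e := hs (Sum.elim (fun p => if p.1 = v then 1 else 0) fun _ => 0) (by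
          rintro (⟨w, j⟩ | ⟨w, j⟩) <;> rfl)
        simp only [hu, Fintype.sum_sum_type, Fintype.sum_prod_type, Sum.elim_inl, Sum.elim_inr,
          zero_mul, Finset.sum_const_zero, add_zero, ite_mul, one_mul] at e
        rw [Finset.sum_eq_single v (fun w _ hw => by simp [hw]) (by simp)] at e
        simpa [Fin.sum_univ_three, codeEdge] using e
      have hd : ∀ v, u (dfc v 0) = u (dfc v 1) := fun v => by
        have e := hs (Sum.elim (fun _ => 0) (fun p => if p.1 = v then 1 else 0)) (by
          rintro (⟨w, j⟩ | ⟨w, j⟩) <;> rfl)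
        simp only [hu, Fintype.sum_sum_type, Fintype.sum_prod_type, Sum.elim_inl, Sum.elim_inr,
          zero_mul, Finset.sum_const_zero, zero_add, ite_mul, one_mul] at e
        rw [Finset.sum_eq_single v (fun w _ hw => by simp [hw]) (by simp)] at e
        rw [← zmod_two_add_eq_zero]
        simpa [Fin.sum_univ_two, codeEdge] using e
      obtain ⟨r1, r2, r3⟩ := hg u ht hd
      refine ⟨fun x => (g u).getD (codeEdge tF dF lF x) 0,
        fun x => congrArg (fun k => (g u).getD k 0) (hface x),
        fun (x : CodeDart t b ⊕ Fin n) => ?_⟩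
      have e := congrArg (fun k => (g u).getD k 0) (hopp x)
      refine Eq.trans ?_ (congrArg ((g u).getD (codeEdge tF dF lF x) 0 + ·) e.symm)
      rw [hu]
      rcases x with (⟨v, j⟩ | ⟨v, j⟩) | i
      exacts [r1 v j, r2 v j, r3 i]
  exact (Subsingleton.elim (α := Fintype (CodeDart t b)) _ inst) ▸ H

end OfCode

set_option maxRecDepth 100000

/-! In each of the following lemmas, the first line of data names for every end the region that lies
to its left, the second line the region to its right, and the last argument gives the set of
regions that is bounded by a cycle: its value at region `0` is normalised to zero and it changes
along an edge by the value of the cycle on that edge. -/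
theorem edge2_isPlane (inst : Fintype edge2.Dart) : @Tangle.IsPlane _ _ edge2 inst :=
  ofCode_isPlane ![] ![] ![0, 1]
    ![] ![] ![1, 0]
    (fun z => [0, z 0]) (by decide) (by decide)
    (fun z h1 h2 => by simp [Fin.forall_fin_succ] at h1 h2 ⊢ <;> grind)
    (fun z h1 h2 h3 => by simp [Fin.forall_fin_succ] at h1 h2 h3 ⊢ <;> grind) inst

theorem edge2TwoDefects_isPlane (inst : Fintype edge2TwoDefects.Dart) : @Tangle.IsPlane _ _ edge2TwoDefects inst :=
  ofCode_isPlane ![] ![![1, 0], ![1, 0]] ![0, 1]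
    ![] ![![0, 1], ![0, 1]] ![1, 0]
    (fun z => [0, z 0]) (by decide) (by decide)
    (fun z h1 h2 => by simp [Fin.forall_fin_succ] at h1 h2 ⊢ <;> grind)
    (fun z h1 h2 h3 => by simp [Fin.forall_fin_succ] at h1 h2 h3 ⊢ <;> grind) inst

theorem vertex222_isPlane (inst : Fintype vertex222.Dart) : @Tangle.IsPlane _ _ vertex222 inst :=
  ofCode_isPlane ![![1, 2, 0]] ![] ![0, 1, 2]
    ![![0, 1, 2]] ![] ![1, 2, 0]
    (fun z => [0, z 0, z 0 + z 1]) (by decide) (by decide)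
    (fun z h1 h2 => by simp [Fin.forall_fin_succ] at h1 h2 ⊢ <;> grind)
    (fun z h1 h2 h3 => by simp [Fin.forall_fin_succ] at h1 h2 h3 ⊢ <;> grind) inst

theorem vertex222Defect0_isPlane (inst : Fintype vertex222Defect0.Dart) : @Tangle.IsPlane _ _ vertex222Defect0 inst :=
  ofCode_isPlane ![![1, 2, 0]] ![![1, 0]] ![0, 1, 2]
    ![![0, 1, 2]] ![![0, 1]] ![1, 2, 0]
    (fun z => [0, z 0, z 0 + z 1]) (by decide) (by decide)
    (fun z h1 h2 => by simp [Fin.forall_fin_succ] at h1 h2 ⊢ <;> grind)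
    (fun z h1 h2 h3 => by simp [Fin.forall_fin_succ] at h1 h2 h3 ⊢ <;> grind) inst

theorem vertex222Defect1_isPlane (inst : Fintype vertex222Defect1.Dart) : @Tangle.IsPlane _ _ vertex222Defect1 inst :=
  ofCode_isPlane ![![1, 2, 0]] ![![2, 1]] ![0, 1, 2]
    ![![0, 1, 2]] ![![1, 2]] ![1, 2, 0]
    (fun z => [0, z 0, z 0 + z 1]) (by decide) (by decide)
    (fun z h1 h2 => by simp [Fin.forall_fin_succ] at h1 h2 ⊢ <;> grind)
    (fun z h1 h2 h3 => by simp [Fin.forall_fin_succ] at h1 h2 h3 ⊢ <;> grind) inst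

theorem verticalDumbbell_isPlane (inst : Fintype verticalDumbbell.Dart) : @Tangle.IsPlane _ _ verticalDumbbell inst :=
  ofCode_isPlane ![![1, 3, 0], ![2, 3, 1]] ![] ![0, 1, 2, 3]
    ![![0, 1, 3], ![1, 2, 3]] ![] ![1, 2, 3, 0]
    (fun z => [0, z 0, z 0 + z 1, z 0 + z 1 + z 2]) (by decide) (by decide)
    (fun z h1 h2 => by simp [Fin.forall_fin_succ] at h1 h2 ⊢ <;> grind)
    (fun z h1 h2 h3 => by simp [Fin.forall_fin_succ] at h1 h2 h3 ⊢ <;> grind) inst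

theorem verticalDumbbellDefect_isPlane (inst : Fintype verticalDumbbellDefect.Dart) : @Tangle.IsPlane _ _ verticalDumbbellDefect inst :=
  ofCode_isPlane ![![1, 3, 0], ![2, 3, 1]] ![![1, 3]] ![0, 1, 2, 3]
    ![![0, 1, 3], ![1, 2, 3]] ![![3, 1]] ![1, 2, 3, 0]
    (fun z => [0, z 0, z 0 + z 1, z 0 + z 1 + z 2]) (by decide) (by decide)
    (fun z h1 h2 => by simp [Fin.forall_fin_succ] at h1 h2 ⊢ <;> grind)
    (fun z h1 h2 h3 => by simp [Fin.forall_fin_succ] at h1 h2 h3 ⊢ <;> grind) inst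

theorem horizontalDumbbell_isPlane (inst : Fintype horizontalDumbbell.Dart) : @Tangle.IsPlane _ _ horizontalDumbbell inst :=
  ofCode_isPlane ![![1, 2, 0], ![3, 0, 2]] ![] ![0, 1, 2, 3]
    ![![0, 1, 2], ![2, 3, 0]] ![] ![1, 2, 3, 0]
    (fun z => [0, z 0, z 0 + z 1, z 0 + z 1 + z 2]) (by decide) (by decide)
    (fun z h1 h2 => by simp [Fin.forall_fin_succ] at h1 h2 ⊢ <;> grind)
    (fun z h1 h2 h3 => by simp [Fin.forall_fin_succ] at h1 h2 h3 ⊢ <;> grind) inst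

theorem horizontalDumbbellDefect_isPlane (inst : Fintype horizontalDumbbellDefect.Dart) : @Tangle.IsPlane _ _ horizontalDumbbellDefect inst :=
  ofCode_isPlane ![![1, 2, 0], ![3, 0, 2]] ![![2, 0]] ![0, 1, 2, 3]
    ![![0, 1, 2], ![2, 3, 0]] ![![0, 2]] ![1, 2, 3, 0]
    (fun z => [0, z 0, z 0 + z 1, z 0 + z 1 + z 2]) (by decide) (by decide)
    (fun z h1 h2 => by simp [Fin.forall_fin_succ] at h1 h2 ⊢ <;> grind)
    (fun z h1 h2 h3 => by simp [Fin.forall_fin_succ] at h1 h2 h3 ⊢ <;> grind) inst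

theorem horizontal11v22_isPlane (inst : Fintype horizontal11v22.Dart) : @Tangle.IsPlane _ _ horizontal11v22 inst :=
  ofCode_isPlane ![![1, 2, 0], ![3, 0, 2]] ![] ![0, 1, 2, 3]
    ![![0, 1, 2], ![2, 3, 0]] ![] ![1, 2, 3, 0]
    (fun z => [0, z 0, z 0 + z 1, z 0 + z 1 + z 2]) (by decide) (by decide)
    (fun z h1 h2 => by simp [Fin.forall_fin_succ] at h1 h2 ⊢ <;> grind)
    (fun z h1 h2 h3 => by simp [Fin.forall_fin_succ] at h1 h2 h3 ⊢ <;> grind) inst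

theorem vertical12v12_isPlane (inst : Fintype vertical12v12.Dart) : @Tangle.IsPlane _ _ vertical12v12 inst :=
  ofCode_isPlane ![![1, 3, 0], ![2, 3, 1]] ![] ![0, 1, 2, 3]
    ![![0, 1, 3], ![1, 2, 3]] ![] ![1, 2, 3, 0]
    (fun z => [0, z 0, z 0 + z 1, z 0 + z 1 + z 2]) (by decide) (by decide)
    (fun z h1 h2 => by simp [Fin.forall_fin_succ] at h1 h2 ⊢ <;> grind)
    (fun z h1 h2 h3 => by simp [Fin.forall_fin_succ] at h1 h2 h3 ⊢ <;> grind) inst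

theorem vertical12v12Defects_isPlane (inst : Fintype vertical12v12Defects.Dart) : @Tangle.IsPlane _ _ vertical12v12Defects inst :=
  ofCode_isPlane ![![1, 3, 0], ![2, 3, 1]] ![![2, 3], ![3, 0]] ![0, 1, 2, 3]
    ![![0, 1, 3], ![1, 2, 3]] ![![3, 2], ![0, 3]] ![1, 2, 3, 0]
    (fun z => [0, z 0, z 0 + z 1, z 0 + z 1 + z 2]) (by decide) (by decide)
    (fun z h1 h2 => by simp [Fin.forall_fin_succ] at h1 h2 ⊢ <;> grind)
    (fun z h1 h2 h3 => by simp [Fin.forall_fin_succ] at h1 h2 h3 ⊢ <;> grind) inst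

theorem vertical12_isPlane (inst : Fintype vertical12.Dart) : @Tangle.IsPlane _ _ vertical12 inst :=
  ofCode_isPlane ![] ![] ![0, 1, 0, 3]
    ![] ![] ![1, 0, 3, 0]
    (fun z => [0, z 0, z 0 + z 0, z 0 + z 0 + z 1]) (by decide) (by decide)
    (fun z h1 h2 => by simp [Fin.forall_fin_succ] at h1 h2 ⊢ <;> grind)
    (fun z h1 h2 h3 => by simp [Fin.forall_fin_succ] at h1 h2 h3 ⊢ <;> grind) inst

theorem vertical11_isPlane (inst : Fintype vertical11.Dart) : @Tangle.IsPlane _ _ vertical11 inst :=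
  ofCode_isPlane ![] ![] ![0, 1, 0, 3]
    ![] ![] ![1, 0, 3, 0]
    (fun z => [0, z 0, z 0 + z 0, z 0 + z 0 + z 1]) (by decide) (by decide)
    (fun z h1 h2 => by simp [Fin.forall_fin_succ] at h1 h2 ⊢ <;> grind)
    (fun z h1 h2 h3 => by simp [Fin.forall_fin_succ] at h1 h2 h3 ⊢ <;> grind) inst

theorem horizontal11_isPlane (inst : Fintype horizontal11.Dart) : @Tangle.IsPlane _ _ horizontal11 inst :=
  ofCode_isPlane ![] ![] ![0, 1, 2, 1]
    ![] ![] ![1, 2, 1, 0]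
    (fun z => [0, z 0, z 0 + z 1, z 0 + z 1 + z 1]) (by decide) (by decide)
    (fun z h1 h2 => by simp [Fin.forall_fin_succ] at h1 h2 ⊢ <;> grind)
    (fun z h1 h2 h3 => by simp [Fin.forall_fin_succ] at h1 h2 h3 ⊢ <;> grind) inst

theorem digon11_isPlane (inst : Fintype digon11.Dart) : @Tangle.IsPlane _ _ digon11 inst :=
  ofCode_isPlane ![![1, 2, 0], ![0, 2, 1]] ![] ![0, 1]
    ![![0, 1, 2], ![1, 0, 2]] ![] ![1, 0]
    (fun z => [0, z 0, z 2 + z 0]) (by decide) (by decide)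
    (fun z h1 h2 => by simp [Fin.forall_fin_succ] at h1 h2 ⊢ <;> grind)
    (fun z h1 h2 h3 => by simp [Fin.forall_fin_succ] at h1 h2 h3 ⊢ <;> grind) inst

theorem triangle111_isPlane (inst : Fintype triangle111.Dart) : @Tangle.IsPlane _ _ triangle111 inst :=
  ofCode_isPlane ![![1, 3, 0], ![2, 3, 1], ![0, 3, 2]] ![] ![0, 1, 2]
    ![![0, 1, 3], ![1, 2, 3], ![2, 0, 3]] ![] ![1, 2, 0]
    (fun z => [0, z 0, z 0 + z 1, z 3 + z 0]) (by decide) (by decide)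
    (fun z h1 h2 => by simp [Fin.forall_fin_succ] at h1 h2 ⊢ <;> grind)
    (fun z h1 h2 h3 => by simp [Fin.forall_fin_succ] at h1 h2 h3 ⊢ <;> grind) inst

end Tangle

/-! ### Refilling a disc around a pair of defects -/

namespace WebDiagram

variable {Γ : WebDiagram} {d : Γ.Dart}

theorem IsPlane.region_of_opp_eq_rot (H : Γ.IsPlane) {x y : Γ.Dart} (h : Γ.opp x = Γ.rot y) :
    Γ.region (some x) (some y) := by
  have := H.face x
  rwa [h, Equiv.symm_apply_apply] at this

theorem subdivideOpp_self (Γ : WebDiagram) (d : Γ.Dart) :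
    (Γ.subdivide d).opp (.inl d) = .inr false := if_pos rfl

theorem subdivideOpp_opp (Γ : WebDiagram) (d : Γ.Dart) :
    (Γ.subdivide d).opp (.inl (Γ.opp d)) = .inr true :=
  (if_neg (Γ.opp_ne d)).trans (if_pos rfl)

theorem subdivideOpp_of_ne (Γ : WebDiagram) {d x : Γ.Dart} (h1 : x ≠ d) (h2 : x ≠ Γ.opp d) :
    (Γ.subdivide d).opp (.inl x) = .inl (Γ.opp x) := (if_neg h1).trans (if_neg h2)

section Undefect

variable (hd : Γ.defect d = true) (hd' : Γ.defect (Γ.opp d) = true) (hne : Γ.opp d ≠ Γ.rot d)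

/-- A disc around an edge between two defects is refilled by a plain edge.  The boundary points of
the disc take the places of the two bivalent vertices, so that the result has the same darts. -/
theorem glue_edge2_isomorphic_undefect (H : Γ.IsPlane) :
    ((outsidePair hd hd' hne).glue Tangle.edge2).Isomorphic (Γ.undefect d hd hd') := by
  have hb := isBivalent_of_defect hd
  have hb' := isBivalent_of_defect hd'
  have hinj := pairIncl_injective hd hd' hne
  have hr := pairIncl_range hd hd' hne
  -- outside the disc `j` is `pairIncl`; the two ends of the plain edge go to `d` and `Γ.opp d`
  let j : ((outsidePair hd hd' hne).Dart ⊕ Fin 2) ⊕ (CodeDart 0 0 ⊕ Fin 2) → Γ.Dart :=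
    Sum.elim (Γ.pairIncl d) (Sum.elim (fun _ => d) ![d, Γ.opp d])
  have hj : Function.Bijective j := by
    constructor
    · rintro (w | ((⟨x, -⟩ | ⟨x, -⟩) | i)) (w' | ((⟨x, -⟩ | ⟨x, -⟩) | i')) h
      all_goals first | exact x.elim0 | skip
      · exact congrArg Sum.inl (hinj h)
      · have := (hr (Γ.pairIncl d w)).1 ⟨w, rfl⟩
        fin_cases i'
        · exact absurd h this.1
        · exact absurd h this.2
      · have := (hr (Γ.pairIncl d w')).1 ⟨w', rfl⟩
        fin_cases i
        · exact absurd h.symm this.1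
        · exact absurd h.symm this.2
      · fin_cases i <;> fin_cases i' <;>
          first | rfl | exact absurd h (Γ.opp_ne d) | exact absurd h.symm (Γ.opp_ne d)
    · intro x
      by_cases h1 : x = d
      · exact ⟨.inr (.inr 0), h1.symm⟩
      by_cases h2 : x = Γ.opp d
      · exact ⟨.inr (.inr 1), h2.symm⟩
      obtain ⟨w, hw⟩ := (hr x).2 ⟨h1, h2⟩
      exact ⟨.inl w, hw⟩
  have hb0 : ∀ i : Fin 2, Γ.rot (![Γ.rot d, Γ.rot (Γ.opp d)] i) = ![d, Γ.opp d] i := by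
    intro i; fin_cases i
    exacts [hb.2, hb'.2]
  have hb1 : ∀ i : Fin 2, Γ.rot (![d, Γ.opp d] i) = ![Γ.rot d, Γ.rot (Γ.opp d)] i := by
    intro i; fin_cases i <;> rfl
  have hside : ∀ i : Fin 2, Γ.BesideEdge d (![d, Γ.opp d] i) ∧
      Γ.BesideEdge d (![Γ.rot d, Γ.rot (Γ.opp d)] i) := by
    intro i; fin_cases i <;> simp [BesideEdge]
  refine glue_isomorphic (glue_isPlane_of_tangle _ _ (outsidePair_isPlane hd hd' hne H)
      Tangle.edge2_isPlane)
    ((isPlane_undefect hd hd').2 H) (Equiv.ofBijective j hj) ?_ ?_ ?_ ?_ ?_ ?_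
  · rintro ((x | i) | ((⟨x, -⟩ | ⟨x, -⟩) | i))
    · rfl
    · exact (hb0 i).symm
    · exact x.elim0
    · exact x.elim0
    · exact (hb1 i).symm
  · rintro (w | ((⟨x, -⟩ | ⟨x, -⟩) | i))
    · exact pairIncl_opp hd hd' hne w
    · exact x.elim0
    · exact x.elim0
    · fin_cases i
      · rfl
      · exact (Γ.opp_opp d).symm
  · rintro (w | ((⟨x, -⟩ | ⟨x, -⟩) | i))
    · rfl
    · exact x.elim0
    · exact x.elim0
    · fin_cases i
      · exact thick_of_defect (Γ := Γ) hd
      · exact thick_of_defect (Γ := Γ) hd'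
  · rintro ((x | i) | ((⟨x, -⟩ | ⟨x, -⟩) | i))
    · exact if_neg x.2
    · exact if_pos (hside i).2
    · exact x.elim0
    · exact x.elim0
    · exact if_pos (hside i).1
  · intro a b h; exact h
  · intro i
    fin_cases i
    · have := H.face (Γ.opp d)
      rw [Γ.opp_opp, hb.symm_eq] at this
      exact Γ.region.symm this
    · have := H.face d
      rw [hb'.symm_eq] at this
      exact Γ.region.symm this

/-- Marking one point on each side of an edge between two defects. -/
noncomputable def markPair (Γ : WebDiagram) (d : Γ.Dart) : WebDiagram :=
  (Γ.subdivide (Γ.rot d)).subdivide (.inl (Γ.rot (Γ.opp d)))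

/-- A disc around an edge between two defects is refilled by an edge with two defects.  The boundary
points of the disc become marked points on both sides of the pair of defects. -/
theorem glue_edge2TwoDefects_isomorphic (H : Γ.IsPlane) :
    ((outsidePair hd hd' hne).glue Tangle.edge2TwoDefects).Isomorphic (Γ.markPair d) := by
  have hb := isBivalent_of_defect hd
  have hb' := isBivalent_of_defect hd'
  obtain ⟨n1, n2, n3, n4, n5⟩ := besideEdge_ne hd hd' hne
  have HP : (Γ.markPair d).IsPlane := (H.subdivide _).subdivide _
  -- the edge involution of the marked diagram
  obtain ⟨M₁, hM₁⟩ : ∃ M : Γ.Dart ⊕ Bool → Γ.Dart ⊕ Bool,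
      M = (Γ.subdivide (Γ.rot d)).opp := ⟨_, rfl⟩
  obtain ⟨M, hM⟩ : ∃ M : (Γ.Dart ⊕ Bool) ⊕ Bool → (Γ.Dart ⊕ Bool) ⊕ Bool,
      M = (Γ.markPair d).opp := ⟨_, rfl⟩
  have M₁M₁ : ∀ x, M₁ (M₁ x) = x := fun x => by rw [hM₁]; exact (Γ.subdivide (Γ.rot d)).opp_opp x
  have MM : ∀ x, M (M x) = x := fun x => by rw [hM]; exact (Γ.markPair d).opp_opp x
  have inv : ∀ {x y}, M x = y → M y = x := fun h => by rw [← h, MM]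
  have s1 : M₁ (.inl (Γ.rot d)) = .inr false := by rw [hM₁]; exact subdivideOpp_self _ _
  have s2 : M₁ (.inl (Γ.opp (Γ.rot d))) = .inr true := by rw [hM₁]; exact subdivideOpp_opp _ _
  have s3 : ∀ x, x ≠ Γ.rot d → x ≠ Γ.opp (Γ.rot d) → M₁ (.inl x) = .inl (Γ.opp x) :=
    fun x h1 h2 => by rw [hM₁]; exact subdivideOpp_of_ne _ h1 h2
  have t1 : M (.inl (.inl (Γ.rot (Γ.opp d)))) = .inr false := by
    rw [hM]; exact subdivideOpp_self _ _
  have t2 : M (.inl (M₁ (.inl (Γ.rot (Γ.opp d))))) = .inr true := by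
    rw [hM, hM₁]; exact subdivideOpp_opp _ _
  have t3 : ∀ x, x ≠ .inl (Γ.rot (Γ.opp d)) → M₁ x ≠ .inl (Γ.rot (Γ.opp d)) →
      M (.inl x) = .inl (M₁ x) := fun x h1 h2 => by
    have h3 : x ≠ M₁ (.inl (Γ.rot (Γ.opp d))) := fun h => h2 (by rw [h, M₁M₁])
    rw [hM]
    rw [hM₁] at h3 ⊢
    exact subdivideOpp_of_ne _ h1 h3
  -- if the two defects lie on a circle of length two, the second mark subdivides an edge that was
  -- created by the first one; this is the case `o6`, excluded in `o4` and `o5`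
  have o1 : M (.inl (.inl (Γ.rot d))) = .inl (.inr false) := by
    rw [t3 _ (by simpa using n4.symm) (by rw [s1]; exact Sum.inr_ne_inl), s1]
  have o3 : ∀ x, x ≠ Γ.rot d → x ≠ Γ.rot (Γ.opp d) → Γ.opp x ≠ Γ.rot d →
      Γ.opp x ≠ Γ.rot (Γ.opp d) → M (.inl (.inl x)) = .inl (.inl (Γ.opp x)) := by
    intro x h1 h2 h3 h4
    have h5 := s3 x h1 fun h => h3 (by rw [h, Γ.opp_opp])
    rw [t3 _ (by simpa using h2) (by rw [h5]; simpa using h4), h5]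
  have o4 : Γ.opp (Γ.rot d) ≠ Γ.rot (Γ.opp d) →
      M (.inl (.inl (Γ.opp (Γ.rot d)))) = .inl (.inr true) := by
    intro h1
    rw [t3 _ (by simpa using h1) (by rw [s2]; exact Sum.inr_ne_inl), s2]
  have o5 : Γ.opp (Γ.rot d) ≠ Γ.rot (Γ.opp d) →
      M (.inl (.inl (Γ.opp (Γ.rot (Γ.opp d))))) = .inr true := by
    intro h1
    rw [s3 _ n4 h1.symm] at t2
    exact t2
  have o6 : Γ.opp (Γ.rot d) = Γ.rot (Γ.opp d) → M (.inl (.inr true)) = .inr true := by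
    intro h1
    rw [← h1, s2] at t2
    exact t2
  -- the defects of the tangle go to the vertices of `d` and `Γ.opp d`, the boundary points to the
  -- two marks
  let j : ((outsidePair hd hd' hne).Dart ⊕ Fin 2) ⊕ (CodeDart 0 2 ⊕ Fin 2) →
      (Γ.Dart ⊕ Bool) ⊕ Bool
    | .inl (.inl x) => .inl (.inl x.1)
    | .inl (.inr i) => ![.inl (.inr true), .inr true] i
    | .inr (.inl (.inl x)) => x.1.elim0
    | .inr (.inl (.inr (v, k))) => ![![.inl (.inl (Γ.rot d)), .inl (.inl d)],
        ![.inl (.inl (Γ.opp d)), .inl (.inl (Γ.rot (Γ.opp d)))]] v k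
    | .inr (.inr i) => ![.inl (.inr false), .inr false] i
  have hO : ∀ x : {x // ¬ Γ.BesideEdge d x}, x.1 ≠ d ∧ x.1 ≠ Γ.rot d ∧ x.1 ≠ Γ.opp d ∧
      x.1 ≠ Γ.rot (Γ.opp d) := fun x => by
    have := x.2
    simpa only [BesideEdge, not_or] using this
  have hj : Function.Bijective j := by
    constructor
    · rintro ((x | i) | ((⟨x, -⟩ | ⟨v, k⟩) | i)) ((x' | i') | ((⟨x', -⟩ | ⟨v', k'⟩) | i')) h
      all_goals first | exact x.elim0 | exact x'.elim0 | skip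
      · have h' : x.1 = x'.1 := Sum.inl_injective (Sum.inl_injective h)
        rw [Subtype.ext h']
      · fin_cases i' <;> simp [j] at h
      · have := hO x
        fin_cases v' <;> fin_cases k' <;>
          simp [j, this.1, this.2.1, this.2.2.1, this.2.2.2] at h
      · fin_cases i' <;> simp [j] at h
      · fin_cases i <;> simp [j] at h
      · fin_cases i <;> fin_cases i' <;> simp [j] at h ⊢
      · fin_cases i <;> fin_cases v' <;> fin_cases k' <;> simp [j] at h
      · fin_cases i <;> fin_cases i' <;> simp [j] at h
      · have := hO x'
        fin_cases v <;> fin_cases k <;>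
          simp [j, this.1.symm, this.2.1.symm, this.2.2.1.symm, this.2.2.2.symm] at h
      · fin_cases i' <;> fin_cases v <;> fin_cases k <;> simp [j] at h
      · fin_cases v <;> fin_cases k <;> fin_cases v' <;> fin_cases k' <;>
          simp [j, n1, n2, n3, n4, n5, n1.symm, n2.symm, n3.symm, n4.symm, n5.symm, hne,
            hne.symm] at h ⊢
      · fin_cases i' <;> fin_cases v <;> fin_cases k <;> simp [j] at h
      · fin_cases i <;> simp [j] at h
      · fin_cases i <;> fin_cases i' <;> simp [j] at h
      · fin_cases i <;> fin_cases v' <;> fin_cases k' <;> simp [j] at h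
      · fin_cases i <;> fin_cases i' <;> simp [j] at h ⊢
    · rintro ((x | b) | b)
      · by_cases h1 : x = d
        · exact ⟨.inr (.inl (.inr (0, 1))), by rw [h1]; rfl⟩
        by_cases h2 : x = Γ.rot d
        · exact ⟨.inr (.inl (.inr (0, 0))), by rw [h2]; rfl⟩
        by_cases h3 : x = Γ.opp d
        · exact ⟨.inr (.inl (.inr (1, 0))), by rw [h3]; rfl⟩
        by_cases h4 : x = Γ.rot (Γ.opp d)
        · exact ⟨.inr (.inl (.inr (1, 1))), by rw [h4]; rfl⟩
        exact ⟨.inl (.inl ⟨x, by simp [BesideEdge, h1, h2, h3, h4]⟩), rfl⟩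
      · cases b
        · exact ⟨.inr (.inr 0), rfl⟩
        · exact ⟨.inl (.inr 0), rfl⟩
      · cases b
        · exact ⟨.inr (.inr 1), rfl⟩
        · exact ⟨.inl (.inr 1), rfl⟩
  have hrot : ∀ x, j (glueRot (outsidePair hd hd' hne) Tangle.edge2TwoDefects x) =
      (Γ.markPair d).rot (j x) := by
    rintro ((x | i) | ((⟨x, -⟩ | ⟨v, k⟩) | i))
    · rfl
    · fin_cases i <;> rfl
    · exact x.elim0
    · fin_cases v <;> fin_cases k
      · exact congrArg (fun y : Γ.Dart => (.inl (.inl y) : (Γ.Dart ⊕ Bool) ⊕ Bool)) hb.2.symm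
      · rfl
      · rfl
      · exact congrArg (fun y : Γ.Dart => (.inl (.inl y) : (Γ.Dart ⊕ Bool) ⊕ Bool)) hb'.2.symm
    · fin_cases i <;> rfl
  have hopp : ∀ x, j (glueOpp (outsidePair hd hd' hne) Tangle.edge2TwoDefects x) =
      (Γ.markPair d).opp (j x) := by
    rw [← hM]
    rintro (w | ((⟨x, -⟩ | ⟨v, k⟩) | i))
    · have hp := pairIncl_opp hd hd' hne w
      change j (.inl ((outsidePair hd hd' hne).opp w)) = _
      generalize (outsidePair hd hd' hne).opp w = w' at hp
      rcases w with x | i <;> rcases w' with x' | i'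
      · change x'.1 = Γ.opp x.1 at hp
        change _ = M (.inl (.inl x.1))
        rw [o3 x.1 (hO x).2.1 (hO x).2.2.2 (hp ▸ (hO x').2.1) (hp ▸ (hO x').2.2.2), ← hp]
      · change ![Γ.rot d, Γ.rot (Γ.opp d)] i' = Γ.opp x.1 at hp
        change _ = M (.inl (.inl x.1))
        fin_cases i'
        · have h1 : x.1 = Γ.opp (Γ.rot d) := (Γ.opp_opp _).symm.trans (congrArg Γ.opp hp.symm)
          rw [h1, o4 (h1 ▸ (hO x).2.2.2)]; rfl
        · have h1 : x.1 = Γ.opp (Γ.rot (Γ.opp d)) :=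
            (Γ.opp_opp _).symm.trans (congrArg Γ.opp hp.symm)
          rw [h1, o5 fun h => (hO x).2.1 (by rw [h1, ← h, Γ.opp_opp])]; rfl
      · change x'.1 = Γ.opp (![Γ.rot d, Γ.rot (Γ.opp d)] i) at hp
        change (.inl (.inl x'.1) : (Γ.Dart ⊕ Bool) ⊕ Bool) = _
        fin_cases i
        · have h1 : x'.1 = Γ.opp (Γ.rot d) := hp
          rw [h1]
          exact (inv (o4 (h1 ▸ (hO x').2.2.2))).symm
        · have h1 : x'.1 = Γ.opp (Γ.rot (Γ.opp d)) := hp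
          rw [h1]
          exact (inv (o5 fun h => (hO x').2.1 (by rw [h1, ← h, Γ.opp_opp]))).symm
      · change ![Γ.rot d, Γ.rot (Γ.opp d)] i' = Γ.opp (![Γ.rot d, Γ.rot (Γ.opp d)] i) at hp
        fin_cases i <;> fin_cases i'
        · exact absurd hp.symm (Γ.opp_ne _)
        · exact (o6 hp.symm).symm
        · exact (inv (o6 ((congrArg Γ.opp hp).trans (Γ.opp_opp _)))).symm
        · exact absurd hp.symm (Γ.opp_ne _)
    · exact x.elim0
    · fin_cases v <;> fin_cases k
      · exact o1.symm
      · exact (o3 d n1.symm n3.symm hne n5.symm).symm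
      · exact (inv (o3 d n1.symm n3.symm hne n5.symm)).symm
      · exact t1.symm
    · fin_cases i
      · exact (inv o1).symm
      · exact (inv t1).symm
  have tb := thick_rot_of_bivalent hb
  have tb' := thick_rot_of_bivalent hb'
  have td := thick_of_defect hd
  have td' := thick_of_defect hd'
  refine glue_isomorphic (glue_isPlane_of_tangle _ _ (outsidePair_isPlane hd hd' hne H)
      Tangle.edge2TwoDefects_isPlane) HP (Equiv.ofBijective j hj) hrot hopp ?_ ?_ ?_ ?_
  · rintro ((x | i) | ((⟨x, -⟩ | ⟨v, k⟩) | i))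
    · rfl
    · fin_cases i
      · rfl
      · rfl
    · exact x.elim0
    · fin_cases v <;> fin_cases k
      exacts [tb.trans td, td, td', tb'.trans td']
    · fin_cases i
      exacts [tb.trans td, tb'.trans td']
  · rintro ((x | i) | ((⟨x, -⟩ | ⟨v, k⟩) | i))
    · rfl
    · fin_cases i <;> rfl
    · exact x.elim0
    · have db := defect_rot_of_bivalent hb
      have db' := defect_rot_of_bivalent hb'
      fin_cases v <;> fin_cases k
      exacts [db.trans hd, hd, hd', db'.trans hd']
    · fin_cases i <;> rfl
  · intro a b h
    have h' : ∀ a : Option ((outsidePair hd hd' hne).Dart ⊕ Fin 2),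
        Option.map (Sum.elim id fun b => if b then Γ.rot d else Γ.opp (Γ.rot d))
          (Option.map (Sum.elim id fun b => if b then .inl (Γ.rot (Γ.opp d)) else
            (Γ.subdivide (Γ.rot d)).opp (.inl (Γ.rot (Γ.opp d))))
          (Option.map (fun x => Equiv.ofBijective j hj (.inl x)) a)) =
        Option.map (Γ.pairIncl d) a := by
      rintro (_ | (x | i))
      · rfl
      · rfl
      · fin_cases i <;> rfl
    change Γ.region _ _
    have h1 : Γ.region (Option.map (Γ.pairIncl d) a) (Option.map (Γ.pairIncl d) b) := h
    rw [← h', ← h'] at h1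
    exact h1
  -- consecutive darts of a face, from which the two inner regions are followed along the edges
  · have F : ∀ x y : (Γ.Dart ⊕ Bool) ⊕ Bool, M x = (Γ.markPair d).rot y →
        (Γ.markPair d).region (some x) (some y) := fun x y h => by
      rw [hM] at h
      exact HP.region_of_opp_eq_rot h
    intro i
    fin_cases i
    · have f1 := F (.inr false) (.inl (.inl (Γ.opp d))) (inv t1)
      have f2 := F (.inl (.inl (Γ.opp d))) (.inl (.inl (Γ.rot d)))
        ((inv (o3 d n1.symm n3.symm hne n5.symm)).trans
          (congrArg (fun y : Γ.Dart => (.inl (.inl y) : (Γ.Dart ⊕ Bool) ⊕ Bool)) hb.2.symm))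
      have f3 := F (.inl (.inl (Γ.rot d))) (.inl (.inr true)) o1
      exact Setoid.symm' _ (Setoid.trans' _ f1 (Setoid.trans' _ f2 f3))
    · have f1 := F (.inl (.inr false)) (.inl (.inl d)) (inv o1)
      have f2 := F (.inl (.inl d)) (.inl (.inl (Γ.rot (Γ.opp d))))
        ((o3 d n1.symm n3.symm hne n5.symm).trans
          (congrArg (fun y : Γ.Dart => (.inl (.inl y) : (Γ.Dart ⊕ Bool) ⊕ Bool)) hb'.2.symm))
      have f3 := F (.inl (.inl (Γ.rot (Γ.opp d)))) (.inr true) t1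
      exact Setoid.symm' _ (Setoid.trans' _ f1 (Setoid.trans' _ f2 f3))

end Undefect

end WebDiagram

/-! ### Reduced diagrams -/

/-- An invariant of webs that satisfies all the relations. -/
structure SatisfiesAll (f : WebDiagram → ℤ) : Prop where
  invariant : IsWebInvariant f
  web : SatisfiesWebRelations f
  tutte : SatisfiesTutteRelations f

namespace WebDiagram

variable {Γ : WebDiagram} {d : Γ.Dart} {f : WebDiagram → ℤ}

/-- Two adjacent defects cancel in any plane diagram, not only in one presented by gluing. -/
theorem value_undefect (hf : SatisfiesAll f) (H : Γ.IsPlane) (hd : Γ.defect d = true)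
    (hd' : Γ.defect (Γ.opp d) = true) (hne : Γ.opp d ≠ Γ.rot d) :
    f (Γ.undefect d hd hd') = f Γ := by
  have HO := outsidePair_isPlane hd hd' hne H
  have h1 := glue_isPlane_of_tangle _ _ HO Tangle.edge2_isPlane
  have h2 := glue_isPlane_of_tangle _ _ HO Tangle.edge2TwoDefects_isPlane
  have e1 := hf.invariant.isomorphic _ _ h1 ((isPlane_undefect hd hd').2 H)
    (glue_edge2_isomorphic_undefect hd hd' hne H)
  have e2 := hf.invariant.isomorphic _ _ h2 ((H.subdivide _).subdivide _)
    (glue_edge2TwoDefects_isomorphic hd hd' hne H)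
  have e3 : f (Γ.markPair d) = f Γ :=
    (hf.invariant.subdivide _ _ (H.subdivide _)).trans (hf.invariant.subdivide _ _ H)
  rw [← e1, ← hf.web.defects_cancel _ HO, e2]
  exact e3

theorem value_smooth (hf : SatisfiesAll f) (H : Γ.IsPlane) (hd : IsBivalent Γ.rot d)
    (hc : Γ.opp d ≠ Γ.rot d) (hm : Γ.defect d = false) : f (Γ.smooth d hd hc) = f Γ := by
  rw [← hf.invariant.isomorphic _ _ ((H.smooth hd hc).subdivide _) H
    (subdivide_smooth_isomorphic hd hc H hm), hf.invariant.subdivide _ _ (H.smooth hd hc)]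

/-- Apart from circles with one vertex, a reduced diagram has no marked points, and its defects are
separated by trivalent vertices. -/
def Reduced (Γ : WebDiagram) : Prop :=
  ∀ d, IsBivalent Γ.rot d → Γ.opp d = Γ.rot d ∨ (Γ.defect d = true ∧ IsTrivalent Γ.rot (Γ.opp d))

/-- A property of plane diagrams that is preserved by erasing marked points and by cancelling
adjacent defects passes to some reduced diagram. -/
theorem exists_reduced (Q : WebDiagram → Prop)
    (hs : ∀ (Γ : WebDiagram) (d : Γ.Dart) (hd : IsBivalent Γ.rot d) (hc : Γ.opp d ≠ Γ.rot d),
      Γ.IsPlane → Γ.defect d = false → Q Γ → Q (Γ.smooth d hd hc))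
    (hu : ∀ (Γ : WebDiagram) (d : Γ.Dart) (hd : Γ.defect d = true)
      (hd' : Γ.defect (Γ.opp d) = true), Γ.opp d ≠ Γ.rot d → Γ.IsPlane → Q Γ →
        Q (Γ.undefect d hd hd'))
    (Γ : WebDiagram) (H : Γ.IsPlane) (hQ : Q Γ) : ∃ Γ', Γ'.IsPlane ∧ Γ'.Reduced ∧ Q Γ' := by
  -- induction on the number of darts plus the number of defects
  classical
  induction hn : Nat.card Γ.Dart + Nat.card {x : Γ.Dart // Γ.defect x = true} using
    Nat.strong_induction_on generalizing Γ with
  | _ n ih =>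
  have := Γ.finite
  have smooth_step : ∀ (d : Γ.Dart), IsBivalent Γ.rot d → Γ.opp d ≠ Γ.rot d →
      Γ.defect d = false → ∃ Γ', Γ'.IsPlane ∧ Γ'.Reduced ∧ Q Γ' := by
    intro d hd hc hm
    refine ih _ ?_ _ (H.smooth hd hc) (hs Γ d hd hc H hm hQ) rfl
    have h1 : Nat.card (Γ.smooth d hd hc).Dart < Nat.card Γ.Dart :=
      Finite.card_subtype_lt (p := fun x => x ≠ d ∧ x ≠ Γ.rot d) (x := d) (fun h => h.1 rfl)
    have h2 : Nat.card {x : (Γ.smooth d hd hc).Dart // (Γ.smooth d hd hc).defect x = true} ≤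
        Nat.card {x : Γ.Dart // Γ.defect x = true} :=
      Nat.card_le_card_of_injective (fun x => ⟨smoothIncl hd hc x.1, x.2⟩) fun x y h => by
        have h' : smoothIncl hd hc x.1 = smoothIncl hd hc y.1 := by injection h
        exact Subtype.ext (smoothIncl_injective hd hc h')
    omega
  by_cases hred : Γ.Reduced
  · exact ⟨Γ, H, hred, hQ⟩
  · simp only [Reduced, not_forall, not_or, not_and] at hred
    obtain ⟨d, hd, hc, h⟩ := hred
    cases hm : Γ.defect d with
    | false => exact smooth_step d hd hc hm
    | true =>
      have hd' : IsBivalent Γ.rot (Γ.opp d) := (Γ.not_isTrivalent_iff _).1 (h hm)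
      cases hm' : Γ.defect (Γ.opp d) with
      | false =>
        refine smooth_step _ hd' (fun h' => hc ?_) hm'
        rw [Γ.opp_opp] at h'
        rw [← hd'.2, ← h']
      | true =>
        refine ih _ ?_ _ ((isPlane_undefect hm hm').2 H) (hu Γ d hm hm' hc H hQ) rfl
        have h1 : Nat.card {x : Γ.Dart // (Γ.undefect d hm hm').defect x = true} <
            Nat.card {x : Γ.Dart // Γ.defect x = true} := by
          have h2 : ∀ x, (Γ.undefect d hm hm').defect x = true → Γ.defect x = true ∧ x ≠ d := by
            intro x hx
            change (if Γ.BesideEdge d x then false else Γ.defect x) = true at hx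
            split_ifs at hx with h3
            exact ⟨hx, fun h4 => h3 (Or.inl h4)⟩
          let i : {x : Γ.Dart // (Γ.undefect d hm hm').defect x = true} →
              {x : {x : Γ.Dart // Γ.defect x = true} // x ≠ ⟨d, hm⟩} := fun x =>
            ⟨⟨x.1, (h2 x.1 x.2).1⟩, fun h4 => (h2 x.1 x.2).2 (congrArg Subtype.val h4)⟩
          refine lt_of_le_of_lt (Nat.card_le_card_of_injective i fun x y hxy => ?_)
            (Finite.card_subtype_lt (x := ⟨d, hm⟩) (fun h => h rfl))
          exact Subtype.ext (congrArg (fun z => z.1.1) hxy)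
        have h2 : Nat.card (Γ.undefect d hm hm').Dart = Nat.card Γ.Dart := rfl
        have h3 : Nat.card {x : (Γ.undefect d hm hm').Dart //
          (Γ.undefect d hm hm').defect x = true} =
            Nat.card {x : Γ.Dart // (Γ.undefect d hm hm').defect x = true} := rfl
        omega

end WebDiagram

/-! ### Trivalent cores -/

/-- The trivalent graph that underlies a web without circles.  The thick edge of `d` carries
an even or odd number of defects, depending on whether `half d` and `half (opp d)` are equal. -/
structure TriWeb (X : Type) where
  finite : Finite X
  rot : Perm X
  opp : Perm X
  region : Setoid (Option X)
  thick : X → Bool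
  half : X → Bool
  opp_opp : ∀ d, opp (opp d) = d
  opp_ne : ∀ d, opp d ≠ d
  thick_opp : ∀ d, thick (opp d) = thick d
  thick_of_half : ∀ d, half d = true → thick d = true
  trivalent : ∀ d, IsTrivalent rot d
  vertex : ∀ d, IsWebVertex rot thick (fun _ => false) d

namespace TriWeb

/-- Planarity of a trivalent graph, in the same sense as for diagrams. -/
def IsPlane {X : Type} (C : TriWeb X) : Prop := IsPlaneMap C.rot C.opp C.region

theorem isPlane_iff {X : Type} (C : TriWeb X) [Fintype X] :
    C.IsPlane ↔ IsPlaneHom C.rot C.opp C.region :=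
  isPlaneMap_iff_isPlaneHom _ _ _ C.opp_opp C.opp_ne

/-- The graph has at most one component: an invariant set of darts is everything or empty.  (The
empty graph is connected in this sense.) -/
def Connected {X : Type} (C : TriWeb X) : Prop :=
  ∀ S : X → Prop, (∀ d, S (C.rot d) ↔ S d) → (∀ d, S (C.opp d) ↔ S d) →
    (∀ d, S d) ∨ ∀ d, ¬ S d

/-- The diagram `Γ` is obtained from the trivalent graph `C` by adding bivalent vertices:
`e` is the inclusion of darts, `κ y` is the dart of `C` that contains `y`, and `σ` changes along an
edge of `C` exactly at the defects. -/
structure Rep {X : Type} (C : TriWeb X) (Γ : WebDiagram) (e : X → Γ.Dart) (κ : Γ.Dart → X)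
    (σ : Γ.Dart → Bool) : Prop where
  sub : Subdivides C.rot C.opp Γ.rot Γ.opp e κ
  thick : ∀ y, Γ.thick y = C.thick (κ y)
  flag : ∀ x, σ (e x) = C.half x
  flag_opp : ∀ y, σ (Γ.opp y) = σ y
  flag_rot : ∀ y, e (κ y) ≠ y → σ (Γ.rot y) = xor (σ y) (Γ.defect y)
  region : ∀ a b, Γ.region a b → C.region (a.map κ) (b.map κ)

/-- The diagram `Γ` has the core `C`. -/
def HasRep {X : Type} (C : TriWeb X) (Γ : WebDiagram) : Prop := ∃ e κ σ, C.Rep Γ e κ σ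

variable {X : Type} {C : TriWeb X} {Γ : WebDiagram} {e : X → Γ.Dart} {κ : Γ.Dart → X}
  {σ : Γ.Dart → Bool}

theorem Rep.isTrivalent (R : C.Rep Γ e κ σ) (x : X) : IsTrivalent Γ.rot (e x) :=
  (WebDiagram.isTrivalent_incl_iff R.sub x).2 (C.trivalent x)

theorem Rep.isBivalent (R : C.Rep Γ e κ σ) {y : Γ.Dart} (h : e (κ y) ≠ y) :
    IsBivalent Γ.rot y := (R.sub.bivalent y h).1

theorem Rep.eq_of_isTrivalent (R : C.Rep Γ e κ σ) {y : Γ.Dart} (h : IsTrivalent Γ.rot y) :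
    e (κ y) = y := by
  by_contra h'
  exact h.not_isBivalent (R.isBivalent h')

theorem Rep.ne_of_isBivalent (R : C.Rep Γ e κ σ) {y : Γ.Dart} (h : IsBivalent Γ.rot y) :
    e (κ y) ≠ y := fun h' => (R.isTrivalent (κ y)).not_isBivalent (by rwa [h'])

/-- Erasing a marked point does not change the core. -/
theorem HasRep.smooth (R : C.HasRep Γ) {d : Γ.Dart} (hd : IsBivalent Γ.rot d)
    (hc : Γ.opp d ≠ Γ.rot d) (hm : Γ.defect d = false) : C.HasRep (Γ.smooth d hd hc) := by
  obtain ⟨e, κ, σ, R⟩ := R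
  have hne : ∀ x, e x ≠ d ∧ e x ≠ Γ.rot d := fun x =>
    ⟨fun h => (R.isTrivalent x).not_isBivalent (by rwa [h]),
      fun h => (R.isTrivalent x).not_isBivalent (by rw [h]; exact hd.rot)⟩
  have hκ : κ (Γ.rot d) = C.opp (κ d) := (R.sub.bivalent d (R.ne_of_isBivalent hd)).2
  have hσ : σ (Γ.rot d) = σ d := by
    rw [R.flag_rot d (R.ne_of_isBivalent hd), hm, Bool.xor_false]
  have hκo : ∀ x, κ (Γ.smoothOpp d x) = C.opp (κ x) := fun x => by
    unfold WebDiagram.smoothOpp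
    have h0 := R.sub.label_opp x
    split_ifs with h1 h2
    · rw [R.sub.label_opp, hκ, ← h1, h0, C.opp_opp]
    · rw [h2, hκ] at h0
      rw [R.sub.label_opp, h0]
    · exact h0
  have hσo : ∀ x, σ (Γ.smoothOpp d x) = σ x := fun x => by
    unfold WebDiagram.smoothOpp
    have h0 := R.flag_opp x
    split_ifs with h1 h2
    · rw [R.flag_opp, hσ, ← h1, h0]
    · rw [R.flag_opp, ← hσ, ← h2, h0]
    · exact h0
  have hval : ∀ y : (Γ.smooth d hd hc).Dart,
      (⟨e (κ (WebDiagram.smoothIncl hd hc y)), hne _⟩ : (Γ.smooth d hd hc).Dart) ≠ y →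
      e (κ (WebDiagram.smoothIncl hd hc y)) ≠ WebDiagram.smoothIncl hd hc y :=
    fun y hy h => hy (Subtype.ext h)
  refine ⟨fun x => ⟨e x, hne x⟩, fun y => κ (WebDiagram.smoothIncl hd hc y),
    fun y => σ (WebDiagram.smoothIncl hd hc y), ⟨?_, ?_, ?_, ?_⟩, ?_, ?_, ?_, ?_, ?_⟩
  · exact fun x => R.sub.label x
  · exact fun x => Subtype.ext (R.sub.rot_incl x)
  · exact fun y => hκo _
  · intro y hy
    have h := R.sub.bivalent _ (hval y hy)
    refine ⟨⟨fun h' => h.1.1 (congrArg Subtype.val h'), Subtype.ext h.1.2⟩, h.2⟩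
  · exact fun y => R.thick _
  · exact fun x => R.flag x
  · exact fun y => hσo _
  · exact fun y hy => R.flag_rot _ (hval y hy)
  · intro a b h
    have := R.region _ _ h
    rcases a with _ | a <;> rcases b with _ | b <;> exact this

/-- Cancelling two adjacent defects does not change the core. -/
theorem HasRep.undefect (R : C.HasRep Γ) {d : Γ.Dart} (hd : Γ.defect d = true)
    (hd' : Γ.defect (Γ.opp d) = true) (hne : Γ.opp d ≠ Γ.rot d) :
    C.HasRep (Γ.undefect d hd hd') := by
  classical
  obtain ⟨e, κ, σ, R⟩ := R
  have hb := WebDiagram.isBivalent_of_defect hd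
  have hb' := WebDiagram.isBivalent_of_defect hd'
  obtain ⟨n1, n2, n3, n4, n5⟩ := WebDiagram.besideEdge_ne hd hd' hne
  have f1 := R.flag_rot d (R.ne_of_isBivalent hb)
  have f2 := R.flag_rot _ (R.ne_of_isBivalent hb')
  rw [hd] at f1
  rw [hd', R.flag_opp] at f2
  -- between the two defects, the parity of the number of defects is changed
  let τ : Γ.Dart → Bool := fun y => if y = d ∨ y = Γ.opp d then !(σ y) else σ y
  have t1 : ∀ x, τ (e x) = C.half x := fun x => by
    have h1 : e x ≠ d := fun h => (R.isTrivalent x).not_isBivalent (by rwa [h])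
    have h2 : e x ≠ Γ.opp d := fun h => (R.isTrivalent x).not_isBivalent (by rwa [h])
    simp only [τ, h1, h2, or_self, if_false]
    exact R.flag x
  have t2 : ∀ y, τ (Γ.opp y) = τ y := fun y => by
    have h1 : Γ.opp y = d ↔ y = Γ.opp d :=
      ⟨fun h => by rw [← h, Γ.opp_opp], fun h => by rw [h, Γ.opp_opp]⟩
    simp only [τ, h1, Γ.opp.injective.eq_iff, R.flag_opp, or_comm]
  have t3 : ∀ y, e (κ y) ≠ y →
      τ (Γ.rot y) = xor (τ y) (if Γ.BesideEdge d y then false else Γ.defect y) := by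
    intro y hy
    have f3 := R.flag_rot y hy
    by_cases h : Γ.BesideEdge d y
    · rw [if_pos h]
      rcases h with h | h | h | h <;> rw [h]
      · simp [τ, n1, hne.symm, f1]
      · simp [τ, hb.2, n1, hne.symm, f1]
      · simp [τ, n3, n5, f2, R.flag_opp]
      · simp [τ, hb'.2, n3, n5, f2, R.flag_opp]
    · have h' := mt (WebDiagram.besideEdge_rot hb hb' y).1 h
      rw [if_neg h]
      simp only [WebDiagram.BesideEdge, not_or] at h h'
      simp [τ, h.1, h.2.2.1, h'.1, h'.2.2.1, f3]
  exact ⟨e, κ, τ, R.sub, R.thick, t1, t2, t3, R.region⟩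

end TriWeb

/-! ### Diagrams with the same core -/

/-- In a connected reduced diagram with a trivalent vertex all bivalent vertices are isolated
defects. -/
theorem WebDiagram.Reduced.of_isTrivalent {Γ : WebDiagram} (hr : Γ.Reduced) (hc : Γ.Connected)
    {t : Γ.Dart} (ht : IsTrivalent Γ.rot t) {y : Γ.Dart} (hb : IsBivalent Γ.rot y) :
    Γ.defect y = true ∧ IsTrivalent Γ.rot (Γ.opp y) := by
  rcases hr y hb with h | h
  -- a circle with one vertex would be a component without trivalent vertices
  · exfalso
    have h' : Γ.opp (Γ.rot y) = y := by rw [← h, Γ.opp_opp]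
    have hrot : ∀ x, (Γ.rot x = y ∨ Γ.rot x = Γ.rot y) ↔ (x = y ∨ x = Γ.rot y) := fun x => by
      rw [Γ.rot.injective.eq_iff, or_comm]
      refine or_congr_right ⟨fun h => ?_, fun h => by rw [h, hb.2]⟩
      exact Γ.rot.injective (by rw [h, hb.2])
    have hopp : ∀ x, (Γ.opp x = y ∨ Γ.opp x = Γ.rot y) ↔ (x = y ∨ x = Γ.rot y) := fun x => by
      rw [or_comm]
      refine or_congr ⟨fun h1 => ?_, fun h1 => by rw [h1, h]⟩
        ⟨fun h1 => ?_, fun h1 => by rw [h1, h']⟩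
      · exact Γ.opp.injective (by rw [h1, h])
      · exact Γ.opp.injective (by rw [h1, h'])
    rcases hc (fun x => x = y ∨ x = Γ.rot y) hrot hopp with h1 | h1
    · rcases h1 t with h3 | h3
      · rw [h3] at ht; exact ht.not_isBivalent hb
      · rw [h3] at ht; exact ht.not_isBivalent hb.rot
    · exact h1 y (Or.inl rfl)
  · exact h

namespace TriWeb

variable {X : Type} {C : TriWeb X} {Γ Γ' : WebDiagram} {e : X → Γ.Dart} {κ : Γ.Dart → X}
  {σ : Γ.Dart → Bool}

/-- The darts of the reduced diagram with core `C`: the darts at trivalent vertices, and for every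
edge with a defect the two darts at the defect, named by the darts at the opposite ends. -/
abbrev ReducedDart {X : Type} (C : TriWeb X) : Type := X ⊕ {x // C.half x ≠ C.half (C.opp x)}

/-- The rotation of the reduced diagram with core `C`. -/
def reducedRot {X : Type} (C : TriWeb X) : C.ReducedDart → C.ReducedDart
  | .inl x => .inl (C.rot x)
  | .inr x => .inr ⟨C.opp x.1, by rw [C.opp_opp]; exact x.2.symm⟩

/-- The edge involution of the reduced diagram with core `C`. -/
def reducedOpp {X : Type} (C : TriWeb X) : C.ReducedDart → C.ReducedDart
  | .inl x => if h : C.half x = C.half (C.opp x) then .inl (C.opp x) else .inr ⟨x, h⟩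
  | .inr x => .inl x.1

/-- The dart of the core that contains a dart of the reduced diagram. -/
def reducedLabel {X : Type} (C : TriWeb X) : C.ReducedDart → X := Sum.elim id fun x => C.opp x.1

theorem Rep.defect_of_reduced (R : C.Rep Γ e κ σ) (hr : Γ.Reduced) (hc : Γ.Connected)
    {y : Γ.Dart} (hy : e (κ y) ≠ y) :
    Γ.defect y = true ∧ Γ.opp y = e (C.opp (κ y)) := by
  obtain ⟨h1, h2⟩ := hr.of_isTrivalent hc (R.isTrivalent (κ y)) (R.isBivalent hy)
  refine ⟨h1, ?_⟩
  rw [← R.sub.label_opp, R.eq_of_isTrivalent h2]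

/-- A connected reduced diagram with core `C` is completely described by `C`. -/
theorem Rep.exists_reduced_form (R : C.Rep Γ e κ σ) (hr : Γ.Reduced) (hc : Γ.Connected) :
    ∃ j : C.ReducedDart ≃ Γ.Dart, (∀ w, j (C.reducedRot w) = Γ.rot (j w)) ∧
      (∀ w, j (C.reducedOpp w) = Γ.opp (j w)) ∧ (∀ w, Γ.thick (j w) = C.thick (C.reducedLabel w)) ∧
      (∀ w, Γ.defect (j w) = Sum.elim (fun _ => false) (fun _ => true) w) ∧
      (∀ w, κ (j w) = C.reducedLabel w) ∧ ∀ x, j (.inl x) = e x := by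
  classical
  -- an edge of the core carries no defect exactly when its two flags agree
  have hold : ∀ x, e (κ (Γ.opp (e x))) = Γ.opp (e x) ↔ C.half x = C.half (C.opp x) := by
    intro x
    have hl : κ (Γ.opp (e x)) = C.opp x := by rw [R.sub.label_opp, R.sub.label]
    constructor
    · intro h
      rw [← R.flag, ← R.flag_opp, ← h, hl, R.flag]
    · intro h
      by_contra hy
      obtain ⟨h1, -⟩ := R.defect_of_reduced hr hc hy
      have h2 := R.flag_rot _ hy
      have hy' := R.sub.new_rot hy
      obtain ⟨-, h3⟩ := R.defect_of_reduced hr hc hy'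
      rw [(R.sub.bivalent _ hy).2, hl, C.opp_opp] at h3
      rw [h1, ← R.flag_opp (Γ.rot _), h3, R.flag, R.flag_opp, R.flag, ← h] at h2
      simp at h2
  -- a defect is named by the dart at the far end of the half-edge on which it is seen
  let j : C.ReducedDart → Γ.Dart := Sum.elim e fun x => Γ.opp (e x.1)
  have hnew : ∀ x : {x // C.half x ≠ C.half (C.opp x)}, e (κ (Γ.opp (e x.1))) ≠ Γ.opp (e x.1) :=
    fun x h => x.2 ((hold _).1 h)
  have hj : Function.Bijective j := by
    constructor
    · rintro (x | x) (y | y) h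
      · exact congrArg Sum.inl (R.sub.injective h)
      · have h' : e x = Γ.opp (e y.1) := h
        exact absurd (by rw [← h', R.sub.label]) (hnew y)
      · have h' : Γ.opp (e x.1) = e y := h
        exact absurd (by rw [h', R.sub.label]) (hnew x)
      · exact congrArg Sum.inr (Subtype.ext (R.sub.injective (Γ.opp.injective h)))
    · intro y
      by_cases hy : e (κ y) = y
      · exact ⟨.inl (κ y), hy⟩
      · obtain ⟨-, h⟩ := R.defect_of_reduced hr hc hy
        have h' : Γ.opp (e (C.opp (κ y))) = y := by rw [← h, Γ.opp_opp]
        refine ⟨.inr ⟨C.opp (κ y), fun h1 => hy ?_⟩, h'⟩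
        rw [← hold, h'] at h1
        exact h1
  refine ⟨Equiv.ofBijective j hj, ?_, ?_, ?_, ?_, ?_, fun _ => rfl⟩
  · rintro (x | x)
    · exact (R.sub.rot_incl x).symm
    · obtain ⟨-, h⟩ := R.defect_of_reduced hr hc (R.sub.new_rot (hnew x))
      rw [(R.sub.bivalent _ (hnew x)).2, C.opp_opp, R.sub.label_opp, R.sub.label] at h
      change Γ.opp (e (C.opp x.1)) = Γ.rot (Γ.opp (e x.1))
      rw [← h, Γ.opp_opp]
  · rintro (x | x)
    · change j (C.reducedOpp (.inl x)) = Γ.opp (e x)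
      by_cases h : C.half x = C.half (C.opp x)
      · have h1 := (hold x).2 h
        rw [R.sub.label_opp, R.sub.label] at h1
        exact (congrArg j (dif_pos h)).trans h1
      · exact congrArg j (dif_neg h)
    · exact (Γ.opp_opp _).symm
  · rintro (x | x)
    · exact (R.thick _).trans (congrArg C.thick (R.sub.label x))
    · refine (R.thick _).trans (congrArg C.thick ?_)
      exact (R.sub.label_opp _).trans (congrArg C.opp (R.sub.label _))
  · rintro (x | x)
    · change Γ.defect (e x) = false
      by_contra h
      exact (R.isTrivalent x).not_isBivalent (WebDiagram.isBivalent_of_defect (by simpa using h))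
    · exact (R.defect_of_reduced hr hc (hnew x)).1
  · rintro (x | x)
    · exact R.sub.label x
    · refine (R.sub.label_opp _).trans ?_
      rw [R.sub.label]; rfl

/-- In a connected reduced plane diagram the regions are those of the core. -/
theorem Rep.region_iff (R : C.Rep Γ e κ σ) (hr : Γ.Reduced) (hc : Γ.Connected) (H : Γ.IsPlane)
    (HC : C.IsPlane) (a b : Option Γ.Dart) : Γ.region a b ↔ C.region (a.map κ) (b.map κ) := by
  have := Γ.finite
  let := Fintype.ofFinite Γ.Dart
  have := C.finite
  let := Fintype.ofFinite X
  have H1 := R.sub.isPlaneHom_subdivision (region' := C.region.comap (Option.map κ)) C.opp_opp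
    (fun a b => Iff.rfl) (fun z h1 h2 y => by
      by_cases hy : e (κ y) = y
      · rw [hy]
      · have hy' := R.sub.new_rot hy
        obtain ⟨-, h⟩ := R.defect_of_reduced hr hc hy'
        rw [(R.sub.bivalent _ hy).2, C.opp_opp] at h
        rw [← h, h1, h2 y hy]) (C.isPlane_iff.1 HC)
  exact (Γ.isPlane_iff.1 H).region_iff_of_le H1 Γ.opp_opp R.region a b

theorem HasRep.isomorphic (h : C.HasRep Γ) (h' : C.HasRep Γ') (hr : Γ.Reduced) (hr' : Γ'.Reduced)
    (hc : Γ.Connected) (hc' : Γ'.Connected) (H : Γ.IsPlane) (H' : Γ'.IsPlane) (HC : C.IsPlane) :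
    Γ.Isomorphic Γ' := by
  obtain ⟨e, κ, σ, R⟩ := h
  obtain ⟨e', κ', σ', R'⟩ := h'
  obtain ⟨j, j1, j2, j3, j4, j5, -⟩ := R.exists_reduced_form hr hc
  obtain ⟨j', j1', j2', j3', j4', j5', -⟩ := R'.exists_reduced_form hr' hc'
  refine WebDiagram.isomorphic_of_equiv H H' (j.symm.trans j') ?_ ?_ ?_ ?_ ?_
  · intro y; obtain ⟨w, rfl⟩ := j.surjective y
    rw [← j1]; simp [j1']
  · intro y; obtain ⟨w, rfl⟩ := j.surjective y
    rw [← j2]; simp [j2']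
  · intro y; obtain ⟨w, rfl⟩ := j.surjective y
    simp [j3, j3']
  · intro y; obtain ⟨w, rfl⟩ := j.surjective y
    simp [j4, j4']
  · intro a b hab
    rw [R'.region_iff hr' hc' H' HC]
    have hκ : ∀ a : Option Γ.Dart, (a.map (j.symm.trans j')).map κ' = a.map κ := by
      rintro (_ | y)
      · rfl
      · obtain ⟨w, rfl⟩ := j.surjective y
        simp [j5, j5']
    rw [hκ, hκ]
    exact R.region _ _ hab

/-- The value of an invariant on a connected diagram depends only on the core. -/
theorem HasRep.value_eq {f : WebDiagram → ℤ} (hf : SatisfiesAll f) (h : C.HasRep Γ)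
    (h' : C.HasRep Γ') (hc : Γ.Connected) (hc' : Γ'.Connected) (H : Γ.IsPlane) (H' : Γ'.IsPlane)
    (HC : C.IsPlane) : f Γ = f Γ' := by
  have key : ∀ Δ : WebDiagram, C.HasRep Δ → Δ.Connected → Δ.IsPlane →
      ∃ Δ', Δ'.IsPlane ∧ Δ'.Reduced ∧ C.HasRep Δ' ∧ Δ'.Connected ∧ f Δ' = f Δ := by
    intro Δ h1 h2 h3
    refine WebDiagram.exists_reduced (fun Δ' => C.HasRep Δ' ∧ Δ'.Connected ∧ f Δ' = f Δ)
      ?_ ?_ Δ h3 ⟨h1, h2, rfl⟩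
    · intro Γ d hd hc HP hm ⟨q1, q2, q3⟩
      exact ⟨q1.smooth hd hc hm, q2.smooth hd hc,
        (WebDiagram.value_smooth hf HP hd hc hm).trans q3⟩
    · intro Γ d hd hd' hne HP ⟨q1, q2, q3⟩
      exact ⟨q1.undefect hd hd' hne, q2, (WebDiagram.value_undefect hf HP hd hd' hne).trans q3⟩
  obtain ⟨Δ, p1, p2, p3, p4, p5⟩ := key Γ h hc H
  obtain ⟨Δ', p1', p2', p3', p4', p5'⟩ := key Γ' h' hc' H'
  rw [← p5, ← p5']
  exact hf.invariant.isomorphic _ _ p1 p1' (p3.isomorphic p3' p2 p2' p4 p4' p1 p1' HC)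

/-- A diagram is connected if its core is and it has no circle components. -/
theorem Rep.connected (R : C.Rep Γ e κ σ) (HC : C.Connected)
    (hcirc : ∀ S : Γ.Dart → Prop, (∀ y, S (Γ.rot y) ↔ S y) → (∀ y, S (Γ.opp y) ↔ S y) →
      (∀ x, ¬ S (e x)) → ∀ y, ¬ S y) : Γ.Connected := by
  classical
  have := Γ.finite
  let := Fintype.ofFinite Γ.Dart
  have := C.finite
  let := Fintype.ofFinite X
  intro S hr ho
  -- `S` contains both or no end of a core edge: the darts of `S` along the edge come in pairs
  have key : ∀ x, S (e (C.opp x)) ↔ S (e x) := by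
    intro x
    let E : X → Prop := fun x' => x' = x ∨ x' = C.opp x
    have hE : ∀ x', E (C.opp x') ↔ E x' := fun x' => by
      have h1 : C.opp x' = x ↔ x' = C.opp x :=
        ⟨fun h => by rw [← h, C.opp_opp], fun h => by rw [h, C.opp_opp]⟩
      simp only [E, h1, C.opp.injective.eq_iff, or_comm]
    let F : Γ.Dart → ZMod 2 := fun y => if S y ∧ E (κ y) then 1 else 0
    have h0 : ∑ y, F y = 0 := sum_eq_zero_of_involution Γ.opp Γ.opp_opp Γ.opp_ne F fun y => by
      simp only [F, ho, R.sub.label_opp, hE]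
    rw [R.sub.sum_eq F fun y hy => by simp only [F, hr, (R.sub.bivalent y hy).2, hE]] at h0
    have h1 : ∑ x', F (e x') = F (e x) + F (e (C.opp x)) := by
      rw [← Finset.sum_pair (f := fun x' => F (e x')) (C.opp_ne x).symm]
      symm
      refine Finset.sum_subset (Finset.subset_univ _) fun x' _ hx' => ?_
      simp only [Finset.mem_insert, Finset.mem_singleton] at hx'
      exact if_neg fun h => hx' (by simpa only [R.sub.label] using h.2)
    rw [h1, zmod_two_add_eq_zero] at h0
    have hEx : E x := Or.inl rfl
    simp only [F, R.sub.label, hE, hEx, and_true] at h0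
    by_cases h2 : S (e x) <;> by_cases h3 : S (e (C.opp x)) <;> simp [h2, h3] at h0 ⊢
  rcases HC (fun x => S (e x)) (fun x => by rw [← R.sub.rot_incl, hr]) key with h | h
  · left
    intro y
    by_contra hy
    exact hcirc (fun y => ¬ S y) (fun y => not_congr (hr y)) (fun y => not_congr (ho y))
      (fun x => not_not.2 (h x)) y hy
  · exact Or.inr (hcirc S hr ho h)

end TriWeb

/-! ### The core of a reduced diagram -/

namespace WebDiagram

/-- All bivalent vertices are isolated defects. -/
def Sparse (Γ : WebDiagram) : Prop :=
  ∀ y, IsBivalent Γ.rot y → Γ.defect y = true ∧ IsTrivalent Γ.rot (Γ.opp y)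

variable {Γ : WebDiagram}

open Classical in
/-- The first dart of the core edge that contains the dart `y`. -/
noncomputable def coreLabel (Γ : WebDiagram) (y : Γ.Dart) : Γ.Dart :=
  if IsTrivalent Γ.rot y then y else Γ.opp (Γ.rot y)

open Classical in
/-- On a core edge with a defect exactly one of the two ends is flagged: the smaller one in an
arbitrary ordering of the darts. -/
noncomputable def coreHalf (Γ : WebDiagram) (x : Γ.Dart) : Bool :=
  !decide (IsTrivalent Γ.rot (Γ.opp x)) && decide (WellOrderingRel x (Γ.coreLabel (Γ.opp x)))

theorem coreLabel_of_isTrivalent {y : Γ.Dart} (h : IsTrivalent Γ.rot y) : Γ.coreLabel y = y :=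
  if_pos h

theorem coreLabel_of_isBivalent {y : Γ.Dart} (h : IsBivalent Γ.rot y) :
    Γ.coreLabel y = Γ.opp (Γ.rot y) :=
  if_neg fun h' => h'.not_isBivalent h

theorem Sparse.isTrivalent_coreLabel (hs : Γ.Sparse) (y : Γ.Dart) :
    IsTrivalent Γ.rot (Γ.coreLabel y) := by
  by_cases h : IsTrivalent Γ.rot y
  · rwa [coreLabel_of_isTrivalent h]
  · rw [not_isTrivalent_iff] at h
    rw [coreLabel_of_isBivalent h]
    exact (hs _ h.rot).2

theorem Sparse.coreLabel_opp (hs : Γ.Sparse) (y : Γ.Dart) :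
    Γ.coreLabel (Γ.opp y) = Γ.coreLabel (Γ.opp (Γ.coreLabel y)) := by
  by_cases h : IsTrivalent Γ.rot y
  · rw [coreLabel_of_isTrivalent h]
  · rw [not_isTrivalent_iff] at h
    rw [coreLabel_of_isBivalent h, Γ.opp_opp, coreLabel_of_isTrivalent (hs _ h).2,
      coreLabel_of_isBivalent h.rot, h.2]

theorem Sparse.coreOpp_coreOpp (hs : Γ.Sparse) {x : Γ.Dart} (hx : IsTrivalent Γ.rot x) :
    Γ.coreLabel (Γ.opp (Γ.coreLabel (Γ.opp x))) = x := by
  rw [← hs.coreLabel_opp, Γ.opp_opp, coreLabel_of_isTrivalent hx]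

theorem Sparse.thick_coreLabel (y : Γ.Dart) : Γ.thick (Γ.coreLabel y) = Γ.thick y := by
  by_cases h : IsTrivalent Γ.rot y
  · rw [coreLabel_of_isTrivalent h]
  · rw [not_isTrivalent_iff] at h
    rw [coreLabel_of_isBivalent h, Γ.thick_opp, thick_rot_of_bivalent h]

/-- The trivalent graph obtained by suppressing the defects, which are recorded by flags on the ends
of edges. -/
noncomputable def core (Γ : WebDiagram) (hs : Γ.Sparse) : TriWeb {x // IsTrivalent Γ.rot x} where
  finite := by have := Γ.finite; infer_instance
  rot := Γ.rot.subtypePerm fun x => by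
    refine ⟨fun h => ?_, fun h => h.rot⟩
    have h2 := h.rot.rot
    rw [IsTrivalent, Γ.rot.injective.ne_iff, Γ.rot.injective.ne_iff, Γ.rot.injective.ne_iff,
      Γ.rot.injective.eq_iff, Γ.rot.injective.eq_iff, Γ.rot.injective.eq_iff] at h2
    exact h2
  opp := Function.Involutive.toPerm
    (fun x => ⟨Γ.coreLabel (Γ.opp x.1), hs.isTrivalent_coreLabel _⟩)
    fun x => Subtype.ext (hs.coreOpp_coreOpp x.2)
  region := Γ.region.comap (Option.map Subtype.val)
  thick x := Γ.thick x.1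
  half x := Γ.coreHalf x.1
  opp_opp x := Subtype.ext (hs.coreOpp_coreOpp x.2)
  opp_ne x h := by
    have h' : Γ.coreLabel (Γ.opp x.1) = x.1 := congrArg Subtype.val h
    by_cases h1 : IsTrivalent Γ.rot (Γ.opp x.1)
    · rw [coreLabel_of_isTrivalent h1] at h'
      exact Γ.opp_ne _ h'
    · rw [not_isTrivalent_iff] at h1
      rw [coreLabel_of_isBivalent h1] at h'
      apply h1.1
      rw [← Γ.opp.injective.eq_iff, h', Γ.opp_opp]
  thick_opp x := (Sparse.thick_coreLabel _).trans (Γ.thick_opp _)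
  thick_of_half x h := by
    simp only [coreHalf, Bool.and_eq_true, Bool.not_eq_true', decide_eq_false_iff_not] at h
    have h1 := (hs _ ((Γ.not_isTrivalent_iff _).1 h.1)).1
    exact (Γ.thick_opp _).symm.trans (thick_of_defect h1)
  trivalent x := by
    exact ⟨fun h => x.2.1 (congrArg Subtype.val h), Subtype.ext x.2.2⟩
  vertex x := by
    have h := Γ.vertex x.1
    rcases h with h | h
    · exact absurd h.1 x.2.not_isBivalent
    · right
      exact ⟨⟨fun h' => x.2.1 (congrArg Subtype.val h'), Subtype.ext x.2.2⟩, rfl, h.2.2⟩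

theorem core_subdivides (hs : Γ.Sparse) :
    Subdivides (Γ.core hs).rot (Γ.core hs).opp Γ.rot Γ.opp
      (fun x : {x // IsTrivalent Γ.rot x} => x.1)
      (fun y => ⟨Γ.coreLabel y, hs.isTrivalent_coreLabel y⟩) where
  label x := Subtype.ext (coreLabel_of_isTrivalent x.2)
  rot_incl _ := rfl
  label_opp y := Subtype.ext (hs.coreLabel_opp y)
  bivalent y hy := by
    have h : IsBivalent Γ.rot y := by
      rw [← not_isTrivalent_iff]
      exact fun h => hy (coreLabel_of_isTrivalent h)
    refine ⟨h, Subtype.ext ?_⟩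
    change Γ.coreLabel (Γ.rot y) = Γ.coreLabel (Γ.opp (Γ.coreLabel y))
    rw [← hs.coreLabel_opp, coreLabel_of_isTrivalent (hs y h).2, coreLabel_of_isBivalent h.rot, h.2]

theorem IsPlane.region_coreLabel (H : Γ.IsPlane) (y : Γ.Dart) :
    Γ.region (some y) (some (Γ.coreLabel y)) := by
  by_cases h : IsTrivalent Γ.rot y
  · rw [coreLabel_of_isTrivalent h]
  · rw [not_isTrivalent_iff] at h
    rw [coreLabel_of_isBivalent h]
    exact Γ.region.symm (H.region_of_opp_eq_rot (Γ.opp_opp _))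

theorem core_region_iff (hs : Γ.Sparse) (H : Γ.IsPlane) (a b : Option Γ.Dart) : Γ.region a b ↔
    (Γ.core hs).region (a.map fun y => ⟨Γ.coreLabel y, hs.isTrivalent_coreLabel y⟩)
      (b.map fun y => ⟨Γ.coreLabel y, hs.isTrivalent_coreLabel y⟩) := by
  have := Γ.region_map_iff (e := id) (ρ := Γ.coreLabel) H.region_coreLabel a b
  rw [Option.map_id, id, id] at this
  refine this.trans ?_
  rcases a with _ | a <;> rcases b with _ | b <;> exact Iff.rfl

theorem core_isPlane (hs : Γ.Sparse) (H : Γ.IsPlane) : (Γ.core hs).IsPlane := by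
  have := Γ.finite
  let := Fintype.ofFinite Γ.Dart
  have := (Γ.core hs).finite
  let := Fintype.ofFinite {x // IsTrivalent Γ.rot x}
  rw [TriWeb.isPlane_iff]
  exact (core_subdivides hs).isPlaneHom_of_subdivision (X := {x // IsTrivalent Γ.rot x})
    (core_region_iff hs H) (Γ.isPlane_iff.1 H)

theorem core_connected (hs : Γ.Sparse) (H : Γ.Connected) : (Γ.core hs).Connected := by
  intro S hr ho
  have hS := core_subdivides hs
  have key : ∀ y, S ⟨Γ.coreLabel (Γ.rot y), hs.isTrivalent_coreLabel _⟩ ↔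
      S ⟨Γ.coreLabel y, hs.isTrivalent_coreLabel _⟩ := fun y => by
    by_cases hy : Γ.coreLabel y = y
    · have h := hr ⟨Γ.coreLabel y, hs.isTrivalent_coreLabel _⟩
      have h1 : (Γ.core hs).rot ⟨Γ.coreLabel y, hs.isTrivalent_coreLabel _⟩ =
          (⟨Γ.coreLabel (Γ.rot y), hs.isTrivalent_coreLabel _⟩ : {x // IsTrivalent Γ.rot x}) := by
        refine Subtype.ext ?_
        change Γ.rot (Γ.coreLabel y) = _
        have h2 : IsTrivalent Γ.rot y := hy ▸ hs.isTrivalent_coreLabel y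
        exact (congrArg Γ.rot hy).trans (coreLabel_of_isTrivalent h2.rot).symm
      rwa [h1] at h
    · exact (hS.bivalent y hy).2 ▸ ho ⟨Γ.coreLabel y, hs.isTrivalent_coreLabel _⟩
  rcases H (fun y => S ⟨Γ.coreLabel y, hs.isTrivalent_coreLabel y⟩) key
    (fun y => by
      have := hS.label_opp y
      exact this ▸ ho ⟨Γ.coreLabel y, hs.isTrivalent_coreLabel y⟩) with h | h
  · exact Or.inl fun x => hS.label x ▸ h x.1
  · exact Or.inr fun x => hS.label x ▸ h x.1

theorem core_hasRep (hs : Γ.Sparse) (H : Γ.IsPlane) : (Γ.core hs).HasRep Γ := by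
  classical
  let σ : Γ.Dart → Bool := fun y => if IsTrivalent Γ.rot y then Γ.coreHalf y else
    Γ.coreHalf (Γ.opp y)
  have hσ : ∀ {y}, IsTrivalent Γ.rot y → σ y = Γ.coreHalf y := fun h => if_pos h
  have hσ' : ∀ {y}, IsBivalent Γ.rot y → σ y = Γ.coreHalf (Γ.opp y) :=
    fun h => if_neg fun h' => h'.not_isBivalent h
  have hh : ∀ {y}, IsTrivalent Γ.rot (Γ.opp y) → Γ.coreHalf y = false := fun h => by
    simp [coreHalf, h]
  refine ⟨fun x => x.1, fun y => ⟨Γ.coreLabel y, hs.isTrivalent_coreLabel y⟩, σ,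
    core_subdivides hs, fun y => (Sparse.thick_coreLabel y).symm, fun x => hσ x.2, ?_, ?_,
    fun a b => (core_region_iff hs H a b).1⟩
  · intro y
    by_cases h : IsTrivalent Γ.rot y
    · by_cases h' : IsTrivalent Γ.rot (Γ.opp y)
      · rw [hσ h, hσ h', hh h', hh (by rwa [Γ.opp_opp])]
      · rw [not_isTrivalent_iff] at h'
        rw [hσ h, hσ' h', Γ.opp_opp]
    · rw [not_isTrivalent_iff] at h
      rw [hσ' h, hσ (hs y h).2]
  · intro y hy
    have h : IsBivalent Γ.rot y := by
      rw [← not_isTrivalent_iff]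
      exact fun h => hy (coreLabel_of_isTrivalent h)
    rw [hσ' h, hσ' h.rot, (hs y h).1]
    have n1 : ¬ IsTrivalent Γ.rot y := fun h' => h'.not_isBivalent h
    have n2 : ¬ IsTrivalent Γ.rot (Γ.rot y) := fun h' => h'.not_isBivalent h.rot
    simp only [coreHalf, Γ.opp_opp, n1, n2, coreLabel_of_isBivalent h,
      coreLabel_of_isBivalent h.rot, h.2, decide_false, Bool.not_false, Bool.true_and]
    have hne : Γ.opp y ≠ Γ.opp (Γ.rot y) := fun h' => h.1 (Γ.opp.injective h').symm
    -- exactly one of the two ends is flagged, so that the flag changes at the defect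
    rcases trichotomous_of WellOrderingRel (Γ.opp y) (Γ.opp (Γ.rot y)) with h1 | h1 | h1
    · simp [h1, asymm_of WellOrderingRel h1]
    · exact absurd h1 hne
    · simp [h1, asymm_of WellOrderingRel h1]

/-- Every connected reduced plane diagram with a trivalent vertex has a core. -/
theorem exists_core (hr : Γ.Reduced) (hc : Γ.Connected) (H : Γ.IsPlane) {t : Γ.Dart}
    (ht : IsTrivalent Γ.rot t) : ∃ (X : Type) (C : TriWeb X), C.IsPlane ∧ C.Connected ∧ C.HasRep Γ := by
  have hs : Γ.Sparse := fun y hy => hr.of_isTrivalent hc ht hy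
  exact ⟨_, Γ.core hs, core_isPlane hs H, core_connected hs hc, core_hasRep hs H⟩

end WebDiagram

/-! ### Circles -/

namespace WebDiagram

variable {Γ : WebDiagram} {f g : WebDiagram → ℤ}

/-- The regions on the two sides of a circle with one vertex are different, and one of them
is the outer region. -/
theorem IsPlane.circle_regions (H : Γ.IsPlane) {d : Γ.Dart} (hd : IsBivalent Γ.rot d)
    (hopp : ∀ x, Γ.opp x = Γ.rot x) (hall : ∀ x, x = d ∨ x = Γ.rot d) :
    ¬ Γ.region (some d) (some (Γ.rot d)) ∧
      (Γ.region none (some d) ∨ Γ.region none (some (Γ.rot d))) := by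
  classical
  have := Γ.finite
  let := Fintype.ofFinite Γ.Dart
  have H' := Γ.isPlane_iff.1 H
  constructor
  -- the circle itself is a cycle, hence it separates its two sides
  · intro h
    obtain ⟨φ, h1, h2⟩ := H'.boundary (fun _ => 1) ⟨fun _ => rfl, fun u hu => by
      have : ∑ x, u x = 0 := sum_eq_zero_of_involution Γ.rot (fun x => by
        rcases hall x with rfl | rfl
        exacts [hd.2, hd.rot.2]) (fun x => by
        rcases hall x with rfl | rfl
        exacts [hd.1, hd.rot.1]) u hu
      simpa using this⟩
    have h3 := h2 d
    rw [hopp, h1 _ _ h, zmod_two_add_self] at h3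
    exact one_ne_zero h3
  · by_contra h
    rw [not_or] at h
    have hn : ∀ x, ¬ Γ.region none (some x) := fun x => by
      rcases hall x with rfl | rfl
      exacts [h.1, h.2]
    let ψ : Option Γ.Dart → ZMod 2 := fun a => if Γ.region none a then 1 else 0
    have h1 := H'.linked ψ (fun a b hab => by
        have : Γ.region none a ↔ Γ.region none b :=
          ⟨fun h => Γ.region.trans h hab, fun h => Γ.region.trans h (Γ.region.symm hab)⟩
        simp only [ψ, this]) (fun x => by simp only [ψ, hn]) (fun x => by simp only [ψ, hn])
      (some d)
    simp [ψ, hn, Γ.region.refl none] at h1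

/-- A circle with one vertex is a standard circle, if `d` is the dart on the outer side. -/
theorem IsPlane.isomorphic_circle_aux (H : Γ.IsPlane) {d : Γ.Dart} (hd : IsBivalent Γ.rot d)
    (hopp : ∀ x, Γ.opp x = Γ.rot x) (hall : ∀ x, x = d ∨ x = Γ.rot d)
    (h0 : Γ.region none (some d)) :
    (circle (Γ.thick d) (Γ.defect d) thick_of_defect).Isomorphic Γ := by
  have h1 := (H.circle_regions hd hopp hall).1
  let j : Bool → Γ.Dart := fun b => if b then d else Γ.rot d
  have hj : Function.Bijective j := by
    constructor
    · rintro (_ | _) (_ | _) h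
      · rfl
      · exact absurd h hd.1
      · exact absurd h.symm hd.1
      · rfl
    · intro x
      rcases hall x with rfl | rfl
      exacts [⟨true, rfl⟩, ⟨false, rfl⟩]
  have hrot : ∀ b, j (!b) = Γ.rot (j b) := by
    rintro (_ | _)
    exacts [hd.2.symm, rfl]
  refine ⟨Equiv.ofBijective j hj, hrot, fun b => (hrot b).trans (hopp _).symm, ?_, ?_, ?_⟩
  · rintro (_ | _)
    exacts [thick_rot_of_bivalent hd, rfl]
  · rintro (_ | _)
    exacts [defect_rot_of_bivalent hd, rfl]
  · have h2 : ¬ Γ.region none (some (Γ.rot d)) := fun h =>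
      h1 (Γ.region.trans (Γ.region.symm h0) h)
    have key : ∀ a b : Option Bool, Γ.region (a.map j) (b.map j) ↔ a.getD true = b.getD true := by
      rintro (_ | _ | _) (_ | _ | _)
      · exact iff_of_true (Γ.region.refl _) rfl
      · exact iff_of_false h2 (by decide)
      · exact iff_of_true h0 rfl
      · exact iff_of_false (fun h => h2 (Γ.region.symm h)) (by decide)
      · exact iff_of_true (Γ.region.refl _) rfl
      · exact iff_of_false (fun h => h1 (Γ.region.symm h)) (by decide)
      · exact iff_of_true (Γ.region.symm h0) rfl
      · exact iff_of_false h1 (by decide)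
      · exact iff_of_true (Γ.region.refl _) rfl
    exact key

/-- A circle with one vertex is one of the three standard circles. -/
theorem IsPlane.isomorphic_circle (H : Γ.IsPlane) {d : Γ.Dart} (hd : IsBivalent Γ.rot d)
    (hopp : ∀ x, Γ.opp x = Γ.rot x) (hall : ∀ x, x = d ∨ x = Γ.rot d) :
    ∃ th df h, (circle th df h).Isomorphic Γ := by
  rcases (H.circle_regions hd hopp hall).2 with h | h
  · exact ⟨_, _, _, H.isomorphic_circle_aux hd hopp hall h⟩
  · refine ⟨_, _, _, H.isomorphic_circle_aux hd.rot hopp (fun x => ?_) h⟩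
    rw [hd.2, or_comm]
    exact hall x

/-- The value of a connected web without trivalent vertices is determined by the relations. -/
theorem value_eq_of_bivalent (hf : SatisfiesAll f) (hg : SatisfiesAll g) (H : Γ.IsPlane)
    (hc : Γ.Connected) (hb : ∀ d, IsBivalent Γ.rot d) : f Γ = g Γ := by
  obtain ⟨Γ', H', hr, hc', hb', h1, h2⟩ := exists_reduced
    (fun Γ' => Γ'.Connected ∧ (∀ d, IsBivalent Γ'.rot d) ∧ f Γ' = f Γ ∧ g Γ' = g Γ)
    (fun Γ d hd hc H hm ⟨q1, q2, q3, q4⟩ => ⟨q1.smooth hd hc, fun x =>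
        ⟨fun h => (q2 (smoothIncl hd hc x)).1 (congrArg Subtype.val h),
          Subtype.ext (q2 (smoothIncl hd hc x)).2⟩,
        (value_smooth hf H hd hc hm).trans q3, (value_smooth hg H hd hc hm).trans q4⟩)
    (fun Γ d hd hd' hne H ⟨q1, q2, q3, q4⟩ => ⟨q1, q2,
        (value_undefect hf H hd hd' hne).trans q3, (value_undefect hg H hd hd' hne).trans q4⟩)
    Γ H ⟨hc, hb, rfl, rfl⟩
  rw [← h1, ← h2]
  -- all components of a reduced diagram without trivalent vertices are circles with one vertex
  have hopp : ∀ x, Γ'.opp x = Γ'.rot x := fun x => by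
    rcases hr x (hb' x) with h | h
    · exact h
    · exact absurd (hb' _) h.2.not_isBivalent
  by_cases he : Nonempty Γ'.Dart
  · obtain ⟨d⟩ := he
    have hrot : ∀ x, (Γ'.rot x = d ∨ Γ'.rot x = Γ'.rot d) ↔ (x = d ∨ x = Γ'.rot d) := fun x => by
      rw [Γ'.rot.injective.eq_iff, or_comm]
      refine or_congr_right ⟨fun h => ?_, fun h => by rw [h, (hb' d).2]⟩
      exact Γ'.rot.injective (by rw [h, (hb' d).2])
    have hall : ∀ x, x = d ∨ x = Γ'.rot d := by
      rcases hc' (fun x => x = d ∨ x = Γ'.rot d) hrot (fun x => by rw [hopp]; exact hrot x)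
        with h | h
      · exact h
      · exact absurd (Or.inl rfl) (h d)
    obtain ⟨th, df, h, hi⟩ := H'.isomorphic_circle (hb' d) hopp hall
    have hP := hi.symm.isPlane H'
    rw [← hf.invariant.isomorphic _ _ hP H' hi, ← hg.invariant.isomorphic _ _ hP H' hi]
    cases th <;> cases df
    · exact hf.web.circle1.trans hg.web.circle1.symm
    · exact absurd (h rfl) (by decide)
    · exact hf.web.circle2.trans hg.web.circle2.symm
    · exact hf.web.circle2Defect.trans hg.web.circle2Defect.symm
  · rw [not_nonempty_iff] at he
    have hi : Γ'.Isomorphic empty := by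
      refine ⟨Equiv.equivOfIsEmpty (α := Γ'.Dart) (β := Empty), fun d => he.elim d,
        fun d => he.elim d, fun d => he.elim d, fun d => he.elim d, ?_⟩
      rintro (_ | a) (_ | b)
      · exact iff_of_true trivial (Γ'.region.refl _)
      exacts [he.elim b, he.elim a, he.elim a]
    rw [hf.invariant.isomorphic _ _ H' (hi.isPlane H') hi,
      hg.invariant.isomorphic _ _ H' (hi.isPlane H') hi]
    exact hf.web.empty.trans hg.web.empty.symm

end WebDiagram

/-! ### Cutting a small disc out of a trivalent graph -/

namespace TriWeb

/-- Some vertices of a trivalent graph which are to be cut out by a disc.  The dart `pt (v, j)` is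
the `j`-th one at the vertex `v`, and the edges of the darts `pt (leg i)` cross the boundary of the
disc. -/
structure Site {X : Type} (C : TriWeb X) (t : ℕ) {n : ℕ} (bd : Fin n → Bool) where
  pt : Fin t × Fin 3 → X
  injective : Function.Injective pt
  rot_pt : ∀ v j, C.rot (pt (v, j)) = pt (v, j + 1)
  leg : Fin n → Fin t × Fin 3
  leg_injective : Function.Injective leg
  thick_leg : ∀ i, C.thick (pt (leg i)) = bd i
  inner : ∀ q, (∀ i, leg i ≠ q) → ∃ q', C.opp (pt q) = pt q' ∧ ∀ i, leg i ≠ q'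

namespace Site

variable {X : Type} {C : TriWeb X} {t n : ℕ} {bd : Fin n → Bool} (S : C.Site t bd)

/-- The darts at the vertices in the disc. -/
def Inside (x : X) : Prop := ∃ q, S.pt q = x

theorem inside_rot (x : X) : S.Inside (C.rot x) ↔ S.Inside x := by
  have h : ∀ x, S.Inside x → S.Inside (C.rot x) := by
    rintro _ ⟨⟨v, j⟩, rfl⟩
    exact ⟨_, (S.rot_pt v j).symm⟩
  refine ⟨fun hx => ?_, h x⟩
  have := h _ (h _ hx)
  rwa [(C.trivalent x).2] at this

/-- The darts whose edges are not inside the disc. -/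
def incl : {x // ¬ S.Inside x} ⊕ Fin n → X := Sum.elim Subtype.val fun i => S.pt (S.leg i)

theorem incl_injective : Function.Injective S.incl := by
  rintro (x | i) (y | j) h
  · exact congrArg Sum.inl (Subtype.ext h)
  · exact absurd ⟨_, Eq.symm h⟩ x.2
  · exact absurd ⟨_, h⟩ y.2
  · exact congrArg Sum.inr (S.leg_injective (S.injective h))

theorem exists_incl_or (x : X) :
    (∃ w, S.incl w = x) ∨ ∃ q, S.pt q = x ∧ ∀ i, S.leg i ≠ q := by
  by_cases h : S.Inside x
  · obtain ⟨q, rfl⟩ := h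
    by_cases h' : ∃ i, S.leg i = q
    · obtain ⟨i, rfl⟩ := h'
      exact Or.inl ⟨.inr i, rfl⟩
    · exact Or.inr ⟨q, rfl, fun i hi => h' ⟨i, hi⟩⟩
  · exact Or.inl ⟨.inl ⟨x, h⟩, rfl⟩

theorem incl_ne {q : Fin t × Fin 3} (hq : ∀ i, S.leg i ≠ q) (w) : S.incl w ≠ S.pt q := by
  rcases w with x | i
  · exact fun h => x.2 ⟨q, h.symm⟩
  · exact fun h => hq i (S.injective h)

theorem exists_incl_opp (w) : ∃ w', S.incl w' = C.opp (S.incl w) := by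
  rcases S.exists_incl_or (C.opp (S.incl w)) with h | ⟨q, h, hq⟩
  · exact h
  · obtain ⟨q', h', hq'⟩ := S.inner q hq
    rw [h, C.opp_opp] at h'
    exact absurd h' (S.incl_ne hq' w)

/-- The edge involution on the darts whose edges are not inside the disc. -/
noncomputable def outOppFun (w : {x // ¬ S.Inside x} ⊕ Fin n) : {x // ¬ S.Inside x} ⊕ Fin n :=
  (S.exists_incl_opp w).choose

theorem incl_outOppFun (w) : S.incl (S.outOppFun w) = C.opp (S.incl w) :=
  (S.exists_incl_opp w).choose_spec

theorem outOppFun_involutive : Function.Involutive S.outOppFun := fun w =>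
  S.incl_injective (by rw [S.incl_outOppFun, S.incl_outOppFun, C.opp_opp])

/-- The edge involution outside the disc, as a permutation. -/
noncomputable def outOpp : Perm ({x // ¬ S.Inside x} ⊕ Fin n) := S.outOppFun_involutive.toPerm

theorem incl_outOpp (w) : S.incl (S.outOpp w) = C.opp (S.incl w) := S.incl_outOppFun w

theorem outOpp_outOpp (w) : S.outOpp (S.outOpp w) = w := S.outOppFun_involutive w

theorem outOpp_ne (w) : S.outOpp w ≠ w := fun h =>
  C.opp_ne (S.incl w) (by rw [← S.incl_outOpp, h])

/-- The rotation at the vertices outside the disc. -/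
def outRot : Perm {x // ¬ S.Inside x} := C.rot.subtypePerm fun x => not_congr (S.inside_rot x)

/-- Edge ends of the outer tangle: every edge outside the disc carries a bivalent vertex, whose two
darts are named by the ends of the edge.  It is a defect or a marked point, so that no choice is
needed of where to put a defect. -/
abbrev OutEnd : Type := ({x // ¬ S.Inside x} ⊕ ({x // ¬ S.Inside x} ⊕ Fin n)) ⊕ Fin n

/-- The edge involution of the outer tangle: every end outside the disc is joined to the bivalent
vertex on its edge. -/
def outerOppFun : S.OutEnd → S.OutEnd
  | .inl (.inl x) => .inl (.inr (.inl x))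
  | .inl (.inr (.inl x)) => .inl (.inl x)
  | .inl (.inr (.inr i)) => .inr i
  | .inr i => .inl (.inr (.inr i))

theorem outerOppFun_involutive : Function.Involutive S.outerOppFun := by
  rintro ((x | x | i) | i) <;> rfl

/-- The dart with the same edge and direction as a given end of the outer tangle. -/
noncomputable def name : S.OutEnd → {x // ¬ S.Inside x} ⊕ Fin n
  | .inl (.inl x) => .inl x
  | .inl (.inr w) => S.outOpp w
  | .inr i => .inr i

theorem name_outerOppFun (y : S.OutEnd) : S.name (S.outerOppFun y) = S.outOpp (S.name y) := by
  rcases y with (x | x | i) | i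
  · rfl
  · exact (S.outOpp_outOpp _).symm
  · exact (S.outOpp_outOpp _).symm
  · rfl

theorem incl_name_outerOppFun (y : S.OutEnd) :
    S.incl (S.name (S.outerOppFun y)) = C.opp (S.incl (S.name y)) := by
  rw [S.name_outerOppFun, S.incl_outOpp]

/-- The part outside the disc.  The bivalent vertex on the edge of `x` is a defect if `flag` takes
different values at both ends of the edge. -/
noncomputable def outer (flag : X → Bool) (hflag : ∀ x, flag x = true → C.thick x = true) :
    OuterTangle bd where
  Dart := {x // ¬ S.Inside x} ⊕ ({x // ¬ S.Inside x} ⊕ Fin n)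
  finite := by have := C.finite; infer_instance
  rot := Equiv.sumCongr S.outRot S.outOpp
  opp := S.outerOppFun_involutive.toPerm
  thick y := C.thick (S.incl (S.name y))
  defect := Sum.elim (fun _ => false) fun w => xor (flag (S.incl w)) (flag (C.opp (S.incl w)))
  opp_opp := S.outerOppFun_involutive
  opp_ne := by rintro ((x | x | i) | i) h <;> cases h
  thick_opp y := by
    change C.thick (S.incl (S.name (S.outerOppFun y))) = _
    rw [S.incl_name_outerOppFun, C.thick_opp]
  thick_bd i := S.thick_leg i
  vertex := by
    rintro (x | w)
    · have h : IsWebVertex S.outRot (fun x => C.thick x.1) (fun _ => false) x := by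
        simpa [IsWebVertex, IsBivalent, IsTrivalent, Subtype.ext_iff, outRot] using C.vertex x.1
      simpa [IsWebVertex, IsBivalent, IsTrivalent, name, incl] using h
    · left
      have h1 := S.outOpp_ne w
      have h2 : ∀ w', C.thick (S.incl (S.outOpp w')) = C.thick (S.incl w') := fun w' => by
        rw [S.incl_outOpp, C.thick_opp]
      have h3 := hflag (S.incl w)
      have h4 := hflag (C.opp (S.incl w))
      rw [C.thick_opp] at h4
      refine ⟨⟨fun h => h1 (Sum.inr_injective h), congrArg Sum.inr (S.outOpp_outOpp w)⟩, ?_, ?_, ?_⟩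
      · simp [S.incl_outOpp, C.opp_opp, Bool.xor_comm]
      · exact h2 _
      · simp only [Sum.elim_inr]
        change _ → C.thick (S.incl (S.outOpp w)) = true
        rw [h2]
        cases h5 : flag (S.incl w) <;> cases h6 : flag (C.opp (S.incl w)) <;> simp_all
  region := C.region.comap (Option.map fun y => S.incl (S.name y))

/-- The vertices to be cut out, with the edges between them, form a connected graph which can be
enclosed by a disc that the legs leave in counterclockwise order. -/
structure IsDisc : Prop where
  leg : ∀ i, C.region (some (S.pt (S.leg i))) (some (C.opp (S.pt (S.leg (finRotate n i)))))
  inner : ∀ q, (∀ i, S.leg i ≠ q) → (∃ i, C.region (some (S.pt q)) (some (S.pt (S.leg i)))) ∨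
    ∀ a, C.region (some (S.pt q)) a → ∃ q', a = some (S.pt q') ∧ ∀ i, S.leg i ≠ q'
  flow : ∀ b : Fin n → ZMod 2, ∑ i, b i = 0 → ∃ u : Fin t × Fin 3 → ZMod 2,
    (∀ i, u (S.leg i) = b i) ∧
    (∀ q q', (∀ i, S.leg i ≠ q) → C.opp (S.pt q) = S.pt q' → u q' = u q) ∧
    ∀ v, u (v, 0) + u (v, 1) + u (v, 2) = 0

/-- The complement of a disc in a plane trivalent graph is plane: the disc is first contracted to a
vertex, and then the edges are subdivided. -/
theorem outer_isPlane [NeZero n] {S : C.Site t bd} (D : S.IsDisc) (H : C.IsPlane) (flag : X → Bool)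
    (hflag : ∀ x, flag x = true → C.thick x = true) : (S.outer flag hflag).IsPlane := by
  classical
  have := C.finite
  let := Fintype.ofFinite X
  have H1 : IsPlaneHom (Equiv.sumCongr S.outRot (finRotate n)) S.outOpp
      (C.region.comap (Option.map S.incl)) := by
    refine IsPlaneHom.contract (Y := {x // ¬ S.Inside x}) ((C.isPlane_iff).1 H) C.opp_opp
      S.incl_injective
      (rot' := S.outRot) (opp' := S.outOpp) (region' := C.region.comap (Option.map S.incl))
      (fun y => rfl) (fun w => (S.incl_outOpp w).symm) (fun a b => Iff.rfl) D.leg ?_ ?_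
    · intro x hx
      obtain ⟨w, hw⟩ | ⟨q, rfl, hq⟩ := S.exists_incl_or x
      · exact absurd hw (hx w)
      · refine (D.inner q hq).imp_right fun h a ha => ?_
        obtain ⟨q', h1, h2⟩ := h _ ha
        rcases a with _ | a
        · exact absurd h1 (by simp)
        · exact S.incl_ne h2 a (Option.some_injective _ h1)
    · intro b hb
      obtain ⟨u, h1, h2, h3⟩ := D.flow b hb
      have hu : ∀ q, Function.extend S.pt u 0 (S.pt q) = u q := fun q =>
        S.injective.extend_apply _ _ _
      refine ⟨Function.extend S.pt u 0, fun i => (hu _).trans (h1 i), ?_, ?_⟩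
      · intro x hx
        obtain ⟨w, hw⟩ | ⟨q, rfl, hq⟩ := S.exists_incl_or x
        · exact absurd hw (hx w)
        · obtain ⟨q', h4, h5⟩ := S.inner q hq
          rw [h4, hu, hu]
          exact h2 q q' hq h4
      · intro h hr h0
        have e : ∑ q, h (S.pt q) * u q = ∑ x, h x * Function.extend S.pt u 0 x := by
          refine Fintype.sum_of_injective S.pt S.injective _ _ ?_ fun q => by rw [hu]
          intro x hx
          rw [Function.extend_apply' _ _ _ fun ⟨q, hq⟩ => hx ⟨q, hq⟩]
          simp
        rw [← e, Fintype.sum_prod_type]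
        refine Finset.sum_eq_zero fun v _ => ?_
        have e1 : h (S.pt (v, 1)) = h (S.pt (v, 0)) := by rw [← hr (S.pt (v, 0)), S.rot_pt]; rfl
        have e2 : h (S.pt (v, 2)) = h (S.pt (v, 1)) := by rw [← hr (S.pt (v, 1)), S.rot_pt]; rfl
        rw [Fin.sum_univ_three, e2, e1, ← mul_add, ← mul_add, h3, mul_zero]
  -- each remaining edge is subdivided by one bivalent vertex
  let e : {x // ¬ S.Inside x} ⊕ Fin n → S.OutEnd := Sum.elim (fun x => .inl (.inl x)) .inr
  have hname : ∀ w, S.name (e w) = w := by rintro (x | i) <;> rfl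
  have hSub : Subdivides (Equiv.sumCongr S.outRot (finRotate n)) S.outOpp
      (Equiv.sumCongr (Equiv.sumCongr S.outRot S.outOpp) (finRotate n))
      S.outerOppFun_involutive.toPerm e S.name := by
    refine ⟨hname, ?_, S.name_outerOppFun, ?_⟩
    · rintro (x | i) <;> rfl
    · rintro ((x | w) | i) h
      · exact absurd rfl h
      · exact ⟨⟨fun h => S.outOpp_ne w (Sum.inr_injective (Sum.inl_injective h)),
          congrArg (fun w => Sum.inl (Sum.inr w)) (S.outOpp_outOpp w)⟩, rfl⟩
      · exact absurd rfl h
  have H2 := hSub.isPlaneHom_subdivision (region' := (S.outer flag hflag).region) S.outOpp_outOpp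
    (fun a b => by
      change C.region _ _ ↔ C.region _ _
      simp only [Option.map_map]; rfl) (fun z hz hz' => ?_) H1
  · exact (isPlaneMap_iff_isPlaneHom (X := S.OutEnd) _ _ _ (S.outer flag hflag).opp_opp
      (S.outer flag hflag).opp_ne).2 H2
  · have h1 : ∀ w, z (.inl (.inr w)) = z (e w) := by
      rintro (x | i)
      · exact hz (.inl (.inl x))
      · exact hz (.inr i)
    rintro ((x | w) | i)
    · rfl
    · have h2 := hz' (.inl (.inr w)) (by
        intro h
        rcases h3 : S.outOpp w with x | i
        · simp [name, e, h3] at h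
        · simp [name, e, h3] at h)
      exact (h1 _).symm.trans h2
    · rfl

end Site

end TriWeb

/-! ### Filling the hole again -/

/-- The face condition passes to subdivisions. -/
theorem Subdivides.face {X Y : Type} {rot opp : Perm X} {rot' opp' : Perm Y} {e : X → Y} {κ : Y → X}
    (S : Subdivides rot opp rot' opp' e κ) {region : Setoid (Option X)}
    (hopp : ∀ x, opp (opp x) = x)
    (H : ∀ x, region (some x) (some (rot.symm (opp x)))) (y : Y) :
    region (some (κ y)) (some (κ (rot'.symm (opp' y)))) := by
  have hw := S.label_opp y
  generalize opp' y = w at hw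
  by_cases h : e (κ w) = w
  · have : rot'.symm w = e (rot.symm (κ w)) := by
      rw [Equiv.symm_apply_eq, S.rot_incl, rot.apply_symm_apply, h]
    rw [this, S.label, hw]
    exact H _
  · have h2 := S.bivalent _ h
    have : rot'.symm w = rot' w := by rw [Equiv.symm_apply_eq, h2.1.2]
    rw [this, h2.2, hw, hopp]

namespace TriWeb

namespace Site

variable {X : Type} {C C' : TriWeb X} {t n b : ℕ} {bd : Fin n → Bool}

/-- The darts of `C'` to which the ends of a tangle belong; `δ v` is the dart of the `v`-th
defect. -/
def fillLabel (S : C.Site t bd) (C' : TriWeb X) (pt' : Fin t × Fin 3 → X) (δ : Fin b → X) :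
    CodeDart t b ⊕ Fin n → X
  | .inl (.inl q) => pt' q
  | .inl (.inr (v, 0)) => δ v
  | .inl (.inr (v, 1)) => C'.opp (δ v)
  | .inr i => C'.opp (S.pt (S.leg i))

/-- A function on the ends of a tangle that changes at the defects. -/
def fillFlag (S : C.Site t bd) (flag : X → Bool) (C' : TriWeb X) (pt' : Fin t × Fin 3 → X)
    (s : Fin b → Bool) : CodeDart t b ⊕ Fin n → Bool
  | .inl (.inl q) => C'.half (pt' q)
  | .inl (.inr (v, 0)) => s v
  | .inl (.inr (v, 1)) => !(s v)
  | .inr i => flag (S.pt (S.leg i))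

/-- The graph `C'` agrees with `C` outside the disc.  The darts `pt' (v, j)` are those at the `v`-th
vertex of `C'` inside the disc, and `flag` plays the role of `half` outside and on the legs. -/
structure IsExtension (S : C.Site t bd) (flag : X → Bool) (C' : TriWeb X)
    (pt' : Fin t × Fin 3 → X) : Prop where
  opp_eq : ∀ x, C'.opp x = C.opp x
  thick_eq : ∀ x, C'.thick x = C.thick x
  rot_eq : ∀ x, ¬ S.Inside x → C'.rot x = C.rot x
  half_eq : ∀ x, ¬ S.Inside x → C'.half x = flag x
  region : ∀ a b : Option ({x // ¬ S.Inside x} ⊕ Fin n), C.region (a.map S.incl) (b.map S.incl) →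
    C'.region (a.map S.incl) (b.map S.incl)
  leg : ∀ i, C'.region (some (S.pt (S.leg i))) (some (C'.opp (S.pt (S.leg (finRotate n i)))))
  injective : Function.Injective pt'
  rot_pt : ∀ v j, C'.rot (pt' (v, j)) = pt' (v, j + 1)
  inside : ∀ x, S.Inside x ↔ ∃ q, pt' q = x

theorem IsDisc.isExtension {S : C.Site t bd} (D : S.IsDisc) {flag : X → Bool}
    (hflag : ∀ x, ¬ S.Inside x → C.half x = flag x) : S.IsExtension flag C S.pt :=
  ⟨fun _ => rfl, fun _ => rfl, fun _ _ => rfl, hflag, fun _ _ h => h, D.leg, S.injective, S.rot_pt,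
    fun _ => Iff.rfl⟩

/-- Filling the hole with a tangle, whose edges are given by `opp` and `thick`, gives a diagram of
the graph `C'`. -/
structure IsFilling (S : C.Site t bd) (flag : X → Bool) (C' : TriWeb X)
    (pt' : Fin t × Fin 3 → X) (opp : CodeDart t b ⊕ Fin n → CodeDart t b ⊕ Fin n)
    (thick : CodeDart t b ⊕ Fin n → Bool) (δ : Fin b → X) (s : Fin b → Bool) : Prop
    extends S.IsExtension flag C' pt' where
  label_opp : ∀ z, S.fillLabel C' pt' δ (opp z) = C'.opp (S.fillLabel C' pt' δ z)
  flag_opp : ∀ z, S.fillFlag flag C' pt' s (opp z) = S.fillFlag flag C' pt' s z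
  thick : ∀ z, thick z = C.thick (S.fillLabel C' pt' δ z)
  defect : ∀ v : Fin b, ∃ j q, opp (.inl (.inr (v, j))) = .inl (.inl q)
  legs : ∀ i : Fin n, ∃ d, opp (.inr i) = .inl d

/-- The end of the outer tangle with the same edge piece whose value of `flag` is relevant. -/
def mark (S : C.Site t bd) : S.OutEnd → {x // ¬ S.Inside x} ⊕ Fin n
  | .inl (.inl x) => .inl x
  | .inl (.inr w) => w
  | .inr i => .inr i

theorem mark_outerOppFun (S : C.Site t bd) (y : S.OutEnd) : S.mark (S.outerOppFun y) = S.mark y := by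
  rcases y with (x | x | i) | i <;> rfl

variable {tri : Fin t → Fin 3 → ℕ}
    {dfc : Fin b → Fin 2 → ℕ} {leg : Fin n → ℕ} {thickEdges : List ℕ}
    {h : ∀ x, ∃! y, y ≠ x ∧ codeEdge tri dfc leg y = codeEdge tri dfc leg x}
    {hbd : ∀ i, decide (leg i ∈ thickEdges) = bd i}
    {hv : ∀ d, IsWebVertex (codeRot t b)
      (fun d => decide (codeEdge tri dfc leg (Sum.inl d) ∈ thickEdges)) (codeDefect t b) d}

/-- For a tangle given by a code, thickness needs to be compared only at the trivalent vertices: at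
the other ends it follows from the edges. -/
theorem IsExtension.isFilling {S : C.Site t bd} {flag : X → Bool} {pt' : Fin t × Fin 3 → X}
    (E : S.IsExtension flag C' pt') (δ : Fin b → X) (s : Fin b → Bool)
    (ht : ∀ v j, decide (tri v j ∈ thickEdges) = C.thick (pt' (v, j)))
    (hl : ∀ z, S.fillLabel C' pt' δ ((Tangle.ofCode bd tri dfc leg thickEdges h hbd hv).opp z) =
      C'.opp (S.fillLabel C' pt' δ z))
    (hs : ∀ z, S.fillFlag flag C' pt' s ((Tangle.ofCode bd tri dfc leg thickEdges h hbd hv).opp z) =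
      S.fillFlag flag C' pt' s z)
    (hd : ∀ v : Fin b, ∃ j q, (Tangle.ofCode bd tri dfc leg thickEdges h hbd hv).opp
      (.inl (.inr (v, j))) = .inl (.inl q))
    (hlegs : ∀ i : Fin n, ∃ d, (Tangle.ofCode bd tri dfc leg thickEdges h hbd hv).opp (.inr i) =
      .inl d) :
    S.IsFilling flag C' pt' (Tangle.ofCode bd tri dfc leg thickEdges h hbd hv).opp
      (Tangle.ofCode bd tri dfc leg thickEdges h hbd hv).thick δ s := by
  set A := Tangle.ofCode bd tri dfc leg thickEdges h hbd hv with hA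
  have hopp : ∀ x, C.thick (C'.opp x) = C.thick x := fun x => by rw [E.opp_eq, C.thick_opp]
  refine ⟨E, hl, hs, ?_, hd, hlegs⟩
  rintro ((⟨v, j⟩ | ⟨v, j⟩) | i)
  · exact ht v j
  · obtain ⟨j', ⟨w, k⟩, hq⟩ := hd v
    -- both sides are the same at both darts of a defect
    have h1 : ∀ j, A.thick (.inl (.inr (v, j))) = A.thick (.inl (.inr (v, j'))) := by
      have h2 : A.thick (.inl (.inr (v, 1))) = A.thick (.inl (.inr (v, 0))) := by
        rcases hv (.inr (v, 0)) with h2 | h2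
        · exact h2.2.2.1
        · exact absurd h2.2.1 (by simp [codeDefect])
      intro j
      fin_cases j <;> fin_cases j'
      exacts [rfl, h2.symm, h2, rfl]
    have h3 : ∀ j, C.thick (S.fillLabel C' pt' δ (.inl (.inr (v, j)))) =
        C.thick (S.fillLabel C' pt' δ (.inl (.inr (v, j')))) := by
      have h2 : C.thick (S.fillLabel C' pt' δ (.inl (.inr (v, 1)))) =
        C.thick (S.fillLabel C' pt' δ (.inl (.inr (v, 0)))) := hopp _
      intro j
      fin_cases j <;> fin_cases j'
      exacts [rfl, h2.symm, h2, rfl]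
    have h4 := hl (.inl (.inr (v, j')))
    have h5 := A.thick_opp (.inl (.inr (v, j')))
    rw [hq] at h4 h5
    refine (h1 j).trans (h5.symm.trans ((ht w k).trans ?_))
    rw [h3]
    exact (congrArg C.thick h4).trans (hopp _)
  · exact (hbd i).trans ((S.thick_leg i).symm.trans (hopp _).symm)

/-- The diagram obtained by filling the hole is a diagram of `C'`, and it is connected. -/
theorem IsFilling.hasRep {S : C.Site t bd} {flag : X → Bool}
    {hflag : ∀ x, flag x = true → C.thick x = true} {pt' : Fin t × Fin 3 → X} {δ : Fin b → X}
    {s : Fin b → Bool}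
    (F : S.IsFilling flag C' pt' (Tangle.ofCode bd tri dfc leg thickEdges h hbd hv).opp
      (Tangle.ofCode bd tri dfc leg thickEdges h hbd hv).thick δ s) (H' : C'.IsPlane)
    (hc : C'.Connected) :
    C'.HasRep ((S.outer flag hflag).glue (Tangle.ofCode bd tri dfc leg thickEdges h hbd hv)) ∧
    ((S.outer flag hflag).glue (Tangle.ofCode bd tri dfc leg thickEdges h hbd hv)).Connected := by
  classical
  -- `κ` names the core edge of each end, `σ` changes at the defects, and `e` includes the core
  let Y : Type := S.OutEnd ⊕ (CodeDart t b ⊕ Fin n)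
  let A := Tangle.ofCode bd tri dfc leg thickEdges h hbd hv
  let rot : Perm Y := glueRot (S.outer flag hflag) A
  let opp : Perm Y := glueOpp (S.outer flag hflag) A
  let κ : Y → X := Sum.elim (fun y => S.incl (S.name y)) (S.fillLabel C' pt' δ)
  let σ : Y → Bool := Sum.elim (fun y => flag (S.incl (S.mark y))) (S.fillFlag flag C' pt' s)
  let e : X → Y := fun x => if hx : S.Inside x then .inr (.inl (.inl ((F.inside x).1 hx).choose))
    else .inl (.inl (.inl ⟨x, hx⟩))
  have he : ∀ q, e (pt' q) = .inr (.inl (.inl q)) := fun q => by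
    have hx := (F.inside (pt' q)).2 ⟨q, rfl⟩
    simp only [e, dif_pos hx]
    rw [F.injective ((F.inside _).1 hx).choose_spec]
  have he' : ∀ x (hx : ¬ S.Inside x), e x = .inl (.inl (.inl ⟨x, hx⟩)) := fun x hx => dif_neg hx
  have hcase : ∀ x, S.Inside x → ∃ q, pt' q = x := fun x => (F.inside x).1
  -- the new bivalent vertices: those of the outer tangle, the boundary points, the defects inside
  have hbiv : ∀ y, e (κ y) ≠ y → IsBivalent rot y ∧ κ (rot y) = C'.opp (κ y) := by
    rintro (((x | w) | i) | ((q | ⟨v, j⟩) | i)) hy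
    · exact absurd (he' x.1 x.2) hy
    · refine ⟨⟨fun h => S.outOpp_ne w ?_, ?_⟩, ?_⟩
      · exact Sum.inr_injective (Sum.inl_injective (Sum.inl_injective h))
      · exact congrArg (fun w => Sum.inl (Sum.inl (Sum.inr w))) (S.outOpp_outOpp w)
      · exact (S.incl_outOpp _).trans (F.opp_eq _).symm
    · exact ⟨⟨fun h => (by cases h), rfl⟩, rfl⟩
    · exact absurd (he q) hy
    · refine ⟨⟨fun h => ?_, ?_⟩, ?_⟩
      · have h2 : j + 1 = j := congrArg Prod.snd (Sum.inr_injective (Sum.inl_injective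
          (Sum.inr_injective h)))
        revert h2; clear hy h; revert j; decide
      · change (Sum.inr (Sum.inl (Sum.inr (v, j + 1 + 1))) : Y) = _
        have h2 : j + 1 + 1 = j := by clear hy; revert j; decide
        rw [h2]
      · fin_cases j
        · rfl
        · exact (C'.opp_opp _).symm
    · exact ⟨⟨fun h => (by cases h), rfl⟩, (C'.opp_opp _).symm⟩
  have hsub : Subdivides C'.rot C'.opp rot opp e κ := by
    refine ⟨fun x => ?_, fun x => ?_, ?_, hbiv⟩
    · by_cases hx : S.Inside x
      · obtain ⟨q, rfl⟩ := hcase x hx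
        rw [he]; rfl
      · rw [he' x hx]; rfl
    · by_cases hx : S.Inside x
      · obtain ⟨⟨v, j⟩, rfl⟩ := hcase x hx
        rw [F.rot_pt, he, he]; rfl
      · have hx' := mt (S.inside_rot x).1 hx
        rw [F.rot_eq x hx, he' x hx, he' _ hx']; rfl
    · rintro (y | z)
      · exact (S.incl_name_outerOppFun y).trans (F.opp_eq _).symm
      · exact F.label_opp z
  have hacross : ∀ y, C'.region (some (κ y)) (some (κ (rot.symm (opp y)))) :=
    hsub.face C'.opp_opp H'.face
  have houter : ∀ a b : Option S.OutEnd, C.region (a.map fun y => S.incl (S.name y))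
      (b.map fun y => S.incl (S.name y)) →
      C'.region ((a.map Sum.inl).map κ) ((b.map Sum.inl).map κ) := fun a b hab => by
    have h0 : ∀ a : Option S.OutEnd, (a.map S.name).map S.incl =
        a.map fun y => S.incl (S.name y) := fun a => Option.map_map _ _ _
    have h0' : ∀ a : Option S.OutEnd, (a.map Sum.inl).map κ =
        a.map fun y => S.incl (S.name y) := fun a => Option.map_map _ _ _
    have h1 := F.region (a.map S.name) (b.map S.name)
    rw [h0, h0] at h1
    rw [h0', h0']
    exact h1 hab
  have hR : C'.Rep ((S.outer flag hflag).glue A) e κ σ := by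
    refine ⟨hsub, ?_, fun x => ?_, ?_, ?_, ?_⟩
    · rintro (y | z)
      · exact (F.thick_eq _).symm
      · exact (F.thick z).trans (F.thick_eq _).symm
    · by_cases hx : S.Inside x
      · obtain ⟨q, rfl⟩ := hcase x hx
        rw [he]; rfl
      · rw [he' x hx]; exact (F.half_eq x hx).symm
    · rintro (y | z)
      · exact congrArg (fun w => flag (S.incl w)) (S.mark_outerOppFun y)
      · exact F.flag_opp z
    · rintro (((x | w) | i) | ((q | ⟨v, j⟩) | i)) hy
      · exact absurd (he' x.1 x.2) hy
      · change flag (S.incl (S.outOpp w)) = xor (flag (S.incl w)) (xor (flag (S.incl w))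
          (flag (C.opp (S.incl w))))
        rw [S.incl_outOpp, ← Bool.xor_assoc, Bool.xor_self, Bool.false_xor]
      · exact (Bool.xor_false _).symm
      · exact absurd (he q) hy
      · fin_cases j
        · exact (Bool.xor_true _).symm
        · exact ((Bool.xor_true _).trans (Bool.not_not _)).symm
      · exact (Bool.xor_false _).symm
    · intro a b hab
      induction hab with
      | rel a b hab =>
        rcases hab with ⟨a, b, hab⟩ | x | y
        · exact houter a b hab
        · rcases hx : A.opp x with d | i
          · have h1 := hacross (.inr x)
            have h2 : rot.symm (opp (.inr x)) = .inr (.inl (A.rot.symm d)) := by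
              change rot.symm (.inr (A.opp x)) = _
              rw [hx]; rfl
            rw [h2] at h1
            exact h1
          · have h1 : κ (.inr x) = S.pt (S.leg i) := by
              have h3 : x = A.opp (.inr i) := by rw [← hx, A.opp_opp]
              rw [h3]
              exact (F.label_opp (.inr i)).trans (C'.opp_opp _)
            have h2 := F.leg i
            rw [← h1] at h2
            exact h2
        · exact hacross y
      | refl => exact C'.region.refl _
      | symm _ _ _ ih => exact C'.region.symm ih
      | trans _ _ _ _ _ ih1 ih2 => exact C'.region.trans ih1 ih2
  refine ⟨⟨e, κ, σ, hR⟩, hR.connected hc ?_⟩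
  -- every edge leads to a trivalent vertex, so that there are no circles without one
  intro (Z : Y → Prop) hr ho hn
  have hr' : ∀ y, Z (rot y) ↔ Z y := hr
  have ho' : ∀ y, Z (opp y) ↔ Z y := ho
  have h1 : ∀ q, ¬ Z (.inr (.inl (.inl q))) := fun q => by
    have := hn (pt' q)
    rwa [he] at this
  have h2 : ∀ x, ¬ Z (.inl (.inl (.inl x))) := fun x => by
    have := hn x.1
    rwa [he' _ x.2] at this
  have h3 : ∀ v j, ¬ Z (.inr (.inl (.inr (v, j)))) := fun v j => by
    obtain ⟨j', q, hq⟩ := F.defect v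
    have e1 : ¬ Z (.inr (.inl (.inr (v, j')))) := fun hz => by
      have := (ho' (.inr (.inl (.inr (v, j'))))).2 hz
      change Z (.inr (A.opp _)) at this
      rw [hq] at this
      exact h1 q this
    have e2 : Z (.inr (.inl (.inr (v, 1)))) ↔ Z (.inr (.inl (.inr (v, 0)))) :=
      hr' (.inr (.inl (.inr (v, 0))))
    fin_cases j <;> fin_cases j'
    · exact e1
    · exact mt e2.2 e1
    · exact mt e2.1 e1
    · exact e1
  have h4 : ∀ i, ¬ Z (.inr (.inr i)) := fun i hz => by
    obtain ⟨d, hd⟩ := F.legs i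
    have := (ho' (.inr (.inr i))).2 hz
    change Z (.inr (A.opp _)) at this
    rw [hd] at this
    rcases d with q | ⟨v, j⟩
    · exact h1 q this
    · exact h3 v j this
  have h5 : ∀ i, ¬ Z (.inl (.inr i)) := fun i => mt (hr' (.inl (.inr i))).2 (h4 i)
  have h6 : ∀ w, ¬ Z (.inl (.inl (.inr w))) := by
    rintro (x | i)
    · exact mt (ho' (.inl (.inl (.inr (.inl x))))).2 (h2 x)
    · exact mt (ho' (.inl (.inl (.inr (.inr i))))).2 (h5 i)
  rintro (((x | w) | i) | ((q | ⟨v, j⟩) | i))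
  exacts [h2 x, h6 w, h5 i, h1 q, h3 v j, h4 i]

end Site

end TriWeb

/-! ### Counting vertices of glued diagrams -/

namespace Tangle

variable {n : ℕ} {bd : Fin n → Bool}

open Classical in
/-- The contribution of a tangle to `WebDiagram.count`. -/
noncomputable def count (A : Tangle bd) (w : Bool → Bool → Bool → ℕ) : ℕ :=
  ∑ᶠ d, if IsTrivalent A.rot d then w (A.thick (.inl d)) (A.thick (.inl (A.rot d)))
    (A.thick (.inl (A.rot (A.rot d)))) else 0

/-- Vertices are counted separately inside and outside: the boundary points are bivalent. -/
theorem _root_.OuterTangle.glue_count (O : OuterTangle bd) (A : Tangle bd)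
    (w : Bool → Bool → Bool → ℕ) : (O.glue A).count w = O.toTangle.count w + A.count w := by
  classical
  have := O.finite
  have := A.finite
  let := Fintype.ofFinite O.Dart
  let := Fintype.ofFinite A.Dart
  have hO := finsum_eq_sum_of_fintype fun d => if IsTrivalent O.rot d then w (O.thick (.inl d))
    (O.thick (.inl (O.rot d))) (O.thick (.inl (O.rot (O.rot d)))) else 0
  have hA := finsum_eq_sum_of_fintype fun d => if IsTrivalent A.rot d then w (A.thick (.inl d))
    (A.thick (.inl (A.rot d))) (A.thick (.inl (A.rot (A.rot d)))) else 0
  let Y : Type := (O.Dart ⊕ Fin n) ⊕ (A.Dart ⊕ Fin n)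
  let F : Y → ℕ := fun d => if IsTrivalent (glueRot O A) d then
    w ((O.glue A).thick d) ((O.glue A).thick (glueRot O A d))
      ((O.glue A).thick (glueRot O A (glueRot O A d))) else 0
  have h1 : ∀ d, F (.inl (.inl d)) = if IsTrivalent O.rot d then w (O.thick (.inl d))
      (O.thick (.inl (O.rot d))) (O.thick (.inl (O.rot (O.rot d)))) else 0 := fun d => by
    have : IsTrivalent (glueRot O A) (.inl (.inl d)) ↔ IsTrivalent O.rot d := by
      simp [IsTrivalent, glueRot]
    simp only [F, this]; rfl
  have h2 : ∀ d, F (.inr (.inl d)) = if IsTrivalent A.rot d then w (A.thick (.inl d))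
      (A.thick (.inl (A.rot d))) (A.thick (.inl (A.rot (A.rot d)))) else 0 := fun d => by
    have : IsTrivalent (glueRot O A) (.inr (.inl d)) ↔ IsTrivalent A.rot d := by
      simp [IsTrivalent, glueRot]
    simp only [F, this]; rfl
  have h3 : ∀ i, F (.inl (.inr i)) = 0 := fun i => if_neg (by simp [IsTrivalent, glueRot])
  have h4 : ∀ i, F (.inr (.inr i)) = 0 := fun i => if_neg (by simp [IsTrivalent, glueRot])
  have h5 : ∑ᶠ d, F d = ∑ d, F d := finsum_eq_sum_of_fintype _
  refine h5.trans (Eq.trans ?_ (congrArg₂ (· + ·) hO hA).symm)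
  rw [Fintype.sum_sum_type, Fintype.sum_sum_type, Fintype.sum_sum_type]
  simp only [h1, h2, h3, h4, Finset.sum_const_zero, add_zero]

theorem ofCode_count {t b : ℕ} {tri : Fin t → Fin 3 → ℕ}
    {dfc : Fin b → Fin 2 → ℕ} {leg : Fin n → ℕ} {thickEdges : List ℕ}
    {h : ∀ x, ∃! y, y ≠ x ∧ codeEdge tri dfc leg y = codeEdge tri dfc leg x}
    {hbd : ∀ i, decide (leg i ∈ thickEdges) = bd i}
    {hv : ∀ d, IsWebVertex (codeRot t b)
      (fun d => decide (codeEdge tri dfc leg (Sum.inl d) ∈ thickEdges)) (codeDefect t b) d}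
    (w : Bool → Bool → Bool → ℕ) :
    (ofCode bd tri dfc leg thickEdges h hbd hv).count w = ∑ v, ∑ j,
      w (decide (tri v j ∈ thickEdges)) (decide (tri v (j + 1) ∈ thickEdges))
        (decide (tri v (j + 1 + 1) ∈ thickEdges)) := by
  classical
  let F : CodeDart t b → ℕ := fun d => if IsTrivalent (codeRot t b) d then
    w (decide (codeEdge tri dfc leg (.inl d) ∈ thickEdges))
      (decide (codeEdge tri dfc leg (.inl (codeRot t b d)) ∈ thickEdges))
      (decide (codeEdge tri dfc leg (.inl (codeRot t b (codeRot t b d))) ∈ thickEdges)) else 0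
  have h1 : ∀ v j, F (.inl (v, j)) = w (decide (tri v j ∈ thickEdges))
      (decide (tri v (j + 1) ∈ thickEdges)) (decide (tri v (j + 1 + 1) ∈ thickEdges)) :=
    fun v j => by
      refine if_pos ⟨fun h => ?_, ?_⟩
      · have h2 : j + 1 = j := congrArg Prod.snd (Sum.inl_injective h)
        revert h2; clear h; revert j; decide
      · have h2 : j + 1 + 1 + 1 = j := by revert j; decide
        exact congrArg (fun j => Sum.inl (v, j)) h2
  have h2 : ∀ d, F (.inr d) = 0 := by
    rintro ⟨v, j⟩
    refine if_neg fun h => ?_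
    have h2 : j + 1 + 1 + 1 = j := congrArg Prod.snd (Sum.inr_injective h.2)
    revert h2; clear h; revert j; decide
  have h3 : ∑ᶠ d, F d = ∑ d, F d := finsum_eq_sum_of_fintype _
  refine h3.trans ?_
  rw [Fintype.sum_sum_type, Fintype.sum_prod_type]
  simp only [h1, h2, Finset.sum_const_zero, add_zero]

end Tangle

/-- The weight of a `222`-vertex is three times the weight of a `112`-vertex. -/
def vertexWeight (a b c : Bool) : ℕ := if a && b && c then 3 else 1

/-- The weight that counts `222`-vertices only. -/
def thickWeight (a b c : Bool) : ℕ := if a && b && c then 1 else 0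

namespace Tangle
set_option maxRecDepth 100000

theorem horizontal11v22_vertexWeight : horizontal11v22.count vertexWeight = 12 := (ofCode_count _).trans (by decide)

theorem vertical12v12_vertexWeight : vertical12v12.count vertexWeight = 6 := (ofCode_count _).trans (by decide)

theorem vertical12v12Defects_vertexWeight : vertical12v12Defects.count vertexWeight = 6 := (ofCode_count _).trans (by decide)

theorem vertical12_vertexWeight : vertical12.count vertexWeight = 0 := (ofCode_count _).trans (by decide)

theorem horizontalDumbbell_vertexWeight : horizontalDumbbell.count vertexWeight = 6 := (ofCode_count _).trans (by decide)

theorem horizontal11_vertexWeight : horizontal11.count vertexWeight = 0 := (ofCode_count _).trans (by decide)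

theorem vertical11_vertexWeight : vertical11.count vertexWeight = 0 := (ofCode_count _).trans (by decide)

theorem triangle111_vertexWeight : triangle111.count vertexWeight = 9 := (ofCode_count _).trans (by decide)

theorem vertex222_vertexWeight : vertex222.count vertexWeight = 9 := (ofCode_count _).trans (by decide)

theorem digon11_vertexWeight : digon11.count vertexWeight = 6 := (ofCode_count _).trans (by decide)

theorem edge2_vertexWeight : edge2.count vertexWeight = 0 := (ofCode_count _).trans (by decide)

theorem vertex222_thickWeight : vertex222.count thickWeight = 3 := (ofCode_count _).trans (by decide)

theorem triangle111_thickWeight : triangle111.count thickWeight = 0 := (ofCode_count _).trans (by decide)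

end Tangle

/-! ### Discs around vertices, edges and faces -/

namespace TriWeb

variable {X : Type} {C C' : TriWeb X} {f g : WebDiagram → ℤ}

/-- Two functions agree on all connected diagrams of a trivalent graph. -/
def Agree (f g : WebDiagram → ℤ) (C : TriWeb X) : Prop :=
  ∀ Γ, C.HasRep Γ → Γ.Connected → Γ.IsPlane → f Γ = g Γ

/-- A sum over the darts of a number that depends on the thickness of the edges at the vertex. -/
noncomputable def count (C : TriWeb X) (w : Bool → Bool → Bool → ℕ) : ℕ :=
  ∑ᶠ x, w (C.thick x) (C.thick (C.rot x)) (C.thick (C.rot (C.rot x)))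

theorem HasRep.count_eq {Γ : WebDiagram} (R : C.HasRep Γ) (w : Bool → Bool → Bool → ℕ) :
    Γ.count w = C.count w := by
  classical
  have := C.finite
  let := Fintype.ofFinite X
  obtain ⟨e, κ, σ, R⟩ := R
  rw [WebDiagram.count_eq_of_subdivides R.sub, count, finsum_eq_sum_of_fintype]
  refine Finset.sum_congr rfl fun x _ => ?_
  rw [if_pos (C.trivalent x)]
  simp only [R.thick, R.sub.label]

/-- The diagram `Γ` represents `C`, as far as the values of `f` and `g` and the numbers of vertices
are concerned. -/
structure Represents (f g : WebDiagram → ℤ) (C : TriWeb X) (Γ : WebDiagram) : Prop where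
  agree_iff : C.Agree f g ↔ f Γ = g Γ
  count_eq : ∀ w, Γ.count w = C.count w
  connected : Γ.Connected

theorem rot_ne (C : TriWeb X) (x : X) : C.rot x ≠ x := (C.trivalent x).1

theorem rot_rot_rot (C : TriWeb X) (x : X) : C.rot (C.rot (C.rot x)) = x := (C.trivalent x).2

theorem rot_rot_ne (C : TriWeb X) (x : X) : C.rot (C.rot x) ≠ x := (C.trivalent x).rot_rot_ne

theorem region_opp_rot (H : C.IsPlane) (x : X) :
    C.region (some (C.opp (C.rot x))) (some x) := by
  have := H.face (C.opp (C.rot x))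
  rwa [C.opp_opp, Equiv.symm_apply_apply] at this

theorem region_rot_rot (H : C.IsPlane) (d : X) :
    C.region (some (C.rot (C.rot d))) (some (C.opp d)) := by
  have := C.region.symm (region_opp_rot H (C.rot (C.rot d)))
  rwa [C.rot_rot_rot] at this

section Value

variable {t n b : ℕ} {bd : Fin n → Bool} {tri : Fin t → Fin 3 → ℕ}
    {dfc : Fin b → Fin 2 → ℕ} {leg : Fin n → ℕ} {thickEdges : List ℕ}
    {h : ∀ x, ∃! y, y ≠ x ∧ codeEdge tri dfc leg y = codeEdge tri dfc leg x}
    {hbd : ∀ i, decide (leg i ∈ thickEdges) = bd i}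
    {hv : ∀ d, IsWebVertex (codeRot t b)
      (fun d => decide (codeEdge tri dfc leg (Sum.inl d) ∈ thickEdges)) (codeDefect t b) d}

/-- Since both invariants depend only on the core, agreement on all diagrams of `C'` can be tested on
the one obtained by filling the hole. -/
theorem Site.IsFilling.represents [NeZero n] {S : C.Site t bd} {flag : X → Bool}
    {hflag : ∀ x, flag x = true → C.thick x = true} {pt' : Fin t × Fin 3 → X} {δ : Fin b → X}
    {s : Fin b → Bool} (F : S.IsFilling flag C' pt'
      (Tangle.ofCode bd tri dfc leg thickEdges h hbd hv).opp
      (Tangle.ofCode bd tri dfc leg thickEdges h hbd hv).thick δ s) (D : S.IsDisc)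
    (hA : ∀ inst, @Tangle.IsPlane _ _ (Tangle.ofCode bd tri dfc leg thickEdges h hbd hv) inst)
    (hf : SatisfiesAll f) (hg : SatisfiesAll g) (H : C.IsPlane) (H' : C'.IsPlane)
    (hc : C'.Connected) :
    Represents f g C' ((S.outer flag hflag).glue
      (Tangle.ofCode bd tri dfc leg thickEdges h hbd hv)) := by
  obtain ⟨R, hR⟩ := F.hasRep (hflag := hflag) H' hc
  have HR := glue_isPlane_of_tangle _ _ (Site.outer_isPlane D H flag hflag) hA
  refine ⟨⟨fun h => h _ R hR HR, fun h Γ h1 h2 h3 => ?_⟩, R.count_eq, hR⟩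
  rw [h1.value_eq hf R h2 hR h3 HR H', h1.value_eq hg R h2 hR h3 HR H', h]

end Value

/-! #### A vertex -/

/-- The three darts at the vertex of `d`. -/
def star (C : TriWeb X) (d : X) : Fin 3 → X
  | 0 => d
  | 1 => C.rot d
  | 2 => C.rot (C.rot d)

theorem star_injective (C : TriWeb X) (d : X) : Function.Injective (C.star d) := by
  have h1 := C.rot_ne d
  have h2 := C.rot_rot_ne d
  have h3 := C.rot_ne (C.rot d)
  intro i j
  fin_cases i <;> fin_cases j <;> simp [star, h1, h2, h3, h1.symm, h2.symm, h3.symm]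

theorem rot_star (C : TriWeb X) (d : X) (j : Fin 3) : C.rot (C.star d j) = C.star d (j + 1) := by
  fin_cases j
  exacts [rfl, rfl, C.rot_rot_rot d]

/-- The disc around a single vertex. -/
def vertexSite (C : TriWeb X) (d : X) (bd : Fin 3 → Bool) (hbd : ∀ i, C.thick (C.star d i) = bd i) :
    C.Site 1 bd where
  pt q := C.star d q.2
  injective := fun ⟨v, i⟩ ⟨w, j⟩ h => Prod.ext (Subsingleton.elim _ _) (C.star_injective d h)
  rot_pt _ := C.rot_star d
  leg i := (0, i)
  leg_injective _ _ h := congrArg Prod.snd h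
  thick_leg := hbd
  inner q hq := (hq q.2 (Prod.ext (Subsingleton.elim _ _) rfl)).elim

theorem vertexSite_isDisc (H : C.IsPlane) (d : X) (bd : Fin 3 → Bool)
    (hbd : ∀ i, C.thick (C.star d i) = bd i) : (C.vertexSite d bd hbd).IsDisc where
  leg i := by
    fin_cases i
    · exact C.region.symm (region_opp_rot H d)
    · exact C.region.symm (region_opp_rot H (C.rot d))
    · exact region_rot_rot H d
  inner q hq := (hq q.2 (Prod.ext (Subsingleton.elim _ _) rfl)).elim
  flow b hb := ⟨fun q => b q.2, fun _ => rfl,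
    fun q q' hq => (hq q.2 (Prod.ext (Subsingleton.elim _ _) rfl)).elim,
    fun _ => by rwa [Fin.sum_univ_three] at hb⟩

/-! #### An edge -/

theorem star_ne_opp_of_thick_ne {d : X} (h1 : C.thick (C.rot d) ≠ C.thick d)
    (h2 : C.thick (C.rot (C.rot d)) ≠ C.thick d) (j : Fin 3) : C.star d j ≠ C.opp d := by
  intro h
  fin_cases j
  · exact C.opp_ne d h.symm
  · exact h1 ((congrArg C.thick h).trans (C.thick_opp d))
  · exact h2 ((congrArg C.thick h).trans (C.thick_opp d))

/-- The darts at the two ends of the edge of `d`, the dart of that edge being the last one at either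
end. -/
def edgePt (C : TriWeb X) (d : X) (q : Fin 2 × Fin 3) : X :=
  C.star (C.rot (if q.1 = 0 then d else C.opp d)) q.2

/-- The four edges that leave a disc around the edge of `d`, in counterclockwise order: two at the
base vertex of `d` and two at the other end. -/
def edgeLeg : Fin 4 → Fin 2 × Fin 3 := ![(0, 0), (0, 1), (1, 0), (1, 1)]

theorem eq_two_of_edgeLeg_ne : ∀ v j, (∀ i, edgeLeg i ≠ (v, j)) → j = 2 := by decide

theorem star_ne_star {d d' : X} (h : ∀ j, C.star d j ≠ d') (i j : Fin 3) :
    C.star d i ≠ C.star d' j := by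
  have h1 : ∀ i j, C.star d i = C.star d' (j + 1) → C.star d (i - 1) = C.star d' j := fun i j h =>
    C.rot.injective (by rw [C.rot_star, C.rot_star, sub_add_cancel, h])
  intro h2
  fin_cases j
  · exact h _ h2
  · exact h _ (h1 _ 0 h2)
  · exact h _ (h1 _ 0 (h1 _ 1 h2))

/-- The disc around an edge that is not a loop. -/
def edgeSite (C : TriWeb X) (d : X) (hne : ∀ j, C.star d j ≠ C.opp d) (bd : Fin 4 → Bool)
    (hbd : ∀ i, C.thick (C.edgePt d (edgeLeg i)) = bd i) : C.Site 2 bd where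
  pt := C.edgePt d
  injective := by
    have h : ∀ i j, C.star (C.rot d) i ≠ C.star (C.rot (C.opp d)) j := by
      have h1 : ∀ d i, C.star (C.rot d) i = C.star d (i + 1) := fun d i => by
        rw [← C.rot_star]; fin_cases i <;> rfl
      intro i j
      rw [h1, h1]
      exact star_ne_star hne _ _
    rintro ⟨v, i⟩ ⟨w, j⟩ h'
    fin_cases v <;> fin_cases w
    · exact congrArg _ (C.star_injective _ h')
    · exact absurd h' (h _ _)
    · exact absurd h'.symm (h _ _)
    · exact congrArg _ (C.star_injective _ h')
  rot_pt v := C.rot_star (C.rot (if v = 0 then d else C.opp d))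
  leg := edgeLeg
  leg_injective := by decide
  thick_leg := hbd
  inner := by
    rintro ⟨v, j⟩ hq
    obtain rfl := eq_two_of_edgeLeg_ne v j hq
    fin_cases v
    · refine ⟨(1, 2), ?_, by decide⟩
      change C.opp (C.rot (C.rot (C.rot d))) = C.rot (C.rot (C.rot (C.opp d)))
      rw [C.rot_rot_rot, C.rot_rot_rot]
    · refine ⟨(0, 2), ?_, by decide⟩
      change C.opp (C.rot (C.rot (C.rot (C.opp d)))) = C.rot (C.rot (C.rot d))
      rw [C.rot_rot_rot, C.rot_rot_rot, C.opp_opp]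

theorem edgePt_two (C : TriWeb X) (d : X) : C.edgePt d (0, 2) = d ∧ C.edgePt d (1, 2) = C.opp d :=
  ⟨C.rot_rot_rot d, C.rot_rot_rot _⟩

theorem edgeSite_isDisc (H : C.IsPlane) (d : X) (hne : ∀ j, C.star d j ≠ C.opp d)
    (bd : Fin 4 → Bool) (hbd : ∀ i, C.thick (C.edgePt d (edgeLeg i)) = bd i) :
    (C.edgeSite d hne bd hbd).IsDisc where
  leg i := by
    have h1 := fun x => C.region.symm (region_opp_rot H x)
    fin_cases i
    · exact h1 (C.rot d)
    · exact C.region.trans (region_rot_rot H d) (h1 (C.opp d))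
    · exact h1 (C.rot (C.opp d))
    · have := region_rot_rot H (C.opp d)
      rw [C.opp_opp] at this
      exact C.region.trans this (h1 d)
  inner := by
    rintro ⟨v, j⟩ hq
    obtain rfl := eq_two_of_edgeLeg_ne v j hq
    left
    fin_cases v
    · refine ⟨3, ?_⟩
      have := region_rot_rot H (C.opp d)
      rw [C.opp_opp] at this
      change C.region (some (C.edgePt d (0, 2))) (some (C.rot (C.rot (C.opp d))))
      rw [(C.edgePt_two d).1]
      exact C.region.symm this
    · refine ⟨1, ?_⟩
      change C.region (some (C.edgePt d (1, 2))) (some (C.rot (C.rot d)))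
      rw [(C.edgePt_two d).2]
      exact C.region.symm (region_rot_rot H d)
  -- the flow through the middle edge is the sum of the flows through the two legs at either end
  flow b hb := by
    refine ⟨fun q => if q = (0, 0) then b 0 else if q = (0, 1) then b 1 else if q = (1, 0) then b 2
      else if q = (1, 1) then b 3 else b 0 + b 1, ?_, ?_, ?_⟩
    · intro i
      fin_cases i <;> rfl
    · rintro ⟨v, j⟩ q' hq hq'
      obtain rfl := eq_two_of_edgeLeg_ne v j hq
      have hq2 : q'.2 = 2 := by
        have h1 : q' = (1 - v, 2) := by
          refine (C.edgeSite d hne bd hbd).injective (hq'.symm.trans ?_)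
          fin_cases v
          · change C.opp (C.edgePt d (0, 2)) = C.edgePt d (1, 2)
            rw [(C.edgePt_two d).1, (C.edgePt_two d).2]
          · change C.opp (C.edgePt d (1, 2)) = C.edgePt d (0, 2)
            rw [(C.edgePt_two d).1, (C.edgePt_two d).2, C.opp_opp]
        rw [h1]
      obtain ⟨w, j⟩ := q'
      obtain rfl : j = 2 := hq2
      fin_cases v <;> fin_cases w <;> rfl
    · rw [Fin.sum_univ_four] at hb
      intro v
      fin_cases v
      · exact zmod_two_add_self _
      · change b 2 + b 3 + (b 0 + b 1) = 0
        rw [← hb]; ring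

/-! #### A face -/

/-- The darts at the vertices of a face; the corner of the face at the `v`-th vertex is between
`y v` and `C.rot (y v)`. -/
def facePt (C : TriWeb X) {n : ℕ} (y : Fin n → X) (q : Fin n × Fin 3) : X :=
  C.star (C.rot (C.rot (y q.1))) q.2

section Face

variable {n : ℕ} [NeZero n] {y : Fin n → X}

theorem facePt_one (C : TriWeb X) (y : Fin n → X) (v : Fin n) : C.facePt y (v, 1) = y v :=
  C.rot_rot_rot _

theorem facePt_two (C : TriWeb X) (y : Fin n → X) (v : Fin n) : C.facePt y (v, 2) = C.rot (y v) :=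
  congrArg C.rot (C.rot_rot_rot _)

theorem facePt_injective (hy : Function.Injective y) (hne : ∀ v w, C.rot (y v) ≠ y w) :
    Function.Injective (C.facePt y) := by
  have h0 : ∀ v, C.facePt y (v, 0) = C.rot (C.rot (y v)) := fun v => rfl
  rintro ⟨v, i⟩ ⟨w, j⟩ h
  have h4 : ∀ v w, C.rot (C.rot (y v)) ≠ y w := fun v w h => by
    have := congrArg C.rot h
    rw [C.rot_rot_rot] at this
    exact hne w v this.symm
  fin_cases i <;> fin_cases j <;>
    simp only [Fin.zero_eta, Fin.mk_one, Fin.reduceFinMk, h0, facePt_one, facePt_two] at h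
  · rw [hy (C.rot.injective (C.rot.injective h))]
  · exact absurd h (h4 _ _)
  · exact absurd (C.rot.injective h) (hne _ _)
  · exact absurd h.symm (h4 _ _)
  · rw [hy h]
  · exact absurd h.symm (hne _ _)
  · exact absurd (C.rot.injective h.symm) (hne _ _)
  · exact absurd h (hne _ _)
  · rw [hy (C.rot.injective h)]

theorem opp_rot_face (hopp : ∀ v, C.opp (y v) = C.rot (y (v + 1))) (v : Fin n) :
    C.opp (C.rot (y v)) = y (v - 1) := by
  have := hopp (v - 1)
  rw [sub_add_cancel] at this
  rw [← this, C.opp_opp]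

/-- The disc around a bounded face with sides `y v`; its legs are the third edges at the vertices of
the face. -/
def faceSite (C : TriWeb X) (y : Fin n → X) (hy : Function.Injective y)
    (hne : ∀ v w, C.rot (y v) ≠ y w) (hopp : ∀ v, C.opp (y v) = C.rot (y (v + 1)))
    (bd : Fin n → Bool) (hbd : ∀ i, C.thick (C.rot (C.rot (y i))) = bd i) : C.Site n bd where
  pt := C.facePt y
  injective := facePt_injective hy hne
  rot_pt v := C.rot_star (C.rot (C.rot (y v)))
  leg i := (i, 0)
  leg_injective _ _ h := congrArg Prod.fst h
  thick_leg := hbd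
  inner := by
    rintro ⟨v, j⟩ hq
    fin_cases j
    · exact absurd rfl (hq v)
    · refine ⟨(v + 1, 2), ?_, fun i h => absurd (congrArg Prod.snd h) (show ¬ (0 : Fin 3) = 2 by decide)⟩
      change C.opp (C.facePt y (v, 1)) = _
      rw [facePt_one, facePt_two, hopp]
    · refine ⟨(v - 1, 1), ?_, fun i h => absurd (congrArg Prod.snd h) (show ¬ (0 : Fin 3) = 1 by decide)⟩
      change C.opp (C.facePt y (v, 2)) = _
      rw [facePt_one, facePt_two, opp_rot_face hopp]

/-- By `hclass`, the face consists of the listed sides only, so that nothing else lies inside it.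
The flow along the sides is found from the flow on the legs by solving `hflow`. -/
theorem faceSite_isDisc (H : C.IsPlane) (hy : Function.Injective y)
    (hne : ∀ v w, C.rot (y v) ≠ y w) (hopp : ∀ v, C.opp (y v) = C.rot (y (v + 1)))
    (bd : Fin n → Bool) (hbd : ∀ i, C.thick (C.rot (C.rot (y i))) = bd i)
    (hclass : ∀ v a, C.region (some (y v)) a → ∃ w, a = some (y w))
    (hflow : ∀ b : Fin n → ZMod 2, ∑ i, b i = 0 → ∃ c : Fin n → ZMod 2,
      ∀ v, b v + c v + c (v - 1) = 0) :
    (C.faceSite y hy hne hopp bd hbd).IsDisc where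
  leg i := by
    have h1 := region_rot_rot H (y i)
    have h2 := region_opp_rot H (C.rot (y (i + 1)))
    rw [hopp] at h1
    have h3 : finRotate n i = i + 1 := by
      obtain ⟨m, rfl⟩ : ∃ m, n = m + 1 := ⟨n - 1, (Nat.succ_pred (NeZero.ne n)).symm⟩
      exact finRotate_apply _
    rw [h3]
    exact C.region.trans h1 (C.region.symm h2)
  inner := by
    rintro ⟨v, j⟩ hq
    fin_cases j
    · exact absurd rfl (hq v)
    · right
      intro a ha
      change C.region (some (C.facePt y (v, 1))) a at ha
      rw [facePt_one] at ha
      obtain ⟨w, hw⟩ := hclass v a ha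
      exact ⟨(w, 1), by rw [hw]; exact congrArg some (facePt_one C y w).symm,
        fun i h => absurd (congrArg Prod.snd h) (show ¬ (0 : Fin 3) = 1 by decide)⟩
    · left
      refine ⟨v - 1, ?_⟩
      change C.region (some (C.facePt y (v, 2))) (some (C.rot (C.rot (y (v - 1)))))
      have h1 := region_rot_rot H (y (v - 1))
      rw [hopp, sub_add_cancel] at h1
      rw [facePt_two]
      exact C.region.symm h1
  flow b hb := by
    obtain ⟨c, hc⟩ := hflow b hb
    refine ⟨fun q => if q.2 = 0 then b q.1 else if q.2 = 1 then c q.1 else c (q.1 - 1),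
      fun i => rfl, ?_, hc⟩
    rintro ⟨v, j⟩ q' hq h
    have h0 := (C.faceSite y hy hne hopp bd hbd).injective
    fin_cases j
    · exact absurd rfl (hq v)
    · have h1 : q' = (v + 1, 2) := by
        refine h0 (h.symm.trans ?_)
        change C.opp (C.facePt y (v, 1)) = C.facePt y (v + 1, 2)
        rw [facePt_one, facePt_two, hopp]
      rw [h1]
      exact congrArg c (add_sub_cancel_right v 1)
    · have h1 : q' = (v - 1, 1) := by
        refine h0 (h.symm.trans ?_)
        change C.opp (C.facePt y (v, 2)) = C.facePt y (v - 1, 1)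
        rw [facePt_one, facePt_two, opp_rot_face hopp]
      rw [h1]; rfl

end Face

end TriWeb

/-! ### Local relations for trivalent graphs -/

namespace TriWeb

variable {X : Type} {C : TriWeb X} {f g : WebDiagram → ℤ}

set_option maxRecDepth 100000

/-- Switching `half` at the darts `d` and `C.rot d` moves a defect from one edge to the next one. -/
def toggle [DecidableEq X] (C : TriWeb X) (d : X)
    (hd : ∀ i, C.thick (C.star d i) = ![true, true, true] i) : TriWeb X :=
  { C with
    half := fun x => if x = d ∨ x = C.rot d then !(C.half x) else C.half x
    thick_of_half := fun x => by
      split_ifs with h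
      · rcases h with rfl | rfl
        · exact fun _ => hd 0
        · exact fun _ => hd 1
      · exact C.thick_of_half x }

/-- A graph with a `222`-vertex is represented by a diagram to which the relations that start from
`vertex222` apply. -/
theorem represents_vertex222 (hf : SatisfiesAll f) (hg : SatisfiesAll g) (H : C.IsPlane)
    (hc : C.Connected) {d : X} (hd : ∀ i, C.thick (C.star d i) = ![true, true, true] i) :
    Represents f g C
      (((C.vertexSite d _ hd).outer C.half C.thick_of_half).glue .vertex222) := by
  have D := vertexSite_isDisc H d _ hd
  refine Site.IsFilling.represents (Site.IsExtension.isFilling (C' := C)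
    (D.isExtension (fun _ _ => rfl)) Fin.elim0 Fin.elim0 ?_ ?_ ?_ ?_ ?_)
    D Tangle.vertex222_isPlane hf hg H H hc
  · intro v j
    fin_cases v; fin_cases j
    exacts [(hd 0).symm, (hd 1).symm, (hd 2).symm]
  · rintro ((⟨v, j⟩ | ⟨v, j⟩) | i)
    · fin_cases v; fin_cases j
      exacts [rfl, rfl, rfl]
    · exact v.elim0
    · fin_cases i
      exacts [(C.opp_opp _).symm, (C.opp_opp _).symm, (C.opp_opp _).symm]
  · rintro ((⟨v, j⟩ | ⟨v, j⟩) | i)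
    · fin_cases v; fin_cases j
      exacts [rfl, rfl, rfl]
    · exact v.elim0
    · fin_cases i
      exacts [rfl, rfl, rfl]
  · exact fun v => v.elim0
  · intro i
    fin_cases i
    exacts [⟨_, rfl⟩, ⟨_, rfl⟩, ⟨_, rfl⟩]

/-- Defects may be moved across a `222`-vertex: the two sides of the relation represent the graph
before and after the flags at two darts of the vertex are switched. -/
theorem agree_toggle_iff [DecidableEq X] (hf : SatisfiesAll f) (hg : SatisfiesAll g) (H : C.IsPlane)
    (hc : C.Connected) {d : X} (hd : ∀ i, C.thick (C.star d i) = ![true, true, true] i) :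
    (C.toggle d hd).Agree f g ↔ C.Agree f g := by
  have D := vertexSite_isDisc H d _ hd
  have HO := fun flag hflag => Site.outer_isPlane D H flag hflag
  -- outside the disc the flags of both graphs agree; on the legs the flag of `d` is switched, and
  -- the defect inside the disc corrects this at `d` or at `C.rot d`
  let flag : X → Bool := fun x => if x = d then !(C.half x) else C.half x
  have hflag : ∀ x, flag x = true → C.thick x = true := fun x => by
    by_cases h : x = d
    · rw [h]; exact fun _ => hd 0
    · simp only [flag, if_neg h]; exact C.thick_of_half x
  have hin : ∀ i, (C.vertexSite d _ hd).Inside (C.star d i) := fun i => ⟨(0, i), rfl⟩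
  have hout : ∀ x, ¬ (C.vertexSite d _ hd).Inside x → x ≠ d ∧ x ≠ C.rot d := fun x hx =>
    ⟨fun h => hx (h ▸ hin 0), fun h => hx (h ▸ hin 1)⟩
  have f0 : flag d = !(C.half d) := if_pos rfl
  have f0' : (!(flag d)) = C.half d := by rw [f0, Bool.not_not]
  have f1 : flag (C.rot d) = C.half (C.rot d) := if_neg (C.rot_ne d)
  have f2 : flag (C.rot (C.rot d)) = C.half (C.rot (C.rot d)) := if_neg (C.rot_rot_ne d)
  have t0 : (C.toggle d hd).half d = !(C.half d) := if_pos (Or.inl rfl)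
  have t1 : (C.toggle d hd).half (C.rot d) = !(C.half (C.rot d)) := if_pos (Or.inr rfl)
  have t2 : (C.toggle d hd).half (C.rot (C.rot d)) = C.half (C.rot (C.rot d)) :=
    if_neg (by simp [C.rot_rot_ne, C.rot_ne])
  have E0 : (C.vertexSite d _ hd).IsExtension flag C (C.vertexSite d _ hd).pt :=
    D.isExtension fun x hx => (if_neg (hout x hx).1).symm
  have E1 : (C.vertexSite d _ hd).IsExtension flag (C.toggle d hd) (C.vertexSite d _ hd).pt :=
    { E0 with
      half_eq := fun x hx => by
        refine (if_neg ?_).trans (if_neg (hout x hx).1).symm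
        exact fun h => h.elim (hout x hx).1 (hout x hx).2 }
  have h0 : Represents f g C
      (((C.vertexSite d _ hd).outer flag hflag).glue .vertex222Defect0) := by
    refine Site.IsFilling.represents (Site.IsExtension.isFilling
      E0 (fun _ => d) (fun _ => flag d) ?_ ?_ ?_ ?_ ?_)
      D Tangle.vertex222Defect0_isPlane hf hg H H hc
    · intro v j
      fin_cases v; fin_cases j
      exacts [(hd 0).symm, (hd 1).symm, (hd 2).symm]
    · rintro ((⟨v, j⟩ | ⟨v, j⟩) | i)
      · fin_cases v; fin_cases j
        exacts [rfl, rfl, rfl]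
      · fin_cases v; fin_cases j
        exacts [rfl, (C.opp_opp _).symm]
      · fin_cases i
        exacts [(C.opp_opp _).symm, (C.opp_opp _).symm, (C.opp_opp _).symm]
    · rintro ((⟨v, j⟩ | ⟨v, j⟩) | i)
      · fin_cases v; fin_cases j
        exacts [f0', f1, f2]
      · fin_cases v; fin_cases j
        exacts [rfl, f0'.symm]
      · fin_cases i
        exacts [rfl, f1.symm, f2.symm]
    · intro v
      fin_cases v
      exact ⟨1, _, rfl⟩
    · intro i
      fin_cases i
      exacts [⟨_, rfl⟩, ⟨_, rfl⟩, ⟨_, rfl⟩]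
  have h1 : Represents f g (C.toggle d hd)
      (((C.vertexSite d _ hd).outer flag hflag).glue .vertex222Defect1) := by
    refine Site.IsFilling.represents (Site.IsExtension.isFilling
      E1 (fun _ => C.rot d) (fun _ => flag (C.rot d)) ?_ ?_ ?_ ?_ ?_)
      D Tangle.vertex222Defect1_isPlane hf hg H H hc
    · intro v j
      fin_cases v; fin_cases j
      exacts [(hd 0).symm, (hd 1).symm, (hd 2).symm]
    · rintro ((⟨v, j⟩ | ⟨v, j⟩) | i)
      · fin_cases v; fin_cases j
        exacts [rfl, rfl, rfl]
      · fin_cases v; fin_cases j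
        exacts [rfl, (C.opp_opp _).symm]
      · fin_cases i
        exacts [(C.opp_opp _).symm, (C.opp_opp _).symm, (C.opp_opp _).symm]
    · rintro ((⟨v, j⟩ | ⟨v, j⟩) | i)
      · fin_cases v; fin_cases j
        exacts [f0.trans t0.symm, (congrArg (!·) f1).trans t1.symm, f2.trans t2.symm]
      · fin_cases v; fin_cases j
        exacts [rfl, t1.trans (congrArg (!·) f1).symm]
      · fin_cases i
        exacts [t0.trans f0.symm, rfl, t2.trans f2.symm]
    · intro v
      fin_cases v
      exact ⟨1, _, rfl⟩
    · intro i
      fin_cases i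
      exacts [⟨_, rfl⟩, ⟨_, rfl⟩, ⟨_, rfl⟩]
  refine h1.agree_iff.trans (Iff.trans ?_ h0.agree_iff.symm)
  have e1 := hf.web.defect_moves _ (HO flag hflag)
  have e2 := hg.web.defect_moves _ (HO flag hflag)
  exact ⟨fun h => e1.trans (h.trans e2.symm), fun h => e1.symm.trans (h.trans e2)⟩


theorem edgePt_opp (C : TriWeb X) (d : X) : C.edgePt d (1, 2) = C.opp (C.edgePt d (0, 2)) := by
  rw [(C.edgePt_two d).1, (C.edgePt_two d).2]

theorem edgePt_opp' (C : TriWeb X) (d : X) : C.edgePt d (0, 2) = C.opp (C.edgePt d (1, 2)) := by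
  rw [(C.edgePt_two d).1, (C.edgePt_two d).2, C.opp_opp]

/-! The next lemmas describe diagrams of graphs in which an edge or a face is bounded by edges of
given thickness.  The hypotheses on `half` say that the edge inside the disc carries an even (`hp`)
or odd number of defects. -/
theorem represents_horizontal11v22 (hf : SatisfiesAll f) (hg : SatisfiesAll g) (H : C.IsPlane)
    (hc : C.Connected) {d : X} (hne : ∀ j, C.star d j ≠ C.opp d) (h0 : C.thick d = true)
    (hd : ∀ i, C.thick (C.edgePt d (edgeLeg i)) = ![false, false, true, true] i)
    (hp : C.half (C.opp d) = C.half d) :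
    Represents f g C
      (((C.edgeSite d hne _ hd).outer C.half C.thick_of_half).glue .horizontal11v22) := by
  have D := edgeSite_isDisc H d hne _ hd
  have t0 : true = C.thick (C.edgePt d (0, 2)) := by rw [(C.edgePt_two d).1, h0]
  have t1 : true = C.thick (C.edgePt d (1, 2)) := by rw [(C.edgePt_two d).2, C.thick_opp, h0]
  have hp' : C.half (C.edgePt d (1, 2)) = C.half (C.edgePt d (0, 2)) := by
    rw [(C.edgePt_two d).1, (C.edgePt_two d).2, hp]
  refine Site.IsFilling.represents (Site.IsExtension.isFilling (C' := C)
    (D.isExtension (fun _ _ => rfl)) Fin.elim0 Fin.elim0 ?_ ?_ ?_ ?_ ?_)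
    D Tangle.horizontal11v22_isPlane hf hg H H hc
  · intro v j
    fin_cases v <;> fin_cases j
    exacts [(hd 0).symm, (hd 1).symm, t0, (hd 2).symm, (hd 3).symm, t1]
  · rintro ((⟨v, j⟩ | ⟨v, j⟩) | i)
    · fin_cases v <;> fin_cases j
      exacts [rfl, rfl, C.edgePt_opp d, rfl, rfl, C.edgePt_opp' d]
    · exact v.elim0
    · fin_cases i
      exacts [(C.opp_opp _).symm, (C.opp_opp _).symm, (C.opp_opp _).symm, (C.opp_opp _).symm]
  · rintro ((⟨v, j⟩ | ⟨v, j⟩) | i)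
    · fin_cases v <;> fin_cases j
      exacts [rfl, rfl, hp', rfl, rfl, hp'.symm]
    · exact v.elim0
    · fin_cases i
      exacts [rfl, rfl, rfl, rfl]
  · exact fun v => v.elim0
  · intro i
    fin_cases i
    exacts [⟨_, rfl⟩, ⟨_, rfl⟩, ⟨_, rfl⟩, ⟨_, rfl⟩]

theorem represents_horizontalDumbbell (hf : SatisfiesAll f) (hg : SatisfiesAll g) (H : C.IsPlane)
    (hc : C.Connected) {d : X} (hne : ∀ j, C.star d j ≠ C.opp d) (h0 : C.thick d = true)
    (hd : ∀ i, C.thick (C.edgePt d (edgeLeg i)) = ![false, false, false, false] i)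
    (hp : C.half (C.opp d) = C.half d) :
    Represents f g C
      (((C.edgeSite d hne _ hd).outer C.half C.thick_of_half).glue .horizontalDumbbell) := by
  have D := edgeSite_isDisc H d hne _ hd
  have t0 : true = C.thick (C.edgePt d (0, 2)) := by rw [(C.edgePt_two d).1, h0]
  have t1 : true = C.thick (C.edgePt d (1, 2)) := by rw [(C.edgePt_two d).2, C.thick_opp, h0]
  have hp' : C.half (C.edgePt d (1, 2)) = C.half (C.edgePt d (0, 2)) := by
    rw [(C.edgePt_two d).1, (C.edgePt_two d).2, hp]
  refine Site.IsFilling.represents (Site.IsExtension.isFilling (C' := C)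
    (D.isExtension (fun _ _ => rfl)) Fin.elim0 Fin.elim0 ?_ ?_ ?_ ?_ ?_)
    D Tangle.horizontalDumbbell_isPlane hf hg H H hc
  · intro v j
    fin_cases v <;> fin_cases j
    exacts [(hd 0).symm, (hd 1).symm, t0, (hd 2).symm, (hd 3).symm, t1]
  · rintro ((⟨v, j⟩ | ⟨v, j⟩) | i)
    · fin_cases v <;> fin_cases j
      exacts [rfl, rfl, C.edgePt_opp d, rfl, rfl, C.edgePt_opp' d]
    · exact v.elim0
    · fin_cases i
      exacts [(C.opp_opp _).symm, (C.opp_opp _).symm, (C.opp_opp _).symm, (C.opp_opp _).symm]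
  · rintro ((⟨v, j⟩ | ⟨v, j⟩) | i)
    · fin_cases v <;> fin_cases j
      exacts [rfl, rfl, hp', rfl, rfl, hp'.symm]
    · exact v.elim0
    · fin_cases i
      exacts [rfl, rfl, rfl, rfl]
  · exact fun v => v.elim0
  · intro i
    fin_cases i
    exacts [⟨_, rfl⟩, ⟨_, rfl⟩, ⟨_, rfl⟩, ⟨_, rfl⟩]

theorem represents_horizontalDumbbellDefect (hf : SatisfiesAll f) (hg : SatisfiesAll g) (H : C.IsPlane)
    (hc : C.Connected) {d : X} (hne : ∀ j, C.star d j ≠ C.opp d) (h0 : C.thick d = true)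
    (hd : ∀ i, C.thick (C.edgePt d (edgeLeg i)) = ![false, false, false, false] i)
    (hp : C.half (C.opp d) = !(C.half d)) :
    Represents f g C
      (((C.edgeSite d hne _ hd).outer C.half C.thick_of_half).glue .horizontalDumbbellDefect) := by
  have D := edgeSite_isDisc H d hne _ hd
  have t0 : true = C.thick (C.edgePt d (0, 2)) := by rw [(C.edgePt_two d).1, h0]
  have t1 : true = C.thick (C.edgePt d (1, 2)) := by rw [(C.edgePt_two d).2, C.thick_opp, h0]
  have l0 := (C.edgePt_two d).1
  have l1 := (C.edgePt_two d).2
  have s0 : C.half (C.edgePt d (0, 2)) = C.half d := by rw [l0]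
  have s1 : C.half (C.edgePt d (1, 2)) = !(C.half d) := by rw [l1, hp]
  refine Site.IsFilling.represents (Site.IsExtension.isFilling (C' := C)
    (D.isExtension (fun _ _ => rfl)) (fun _ => C.opp d) (fun _ => C.half d) ?_ ?_ ?_ ?_ ?_)
    D Tangle.horizontalDumbbellDefect_isPlane hf hg H H hc
  · intro v j
    fin_cases v <;> fin_cases j
    exacts [(hd 0).symm, (hd 1).symm, t0, (hd 2).symm, (hd 3).symm, t1]
  · rintro ((⟨v, j⟩ | ⟨v, j⟩) | i)
    · fin_cases v <;> fin_cases j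
      exacts [rfl, rfl, (congrArg C.opp l0).symm, rfl, rfl, (congrArg C.opp l1).symm]
    · fin_cases v; fin_cases j
      exacts [l0.trans (C.opp_opp d).symm, l1.trans (congrArg C.opp (C.opp_opp d)).symm]
    · fin_cases i
      exacts [(C.opp_opp _).symm, (C.opp_opp _).symm, (C.opp_opp _).symm, (C.opp_opp _).symm]
  · rintro ((⟨v, j⟩ | ⟨v, j⟩) | i)
    · fin_cases v <;> fin_cases j
      exacts [rfl, rfl, s0.symm, rfl, rfl, s1.symm]
    · fin_cases v; fin_cases j
      exacts [s0, s1]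
    · fin_cases i
      exacts [rfl, rfl, rfl, rfl]
  · intro v
    fin_cases v
    exact ⟨0, _, rfl⟩
  · intro i
    fin_cases i
    exacts [⟨_, rfl⟩, ⟨_, rfl⟩, ⟨_, rfl⟩, ⟨_, rfl⟩]

end TriWeb

namespace Tangle

set_option maxRecDepth 100000

theorem lollipop_isPlane (inst : Fintype lollipop.Dart) : @Tangle.IsPlane _ _ lollipop inst :=
  ofCode_isPlane ![![1, 0, 0]] ![] ![0]
    ![![0, 1, 0]] ![] ![0]
    (fun z => [0, z 0]) (by decide) (by decide)
    (fun z h1 h2 => by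
      simp [Fin.forall_fin_succ] at h1 h2 ⊢ <;> grind)
    (fun z h1 h2 h3 => by simp [Fin.forall_fin_succ] at h1 h2 h3 ⊢ <;> grind) inst

end Tangle

namespace TriWeb

variable {X : Type} {C : TriWeb X} {f g : WebDiagram → ℤ}

set_option maxRecDepth 100000

section Face

variable {n : ℕ} [NeZero n] {y : Fin n → X}

theorem opp_facePt_one (hopp : ∀ v, C.opp (y v) = C.rot (y (v + 1))) (v : Fin n) :
    C.opp (C.facePt y (v, 1)) = C.facePt y (v + 1, 2) := by
  rw [facePt_one, facePt_two, hopp]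

theorem opp_facePt_two (hopp : ∀ v, C.opp (y v) = C.rot (y (v + 1))) (v : Fin n) :
    C.opp (C.facePt y (v, 2)) = C.facePt y (v - 1, 1) := by
  rw [facePt_one, facePt_two, opp_rot_face hopp]

theorem half_eq_false (C : TriWeb X) {x : X} (h : C.thick x = false) : C.half x = false := by
  cases h' : C.half x
  · rfl
  · rw [C.thick_of_half x h'] at h; exact absurd h (by simp)

theorem thick_facePt (hopp : ∀ v, C.opp (y v) = C.rot (y (v + 1)))
    (hy : ∀ v, C.thick (y v) = false) (v : Fin n) :
    C.thick (C.facePt y (v, 1)) = false ∧ C.thick (C.facePt y (v, 2)) = false := by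
  constructor
  · rw [facePt_one, hy]
  · rw [facePt_two, ← C.thick_opp, opp_rot_face hopp, hy]

theorem half_facePt (hopp : ∀ v, C.opp (y v) = C.rot (y (v + 1)))
    (hy : ∀ v, C.thick (y v) = false) (v : Fin n) :
    C.half (C.facePt y (v, 1)) = false ∧ C.half (C.facePt y (v, 2)) = false :=
  ⟨C.half_eq_false (thick_facePt hopp hy v).1, C.half_eq_false (thick_facePt hopp hy v).2⟩

end Face

theorem represents_triangle111 (hf : SatisfiesAll f) (hg : SatisfiesAll g) (H : C.IsPlane)
    (hc : C.Connected) {y : Fin 3 → X} (hy : Function.Injective y)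
    (hne : ∀ v w, C.rot (y v) ≠ y w) (hopp : ∀ v, C.opp (y v) = C.rot (y (v + 1)))
    (hd : ∀ i, C.thick (C.rot (C.rot (y i))) = ![true, true, true] i)
    (hthin : ∀ v, C.thick (y v) = false)
    (hclass : ∀ v a, C.region (some (y v)) a → ∃ w, a = some (y w)) :
    (C.faceSite y hy hne hopp _ hd).IsDisc ∧ Represents f g C
      (((C.faceSite y hy hne hopp _ hd).outer C.half C.thick_of_half).glue .triangle111) := by
  have D := faceSite_isDisc H hy hne hopp _ hd hclass (by decide)
  have t := thick_facePt hopp hthin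
  have s := half_facePt hopp hthin
  have o1 := fun v => (opp_facePt_one hopp v).symm
  have o2 := fun v => (opp_facePt_two hopp v).symm
  refine ⟨D, Site.IsFilling.represents (Site.IsExtension.isFilling (C' := C)
    (D.isExtension (fun _ _ => rfl)) Fin.elim0 Fin.elim0 ?_ ?_ ?_ ?_ ?_)
    D Tangle.triangle111_isPlane hf hg H H hc⟩
  · intro v j
    fin_cases v <;> fin_cases j
    exacts [(hd 0).symm, (t 0).1.symm, (t 0).2.symm, (hd 1).symm, (t 1).1.symm, (t 1).2.symm,
      (hd 2).symm, (t 2).1.symm, (t 2).2.symm]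
  · rintro ((⟨v, j⟩ | ⟨v, j⟩) | i)
    · fin_cases v <;> fin_cases j
      exacts [rfl, o1 0, o2 0, rfl, o1 1, o2 1, rfl, o1 2, o2 2]
    · exact v.elim0
    · fin_cases i
      exacts [(C.opp_opp _).symm, (C.opp_opp _).symm, (C.opp_opp _).symm]
  · rintro ((⟨v, j⟩ | ⟨v, j⟩) | i)
    · fin_cases v <;> fin_cases j
      exacts [rfl, (s 1).2.trans (s 0).1.symm, (s 2).1.trans (s 0).2.symm,
        rfl, (s 2).2.trans (s 1).1.symm, (s 0).1.trans (s 1).2.symm,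
        rfl, (s 0).2.trans (s 2).1.symm, (s 1).1.trans (s 2).2.symm]
    · exact v.elim0
    · fin_cases i
      exacts [rfl, rfl, rfl]
  · exact fun v => v.elim0
  · intro i
    fin_cases i
    exacts [⟨_, rfl⟩, ⟨_, rfl⟩, ⟨_, rfl⟩]

theorem represents_digon11 (hf : SatisfiesAll f) (hg : SatisfiesAll g) (H : C.IsPlane)
    (hc : C.Connected) {y : Fin 2 → X} (hy : Function.Injective y)
    (hne : ∀ v w, C.rot (y v) ≠ y w) (hopp : ∀ v, C.opp (y v) = C.rot (y (v + 1)))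
    (hd : ∀ i, C.thick (C.rot (C.rot (y i))) = ![true, true] i)
    (hthin : ∀ v, C.thick (y v) = false)
    (hclass : ∀ v a, C.region (some (y v)) a → ∃ w, a = some (y w)) :
    (C.faceSite y hy hne hopp _ hd).IsDisc ∧ Represents f g C
      (((C.faceSite y hy hne hopp _ hd).outer C.half C.thick_of_half).glue .digon11) := by
  have D := faceSite_isDisc H hy hne hopp _ hd hclass (by decide)
  have t := thick_facePt hopp hthin
  have s := half_facePt hopp hthin
  have o1 := fun v => (opp_facePt_one hopp v).symm
  have o2 := fun v => (opp_facePt_two hopp v).symm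
  refine ⟨D, Site.IsFilling.represents (Site.IsExtension.isFilling (C' := C)
    (D.isExtension (fun _ _ => rfl)) Fin.elim0 Fin.elim0 ?_ ?_ ?_ ?_ ?_)
    D Tangle.digon11_isPlane hf hg H H hc⟩
  · intro v j
    fin_cases v <;> fin_cases j
    exacts [(hd 0).symm, (t 0).1.symm, (t 0).2.symm, (hd 1).symm, (t 1).1.symm, (t 1).2.symm]
  · rintro ((⟨v, j⟩ | ⟨v, j⟩) | i)
    · fin_cases v <;> fin_cases j
      exacts [rfl, o1 0, o2 0, rfl, o1 1, o2 1]
    · exact v.elim0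
    · fin_cases i
      exacts [(C.opp_opp _).symm, (C.opp_opp _).symm]
  · rintro ((⟨v, j⟩ | ⟨v, j⟩) | i)
    · fin_cases v <;> fin_cases j
      exacts [rfl, (s 1).2.trans (s 0).1.symm, (s 1).1.trans (s 0).2.symm,
        rfl, (s 0).2.trans (s 1).1.symm, (s 0).1.trans (s 1).2.symm]
    · exact v.elim0
    · fin_cases i
      exacts [rfl, rfl]
  · exact fun v => v.elim0
  · intro i
    fin_cases i
    exacts [⟨_, rfl⟩, ⟨_, rfl⟩]

/-- A thin loop around a face without further sides makes both invariants vanish. -/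
theorem agree_of_lollipop (hf : SatisfiesAll f) (hg : SatisfiesAll g) (H : C.IsPlane)
    (hc : C.Connected) {y : Fin 1 → X}
    (hopp : ∀ v, C.opp (y v) = C.rot (y (v + 1)))
    (hd : ∀ i, C.thick (C.rot (C.rot (y i))) = ![true] i)
    (hthin : ∀ v, C.thick (y v) = false)
    (hclass : ∀ v a, C.region (some (y v)) a → ∃ w, a = some (y w)) : C.Agree f g := by
  have hy : Function.Injective y := fun _ _ _ => Subsingleton.elim _ _
  have hne : ∀ v w, C.rot (y v) ≠ y w := fun v w h => by
    rw [Subsingleton.elim w v] at h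
    exact C.rot_ne _ h
  have D := faceSite_isDisc H hy hne hopp _ hd hclass (by decide)
  have ho : C.opp (y 0) = C.rot (y 0) := hopp 0
  have ho' : C.opp (C.rot (y 0)) = y 0 := by rw [← ho, C.opp_opp]
  have t : C.thick (C.rot (y 0)) = false := by rw [← ho, C.thick_opp, hthin]
  have s := C.half_eq_false t
  have s' := C.half_eq_false (hthin 0)
  -- `facePt` and the code of the lollipop number the darts at the vertex differently
  have E : (C.faceSite y hy hne hopp _ hd).IsExtension C.half C fun q => C.star (y 0) q.2 :=
    { D.isExtension (fun _ _ => rfl) with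
      injective := fun ⟨v, i⟩ ⟨w, j⟩ h => Prod.ext (Subsingleton.elim _ _) (C.star_injective _ h)
      rot_pt := fun _ => C.rot_star _
      inside := by
        have h1 : ∀ j, C.facePt y (0, j) = C.star (y 0) (j - 1) := by
          intro j
          fin_cases j
          exacts [rfl, C.rot_rot_rot _, congrArg C.rot (C.rot_rot_rot _)]
        intro x
        constructor
        · rintro ⟨⟨v, j⟩, rfl⟩
          exact ⟨(0, j - 1), by rw [Subsingleton.elim v 0]; exact (h1 j).symm⟩
        · rintro ⟨⟨v, j⟩, rfl⟩
          exact ⟨(0, j + 1), (h1 (j + 1)).trans (by rw [add_sub_cancel_right])⟩ }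
  have h1 : Represents f g C
      (((C.faceSite y hy hne hopp _ hd).outer C.half C.thick_of_half).glue .lollipop) := by
    refine Site.IsFilling.represents (Site.IsExtension.isFilling (C' := C)
      E Fin.elim0 Fin.elim0 ?_ ?_ ?_ ?_ ?_)
      D Tangle.lollipop_isPlane hf hg H H hc
    · intro v j
      fin_cases v; fin_cases j
      exacts [(hthin 0).symm, t.symm, (hd 0).symm]
    · rintro ((⟨v, j⟩ | ⟨v, j⟩) | i)
      · fin_cases v; fin_cases j
        exacts [ho.symm, ho'.symm, rfl]
      · exact v.elim0
      · fin_cases i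
        exact (C.opp_opp _).symm
    · rintro ((⟨v, j⟩ | ⟨v, j⟩) | i)
      · fin_cases v; fin_cases j
        exacts [s.trans s'.symm, s'.trans s.symm, rfl]
      · exact v.elim0
      · fin_cases i
        rfl
    · exact fun v => v.elim0
    · intro i
      fin_cases i
      exact ⟨_, rfl⟩
  have HO := Site.outer_isPlane D H C.half C.thick_of_half
  rw [h1.agree_iff, hf.web.lollipop _ HO, hg.web.lollipop _ HO]

end TriWeb

/-! ### Flipping an edge -/

namespace TriWeb

variable {X : Type} {C : TriWeb X} {f g : WebDiagram → ℤ}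

set_option maxRecDepth 100000

/-- In a trivalent map, cycles modulo two are described by one equation at each vertex. -/
theorem isCycle_iff [Fintype X] (rot opp : Perm X) (hrot : ∀ x, IsTrivalent rot x)
    (z : X → ZMod 2) : IsCycle rot opp z ↔
      (∀ x, z (opp x) = z x) ∧ ∀ x, z x + z (rot x) + z (rot (rot x)) = 0 := by
  classical
  have h3 : ∀ a : ZMod 2, a + a + a = a := by decide
  have hsum : ∀ F : X → ZMod 2, ∑ x, F x = ∑ x, (F x + F (rot x) + F (rot (rot x))) := fun F => by
    have e1 : ∑ x, F (rot x) = ∑ x, F x := Equiv.sum_comp rot F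
    have e2 : ∑ x, F (rot (rot x)) = ∑ x, F x := (Equiv.sum_comp rot fun x => F (rot x)).trans e1
    rw [Finset.sum_add_distrib, Finset.sum_add_distrib, e1, e2, h3]
  constructor
  · refine fun hz => ⟨hz.opp, fun x => ?_⟩
    have hx := hrot x
    have n1 : rot x ≠ x := hx.1
    have n2 : rot (rot x) ≠ x := hx.rot_rot_ne
    have n3 : rot (rot x) ≠ rot x := fun h => n1 (rot.injective h)
    have := hz.vertex (fun y => if y = x ∨ y = rot x ∨ y = rot (rot x) then 1 else 0) (fun y => by
      have e1 : rot y = x ↔ y = rot (rot x) := by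
        rw [← rot.injective.eq_iff (b := rot (rot x)), hx.2]
      simp only [e1, rot.injective.eq_iff]
      congr 1
      exact propext ⟨fun h => by tauto, fun h => by tauto⟩)
    simp only [ite_mul, one_mul, zero_mul] at this
    rw [← Finset.sum_filter, show Finset.univ.filter
      (fun y => y = x ∨ y = rot x ∨ y = rot (rot x)) = {x, rot x, rot (rot x)} by ext; simp,
      Finset.sum_insert (by simp [n1.symm, n2.symm]), Finset.sum_pair n3.symm, ← add_assoc] at this
    exact this
  · rintro ⟨h1, h2⟩
    refine ⟨h1, fun h hh => ?_⟩
    rw [hsum]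
    refine Finset.sum_eq_zero fun x _ => ?_
    rw [hh (rot x), hh x, ← mul_add, ← mul_add, h2, mul_zero]

theorem isCycle_iff_trivalent [Fintype X] (C : TriWeb X) (z : X → ZMod 2) :
    IsCycle C.rot C.opp z ↔
      (∀ x, z (C.opp x) = z x) ∧ ∀ x, z x + z (C.rot x) + z (C.rot (C.rot x)) = 0 :=
  isCycle_iff _ _ C.trivalent z

section Flip

variable {d : X} (hne : ∀ j, C.star d j ≠ C.opp d) (h0 : C.thick d = true)
  (hd : ∀ i, C.thick (C.edgePt d (edgeLeg i)) = ![false, false, false, false] i)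

/-- The rotation at the two new vertices. -/
def flipNext (q : Fin 2 × Fin 3) : Fin 2 × Fin 3 :=
  ![![(0, 2), (1, 0), (1, 1)], ![(1, 2), (0, 0), (0, 1)]] q.1 q.2

/-- After the flip, the regions to the left of the darts of the new edge are those to the left of
two of the legs. -/
def flipLeft (q : Fin 2 × Fin 3) : Fin 2 × Fin 3 :=
  ![![(0, 0), (0, 1), (1, 0)], ![(1, 0), (1, 1), (0, 0)]] q.1 q.2

/-- The darts at the two new vertices. -/
def flipVertex (q : Fin 2 × Fin 3) : Fin 2 × Fin 3 :=
  ![![(0, 0), (0, 2), (1, 1)], ![(0, 1), (1, 0), (1, 2)]] q.1 q.2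

theorem edgePt_injective (hne : ∀ j, C.star d j ≠ C.opp d) : Function.Injective (C.edgePt d) :=
  (C.edgeSite d hne _ fun _ => rfl).injective

/-- The rotation after the flip, as a function. -/
noncomputable def flipRotFun (C : TriWeb X) (d : X) : X → X :=
  Function.extend (C.edgePt d) (fun q => C.edgePt d (flipNext q)) C.rot

/-- A dart of the original graph that has on its left the region which a given dart has on its left
after the flip. -/
noncomputable def flipLabel (C : TriWeb X) (d : X) : X → X :=
  Function.extend (C.edgePt d) (fun q => C.edgePt d (flipLeft q)) id

theorem flipRotFun_pt (hne : ∀ j, C.star d j ≠ C.opp d) (q) :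
    C.flipRotFun d (C.edgePt d q) = C.edgePt d (flipNext q) :=
  (edgePt_injective hne).extend_apply _ _ _

theorem flipLabel_pt (hne : ∀ j, C.star d j ≠ C.opp d) (q) :
    C.flipLabel d (C.edgePt d q) = C.edgePt d (flipLeft q) :=
  (edgePt_injective hne).extend_apply _ _ _

theorem flipRotFun_of_not {x : X} (hx : ∀ q, C.edgePt d q ≠ x) : C.flipRotFun d x = C.rot x :=
  Function.extend_apply' _ _ _ fun ⟨q, hq⟩ => hx q hq

theorem flipLabel_of_not {x : X} (hx : ∀ q, C.edgePt d q ≠ x) : C.flipLabel d x = x :=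
  Function.extend_apply' _ _ _ fun ⟨q, hq⟩ => hx q hq

theorem edgePt_ne_rot {x : X} (hx : ∀ q, C.edgePt d q ≠ x) (q) : C.edgePt d q ≠ C.rot x := by
  intro h
  refine hx (q.1, q.2 - 1) (C.rot.injective ?_)
  rw [← h]
  exact (C.rot_star _ _).trans (by rw [sub_add_cancel]; rfl)

theorem edgePt_cases (C : TriWeb X) (d x : X) :
    (∃ q, C.edgePt d q = x) ∨ ∀ q, C.edgePt d q ≠ x := by
  by_cases h : ∃ q, C.edgePt d q = x
  · exact Or.inl h
  · exact Or.inr fun q hq => h ⟨q, hq⟩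

theorem flipRotFun_three (hne : ∀ j, C.star d j ≠ C.opp d) (x : X) :
    C.flipRotFun d (C.flipRotFun d (C.flipRotFun d x)) = x := by
  rcases C.edgePt_cases d x with ⟨q, rfl⟩ | hx
  · rw [flipRotFun_pt hne, flipRotFun_pt hne, flipRotFun_pt hne]
    have : ∀ q, flipNext (flipNext (flipNext q)) = q := by decide
    rw [this]
  · rw [flipRotFun_of_not hx, flipRotFun_of_not (edgePt_ne_rot hx),
      flipRotFun_of_not (edgePt_ne_rot (edgePt_ne_rot hx)), C.rot_rot_rot]

/-- The rotation after the flip, as a permutation of order three. -/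
noncomputable def flipRot (hne : ∀ j, C.star d j ≠ C.opp d) : Perm X where
  toFun := C.flipRotFun d
  invFun x := C.flipRotFun d (C.flipRotFun d x)
  left_inv := flipRotFun_three hne
  right_inv := flipRotFun_three hne

theorem thick_edgePt (h0 : C.thick d = true)
    (hd : ∀ i, C.thick (C.edgePt d (edgeLeg i)) = ![false, false, false, false] i) (q) :
    C.thick (C.edgePt d q) = decide (q.2 = 2) := by
  obtain ⟨v, j⟩ := q
  fin_cases v <;> fin_cases j
  exacts [hd 0, hd 1, (congrArg C.thick (C.edgePt_two d).1).trans h0, hd 2, hd 3,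
    (congrArg C.thick (C.edgePt_two d).2).trans ((C.thick_opp d).trans h0)]

theorem flipRotFun_ne (hne : ∀ j, C.star d j ≠ C.opp d) (x : X) : C.flipRotFun d x ≠ x := by
  rcases C.edgePt_cases d x with ⟨q, rfl⟩ | hx
  · rw [flipRotFun_pt hne]
    have : ∀ q, flipNext q ≠ q := by decide
    exact fun h => this q (edgePt_injective hne h)
  · rw [flipRotFun_of_not hx]
    exact C.rot_ne x

/-- Replacing a thick edge between two `112`-vertices by the transversal edge.  The edges keep their
darts; the new regions are obtained from the old ones by `flipLabel`. -/
noncomputable def flip (hne : ∀ j, C.star d j ≠ C.opp d) (h0 : C.thick d = true)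
    (hd : ∀ i, C.thick (C.edgePt d (edgeLeg i)) = ![false, false, false, false] i) : TriWeb X :=
  { C with
    rot := flipRot hne
    region := C.region.comap (Option.map (C.flipLabel d))
    trivalent := fun x => ⟨flipRotFun_ne hne x, flipRotFun_three hne x⟩
    vertex := fun x => by
      right
      refine ⟨⟨flipRotFun_ne hne x, flipRotFun_three hne x⟩, rfl, ?_⟩
      change (_ ∧ C.thick (C.flipRotFun d x) = true ∧
          C.thick (C.flipRotFun d (C.flipRotFun d x)) = true) ∨
        (_ ∧ C.thick (C.flipRotFun d x) = false ∧
          C.thick (C.flipRotFun d (C.flipRotFun d x)) = false) ∨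
        (_ ∧ C.thick (C.flipRotFun d x) = true ∧
          C.thick (C.flipRotFun d (C.flipRotFun d x)) = false) ∨
        (_ ∧ C.thick (C.flipRotFun d x) = false ∧
          C.thick (C.flipRotFun d (C.flipRotFun d x)) = true)
      rcases C.edgePt_cases d x with ⟨q, rfl⟩ | hx
      · rw [flipRotFun_pt hne, flipRotFun_pt hne, thick_edgePt h0 hd, thick_edgePt h0 hd,
          thick_edgePt h0 hd]
        revert q; decide
      · rw [flipRotFun_of_not hx, flipRotFun_of_not (edgePt_ne_rot hx)]
        exact (C.vertex x).elim (fun h => absurd h.1 (C.trivalent x).not_isBivalent)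
          fun h => h.2.2 }

variable {hne h0 hd}

theorem opp_edgePt_ne {x : X} (hx : ∀ q, q.2 = 2 → C.edgePt d q ≠ x) (q : Fin 2 × Fin 3)
    (hq : q.2 = 2) : C.edgePt d q ≠ C.opp x := by
  obtain ⟨v, j⟩ := q
  obtain rfl : j = 2 := hq
  intro h
  have h' := congrArg C.opp h
  rw [C.opp_opp] at h'
  fin_cases v
  · exact hx (1, 2) rfl ((C.edgePt_opp d).trans h')
  · exact hx (0, 2) rfl ((C.edgePt_opp' d).trans h')

theorem flipLabel_eq_self (hne : ∀ j, C.star d j ≠ C.opp d) {x : X}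
    (hx : ∀ q, q.2 = 2 → C.edgePt d q ≠ x) : C.flipLabel d x = x := by
  rcases C.edgePt_cases d x with ⟨q, rfl⟩ | hx'
  · rw [flipLabel_pt hne]
    have : ∀ q : Fin 2 × Fin 3, q.2 ≠ 2 → flipLeft q = q := by decide
    rw [this q fun h => hx q h rfl]
  · exact flipLabel_of_not hx'

theorem flip_connected (hc : C.Connected) : (flip hne h0 hd).Connected := by
  intro Z hr ho
  have hr' : ∀ q, Z (C.edgePt d (flipNext q)) ↔ Z (C.edgePt d q) := fun q => by
    rw [← flipRotFun_pt hne]; exact hr _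
  have hall : ∀ q, Z (C.edgePt d q) ↔ Z d := by
    have e1 : Z (C.edgePt d (0, 2)) ↔ Z d := by rw [(C.edgePt_two d).1]
    have e2 : Z (C.edgePt d (1, 2)) ↔ Z d := by rw [(C.edgePt_two d).2]; exact ho d
    have a1 := hr' (0, 0)
    have a2 := hr' (0, 2)
    have b1 := hr' (0, 1)
    have b2 := hr' (1, 0)
    simp only [flipNext, Matrix.cons_val] at a1 a2 b1 b2
    rintro ⟨v, j⟩
    fin_cases v <;> fin_cases j <;> simp only [Fin.zero_eta, Fin.mk_one, Fin.reduceFinMk] <;> tauto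
  refine hc Z (fun x => ?_) ho
  rcases C.edgePt_cases d x with ⟨q, rfl⟩ | hx
  · have : C.rot (C.edgePt d q) = C.edgePt d (q.1, q.2 + 1) := C.rot_star _ _
    rw [this, hall, hall]
  · rw [← flipRotFun_of_not hx]; exact hr x

theorem edgePt_rot (C : TriWeb X) (d : X) (v : Fin 2) (j : Fin 3) :
    C.rot (C.edgePt d (v, j)) = C.edgePt d (v, j + 1) := C.rot_star _ _

/-- The regions next to an edge. -/
theorem edge_regions (H : C.IsPlane) (d : X) :
    C.region (some (C.opp (C.edgePt d (0, 0)))) (some (C.edgePt d (0, 2))) ∧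
    C.region (some (C.opp (C.edgePt d (0, 1)))) (some (C.edgePt d (0, 0))) ∧
    C.region (some (C.opp (C.edgePt d (1, 0)))) (some (C.edgePt d (1, 2))) ∧
    C.region (some (C.opp (C.edgePt d (1, 1)))) (some (C.edgePt d (1, 0))) ∧
    C.region (some (C.edgePt d (0, 2))) (some (C.edgePt d (1, 1))) ∧
    C.region (some (C.edgePt d (1, 2))) (some (C.edgePt d (0, 1))) := by
  have h := fun v j => region_opp_rot H (C.edgePt d (v, j))
  simp only [edgePt_rot] at h
  refine ⟨h 0 2, h 0 0, h 1 2, h 1 0, ?_, ?_⟩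
  · rw [edgePt_opp']; exact h 1 1
  · rw [edgePt_opp]; exact h 0 1

/-- Flipping an edge preserves planarity. -/
theorem flip_isPlane (H : C.IsPlane) : (flip hne h0 hd).IsPlane := by
  classical
  have := C.finite
  let := Fintype.ofFinite X
  obtain ⟨ra, rb, rc, re, rd, rd'⟩ := edge_regions H d
  have H0 := (C.isPlane_iff).1 H
  have ho1 := C.edgePt_opp d
  have ho2 := C.edgePt_opp' d
  have hl := flipLabel_pt hne
  have hr := flipRotFun_pt hne
  have hopp : ∀ q : Fin 2 × Fin 3, q.2 ≠ 2 →
      C.flipLabel d (C.opp (C.edgePt d q)) = C.opp (C.edgePt d q) := fun q hq =>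
    flipLabel_eq_self hne (opp_edgePt_ne fun q' hq' h => hq (by
      rw [← edgePt_injective hne h, hq']))
  refine ((flip hne h0 hd).isPlane_iff).2 ⟨?_, ?_, ?_⟩
  -- the face condition, at the six darts in the disc and elsewhere
  · have key : ∀ w, C.region (some (C.flipLabel d (C.opp (C.flipRotFun d w))))
        (some (C.flipLabel d w)) := by
      intro w
      rcases C.edgePt_cases d w with ⟨⟨v, j⟩, rfl⟩ | hw
      · rw [hl, hr]
        fin_cases v <;> fin_cases j
        · change C.region (some (C.flipLabel d (C.opp (C.edgePt d (0, 2)))))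
            (some (C.edgePt d (0, 0)))
          rw [← ho1, hl]
          exact C.region.refl _
        · change C.region (some (C.flipLabel d (C.opp (C.edgePt d (1, 0)))))
            (some (C.edgePt d (0, 1)))
          rw [hopp _ (by decide)]
          exact C.region.trans rc rd'
        · change C.region (some (C.flipLabel d (C.opp (C.edgePt d (1, 1)))))
            (some (C.edgePt d (1, 0)))
          rw [hopp _ (by decide)]
          exact re
        · change C.region (some (C.flipLabel d (C.opp (C.edgePt d (1, 2)))))
            (some (C.edgePt d (1, 0)))
          rw [← ho2, hl]
          exact C.region.refl _
        · change C.region (some (C.flipLabel d (C.opp (C.edgePt d (0, 0)))))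
            (some (C.edgePt d (1, 1)))
          rw [hopp _ (by decide)]
          exact C.region.trans ra rd
        · change C.region (some (C.flipLabel d (C.opp (C.edgePt d (0, 1)))))
            (some (C.edgePt d (0, 0)))
          rw [hopp _ (by decide)]
          exact rb
      · rw [flipRotFun_of_not hw, flipLabel_of_not hw, flipLabel_eq_self hne
          (opp_edgePt_ne fun q _ => edgePt_ne_rot hw q)]
        exact region_opp_rot H w
    intro x
    have h1 := key ((flipRot hne).symm (C.opp x))
    have h2 : C.flipRotFun d ((flipRot hne).symm (C.opp x)) = C.opp x :=
      (flipRot hne).apply_symm_apply _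
    rw [h2, C.opp_opp] at h1
    exact h1
  · intro ψ h1 h2 h3
    -- linkedness: an invariant function `ψ` is constant on the darts in the disc
    have h1' : ∀ a b : Option X, C.region (a.map (C.flipLabel d)) (b.map (C.flipLabel d)) →
      ψ a = ψ b := h1
    have h2' : ∀ x, ψ (some (C.flipRotFun d x)) = ψ (some x) := h2
    have h3' : ∀ x, ψ (some (C.opp x)) = ψ (some x) := h3
    have hall : ∀ q, ψ (some (C.edgePt d q)) = ψ (some (C.edgePt d (0, 0))) := by
      have hs := fun q => h2' (C.edgePt d q)
      simp only [hr] at hs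
      have a1 : ψ (some (C.edgePt d (0, 2))) = ψ (some (C.edgePt d (0, 0))) := hs (0, 0)
      have a2 : ψ (some (C.edgePt d (1, 1))) = ψ (some (C.edgePt d (0, 2))) := hs (0, 2)
      have b1 : ψ (some (C.edgePt d (1, 0))) = ψ (some (C.edgePt d (0, 1))) := hs (0, 1)
      have b2 : ψ (some (C.edgePt d (1, 2))) = ψ (some (C.edgePt d (1, 0))) := hs (1, 0)
      have c1 : ψ (some (C.edgePt d (1, 2))) = ψ (some (C.edgePt d (0, 2))) := by
        rw [ho1]; exact h3' _
      have e1 := c1.trans a1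
      have e2 := b2.symm.trans e1
      rintro ⟨v, j⟩
      fin_cases v <;> fin_cases j
      exacts [rfl, b1.symm.trans e2, a1, e2, a2.trans a1, e1]
    -- `r` replaces the darts of the middle edge by legs with the same region in the original graph,
    -- so that regions are compared on darts that are not affected by the flip
    let r : X → X := Function.extend (C.edgePt d)
      (fun q => C.edgePt d (if q = (0, 2) then (1, 1) else if q = (1, 2) then (0, 1) else q)) id
    have hrpt : ∀ q, r (C.edgePt d q) =
        C.edgePt d (if q = (0, 2) then (1, 1) else if q = (1, 2) then (0, 1) else q) := fun q =>
      (edgePt_injective hne).extend_apply _ _ _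
    have hrid : ∀ x, (∀ q, C.edgePt d q ≠ x) → r x = x := fun x hx =>
      Function.extend_apply' _ _ _ fun ⟨q, hq⟩ => hx q hq
    have r1 : ∀ x, C.region (some x) (some (r x)) := by
      intro x
      rcases C.edgePt_cases d x with ⟨⟨v, j⟩, rfl⟩ | hx
      · rw [hrpt]
        fin_cases v <;> fin_cases j
        exacts [C.region.refl _, C.region.refl _, rd, C.region.refl _, C.region.refl _, rd']
      · rw [hrid x hx]
    have r2 : ∀ x, C.flipLabel d (r x) = r x := by
      intro x
      rcases C.edgePt_cases d x with ⟨q, rfl⟩ | hx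
      · rw [hrpt, hl]
        have : ∀ q : Fin 2 × Fin 3, flipLeft (if q = (0, 2) then (1, 1) else
          if q = (1, 2) then (0, 1) else q) = if q = (0, 2) then (1, 1) else
          if q = (1, 2) then (0, 1) else q := by decide
        rw [this]
      · rw [hrid x hx, flipLabel_of_not hx]
    have r3 : ∀ x, ψ (some (r x)) = ψ (some x) := by
      intro x
      rcases C.edgePt_cases d x with ⟨q, rfl⟩ | hx
      · rw [hrpt, hall, hall q]
      · rw [hrid x hx]
    refine H0.linked ψ (fun a b hab => ?_) (fun x => ?_) h3'
    · have e1 : ∀ a : Option X, C.region a (a.map r) := by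
        rintro (_ | x)
        exacts [C.region.refl _, r1 x]
      have e2 : ∀ a : Option X, (a.map r).map (C.flipLabel d) = a.map r := by
        rintro (_ | x)
        exacts [rfl, congrArg some (r2 x)]
      have e3 : ∀ a : Option X, ψ (a.map r) = ψ a := by
        rintro (_ | x)
        exacts [rfl, r3 x]
      rw [← e3, ← e3 b]
      refine h1' _ _ ?_
      rw [e2, e2]
      exact C.region.trans (C.region.symm (e1 a)) (C.region.trans hab (e1 b))
    · rcases C.edgePt_cases d x with ⟨⟨v, j⟩, rfl⟩ | hx
      · rw [edgePt_rot, hall, hall (v, j)]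
      · rw [← flipRotFun_of_not hx, h2']
  · intro z' hz'
    -- a cycle is turned into a cycle of the original graph by changing its value on the middle edge
    -- to the sum `k` over the legs at one end; the set it bounds also works after the flip
    have hz := ((flip hne h0 hd).isCycle_iff_trivalent z').1 hz'
    have z1 : ∀ x, z' (C.opp x) = z' x := hz.1
    have z2 : ∀ x, z' x + z' (C.flipRotFun d x) + z' (C.flipRotFun d (C.flipRotFun d x)) = 0 := hz.2
    have s1 : z' (C.edgePt d (0, 0)) + z' (C.edgePt d (0, 2)) + z' (C.edgePt d (1, 1)) = 0 := by
      have := z2 (C.edgePt d (0, 0)); rw [hr, hr] at this; exact this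
    have s2 : z' (C.edgePt d (0, 1)) + z' (C.edgePt d (1, 0)) + z' (C.edgePt d (1, 2)) = 0 := by
      have := z2 (C.edgePt d (0, 1)); rw [hr, hr] at this; exact this
    have s3 : z' (C.edgePt d (1, 2)) = z' (C.edgePt d (0, 2)) := by rw [ho1, z1]
    let k := z' (C.edgePt d (0, 0)) + z' (C.edgePt d (0, 1))
    let z : X → ZMod 2 := fun x =>
      if x = C.edgePt d (0, 2) ∨ x = C.edgePt d (1, 2) then k else z' x
    have zc : ∀ v, z (C.edgePt d (v, 2)) = k := fun v => by
      fin_cases v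
      exacts [if_pos (Or.inl rfl), if_pos (Or.inr rfl)]
    have zl : ∀ q : Fin 2 × Fin 3, q.2 ≠ 2 → z (C.edgePt d q) = z' (C.edgePt d q) := fun q hq =>
      if_neg fun h => h.elim (fun h => hq (by rw [edgePt_injective hne h]))
        (fun h => hq (by rw [edgePt_injective hne h]))
    have zo : ∀ x, (∀ q, C.edgePt d q ≠ x) → z x = z' x := fun x hx =>
      if_neg fun h => h.elim (fun h => hx _ h.symm) (fun h => hx _ h.symm)
    have hcyc : IsCycle C.rot C.opp z := by
      refine (C.isCycle_iff_trivalent z).2 ⟨fun x => ?_, fun x => ?_⟩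
      · have e1 : C.opp x = C.edgePt d (0, 2) ↔ x = C.edgePt d (1, 2) := by
          rw [ho1, ← C.opp.injective.eq_iff (a := C.opp x), C.opp_opp]
        have e2 : C.opp x = C.edgePt d (1, 2) ↔ x = C.edgePt d (0, 2) := by
          rw [ho2, ← C.opp.injective.eq_iff (a := C.opp x), C.opp_opp]
        simp only [z, e1, e2, z1, or_comm]
      · rcases C.edgePt_cases d x with ⟨⟨v, j⟩, rfl⟩ | hx
        · have h5 : ∀ a b c e D : ZMod 2, a + D + e = 0 → b + c + D = 0 →
            a + b + c + e = 0 := by decide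
          rw [s3] at s2
          have h6 := h5 _ _ _ _ _ s1 s2
          have hv : z (C.edgePt d (v, 0)) + z (C.edgePt d (v, 1)) + z (C.edgePt d (v, 2)) = 0 := by
            rw [zc, zl _ (by simp), zl _ (by simp)]
            fin_cases v
            · exact zmod_two_add_self _
            · have h7 : ∀ a b c e : ZMod 2, a + b + c + e = 0 → c + e + (a + b) = 0 := by decide
              exact h7 _ _ _ _ h6
          rw [edgePt_rot, edgePt_rot]
          have h8 : ∀ a b c : ZMod 2, a + b + c = 0 → b + c + a = 0 ∧ c + a + b = 0 := by decide
          fin_cases j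
          exacts [hv, (h8 _ _ _ hv).1, (h8 _ _ _ hv).2]
        · rw [zo x hx, zo _ (edgePt_ne_rot hx), zo _ (edgePt_ne_rot (edgePt_ne_rot hx))]
          have := z2 x
          rwa [flipRotFun_of_not hx, flipRotFun_of_not (edgePt_ne_rot hx)] at this
    obtain ⟨φ, p1, p2⟩ := H0.boundary z hcyc
    refine ⟨fun a => φ (a.map (C.flipLabel d)), fun a b hab => p1 _ _ hab, fun x => ?_⟩
    change z' x = φ (some (C.flipLabel d x)) + φ (some (C.flipLabel d (C.opp x)))
    have pc : z' (C.edgePt d (0, 2)) = φ (some (C.edgePt d (1, 0))) + φ (some (C.edgePt d (0, 0))) := by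
      have q1 := p2 (C.edgePt d (0, 0))
      have q2 := p2 (C.edgePt d (1, 1))
      rw [zl _ (by simp), p1 _ _ ra, p1 _ _ rd] at q1
      rw [zl _ (by simp), p1 _ _ re] at q2
      rw [q1, q2] at s1
      have h7 : ∀ a c e D : ZMod 2, a + e + D + (e + c) = 0 → D = c + a := by decide
      exact h7 _ _ _ _ s1
    by_cases hx : ∀ q, q.2 = 2 → C.edgePt d q ≠ x
    · rw [flipLabel_eq_self hne hx, flipLabel_eq_self hne (opp_edgePt_ne hx), ← p2]
      exact (if_neg fun h => h.elim (fun h => hx _ rfl h.symm) (fun h => hx _ rfl h.symm)).symm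
    · push Not at hx
      obtain ⟨⟨v, j⟩, hj, rfl⟩ := hx
      obtain rfl : j = 2 := hj
      fin_cases v
      · change z' (C.edgePt d (0, 2)) = φ (some (C.flipLabel d (C.edgePt d (0, 2)))) +
          φ (some (C.flipLabel d (C.opp (C.edgePt d (0, 2)))))
        rw [← ho1, hl, hl]
        exact pc
      · change z' (C.edgePt d (1, 2)) = φ (some (C.flipLabel d (C.edgePt d (1, 2)))) +
          φ (some (C.flipLabel d (C.opp (C.edgePt d (1, 2)))))
        rw [← ho2, hl, hl, s3, pc]
        exact add_comm _ _

end Flip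

end TriWeb

namespace TriWeb

variable {X : Type} {C : TriWeb X} {f g : WebDiagram → ℤ}

set_option maxRecDepth 100000

section Flip

variable {d : X} {hne : ∀ j, C.star d j ≠ C.opp d} {h0 : C.thick d = true}
  {hd : ∀ i, C.thick (C.edgePt d (edgeLeg i)) = ![false, false, false, false] i}

/-- The flipped graph differs from the original one only inside the disc around the edge. -/
theorem flip_isExtension (H : C.IsPlane) : (C.edgeSite d hne _ hd).IsExtension C.half
    (flip hne h0 hd) fun q => C.edgePt d (flipVertex q) := by
  have hleg : ∀ i, (edgeLeg i).2 ≠ 2 := by decide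
  -- the regions of darts that are seen from outside are not renamed
  have hl : ∀ w, C.flipLabel d ((C.edgeSite d hne _ hd).incl w) =
      (C.edgeSite d hne _ hd).incl w := by
    rintro (x | i)
    · exact flipLabel_of_not fun q hq => x.2 ⟨q, hq⟩
    · refine flipLabel_eq_self hne fun q hq h => hleg i ?_
      have h' : q = edgeLeg i := edgePt_injective hne h
      rw [← h', hq]
  have D := edgeSite_isDisc H d hne _ hd
  refine ⟨fun _ => rfl, fun _ => rfl, ?_, fun _ _ => rfl, ?_, ?_, ?_, ?_, ?_⟩
  · exact fun x hx => flipRotFun_of_not fun q hq => hx ⟨q, hq⟩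
  · intro a b hab
    have h1 : ∀ a : Option _, (a.map (C.edgeSite d hne _ hd).incl).map (C.flipLabel d) =
        a.map (C.edgeSite d hne _ hd).incl := by
      rintro (_ | w)
      exacts [rfl, congrArg some (hl w)]
    change C.region ((a.map (C.edgeSite d hne _ hd).incl).map (C.flipLabel d))
      ((b.map (C.edgeSite d hne _ hd).incl).map (C.flipLabel d))
    rw [h1, h1]
    exact hab
  · intro i
    have h1 : ∀ i, C.flipLabel d (C.edgePt d (edgeLeg i)) = C.edgePt d (edgeLeg i) := fun i =>
      hl (.inr i)
    have h2 : ∀ i, C.flipLabel d (C.opp (C.edgePt d (edgeLeg i))) =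
        C.opp (C.edgePt d (edgeLeg i)) := fun i => by
      obtain ⟨w, hw⟩ := (C.edgeSite d hne _ hd).exists_incl_opp (.inr i)
      have hw' : (C.edgeSite d hne _ hd).incl w = C.opp (C.edgePt d (edgeLeg i)) := hw
      rw [← hw', hl]
    change C.region (some (C.flipLabel d (C.edgePt d (edgeLeg i))))
      (some (C.flipLabel d (C.opp (C.edgePt d (edgeLeg (finRotate 4 i))))))
    rw [h1, h2]
    exact D.leg i
  · have : Function.Injective flipVertex := by decide
    exact (edgePt_injective hne).comp this
  · intro v j
    refine (flipRotFun_pt hne _).trans ?_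
    have : ∀ v j, flipNext (flipVertex (v, j)) = flipVertex (v, j + 1) := by decide
    rw [this]
  · have : Function.Surjective flipVertex := by decide
    intro x
    constructor
    · rintro ⟨q, rfl⟩
      obtain ⟨q', rfl⟩ := this q
      exact ⟨q', rfl⟩
    · rintro ⟨q, rfl⟩
      exact ⟨_, rfl⟩

theorem thick_flipVertex (h0 : C.thick d = true)
    (hd : ∀ i, C.thick (C.edgePt d (edgeLeg i)) = ![false, false, false, false] i) (v j) :
    decide ((flipVertex (v, j)).2 = 2) = C.thick (C.edgePt d (flipVertex (v, j))) :=
  (thick_edgePt h0 hd _).symm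

theorem flip_represents_verticalDumbbell (hf : SatisfiesAll f) (hg : SatisfiesAll g) (H : C.IsPlane)
    (hc : C.Connected) (hp : C.half (C.opp d) = C.half d) :
    Represents f g (flip hne h0 hd)
      (((C.edgeSite d hne _ hd).outer C.half C.thick_of_half).glue .verticalDumbbell) := by
  have D := edgeSite_isDisc H d hne _ hd
  have hp' : C.half (C.edgePt d (1, 2)) = C.half (C.edgePt d (0, 2)) := by
    rw [(C.edgePt_two d).1, (C.edgePt_two d).2, hp]
  have t := thick_flipVertex h0 hd
  refine Site.IsFilling.represents (Site.IsExtension.isFilling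
    (flip_isExtension H) Fin.elim0 Fin.elim0 ?_ ?_ ?_ ?_ ?_)
    D Tangle.verticalDumbbell_isPlane hf hg H (flip_isPlane H) (flip_connected hc)
  · intro v j
    fin_cases v <;> fin_cases j
    exacts [t 0 0, t 0 1, t 0 2, t 1 0, t 1 1, t 1 2]
  · rintro ((⟨v, j⟩ | ⟨v, j⟩) | i)
    · fin_cases v <;> fin_cases j
      exacts [rfl, C.edgePt_opp d, rfl, rfl, rfl, C.edgePt_opp' d]
    · exact v.elim0
    · fin_cases i
      exacts [(C.opp_opp _).symm, (C.opp_opp _).symm, (C.opp_opp _).symm, (C.opp_opp _).symm]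
  · rintro ((⟨v, j⟩ | ⟨v, j⟩) | i)
    · fin_cases v <;> fin_cases j
      exacts [rfl, hp', rfl, rfl, rfl, hp'.symm]
    · exact v.elim0
    · fin_cases i
      exacts [rfl, rfl, rfl, rfl]
  · exact fun v => v.elim0
  · intro i
    fin_cases i
    exacts [⟨_, rfl⟩, ⟨_, rfl⟩, ⟨_, rfl⟩, ⟨_, rfl⟩]

theorem flip_represents_verticalDumbbellDefect (hf : SatisfiesAll f) (hg : SatisfiesAll g)
    (H : C.IsPlane) (hc : C.Connected) (hp : C.half (C.opp d) = !(C.half d)) :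
    Represents f g (flip hne h0 hd)
      (((C.edgeSite d hne _ hd).outer C.half C.thick_of_half).glue .verticalDumbbellDefect) := by
  have D := edgeSite_isDisc H d hne _ hd
  have l0 := (C.edgePt_two d).1
  have l1 := (C.edgePt_two d).2
  have s0 : C.half (C.edgePt d (0, 2)) = C.half d := by rw [l0]
  have s1 : C.half (C.edgePt d (1, 2)) = !(C.half d) := by rw [l1, hp]
  have t := thick_flipVertex h0 hd
  refine Site.IsFilling.represents (Site.IsExtension.isFilling
    (flip_isExtension H) (fun _ => C.opp d) (fun _ => C.half d) ?_ ?_ ?_ ?_ ?_)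
    D Tangle.verticalDumbbellDefect_isPlane hf hg H (flip_isPlane H) (flip_connected hc)
  · intro v j
    fin_cases v <;> fin_cases j
    exacts [t 0 0, t 0 1, t 0 2, t 1 0, t 1 1, t 1 2]
  · rintro ((⟨v, j⟩ | ⟨v, j⟩) | i)
    · fin_cases v <;> fin_cases j
      exacts [rfl, (congrArg C.opp l0).symm, rfl, rfl, rfl, (congrArg C.opp l1).symm]
    · fin_cases v; fin_cases j
      exacts [l0.trans (C.opp_opp d).symm, l1.trans (congrArg C.opp (C.opp_opp d)).symm]
    · fin_cases i
      exacts [(C.opp_opp _).symm, (C.opp_opp _).symm, (C.opp_opp _).symm, (C.opp_opp _).symm]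
  · rintro ((⟨v, j⟩ | ⟨v, j⟩) | i)
    · fin_cases v <;> fin_cases j
      exacts [rfl, s0.symm, rfl, rfl, rfl, s1.symm]
    · fin_cases v; fin_cases j
      exacts [s0, s1]
    · fin_cases i
      exacts [rfl, rfl, rfl, rfl]
  · intro v
    fin_cases v
    exact ⟨0, _, rfl⟩
  · intro i
    fin_cases i
    exacts [⟨_, rfl⟩, ⟨_, rfl⟩, ⟨_, rfl⟩, ⟨_, rfl⟩]

end Flip

end TriWeb

/-! ### Induction steps for trivalent graphs -/

namespace TriWeb

variable {X : Type} {C : TriWeb X} {f g : WebDiagram → ℤ} {d : X}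

set_option maxRecDepth 100000

theorem vertex_cases (C : TriWeb X) (x : X) :
    (C.thick x = true ∧ C.thick (C.rot x) = true ∧ C.thick (C.rot (C.rot x)) = true) ∨
     (C.thick x = true ∧ C.thick (C.rot x) = false ∧ C.thick (C.rot (C.rot x)) = false) ∨
     (C.thick x = false ∧ C.thick (C.rot x) = true ∧ C.thick (C.rot (C.rot x)) = false) ∨
     (C.thick x = false ∧ C.thick (C.rot x) = false ∧ C.thick (C.rot (C.rot x)) = true) :=
  (C.vertex x).elim (fun h => absurd h.1 (C.trivalent x).not_isBivalent) fun h => h.2.2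

/-- The dart `x` is at a `222`-vertex. -/
def IsThickVertex (C : TriWeb X) (x : X) : Prop :=
  C.thick x = true ∧ C.thick (C.rot x) = true ∧ C.thick (C.rot (C.rot x)) = true

theorem isThickVertex_rot (x : X) : C.IsThickVertex (C.rot x) ↔ C.IsThickVertex x := by
  simp only [IsThickVertex, C.rot_rot_rot]
  tauto

/-- A thick edge between two `112`-vertices may be flipped.  If it carries no defect, the first Tutte
relation applies, whose other two terms have fewer vertices; if it carries a defect, the crossing
relation applies. -/
theorem agree_of_flip (hf : SatisfiesAll f) (hg : SatisfiesAll g) (H : C.IsPlane)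
    (hc : C.Connected) {hne : ∀ j, C.star d j ≠ C.opp d} {h0 : C.thick d = true}
    {hd : ∀ i, C.thick (C.edgePt d (edgeLeg i)) = ![false, false, false, false] i}
    (ih : ∀ Γ : WebDiagram, Γ.IsPlane → Γ.count vertexWeight < C.count vertexWeight → f Γ = g Γ)
    (hC' : (flip hne h0 hd).Agree f g) : C.Agree f g := by
  have D := edgeSite_isDisc H d hne _ hd
  have HO := Site.outer_isPlane D H C.half C.thick_of_half
  rcases Bool.eq_or_eq_not (C.half (C.opp d)) (C.half d) with hp | hp
  · have R1 := represents_horizontalDumbbell hf hg H hc hne h0 hd hp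
    have R2 := flip_represents_verticalDumbbell hf hg H hc (hne := hne) (h0 := h0) (hd := hd) hp
    refine R1.agree_iff.2 ?_
    have e := R2.agree_iff.1 hC'
    have n1 := R1.count_eq vertexWeight
    rw [OuterTangle.glue_count, Tangle.horizontalDumbbell_vertexWeight] at n1
    have e1 := ih _ (glue_isPlane_of_tangle _ _ HO Tangle.horizontal11_isPlane) (by
      rw [OuterTangle.glue_count, Tangle.horizontal11_vertexWeight]
      omega)
    have e2 := ih _ (glue_isPlane_of_tangle _ _ HO Tangle.vertical11_isPlane) (by
      rw [OuterTangle.glue_count, Tangle.vertical11_vertexWeight]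
      omega)
    have t1 := hf.tutte.tutte1 _ HO
    have t2 := hg.tutte.tutte1 _ HO
    linarith
  · have R1 := represents_horizontalDumbbellDefect hf hg H hc hne h0 hd hp
    have R2 := flip_represents_verticalDumbbellDefect hf hg H hc (hne := hne) (h0 := h0) (hd := hd)
      hp
    refine R1.agree_iff.2 ?_
    rw [← hf.web.crossing _ HO, ← hg.web.crossing _ HO]
    exact R2.agree_iff.1 hC'

/-- The second Tutte relation expresses a graph with an edge between a `112`-vertex and a
`222`-vertex by webs of smaller weight, provided that the edge carries no defect. -/
theorem agree_of_mixed_edge (hf : SatisfiesAll f) (hg : SatisfiesAll g) (H : C.IsPlane)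
    (hc : C.Connected) (hne : ∀ j, C.star d j ≠ C.opp d) (h0 : C.thick d = true)
    (hd : ∀ i, C.thick (C.edgePt d (edgeLeg i)) = ![false, false, true, true] i)
    (ih : ∀ Γ : WebDiagram, Γ.IsPlane → Γ.count vertexWeight < C.count vertexWeight → f Γ = g Γ)
    (hp : C.half (C.opp d) = C.half d) : C.Agree f g := by
  have D := edgeSite_isDisc H d hne _ hd
  have HO := Site.outer_isPlane D H C.half C.thick_of_half
  have R1 := represents_horizontal11v22 hf hg H hc hne h0 hd hp
  refine R1.agree_iff.2 ?_
  have n1 := R1.count_eq vertexWeight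
  rw [OuterTangle.glue_count, Tangle.horizontal11v22_vertexWeight] at n1
  have e1 := ih _ (glue_isPlane_of_tangle _ _ HO Tangle.vertical12v12_isPlane) (by
    rw [OuterTangle.glue_count, Tangle.vertical12v12_vertexWeight]
    omega)
  have e2 := ih _ (glue_isPlane_of_tangle _ _ HO Tangle.vertical12v12Defects_isPlane) (by
    rw [OuterTangle.glue_count, Tangle.vertical12v12Defects_vertexWeight]
    omega)
  have e3 := ih _ (glue_isPlane_of_tangle _ _ HO Tangle.vertical12_isPlane) (by
    rw [OuterTangle.glue_count, Tangle.vertical12_vertexWeight]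
    omega)
  have t1 := hf.tutte.tutte2 _ HO
  have t2 := hg.tutte.tutte2 _ HO
  linarith

/-- An edge between a `112`-vertex and a `222`-vertex can be removed by the second Tutte
relation. -/
theorem agree_of_mixed (hf : SatisfiesAll f) (hg : SatisfiesAll g) (H : C.IsPlane)
    (hc : C.Connected) (hT : ∃ x, C.IsThickVertex x) (hT' : ∃ x, ¬ C.IsThickVertex x)
    (ih : ∀ Γ : WebDiagram, Γ.IsPlane → Γ.count vertexWeight < C.count vertexWeight → f Γ = g Γ) :
    C.Agree f g := by
  classical
  -- by connectedness some edge joins vertices of different kinds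
  obtain ⟨x, h1, h2⟩ : ∃ x, C.IsThickVertex x ∧ ¬ C.IsThickVertex (C.opp x) := by
    by_contra hcon
    push Not at hcon
    rcases hc C.IsThickVertex isThickVertex_rot (fun x =>
      ⟨fun h => by simpa only [C.opp_opp] using hcon _ h, hcon x⟩) with h | h
    · obtain ⟨x, hx⟩ := hT'
      exact hx (h x)
    · obtain ⟨x, hx⟩ := hT
      exact h x hx
  obtain ⟨d, rfl⟩ : ∃ d, C.opp d = x := ⟨C.opp x, C.opp_opp x⟩
  rw [C.opp_opp] at h2
  have h0 : C.thick d = true := (C.thick_opp d).symm.trans h1.1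
  obtain ⟨h3, h4⟩ : C.thick (C.rot d) = false ∧ C.thick (C.rot (C.rot d)) = false := by
    rcases C.vertex_cases d with h | h | h | h
    · exact absurd h h2
    · exact h.2
    · rw [h.1] at h0; exact absurd h0 (by simp)
    · rw [h.1] at h0; exact absurd h0 (by simp)
  have hne := star_ne_opp_of_thick_ne (d := d) (by rw [h3, h0]; simp) (by rw [h4, h0]; simp)
  have hd : ∀ i, C.thick (C.edgePt d (edgeLeg i)) = ![false, false, true, true] i := by
    intro i
    fin_cases i
    exacts [h3, h4, h1.2.1, h1.2.2]
  rcases Bool.eq_or_eq_not (C.half (C.opp d)) (C.half d) with hp | hp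
  · exact agree_of_mixed_edge hf hg H hc hne h0 hd ih hp
  -- a defect on the edge is first moved across the `222`-vertex
  · have hd' : ∀ i, C.thick (C.star (C.opp d) i) = ![true, true, true] i := by
      intro i
      fin_cases i
      exacts [h1.1, h1.2.1, h1.2.2]
    rw [← agree_toggle_iff hf hg H hc hd']
    refine agree_of_mixed_edge (C := C.toggle (C.opp d) hd') (d := d) hf hg H hc (fun j => ?_) h0
      hd ih ?_
    · fin_cases j
      exacts [hne 0, hne 1, hne 2]
    · change (if C.opp d = C.opp d ∨ C.opp d = C.rot (C.opp d) then !(C.half (C.opp d)) else _) =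
        if d = C.opp d ∨ d = C.rot (C.opp d) then _ else C.half d
      have n1 : ¬ (d = C.opp d ∨ d = C.rot (C.opp d)) := by
        rintro (h | h)
        · exact C.opp_ne d h.symm
        · have : C.rot (C.rot d) = C.opp d := by
            rw [h, C.rot_rot_rot, ← h]
          exact hne 2 this
      rw [if_pos (Or.inl rfl), if_neg n1, hp, Bool.not_not]

/-- A `222`-vertex may be replaced by a triangle with thin sides, which has three `112`-vertices.  By
the choice of `vertexWeight`, the weight does not change. -/
theorem agree_of_thick (hf : SatisfiesAll f) (hg : SatisfiesAll g) (H : C.IsPlane)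
    (hc : C.Connected) (hT : C.IsThickVertex d)
    (ih : ∀ Γ : WebDiagram, Γ.IsPlane → Γ.count vertexWeight = C.count vertexWeight →
      Γ.count thickWeight < C.count thickWeight → f Γ = g Γ) :
    C.Agree f g := by
  have hd : ∀ i, C.thick (C.star d i) = ![true, true, true] i := by
    intro i
    fin_cases i
    exacts [hT.1, hT.2.1, hT.2.2]
  have D := vertexSite_isDisc H d _ hd
  have HO := Site.outer_isPlane D H C.half C.thick_of_half
  have R1 := represents_vertex222 hf hg H hc hd
  refine R1.agree_iff.2 ?_
  rw [← hf.web.triangle111 _ HO, ← hg.web.triangle111 _ HO]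
  have n1 := R1.count_eq vertexWeight
  have n2 := R1.count_eq thickWeight
  rw [OuterTangle.glue_count, Tangle.vertex222_vertexWeight] at n1
  rw [OuterTangle.glue_count, Tangle.vertex222_thickWeight] at n2
  refine ih _ (glue_isPlane_of_tangle _ _ HO Tangle.triangle111_isPlane) ?_ ?_
  · rw [OuterTangle.glue_count, Tangle.triangle111_vertexWeight]
    omega
  · rw [OuterTangle.glue_count, Tangle.triangle111_thickWeight]
    omega

/-! #### Faces of graphs without `222`-vertices -/

/-- The next dart along the boundary of the region to the left. -/
def next (C : TriWeb X) (x : X) : X := C.rot (C.rot (C.opp x))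

theorem next_eq (C : TriWeb X) (x : X) : C.next x = C.rot.symm (C.opp x) := by
  rw [Equiv.eq_symm_apply, next, C.rot_rot_rot]

theorem next_injective (C : TriWeb X) : Function.Injective C.next := fun x y h =>
  C.opp.injective (C.rot.injective (C.rot.injective h))

theorem rot_next (C : TriWeb X) (x : X) : C.rot (C.next x) = C.opp x := C.rot_rot_rot _

theorem region_next (H : C.IsPlane) (x : X) : C.region (some x) (some (C.next x)) := by
  rw [next_eq]; exact H.face x

/-- In a connected plane graph the boundary of a region is traced by a single face walk. -/
theorem mem_iff_of_region (H : C.IsPlane) (hc : C.Connected) (P : X → Prop)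
    (hP : ∀ x, P (C.next x) ↔ P x) {x y : X} (hxy : C.region (some x) (some y)) : P x ↔ P y := by
  classical
  have := C.finite
  let := Fintype.ofFinite X
  -- `P` is a set of faces; its boundary also bounds a set `φ` of regions, and `ψ + φ` is constant by
  -- connectedness
  let ψ : X → ZMod 2 := fun x => if P x then 1 else 0
  have hψ : ∀ x, ψ (C.rot.symm (C.opp x)) = ψ x := fun x => by
    simp only [ψ, ← next_eq, hP]
  obtain ⟨φ, p1, p2⟩ := ((C.isPlane_iff).1 H).boundary _ (isCycle_boundary C.opp_opp ψ hψ)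
  let χ : X → ZMod 2 := fun x => ψ x + φ (some x)
  have c1 : ∀ x, χ (C.opp x) = χ x := fun x => by
    have h5 : ∀ a b c d : ZMod 2, a + b = c + d → b + d = a + c := by decide
    exact h5 _ _ _ _ (p2 x)
  have c2 : ∀ x, χ (C.rot x) = χ x := fun x => by
    have h1 : χ (C.next (C.opp (C.rot x))) = χ (C.opp (C.rot x)) := by
      simp only [χ]
      rw [p1 _ _ (C.region.symm (region_next H _)), next_eq, hψ]
    rw [c1, next_eq, C.opp_opp, Equiv.symm_apply_apply] at h1
    exact h1.symm
  have h2 : χ x = χ y := by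
    rcases hc (fun w => χ w = χ x) (fun w => by rw [c2]) (fun w => by rw [c1]) with h | h
    · exact (h y).symm
    · exact absurd rfl (h x)
  simp only [χ, p1 _ _ hxy] at h2
  have h3 : ψ x = ψ y := add_right_cancel h2
  by_cases h4 : P x <;> by_cases h5 : P y <;> simp [ψ, h4, h5] at h3 ⊢

/-- There are no `222`-vertices. -/
def IsThin (C : TriWeb X) : Prop := ∀ x, ¬ C.IsThickVertex x

theorem IsThin.cases (hT : C.IsThin) (x : X) :
    (C.thick x = true ∧ C.thick (C.rot x) = false ∧ C.thick (C.rot (C.rot x)) = false) ∨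
     (C.thick x = false ∧ C.thick (C.rot x) = true ∧ C.thick (C.rot (C.rot x)) = false) ∨
     (C.thick x = false ∧ C.thick (C.rot x) = false ∧ C.thick (C.rot (C.rot x)) = true) :=
  (C.vertex_cases x).resolve_left (hT x)

/-- The thin edges form disjoint closed curves, so that they have different regions on both
sides. -/
theorem IsThin.not_region_opp (hT : C.IsThin) (H : C.IsPlane) {x : X} (hx : C.thick x = false) :
    ¬ C.region (some x) (some (C.opp x)) := by
  classical
  have := C.finite
  let := Fintype.ofFinite X
  obtain ⟨φ, p1, p2⟩ := ((C.isPlane_iff).1 H).boundary (fun x => if C.thick x then 0 else 1)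
    ((C.isCycle_iff_trivalent _).2 ⟨fun x => by simp only [C.thick_opp], fun x => by
      rcases hT.cases x with ⟨a, b, c⟩ | ⟨a, b, c⟩ | ⟨a, b, c⟩ <;> simp only [a, b, c] <;> decide⟩)
  intro h
  have := p2 x
  rw [hx, p1 _ _ h, zmod_two_add_self] at this
  exact absurd this (by decide)

theorem IsThin.thick_next (hT : C.IsThin) {x : X} (hx : C.thick x = true) :
    C.thick (C.next x) = false := by
  rw [← C.thick_opp] at hx
  rcases hT.cases (C.opp x) with ⟨a, b, c⟩ | ⟨a, b, c⟩ | ⟨a, b, c⟩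
  · exact c
  · rw [a] at hx; exact absurd hx (by simp)
  · rw [a] at hx; exact absurd hx (by simp)

theorem IsThin.count_eq (hT : C.IsThin) : C.count vertexWeight = Nat.card X := by
  classical
  have := C.finite
  let := Fintype.ofFinite X
  rw [count, finsum_eq_sum_of_fintype, Nat.card_eq_fintype_card, Fintype.card_eq_sum_ones]
  refine Finset.sum_congr rfl fun x _ => ?_
  rcases hT.cases x with ⟨a, b, c⟩ | ⟨a, b, c⟩ | ⟨a, b, c⟩ <;> rw [a, b, c] <;> rfl

end TriWeb

/-! ### A small face -/

/-- The classes of a relation can be counted by a set `T` of representatives. -/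
theorem card_quot_eq_of_representatives {X : Type} (r : X → X → Prop) (T : X → Prop) (ρ : X → X)
    (h1 : ∀ x y, r x y → ρ x = ρ y) (h2 : ∀ x, T (ρ x)) (h3 : ∀ x, T x → ρ x = x)
    (h4 : ∀ x, Quot.mk r (ρ x) = Quot.mk r x) : Nat.card (Quot r) = Nat.card {x // T x} :=
  Nat.card_congr
    { toFun := Quot.lift (fun x => ⟨ρ x, h2 x⟩) fun x y h => Subtype.ext (h1 x y h)
      invFun := fun x => Quot.mk r x.1
      left_inv := by rintro ⟨x⟩; exact h4 x
      right_inv := fun x => Subtype.ext (h3 x.1 x.2) }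

namespace TriWeb

variable {X : Type} {C : TriWeb X}

theorem card_edges (C : TriWeb X) :
    2 * Nat.card (Quot fun x y : X => y = C.opp x) = Nat.card X := by
  classical
  have := C.finite
  let := Fintype.ofFinite X
  -- each edge is represented by the smaller of its two darts
  let o := Fintype.equivFin X
  have hne : ∀ x, o x ≠ o (C.opp x) := fun x h => C.opp_ne x (o.injective h).symm
  have h := card_quot_eq_of_representatives (fun x y : X => y = C.opp x)
    (fun x => o x < o (C.opp x)) (fun x => if o x < o (C.opp x) then x else C.opp x) ?_ ?_ ?_ ?_
  · rw [h, Nat.card_eq_fintype_card, Nat.card_eq_fintype_card, Fintype.card_subtype,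
      Finset.card_filter, two_mul]
    let F : X → ℕ := fun x => if o x < o (C.opp x) then 1 else 0
    have e1 : ∑ x, F (C.opp x) = ∑ x, F x := Equiv.sum_comp C.opp F
    have e2 : ∑ x, (F x + F (C.opp x)) = ∑ _x : X, 1 := Finset.sum_congr rfl fun x _ => by
      rcases lt_or_gt_of_ne (hne x) with h | h <;> simp [F, C.opp_opp, h, h.not_gt]
    rw [Finset.sum_add_distrib, e1] at e2
    exact e2.trans Fintype.card_eq_sum_ones.symm
  · rintro x y rfl
    rcases lt_or_gt_of_ne (hne x) with h | h
    · simp [C.opp_opp, h, h.not_gt]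
    · simp [C.opp_opp, h, h.not_gt]
  · intro x
    rcases lt_or_gt_of_ne (hne x) with h | h
    · simp [h]
    · simp [C.opp_opp, h, h.not_gt]
  · exact fun x h => if_pos h
  · intro x
    split_ifs
    · rfl
    · exact (Quot.sound (r := fun x y : X => y = C.opp x) rfl).symm

/-- Without `222`-vertices, each vertex has exactly one thick dart. -/
theorem IsThin.card_vertices (hT : C.IsThin) :
    Nat.card (Quot fun x y : X => y = C.rot x) = Nat.card {x // C.thick x = true} := by
  refine card_quot_eq_of_representatives (fun x y : X => y = C.rot x) (fun x => C.thick x = true)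
    (fun x => if C.thick x then x else if C.thick (C.rot x) then C.rot x else C.rot (C.rot x))
    ?_ ?_ ?_ ?_
  · rintro x y rfl
    rcases hT.cases x with ⟨a, b, c⟩ | ⟨a, b, c⟩ | ⟨a, b, c⟩ <;> simp [a, b, c, C.rot_rot_rot]
  · intro x
    rcases hT.cases x with ⟨a, b, c⟩ | ⟨a, b, c⟩ | ⟨a, b, c⟩ <;> simp [a, b, c]
  · exact fun x h => if_pos h
  · intro x
    have h1 : ∀ x, Quot.mk (fun x y : X => y = C.rot x) (C.rot x) = Quot.mk _ x := fun x =>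
      (Quot.sound (r := fun x y : X => y = C.rot x) rfl).symm
    split_ifs
    · rfl
    · exact h1 x
    · exact (h1 _).trans (h1 x)

theorem IsThin.card_thick (hT : C.IsThin) : 3 * Nat.card {x // C.thick x = true} = Nat.card X := by
  classical
  have := C.finite
  let := Fintype.ofFinite X
  rw [Nat.card_eq_fintype_card, Nat.card_eq_fintype_card, Fintype.card_subtype,
    Finset.card_filter]
  let F : X → ℕ := fun x => if C.thick x = true then 1 else 0
  have e1 : ∑ x, F (C.rot x) = ∑ x, F x := Equiv.sum_comp C.rot F
  have e2 : ∑ x, F (C.rot (C.rot x)) = ∑ x, F x :=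
    (Equiv.sum_comp C.rot fun x => F (C.rot x)).trans e1
  have e3 : ∑ x, (F x + F (C.rot x) + F (C.rot (C.rot x))) = ∑ _x : X, 1 :=
    Finset.sum_congr rfl fun x _ => by
      rcases hT.cases x with ⟨a, b, c⟩ | ⟨a, b, c⟩ | ⟨a, b, c⟩ <;> simp [F, a, b, c]
  rw [Finset.sum_add_distrib, Finset.sum_add_distrib, e1, e2] at e3
  rw [Fintype.card_eq_sum_ones, ← e3]
  ring

theorem Connected.card_components (hc : C.Connected) [Nonempty X] :
    Nat.card (Quot fun x y : X => y = C.rot x ∨ y = C.opp x) = 1 := by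
  rw [Nat.card_eq_one_iff_unique]
  obtain ⟨x0⟩ := ‹Nonempty X›
  refine ⟨⟨?_⟩, ⟨Quot.mk _ x0⟩⟩
  have h : ∀ x, Quot.mk (fun x y : X => y = C.rot x ∨ y = C.opp x) x = Quot.mk _ x0 := by
    rcases hc (fun x => Quot.mk (fun x y : X => y = C.rot x ∨ y = C.opp x) x = Quot.mk _ x0)
      (fun x => by rw [← Quot.sound (r := fun x y : X => y = C.rot x ∨ y = C.opp x) (Or.inl rfl)]) (fun x => by rw [← Quot.sound (r := fun x y : X => y = C.rot x ∨ y = C.opp x) (Or.inr rfl)])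
      with h | h
    · exact h
    · exact absurd rfl (h x0)
  rintro ⟨x⟩ ⟨y⟩
  exact (h x).trans (h y).symm

/-- By Euler's formula, some bounded region has at most three thin sides. -/
theorem IsThin.exists_small_region (hT : C.IsThin) (H : C.IsPlane) (hc : C.Connected) [Nonempty X] :
    ∃ y, C.thick y = false ∧ ¬ C.region (some y) none ∧
      Nat.card {x // C.thick x = false ∧ C.region (some y) (some x)} ≤ 3 := by
  classical
  have := C.finite
  let := Fintype.ofFinite X
  by_contra hcon
  push Not at hcon
  let Q := Quotient C.region
  let := Fintype.ofFinite Q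
  let q : Option X → Q := Quotient.mk C.region
  let s : Finset X := Finset.univ.filter fun x => C.thick x = false
  have hs : s.card + Nat.card {x // C.thick x = true} = Nat.card X := by
    have h := Finset.card_filter_add_card_filter_not (s := (Finset.univ : Finset X))
      fun x => C.thick x = true
    simp only [Bool.not_eq_true] at h
    rw [Nat.card_eq_fintype_card, Nat.card_eq_fintype_card, Fintype.card_subtype,
      ← Finset.card_univ, ← h, add_comm]
  -- otherwise every bounded region has at least four thin sides; every region has one, because a
  -- thick side is followed by a thin one
  have hfib : ∀ c ∈ Finset.univ.erase (q none), 4 ≤ (s.filter fun x => q (some x) = c).card := by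
    intro c hcn
    have hcn' := Finset.ne_of_mem_erase hcn
    obtain ⟨a, rfl⟩ : ∃ a, q a = c := Quotient.exists_rep c
    rcases a with _ | x
    · exact absurd rfl hcn'
    have hy : ∃ y, C.thick y = false ∧ q (some y) = q (some x) := by
      cases hx : C.thick x
      · exact ⟨x, hx, rfl⟩
      · exact ⟨C.next x, hT.thick_next hx, (Quotient.sound (region_next H x)).symm⟩
    obtain ⟨y, hy1, hy2⟩ := hy
    have h1 := hcon y hy1 fun h => hcn' (hy2.symm.trans (Quotient.sound h))
    rw [Nat.card_eq_fintype_card, Fintype.card_subtype] at h1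
    refine h1.trans_le (Finset.card_le_card fun w hw => ?_)
    simp only [Finset.mem_filter, Finset.mem_univ, true_and, s] at hw ⊢
    exact ⟨hw.1, (Quotient.sound (C.region.symm hw.2)).trans hy2⟩
  have h1 : 4 * (Nat.card Q - 1) ≤ s.card := by
    have h2 := Finset.card_nsmul_le_sum _ _ _ hfib
    rw [Finset.card_erase_of_mem (Finset.mem_univ _), Finset.card_univ, smul_eq_mul, mul_comm] at h2
    rw [Nat.card_eq_fintype_card]
    refine h2.trans ?_
    rw [Finset.card_eq_sum_card_fiberwise (f := fun x => q (some x)) (t := Finset.univ)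
      (fun _ _ => Finset.mem_univ _)]
    exact Finset.sum_le_sum_of_subset (Finset.erase_subset _ _)
  -- for `2 k` vertices there are `3 k` edges, `4 k` thin darts and hence `k + 2` regions, while
  -- `4 * (k + 1) ≤ 4 * k` would have to hold
  have h2 := H.euler
  rw [hT.card_vertices, hc.card_components] at h2
  have h3 := C.card_edges
  have h4 := hT.card_thick
  have h5 : 0 < Nat.card Q := Nat.card_pos_iff.2 ⟨⟨q none⟩, inferInstance⟩
  change (_ : ℤ) - _ + (Nat.card Q : ℤ) = _ at h2
  omega

end TriWeb

/-! ### Uniqueness -/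

namespace TriWeb

variable {X : Type} {C : TriWeb X} {f g : WebDiagram → ℤ} {d : X}

theorem IsThin.flip_isThin (hT : C.IsThin) {hne : ∀ j, C.star d j ≠ C.opp d}
    {h0 : C.thick d = true}
    {hd : ∀ i, C.thick (C.edgePt d (edgeLeg i)) = ![false, false, false, false] i} :
    (flip hne h0 hd).IsThin := by
  intro x hx
  have hx1 : C.thick x = true := hx.1
  have hx2 : C.thick (C.flipRotFun d x) = true := hx.2.1
  have hx3 : C.thick (C.flipRotFun d (C.flipRotFun d x)) = true := hx.2.2
  rcases C.edgePt_cases d x with ⟨q, rfl⟩ | hx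
  · rw [flipRotFun_pt hne, thick_edgePt h0 hd] at hx2
    rw [thick_edgePt h0 hd] at hx1
    have : ∀ q : Fin 2 × Fin 3, decide (q.2 = 2) = true → decide ((flipNext q).2 = 2) = true →
        False := by decide
    exact this q hx1 hx2
  · rw [flipRotFun_of_not hx] at hx2 hx3
    rw [flipRotFun_of_not (edgePt_ne_rot hx)] at hx3
    exact hT x ⟨hx1, hx2, hx3⟩

theorem IsThin.count_thickWeight (hT : C.IsThin) : C.count thickWeight = 0 := by
  have := C.finite
  let := Fintype.ofFinite X
  rw [count, finsum_eq_sum_of_fintype]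
  refine Finset.sum_eq_zero fun x _ => ?_
  rcases hT.cases x with ⟨a, b, c⟩ | ⟨a, b, c⟩ | ⟨a, b, c⟩ <;> rw [a, b, c] <;> rfl

/-- Filling the disc with a connected tangle keeps a diagram connected. -/
theorem _root_.OuterTangle.glue_connected {n : ℕ} [NeZero n] {bd : Fin n → Bool}
    (O : OuterTangle bd) {A B : Tangle bd}
    (hB : ∀ S : B.Dart ⊕ Fin n → Prop, (∀ d, S (.inl (B.rot d)) ↔ S (.inl d)) →
      (∀ x, S (B.opp x) ↔ S x) → ∀ x, S x ↔ S (.inr 0))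
    (h : (O.glue A).Connected) : (O.glue B).Connected := by
  intro S hr ho
  have hS := hB (fun x => S (.inr x)) (fun d => hr (.inr (.inl d))) fun x => ho (.inr x)
  have hi : ∀ i, S (.inl (.inr i)) ↔ S (.inr (.inr 0)) := fun i =>
    (hr (.inl (.inr i))).symm.trans (hS (.inr i))
  have := h (Sum.elim (fun x => S (.inl x)) fun _ => S (.inr (.inr 0)))
    (by
      rintro ((d | i) | (d | i))
      exacts [hr (.inl (.inl d)), (hi i).symm, Iff.rfl, hi i])
    (by
      rintro (x | x)
      exacts [ho (.inl x), Iff.rfl])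
  rcases this with h1 | h1
  · left
    rintro (x | x)
    exacts [h1 (.inl x), (hS x).2 (h1 (.inr (.inr 0)))]
  · right
    rintro (x | x)
    exacts [h1 (.inl x), fun hx => h1 (.inr (.inr 0)) ((hS x).1 hx)]

/-- A region with at most three sides, all of which are thin, can be removed. -/
theorem agree_of_small_face (hf : SatisfiesAll f) (hg : SatisfiesAll g) (H : C.IsPlane)
    (hc : C.Connected) (hT : C.IsThin)
    (ih : ∀ Γ : WebDiagram, Γ.IsPlane → Γ.count vertexWeight < C.count vertexWeight → f Γ = g Γ)
    (ih' : ∀ Γ : WebDiagram, Γ.IsPlane → Γ.Connected →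
      Γ.count vertexWeight = C.count vertexWeight → Γ.count thickWeight = 3 → f Γ = g Γ)
    {y : X} (hb : ¬ C.region (some y) none)
    (h3 : Nat.card {x // C.thick x = false ∧ C.region (some y) (some x)} ≤ 3)
    (hthick : ∀ x, C.region (some y) (some x) → C.thick x = false) : C.Agree f g := by
  classical
  have := C.finite
  let := Fintype.ofFinite X
  have hr1 : C.region (some y) (some (C.next y)) := region_next H y
  have hr2 : C.region (some y) (some (C.next (C.next y))) := C.region.trans hr1 (region_next H _)
  have hr3 : C.region (some y) (some (C.next (C.next (C.next y)))) :=
    C.region.trans hr2 (region_next H _)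
  have hopp : ∀ x, C.opp x = C.rot (C.next x) := fun x => (C.rot_next x).symm
  -- the general form of the conclusion for a face walk of length `n`
  have key : ∀ {n : ℕ} [NeZero n] (z : Fin n → X), (∀ v, C.region (some y) (some (z v))) →
      (∀ v, z (v + 1) = C.next (z v)) → (∃ v, z v = y) →
      (∀ v w, C.rot (z v) ≠ z w) ∧ (∀ v, C.opp (z v) = C.rot (z (v + 1))) ∧
      (∀ i, C.thick (C.rot (C.rot (z i))) = true) ∧ (∀ v, C.thick (z v) = false) ∧
      (∀ v a, C.region (some (z v)) a → ∃ w, a = some (z w)) := by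
    intro n _ z hz hnext hzy
    have k1 : ∀ v, C.opp (z v) = C.rot (z (v + 1)) := fun v => by rw [hnext, ← hopp]
    have k2 : ∀ v, C.thick (z v) = false := fun v => hthick _ (hz v)
    have k3 : ∀ v, C.opp (z (v - 1)) = C.rot (z v) := fun v => by rw [k1, sub_add_cancel]
    refine ⟨fun v w h => ?_, k1, fun i => ?_, k2, fun v a ha => ?_⟩
    · rw [← k3] at h
      refine hT.not_region_opp H (k2 (v - 1)) ?_
      rw [h]
      exact C.region.trans (C.region.symm (hz _)) (hz _)
    · have h1 := k2 (i - 1)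
      rw [← C.thick_opp, k3] at h1
      rcases hT.cases (z i) with ⟨a, b, c⟩ | ⟨a, b, c⟩ | ⟨a, b, c⟩
      · rw [k2] at a; exact absurd a (by simp)
      · rw [h1] at b; exact absurd b (by simp)
      · exact c
    · rcases a with _ | x
      · exact absurd (C.region.trans (hz v) ha) hb
      · have h1 := mem_iff_of_region H hc (fun x => ∃ v, z v = x) (fun x => ?_)
          (C.region.trans (hz v) ha)
        · obtain ⟨w, hw⟩ := h1.1 hzy
          exact ⟨w, congrArg some hw.symm⟩
        · constructor
          · rintro ⟨v, hv⟩
            refine ⟨v - 1, C.next_injective ?_⟩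
            rw [← hnext, sub_add_cancel, hv]
          · rintro ⟨v, rfl⟩
            exact ⟨v + 1, hnext v⟩
  -- a lollipop
  by_cases e1 : C.next y = y
  · obtain ⟨k1, k2, k3, k4, k5⟩ := key (n := 1) (fun _ => y) (fun _ => C.region.refl _)
      (fun _ => e1.symm) ⟨0, rfl⟩
    exact agree_of_lollipop hf hg H hc k2 (fun i => (k3 i).trans (by fin_cases i; rfl)) k4 k5
  -- a digon
  by_cases e2 : C.next (C.next y) = y
  · obtain ⟨k1, k2, k3, k4, k5⟩ := key (n := 2) ![y, C.next y]
      (fun v => by fin_cases v; exacts [C.region.refl _, hr1])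
      (fun v => by fin_cases v; exacts [rfl, e2.symm]) ⟨0, rfl⟩
    have hy : Function.Injective ![y, C.next y] := by
      intro v w h
      fin_cases v <;> fin_cases w
      exacts [rfl, absurd h.symm e1, absurd h e1, rfl]
    obtain ⟨D, R⟩ := represents_digon11 hf hg H hc hy k1 k2
      (fun i => by rw [k3]; fin_cases i <;> rfl) k4 k5
    have HO := Site.outer_isPlane D H C.half C.thick_of_half
    have n1 := R.count_eq vertexWeight
    rw [OuterTangle.glue_count, Tangle.digon11_vertexWeight] at n1
    rw [R.agree_iff, hf.web.digon11 _ HO, hg.web.digon11 _ HO,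
      ih _ (glue_isPlane_of_tangle _ _ HO Tangle.edge2_isPlane) (by
        rw [OuterTangle.glue_count, Tangle.edge2_vertexWeight]; omega)]
  -- a triangle: it is replaced by a `222`-vertex, which has the same weight
  have e3 : C.next (C.next (C.next y)) = y := by
    by_contra e3
    have hcard : ({y, C.next y, C.next (C.next y), C.next (C.next (C.next y))} : Finset X).card = 4 := by
      have e4 : C.next (C.next y) ≠ C.next y := fun h => e1 (C.next_injective h)
      have e5 : C.next (C.next (C.next y)) ≠ C.next y := fun h => e2 (C.next_injective h)
      have e6 : C.next (C.next (C.next y)) ≠ C.next (C.next y) := fun h =>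
        e4 (C.next_injective h)
      rw [Finset.card_insert_of_notMem, Finset.card_insert_of_notMem, Finset.card_pair e6.symm]
      · simp [e4.symm, e5.symm]
      · simp [Ne.symm e1, Ne.symm e2, Ne.symm e3]
    rw [Nat.card_eq_fintype_card, Fintype.card_subtype] at h3
    have h4 := Finset.card_le_card (s := {y, C.next y, C.next (C.next y),
      C.next (C.next (C.next y))})
      (t := Finset.univ.filter fun x => C.thick x = false ∧ C.region (some y) (some x)) (by
        intro x hx
        simp only [Finset.mem_insert, Finset.mem_singleton] at hx
        have hx' : C.region (some y) (some x) := by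
          rcases hx with rfl | rfl | rfl | rfl
          exacts [C.region.refl _, hr1, hr2, hr3]
        simpa using ⟨hthick x hx', hx'⟩)
    omega
  obtain ⟨k1, k2, k3, k4, k5⟩ := key (n := 3) ![y, C.next y, C.next (C.next y)]
    (fun v => by fin_cases v; exacts [C.region.refl _, hr1, hr2])
    (fun v => by fin_cases v; exacts [rfl, rfl, e3.symm]) ⟨0, rfl⟩
  have hy : Function.Injective ![y, C.next y, C.next (C.next y)] := by
    have e4 : C.next (C.next y) ≠ C.next y := fun h => e1 (C.next_injective h)
    intro v w h
    fin_cases v <;> fin_cases w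
    exacts [rfl, absurd h.symm e1, absurd h.symm e2, absurd h e1, rfl, absurd h.symm e4,
      absurd h e2, absurd h e4, rfl]
  obtain ⟨D, R⟩ := represents_triangle111 hf hg H hc hy k1 k2
    (fun i => by rw [k3]; fin_cases i <;> rfl) k4 k5
  have HO := Site.outer_isPlane D H C.half C.thick_of_half
  have n1 := R.count_eq vertexWeight
  have n2 := R.count_eq thickWeight
  rw [OuterTangle.glue_count, Tangle.triangle111_vertexWeight] at n1
  rw [OuterTangle.glue_count, Tangle.triangle111_thickWeight, hT.count_thickWeight] at n2
  rw [R.agree_iff, hf.web.triangle111 _ HO, hg.web.triangle111 _ HO]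
  refine ih' _ (glue_isPlane_of_tangle _ _ HO Tangle.vertex222_isPlane)
    (OuterTangle.glue_connected _ (fun S hr ho => ?_) R.connected)
    (by rw [OuterTangle.glue_count, Tangle.vertex222_vertexWeight]; omega)
    (by rw [OuterTangle.glue_count, Tangle.vertex222_thickWeight]; omega)
  have h1 : ∀ j : Fin 3, S (.inr j) ↔ S (.inl (.inl (0, j))) := fun j => by
    fin_cases j
    exacts [ho (.inl (.inl (0, 0))), ho (.inl (.inl (0, 1))), ho (.inl (.inl (0, 2)))]
  have h2 : ∀ j : Fin 3, S (.inl (.inl (0, j))) ↔ S (.inl (.inl (0, 0))) := fun j => by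
    fin_cases j
    exacts [Iff.rfl, hr (.inl (0, 0)), (hr (.inl (0, 1))).trans (hr (.inl (0, 0)))]
  rintro ((⟨v, j⟩ | ⟨v, j⟩) | j)
  · rw [Subsingleton.elim v 0]; exact (h2 j).trans (h1 0).symm
  · exact v.elim0
  · exact (h1 j).trans ((h2 j).trans (h1 0).symm)

end TriWeb

namespace TriWeb

variable {X : Type} {f g : WebDiagram → ℤ}

/-- A region with at most three thin sides can be removed: flipping its thick sides moves them out
of its boundary. -/
theorem agree_of_region (hf : SatisfiesAll f) (hg : SatisfiesAll g)
    (ih : ∀ Γ : WebDiagram, Γ.IsPlane → Γ.count vertexWeight < Nat.card X → f Γ = g Γ)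
    (ih' : ∀ Γ : WebDiagram, Γ.IsPlane → Γ.Connected →
      Γ.count vertexWeight = Nat.card X → Γ.count thickWeight = 3 → f Γ = g Γ)
    (n : ℕ) (C : TriWeb X) (H : C.IsPlane) (hc : C.Connected) (hT : C.IsThin) {y : X}
    (hy : C.thick y = false) (hb : ¬ C.region (some y) none)
    (h3 : Nat.card {x // C.thick x = false ∧ C.region (some y) (some x)} ≤ 3)
    (hn : Nat.card {x // C.thick x = true ∧ C.region (some y) (some x)} = n) : C.Agree f g := by
  induction n using Nat.strong_induction_on generalizing C with
  | _ n ihn =>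
  classical
  have := C.finite
  let := Fintype.ofFinite X
  by_cases hex : ∃ d, C.thick d = true ∧ C.region (some y) (some d)
  · obtain ⟨d, h0, hyd⟩ := hex
    have hstar : ∀ d, C.thick d = true →
        C.thick (C.rot d) = false ∧ C.thick (C.rot (C.rot d)) = false := fun d h0 => by
      rcases hT.cases d with ⟨a, b, c⟩ | ⟨a, b, c⟩ | ⟨a, b, c⟩
      · exact ⟨b, c⟩
      all_goals rw [a] at h0; exact absurd h0 (by simp)
    -- flip a thick side `d` and use induction on the number of thick sides
    obtain ⟨a1, a2⟩ := hstar d h0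
    obtain ⟨b1, b2⟩ := hstar (C.opp d) ((C.thick_opp d).trans h0)
    have hne : ∀ j, C.star d j ≠ C.opp d :=
      star_ne_opp_of_thick_ne (by rw [a1, h0]; decide) (by rw [a2, h0]; decide)
    have hd : ∀ i, C.thick (C.edgePt d (edgeLeg i)) = ![false, false, false, false] i := by
      intro i
      fin_cases i
      exacts [a1, a2, b1, b2]
    obtain ⟨ra, rb, rc, re, rd, rd'⟩ := edge_regions H d
    have ht := thick_edgePt h0 hd
    -- the flipped edge leaves the region
    have hd1 : ¬ C.region (some y) (some (C.edgePt d (1, 0))) := fun h => by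
      rw [(C.edgePt_two d).1] at rd
      refine hT.not_region_opp H ((ht (1, 1)).trans rfl) (C.region.symm (C.region.trans re ?_))
      exact C.region.trans (C.region.symm h) (C.region.trans hyd rd)
    have hd2 : ¬ C.region (some y) (some (C.edgePt d (0, 0))) := fun h => by
      rw [(C.edgePt_two d).1] at ra
      refine hT.not_region_opp H ((ht (0, 0)).trans rfl) (C.region.symm (C.region.trans ra ?_))
      exact C.region.trans (C.region.symm hyd) h
    have hthin : ∀ x, C.thick x = false → C.flipLabel d x = x := fun x hx =>
      flipLabel_eq_self hne fun q hq h => by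
        rw [← h, ht, hq] at hx
        exact absurd hx (by decide)
    have hreg : ∀ x, (flip hne h0 hd).region (some y) (some x) ↔
        C.region (some y) (some (C.flipLabel d x)) := fun x => by
      change C.region (some (C.flipLabel d y)) (some (C.flipLabel d x)) ↔ _
      rw [hthin y hy]
    refine agree_of_flip hf hg H hc (hne := hne) (h0 := h0) (hd := hd)
      (fun Γ hΓ hlt => ih Γ hΓ (hT.count_eq ▸ hlt))
      (ihn _ ?_ _ (flip_isPlane H) (flip_connected hc) hT.flip_isThin hy ?_ ?_ rfl)
    · rw [← hn]
      refine Set.ncard_lt_ncard (s := {x | C.thick x = true ∧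
        (flip hne h0 hd).region (some y) (some x)})
        (t := {x | C.thick x = true ∧ C.region (some y) (some x)}) ?_ (Set.toFinite _)
      rw [Set.ssubset_iff_of_subset]
      · refine ⟨d, ⟨h0, hyd⟩, fun h => hd1 ?_⟩
        have h' := (hreg d).1 h.2
        have h2 := flipLabel_pt hne (0, 2)
        rw [(C.edgePt_two d).1] at h2
        rwa [h2] at h'
      · rintro x ⟨hx, hxy⟩
        rw [hreg] at hxy
        rcases C.edgePt_cases d x with ⟨q, rfl⟩ | hx'
        · rw [flipLabel_pt hne] at hxy
          rw [ht] at hx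
          obtain ⟨v, j⟩ := q
          obtain rfl : j = 2 := of_decide_eq_true hx
          fin_cases v
          exacts [absurd hxy hd1, absurd hxy hd2]
        · rw [flipLabel_of_not hx'] at hxy
          exact ⟨hx, hxy⟩
    · intro h
      have h' : C.region (some (C.flipLabel d y)) none := h
      rw [hthin y hy] at h'
      exact hb h'
    · refine le_of_eq_of_le (Nat.card_congr (Equiv.subtypeEquivRight fun x => ?_)) h3
      refine and_congr_right fun hx => ?_
      rw [hreg, hthin x hx]
  · push Not at hex
    refine agree_of_small_face hf hg H hc hT (hT.count_eq ▸ ih) (hT.count_eq ▸ ih') hb h3 fun x hx => ?_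
    cases h : C.thick x
    · rfl
    · exact absurd hx (hex x h)

end TriWeb

namespace WebDiagram

variable {Γ : WebDiagram} {f g : WebDiagram → ℤ}

theorem exists_trivalent_of_count_ne_zero {w : Bool → Bool → Bool → ℕ} (h : Γ.count w ≠ 0) :
    ∃ t, IsTrivalent Γ.rot t := by
  by_contra hcon
  push Not at hcon
  refine h ?_
  unfold count
  simp only [hcon, if_false, finsum_zero]

theorem count_ne_zero {t : Γ.Dart} (ht : IsTrivalent Γ.rot t) {w : Bool → Bool → Bool → ℕ}
    (hw : ∀ a b c, w a b c ≠ 0) : Γ.count w ≠ 0 := by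
  classical
  have := Γ.finite
  let := Fintype.ofFinite Γ.Dart
  rw [count_eq_sum]
  intro h
  have := (Finset.sum_eq_zero_iff.1 h) t (Finset.mem_univ t)
  rw [if_pos ht] at this
  exact hw _ _ _ this

/-- The values of a connected web with a trivalent vertex are controlled by a trivalent graph. -/
theorem exists_triWeb (hf : SatisfiesAll f) (hg : SatisfiesAll g) (H : Γ.IsPlane)
    (hc : Γ.Connected) {t : Γ.Dart} (ht : IsTrivalent Γ.rot t) :
    ∃ (X : Type) (C : TriWeb X), Nonempty X ∧ C.IsPlane ∧ C.Connected ∧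
      (∀ w, C.count w = Γ.count w) ∧ (C.Agree f g → f Γ = g Γ) := by
  obtain ⟨Γ', H', hr, hc', hw, h1, h2⟩ := exists_reduced
    (fun Γ' => Γ'.Connected ∧ (∀ w, Γ'.count w = Γ.count w) ∧ f Γ' = f Γ ∧ g Γ' = g Γ)
    (fun Γ d hd hc H hm ⟨q1, q2, q3, q4⟩ => ⟨q1.smooth hd hc,
      fun w => (smooth_count hd hc w).trans (q2 w),
      (value_smooth hf H hd hc hm).trans q3, (value_smooth hg H hd hc hm).trans q4⟩)
    (fun Γ d hd hd' hne H ⟨q1, q2, q3, q4⟩ => ⟨q1, q2,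
      (value_undefect hf H hd hd' hne).trans q3, (value_undefect hg H hd hd' hne).trans q4⟩)
    Γ H ⟨hc, fun _ => rfl, rfl, rfl⟩
  have h0 := count_ne_zero ht (w := fun _ _ _ => 1) (fun _ _ _ => one_ne_zero)
  rw [← hw] at h0
  obtain ⟨t', ht'⟩ := exists_trivalent_of_count_ne_zero h0
  obtain ⟨X, C, p1, p2, p3⟩ := exists_core hr hc' H' ht'
  refine ⟨X, C, ?_, p1, p2, fun w => by rw [← p3.count_eq, hw], fun h => ?_⟩
  · by_contra hX
    rw [not_nonempty_iff] at hX
    refine h0 (p3.count_eq _ |>.trans ?_)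
    exact finsum_of_isEmpty _
  · rw [← h1, ← h2]
    exact h Γ' p3 hc' H'

/-- A web with exactly one `222`-vertex also has a `112`-vertex, since the number of vertices of a
trivalent graph is even. -/
theorem value_eq_of_thickWeight_eq_three (hf : SatisfiesAll f) (hg : SatisfiesAll g)
    (H : Γ.IsPlane) (hc : Γ.Connected) (h3 : Γ.count thickWeight = 3)
    (ih : ∀ Γ' : WebDiagram, Γ'.IsPlane → Γ'.count vertexWeight < Γ.count vertexWeight →
      f Γ' = g Γ') : f Γ = g Γ := by
  obtain ⟨t, ht⟩ := exists_trivalent_of_count_ne_zero (h3.trans_ne three_ne_zero)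
  obtain ⟨X, C, hX, p1, p2, hw, hC⟩ := exists_triWeb hf hg H hc ht
  have := C.finite
  let := Fintype.ofFinite X
  rw [← hw] at ih h3
  refine hC (TriWeb.agree_of_mixed hf hg p1 p2 ?_ ?_ ih)
  · by_contra hcon
    push Not at hcon
    have hT : C.IsThin := hcon
    rw [hT.count_thickWeight] at h3
    exact absurd h3 (by decide)
  · by_contra hcon
    push Not at hcon
    have h1 : C.count thickWeight = Nat.card X := by
      rw [TriWeb.count, finsum_eq_sum_of_fintype, Nat.card_eq_fintype_card,
        Fintype.card_eq_sum_ones]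
      refine Finset.sum_congr rfl fun x _ => ?_
      obtain ⟨a, b, c⟩ := hcon x
      rw [a, b, c]; rfl
    have h2 := C.card_edges
    omega

theorem restrict_count_le (S : Γ.Dart → Prop) (hrot : ∀ d, S (Γ.rot d) ↔ S d)
    (hopp : ∀ d, S (Γ.opp d) ↔ S d) (w : Bool → Bool → Bool → ℕ) :
    (Γ.restrict S hrot hopp).count w ≤ Γ.count w := by
  classical
  have := Γ.finite
  let := Fintype.ofFinite Γ.Dart
  have := (Γ.restrict S hrot hopp).finite
  let := Fintype.ofFinite (Γ.restrict S hrot hopp).Dart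
  rw [count_eq_sum, count_eq_sum]
  have h1 : ∀ d : {d // S d}, IsTrivalent (Γ.restrict S hrot hopp).rot d ↔
      IsTrivalent Γ.rot d.1 := fun d => by
    exact and_congr (not_congr Subtype.ext_iff) Subtype.ext_iff
  calc _ = ∑ d : (Γ.restrict S hrot hopp).Dart, if IsTrivalent Γ.rot d.1 then
          w (Γ.thick d.1) (Γ.thick (Γ.rot d.1)) (Γ.thick (Γ.rot (Γ.rot d.1))) else 0 :=
        Finset.sum_congr rfl fun d _ => if_congr (h1 d) rfl rfl
    _ = ∑ d with S d, if IsTrivalent Γ.rot d then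
          w (Γ.thick d) (Γ.thick (Γ.rot d)) (Γ.thick (Γ.rot (Γ.rot d))) else 0 :=
        (Finset.sum_subtype _ (fun d => by simp) fun d => if IsTrivalent Γ.rot d then
          w (Γ.thick d) (Γ.thick (Γ.rot d)) (Γ.thick (Γ.rot (Γ.rot d))) else 0).symm
    _ ≤ _ := Finset.sum_le_sum_of_subset (Finset.subset_univ _)

theorem card_restrict_lt (S : Γ.Dart → Prop) (hrot : ∀ d, S (Γ.rot d) ↔ S d)
    (hopp : ∀ d, S (Γ.opp d) ↔ S d) {d : Γ.Dart} (hd : ¬ S d) :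
    Nat.card (Γ.restrict S hrot hopp).Dart < Nat.card Γ.Dart := by
  have := Γ.finite
  exact Finite.card_subtype_lt hd

/-- Any two functions that satisfy all the relations are equal. -/
theorem value_eq (hf : SatisfiesAll f) (hg : SatisfiesAll g) (H : Γ.IsPlane) : f Γ = g Γ := by
  induction hm : Γ.count vertexWeight using Nat.strong_induction_on generalizing Γ with
  | _ m ih1 =>
  induction ht : Γ.count thickWeight using Nat.strong_induction_on generalizing Γ with
  | _ t ih2 =>
  induction hn : Nat.card Γ.Dart using Nat.strong_induction_on generalizing Γ with
  | _ n ih3 =>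
  -- lexicographic induction on the weight, the number of `222`-vertices and the number of darts
  have small : ∀ Γ' : WebDiagram, Γ'.IsPlane → Γ'.count vertexWeight ≤ m →
      Γ'.count thickWeight ≤ t → Nat.card Γ'.Dart < n → f Γ' = g Γ' := fun Γ' H' h1 h2 h3 => by
    rcases h1.lt_or_eq with h1 | h1
    · exact ih1 _ h1 H' rfl
    rcases h2.lt_or_eq with h2 | h2
    · exact ih2 _ h2 H' h1 rfl
    exact ih3 _ h3 H' h1 h2 rfl
  by_cases hc : Γ.Connected
  swap
  · unfold Connected at hc
    push Not at hc
    obtain ⟨S, hr, ho, ⟨d, hd⟩, ⟨e, he⟩⟩ := hc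
    rw [hf.web.disjoint_union Γ S hr ho H, hg.web.disjoint_union Γ S hr ho H,
      small _ (H.restrict S hr ho) (hm ▸ restrict_count_le S hr ho _)
        (ht ▸ restrict_count_le S hr ho _) (hn ▸ card_restrict_lt S hr ho hd),
      small _ (H.restrict _ _ _) (hm ▸ restrict_count_le _ _ _ _)
        (ht ▸ restrict_count_le _ _ _ _) (hn ▸ card_restrict_lt _ _ _ (not_not.2 he))]
  by_cases hb : ∀ d, IsBivalent Γ.rot d
  · exact value_eq_of_bivalent hf hg H hc hb
  push Not at hb
  obtain ⟨d, hd⟩ := hb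
  have hd' : IsTrivalent Γ.rot d := (Γ.vertex d).elim (fun h => absurd h.1 hd) fun h => h.1
  obtain ⟨X, C, hX, p1, p2, hw, hC⟩ := exists_triWeb hf hg H hc hd'
  have ih : ∀ Γ' : WebDiagram, Γ'.IsPlane → Γ'.count vertexWeight < C.count vertexWeight →
      f Γ' = g Γ' := fun Γ' H' h => ih1 _ (hm ▸ hw vertexWeight ▸ h) H' rfl
  apply hC
  by_cases hT : ∃ x, C.IsThickVertex x
  · by_cases hT' : ∃ x, ¬ C.IsThickVertex x
    · exact TriWeb.agree_of_mixed hf hg p1 p2 hT hT' ih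
    · obtain ⟨x, hx⟩ := hT
      exact TriWeb.agree_of_thick hf hg p1 p2 hx fun Γ' H' h1 h2 =>
        ih2 _ (ht ▸ hw thickWeight ▸ h2) H' (h1.trans ((hw _).trans hm)) rfl
  · push Not at hT
    have hT : C.IsThin := hT
    obtain ⟨y, h1, h2, h3⟩ := hT.exists_small_region p1 p2
    rw [hT.count_eq] at ih
    exact TriWeb.agree_of_region hf hg ih (fun Γ' H' c' e1 e2 =>
      value_eq_of_thickWeight_eq_three hf hg H' c' e2 fun Γ'' H'' h => ih _ H'' (e1 ▸ h))
      _ C p1 p2 hT h1 h2 h3 rfl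

end WebDiagram

/-! ### Colorings -/

/-- A set of pigments. -/
abbrev Color : Type := Finset (Fin 4)

/-- The condition on a coloring at the vertex of `d`, written additively. -/
def IsColoredVertex {X : Type} (rot : Perm X) (defect : X → Bool) (c : X → Color) (d : X) : Prop :=
  (IsBivalent rot d → c (rot d) = if defect d then (c d)ᶜ else c d) ∧
    (IsTrivalent rot d → c (rot (rot d)) = symmDiff (c d) (c (rot d)))

theorem isColoredVertex_congr {X Y : Type} {rot : Perm X} {rot' : Perm Y} {defect : X → Bool}
    {defect' : Y → Bool} {c : Y → Color} (e : X → Y) (he : Function.Injective e)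
    (hrot : ∀ x, e (rot x) = rot' (e x)) {x : X} (hdef : defect' (e x) = defect x) :
    IsColoredVertex rot' defect' c (e x) ↔ IsColoredVertex rot defect (fun x => c (e x)) x := by
  simp only [IsColoredVertex, IsBivalent, IsTrivalent, ← hrot, hdef, he.eq_iff, ne_eq]

namespace WebDiagram

variable {Γ Γ' : WebDiagram}

/-- The conditions on a coloring at a dart. -/
def IsColoredAt (Γ : WebDiagram) (c : Γ.Dart → Color) (d : Γ.Dart) : Prop :=
  c (Γ.opp d) = c d ∧ (c d).card = (if Γ.thick d then 2 else 1) ∧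
    IsColoredVertex Γ.rot Γ.defect c d

theorem eq_symmDiff_of_powersetCard : ∀ s : Color, s.card = 3 → ∀ a ∈ s.powersetCard 2,
    ∀ b ∈ s.powersetCard 2, ∀ c ∈ s.powersetCard 2, {a, b, c} = s.powersetCard 2 →
      c = symmDiff a b := by decide +kernel

theorem powersetCard_of_symmDiff : ∀ a b : Color, a.card = 2 → b.card = 2 →
    (symmDiff a b).card = 2 → (a ∪ b).card = 3 ∧ {a, b, symmDiff a b} = (a ∪ b).powersetCard 2 := by
  decide +kernel

theorem eq_union_iff : ∀ a b c : Color, a.card = 2 → b.card = 1 → c.card = 1 →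
    (a = b ∪ c ↔ c = symmDiff a b) := by decide +kernel

theorem symmDiff_rot : ∀ a b c : Color, c = symmDiff a b → a = symmDiff b c := by
  rintro a b c rfl
  rw [symmDiff_comm a b, symmDiff_symmDiff_cancel_left]

/-- The conditions at trivalent vertices amount to the vanishing of a sum modulo two. -/
theorem isColoring_iff {c : Γ.Dart → Color} : Γ.IsColoring c ↔ ∀ d, Γ.IsColoredAt c d := by
  constructor
  · intro H d
    refine ⟨H.edge d, H.card d, fun hb => ?_, fun ht => ?_⟩
    · split_ifs with h
      · exact H.complementary d hb h
      · exact H.ordinary d hb (by simpa using h)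
    · have h1 := H.card d
      have h2 := H.card (Γ.rot d)
      have h3 := H.card (Γ.rot (Γ.rot d))
      have t1 := ht.rot
      have t2 := t1.rot
      rcases (Γ.vertex d).resolve_left (fun h => ht.not_isBivalent h.1) with
        ⟨-, -, ⟨a, b, e⟩ | ⟨a, b, e⟩ | ⟨a, b, e⟩ | ⟨a, b, e⟩⟩ <;> rw [a] at h1 <;> rw [b] at h2 <;>
          rw [e] at h3
      · obtain ⟨s, hs, hcs⟩ := H.v222 d ht a b
        refine eq_symmDiff_of_powersetCard s hs _ ?_ _ ?_ _ ?_ hcs <;> rw [← hcs] <;> simp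
      · exact (eq_union_iff _ _ _ h1 h2 h3).1 (H.v112 d ht a b)
      · have h := (eq_union_iff _ _ _ h2 h3 h1).1 (by
          simpa only [ht.2] using H.v112 _ t1 b e)
        exact symmDiff_rot _ _ _ (symmDiff_rot _ _ _ h) |>.trans rfl
      · have h := (eq_union_iff _ _ _ h3 h1 h2).1 (by
          simpa only [ht.2] using H.v112 _ t2 e (by rw [ht.2]; exact a))
        exact symmDiff_rot _ _ _ h
  · intro H
    refine ⟨fun d => (H d).1, fun d => (H d).2.1, fun d hb h => ?_, fun d hb h => ?_,
      fun d ht a b => ?_, fun d ht a b => ?_⟩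
    · rw [(H d).2.2.1 hb, h]; rfl
    · rw [(H d).2.2.1 hb, h]; rfl
    · have h1 := (H d).2.1
      have h2 := (H (Γ.rot d)).2.1
      have h3 := (H (Γ.rot (Γ.rot d))).2.1
      rcases (Γ.vertex d).resolve_left (fun h => ht.not_isBivalent h.1) with
        ⟨-, -, ⟨a', b', e⟩ | ⟨a', b', e⟩ | ⟨a', b', e⟩ | ⟨a', b', e⟩⟩
      · rw [b] at b'; exact absurd b' (by simp)
      · rw [a] at h1
        rw [b] at h2
        rw [e] at h3
        exact (eq_union_iff _ _ _ h1 h2 h3).2 ((H d).2.2.2 ht)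
      all_goals rw [a] at a'; exact absurd a' (by simp)
    · have h1 := (H d).2.1
      have h2 := (H (Γ.rot d)).2.1
      have h3 := (H (Γ.rot (Γ.rot d))).2.1
      have h := (H d).2.2.2 ht
      rcases (Γ.vertex d).resolve_left (fun h => ht.not_isBivalent h.1) with
        ⟨-, -, ⟨a', b', e⟩ | ⟨a', b', e⟩ | ⟨a', b', e⟩ | ⟨a', b', e⟩⟩
      · rw [a] at h1
        rw [b] at h2
        rw [e, h] at h3
        obtain ⟨p, q⟩ := powersetCard_of_symmDiff _ _ h1 h2 h3
        exact ⟨_, p, by rw [h]; exact q⟩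
      · rw [b] at b'; exact absurd b' (by simp)
      all_goals rw [a] at a'; exact absurd a' (by simp)

theorem t4_eq (Γ : WebDiagram) : Γ.t4 = Nat.card {c // ∀ d, Γ.IsColoredAt c d} :=
  Nat.card_congr (Equiv.subtypeEquivRight fun _ => isColoring_iff)

theorem isColoredAt_congr (e : Γ.Dart → Γ'.Dart) (he : Function.Injective e)
    (hrot : ∀ x, e (Γ.rot x) = Γ'.rot (e x)) (c : Γ'.Dart → Color) {x : Γ.Dart}
    (hopp : e (Γ.opp x) = Γ'.opp (e x)) (hthick : Γ'.thick (e x) = Γ.thick x)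
    (hdef : Γ'.defect (e x) = Γ.defect x) :
    Γ'.IsColoredAt c (e x) ↔ Γ.IsColoredAt (fun x => c (e x)) x := by
  unfold IsColoredAt
  rw [isColoredVertex_congr e he hrot hdef, ← hopp, hthick]

theorem Isomorphic.t4_eq (h : Γ.Isomorphic Γ') : Γ.t4 = Γ'.t4 := by
  obtain ⟨e, h1, h2, h3, h4, -⟩ := h
  rw [WebDiagram.t4_eq, WebDiagram.t4_eq]
  refine (Nat.card_congr (Equiv.subtypeEquiv (Equiv.arrowCongr e.symm (Equiv.refl _))
    fun c => ?_)).symm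
  exact e.surjective.forall.trans (forall_congr' fun x =>
    isColoredAt_congr e e.injective h1 c (h2 x) (h3 x) (h4 x))

/-- The new vertex is bivalent without a defect, so both halves of the edge keep its color. -/
theorem t4_subdivide (Γ : WebDiagram) (d : Γ.Dart) : (Γ.subdivide d).t4 = Γ.t4 := by
  classical
  rw [t4_eq, t4_eq]
  have hb : ∀ b, IsBivalent (Γ.subdivide d).rot (.inr b) := fun b =>
    ⟨fun h => Bool.not_ne_self b (Sum.inr.inj h), congrArg Sum.inr (Bool.not_not b)⟩
  have hs : ∀ x, Γ.subdivideOpp d (.inl x) = if x = d then .inr false else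
    if x = Γ.opp d then .inr true else .inl (Γ.opp x) := fun _ => by simp only [subdivideOpp]
  have hv : ∀ (c : Γ.Dart ⊕ Bool → Color) x,
      IsColoredVertex (Γ.subdivide d).rot (Γ.subdivide d).defect c (.inl x) ↔
        IsColoredVertex Γ.rot Γ.defect (fun x => c (.inl x)) x := fun c x =>
    isColoredVertex_congr (rot' := (Γ.subdivide d).rot) Sum.inl Sum.inl_injective (fun _ => rfl) rfl
  refine Nat.card_congr
    { toFun := fun c => ⟨fun x => c.1 (.inl x), fun x => ?_⟩
      invFun := fun c => ⟨Sum.elim c.1 fun _ => c.1 d, ?_⟩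
      left_inv := ?_
      right_inv := fun c => rfl }
  · obtain ⟨c, hc⟩ := c
    have e1 : c (.inl d) = c (.inr false) := (hc (.inr false)).1
    have e2 : c (.inl (Γ.opp d)) = c (.inr true) := (hc (.inr true)).1
    have e3 : c (.inr true) = c (.inr false) := (hc (.inr false)).2.2.1 (hb false)
    refine ⟨?_, (hc (.inl x)).2.1, (hv c x).1 (hc (.inl x)).2.2⟩
    have e4 : c (Γ.subdivideOpp d (.inl x)) = c (.inl x) := (hc (.inl x)).1
    change c (.inl (Γ.opp x)) = c (.inl x)
    rw [hs] at e4
    split_ifs at e4 with g1 g2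
    · rw [g1]; exact e2.trans (e3.trans e1.symm)
    · rw [g2, Γ.opp_opp]; exact e1.trans (e3.symm.trans e2.symm)
    · exact e4
  · have hd := c.2 d
    rintro (x | b)
    · refine ⟨?_, (c.2 x).2.1, (hv _ x).2 (c.2 x).2.2⟩
      change Sum.elim c.1 (fun _ => c.1 d) (Γ.subdivideOpp d (.inl x)) = c.1 x
      rw [hs]
      split_ifs with g1 g2
      · rw [g1]; rfl
      · rw [g2]; exact (c.2 d).1.symm
      · exact (c.2 x).1
    · refine ⟨?_, hd.2.1, fun _ => rfl, fun h => ?_⟩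
      · cases b
        exacts [rfl, hd.1]
      · exact absurd (hb b) h.not_isBivalent
  · rintro ⟨c, hc⟩
    ext1
    funext x
    rcases x with x | b
    · rfl
    · have e1 : c (.inl d) = c (.inr false) := (hc (.inr false)).1
      have e3 : c (.inr true) = c (.inr false) := (hc (.inr false)).2.2.1 (hb false)
      cases b
      exacts [e1, e1.trans e3.symm]

/-- A coloring of a disjoint union is a pair of colorings of its two parts. -/
theorem t4_restrict (Γ : WebDiagram) (S : Γ.Dart → Prop) (hrot : ∀ d, S (Γ.rot d) ↔ S d)
    (hopp : ∀ d, S (Γ.opp d) ↔ S d) : Γ.t4 = (Γ.restrict S hrot hopp).t4 *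
      (Γ.restrict (fun d => ¬ S d) (fun d => not_congr (hrot d))
        (fun d => not_congr (hopp d))).t4 := by
  classical
  have key : ∀ (S : Γ.Dart → Prop) (hrot : ∀ d, S (Γ.rot d) ↔ S d)
      (hopp : ∀ d, S (Γ.opp d) ↔ S d) (c : Γ.Dart → Color),
      (∀ d, (Γ.restrict S hrot hopp).IsColoredAt (fun x => c x.1) d) ↔
        ∀ d, S d → Γ.IsColoredAt c d := fun S hrot hopp c =>
    (forall_congr' fun d => (isColoredAt_congr (Γ := Γ.restrict S hrot hopp) Subtype.val
      Subtype.val_injective (fun _ => rfl) c rfl rfl rfl).symm).trans Subtype.forall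
  rw [t4_eq, t4_eq, t4_eq, ← Nat.card_prod]
  refine Nat.card_congr ((Equiv.subtypeEquiv (Equiv.piEquivPiSubtypeProd S fun _ => Color)
    fun c => ?_).trans Equiv.subtypeProdEquivProd)
  refine Iff.trans ?_ (and_congr (key S hrot hopp c) (key _ _ _ c)).symm
  exact ⟨fun h => ⟨fun d _ => h d, fun d _ => h d⟩, fun h d =>
    (em (S d)).elim (h.1 d) (h.2 d)⟩

theorem t4_empty : empty.t4 = 1 := by
  rw [t4_eq, Nat.card_eq_one_iff_unique]
  exact ⟨⟨fun a b => Subtype.ext (funext fun x => x.elim)⟩, ⟨⟨fun x => x.elim, fun x => x.elim⟩⟩⟩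

theorem t4_circle (th df : Bool) (h : df = true → th = true) : (circle th df h).t4 =
    Nat.card {a : Color // a.card = (if th then 2 else 1) ∧ a = if df then aᶜ else a} := by
  have hb : ∀ x, IsBivalent (circle th df h).rot x := fun x =>
    ⟨fun h => Bool.not_ne_self x h, Bool.not_not x⟩
  rw [t4_eq]
  refine Nat.card_congr
    { toFun := fun c => ⟨c.1 true, (c.2 true).2.1, ?_⟩
      invFun := fun a => ⟨fun _ => a.1, fun d => ⟨rfl, a.2.1, fun _ => a.2.2, fun h =>
        absurd (hb d) h.not_isBivalent⟩⟩
      left_inv := fun c => Subtype.ext (funext fun x => ?_)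
      right_inv := fun a => rfl }
  · have h1 := (c.2 true).1
    have h2 := (c.2 true).2.2.1 (hb true)
    exact h1.symm.trans h2
  · cases x
    exacts [(c.2 true).1.symm, rfl]

end WebDiagram

/-! ### Counting colorings of tangles -/

namespace Tangle

variable {n : ℕ} {bd : Fin n → Bool}

/-- Colorings of a tangle. -/
structure IsColoring (A : Tangle bd) (c : A.Dart ⊕ Fin n → Color) : Prop where
  edge : ∀ x, c (A.opp x) = c x
  card : ∀ x, (c x).card = if A.thick x then 2 else 1
  vertex : ∀ d, IsColoredVertex A.rot A.defect (fun d => c (.inl d)) d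

/-- The number of colorings of a tangle with given colors at the boundary. -/
noncomputable def state (A : Tangle bd) (b : Fin n → Color) : ℕ :=
  Nat.card {c // A.IsColoring c ∧ (fun i => c (.inr i)) = b}

theorem state_eq_zero (A : Tangle bd) {b : Fin n → Color}
    (hb : ¬ ∀ i, (b i).card = if bd i then 2 else 1) : A.state b = 0 := by
  rw [state, Nat.card_eq_zero]
  refine Or.inl ⟨fun c => hb fun i => ?_⟩
  rw [← c.2.2, c.2.1.card, A.thick_bd]

theorem isColoring_map (A : Tangle bd) (σ : Perm (Fin 4)) {c : A.Dart ⊕ Fin n → Color}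
    (hc : A.IsColoring c) : A.IsColoring fun x => (c x).map σ.toEmbedding where
  edge x := by rw [hc.edge]
  card x := by rw [Finset.card_map, hc.card]
  vertex d := by
    refine ⟨fun h => ?_, fun h => ?_⟩
    · have := (hc.vertex d).1 h
      simp only [this]
      split_ifs
      · ext; simp [Finset.mem_map_equiv]
      · rfl
    · have := (hc.vertex d).2 h
      simp only [this]
      ext; simp [Finset.mem_map_equiv, Finset.mem_symmDiff]

/-- The pigments can be permuted. -/
theorem state_map (A : Tangle bd) (σ : Perm (Fin 4)) (b : Fin n → Color) :
    A.state (fun i => (b i).map σ.toEmbedding) = A.state b := by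
  have h1 : ∀ (τ : Perm (Fin 4)) (s : Color),
      (s.map τ.toEmbedding).map τ.symm.toEmbedding = s := fun τ s => by
    ext; simp [Finset.mem_map_equiv]
  refine Nat.card_congr
    { toFun := fun c => ⟨fun x => (c.1 x).map σ.symm.toEmbedding,
        A.isColoring_map σ.symm c.2.1, funext fun i => ?_⟩
      invFun := fun c => ⟨fun x => (c.1 x).map σ.toEmbedding, A.isColoring_map σ c.2.1,
        funext fun i => ?_⟩
      left_inv := fun c => Subtype.ext (funext fun x => h1 σ.symm _)
      right_inv := fun c => Subtype.ext (funext fun x => h1 σ _) }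
  · change (c.1 (.inr i)).map _ = _
    rw [congrFun c.2.2 i, h1]
  · change (c.1 (.inr i)).map _ = _
    rw [congrFun c.2.2 i]

/-- The Tait number is a state sum over the colors on the boundary of a disc. -/
theorem _root_.OuterTangle.t4_glue (O : OuterTangle bd) (A : Tangle bd) :
    (O.glue A).t4 = ∑ b, O.toTangle.state b * A.state b := by
  classical
  have := O.finite
  have := A.finite
  have hO : ∀ (c : (O.glue A).Dart → Color) d,
      IsColoredVertex (O.glue A).rot (O.glue A).defect c (.inl (.inl d)) ↔
        IsColoredVertex O.rot O.defect (fun x => c (.inl (.inl x))) d := fun c d =>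
    isColoredVertex_congr (rot' := (O.glue A).rot) (fun x => Sum.inl (Sum.inl x))
      (Sum.inl_injective.comp Sum.inl_injective) (fun _ => rfl) rfl
  have hA : ∀ (c : (O.glue A).Dart → Color) d,
      IsColoredVertex (O.glue A).rot (O.glue A).defect c (.inr (.inl d)) ↔
        IsColoredVertex A.rot A.defect (fun x => c (.inr (.inl x))) d := fun c d =>
    isColoredVertex_congr (rot' := (O.glue A).rot) (fun x => Sum.inr (Sum.inl x))
      (Sum.inr_injective.comp Sum.inl_injective) (fun _ => rfl) rfl
  have hb1 : ∀ i, IsBivalent (O.glue A).rot (.inl (.inr i)) := fun i => ⟨Sum.inr_ne_inl, rfl⟩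
  have hb2 : ∀ i, IsBivalent (O.glue A).rot (.inr (.inr i)) := fun i => ⟨Sum.inl_ne_inr, rfl⟩
  -- the leg ends become bivalent vertices: colorings of the glued web are pairs of colorings that
  -- agree at the boundary
  have key : ∀ c : (O.glue A).Dart → Color, (∀ d, (O.glue A).IsColoredAt c d) ↔
      O.toTangle.IsColoring (fun x => c (.inl x)) ∧ A.IsColoring (fun x => c (.inr x)) ∧
        (fun i => c (.inl (.inr i))) = fun i => c (.inr (.inr i)) := fun c =>
    ⟨fun h => ⟨⟨fun x => (h (.inl x)).1, fun x => (h (.inl x)).2.1, fun d =>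
        (hO c d).1 (h (.inl (.inl d))).2.2⟩, ⟨fun x => (h (.inr x)).1, fun x => (h (.inr x)).2.1,
        fun d => (hA c d).1 (h (.inr (.inl d))).2.2⟩, funext fun i =>
        ((h (.inl (.inr i))).2.2.1 (hb1 i)).symm⟩, fun ⟨h1, h2, h3⟩ => by
      have h4 : ∀ i, c (.inl (.inr i)) = c (.inr (.inr i)) := congrFun h3
      rintro ((d | i) | (d | i))
      · exact ⟨h1.edge _, h1.card _, (hO c d).2 (h1.vertex d)⟩
      · exact ⟨h1.edge _, h1.card _, fun _ => (h4 i).symm, fun h => absurd (hb1 i) h.not_isBivalent⟩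
      · exact ⟨h2.edge _, h2.card _, (hA c d).2 (h2.vertex d)⟩
      · exact ⟨h2.edge _, h2.card _, fun _ => h4 i, fun h => absurd (hb2 i) h.not_isBivalent⟩⟩
  have e : {c // ∀ d, (O.glue A).IsColoredAt c d} ≃ Σ b : Fin n → Color,
      {c // O.toTangle.IsColoring c ∧ (fun i => c (.inr i)) = b} ×
        {c // A.IsColoring c ∧ (fun i => c (.inr i)) = b} :=
    { toFun := fun c => ⟨_, ⟨_, ((key c.1).1 c.2).1, rfl⟩, ⟨_, ((key c.1).1 c.2).2.1,
        ((key c.1).1 c.2).2.2.symm⟩⟩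
      invFun := fun q => ⟨Sum.elim q.2.1.1 q.2.2.1, (key _).2 ⟨q.2.1.2.1, q.2.2.2.1,
        q.2.1.2.2.trans q.2.2.2.2.symm⟩⟩
      left_inv := fun c => Subtype.ext (by funext x; rcases x with x | x <;> rfl)
      right_inv := by
        rintro ⟨b, ⟨c, h1, rfl⟩, ⟨c', h2, h3⟩⟩
        rfl }
  rw [WebDiagram.t4_eq, Nat.card_congr e, Nat.card_sigma]
  exact Finset.sum_congr rfl fun b _ => Nat.card_prod _ _

end Tangle

/-! ### Evaluating state sums -/

/-- A set of pigments as a binary number. -/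
def mask (s : Color) : ℕ := ∑ i ∈ s, 2 ^ (i : ℕ)

/-- The codes of the colors of an edge. -/
def masks (w : Bool) : List ℕ := Bool.rec [1, 2, 4, 8] [3, 5, 6, 9, 10, 12] w

theorem mask_injective : Function.Injective mask := by
  have : ∀ a b, mask a = mask b → a = b := by decide +kernel
  exact this

theorem mask_symmDiff : ∀ a b, mask (symmDiff a b) = mask a ^^^ mask b := by decide +kernel

theorem mask_compl : ∀ a, mask aᶜ = mask a ^^^ 15 := by decide +kernel

theorem mask_mem_masks : ∀ (a : Color) (w : Bool), a.card = (if w then 2 else 1) →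
    mask a ∈ masks w := by decide +kernel

theorem sum_masks (w : Bool) (F : ℕ → ℕ) :
    ∑ a : Color, (if a.card = (if w then 2 else 1) then F (mask a) else 0) =
      ((masks w).map F).sum := by
  have h : ∀ w : Bool, ((Finset.univ.filter fun a : Color =>
      a.card = if w then 2 else 1).val.map mask) = (masks w : Multiset ℕ) := by decide +kernel
  rw [← Finset.sum_filter, Finset.sum, ← Multiset.sum_coe, ← Multiset.map_coe, ← h,
    Multiset.map_map]
  rfl

/-! The following functions are evaluated by the kernel, which is why they are defined by
recursors. -/

/-- All elements of the list satisfy `p`. -/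
def allOf {α : Type} (p : α → Bool) (l : List α) : Bool :=
  List.rec true (fun q _ r => Bool.rec false r (p q)) l

/-- The sum of `f` over the elements of the list that satisfy `p`. -/
def sumOf (p : ℕ → Bool) (f : ℕ → ℕ) (l : List ℕ) : ℕ :=
  List.rec 0 (fun z _ m => Bool.rec m (Nat.add (f z) m) (p z)) l

theorem allOf_eq {α : Type} (p : α → Bool) (l : List α) : allOf p l = true ↔ ∀ q ∈ l, p q = true := by
  induction l with
  | nil => simp [allOf]
  | cons a l ih =>
    have : allOf p (a :: l) = Bool.rec false (allOf p l) (p a) := rfl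
    rw [this, List.forall_mem_cons, ← ih]
    cases p a <;> simp

theorem sumOf_eq (p : ℕ → Bool) (f : ℕ → ℕ) (l : List ℕ) :
    sumOf p f l = (l.map fun z => if p z = true then f z else 0).sum := by
  induction l with
  | nil => rfl
  | cons a l ih =>
    have : sumOf p f (a :: l) = Bool.rec (sumOf p f l) (Nat.add (f a) (sumOf p f l)) (p a) := rfl
    rw [this, List.map_cons, List.sum_cons, ← ih]
    cases p a <;> simp

/-- The sum modulo two of the colors of a list of edges. -/
def xorAll (env : ℕ → ℕ) (es : List ℕ) : ℕ := List.rec 0 (fun e _ r => Nat.xor (env e) r) es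

theorem xorAll_congr {env env' : ℕ → ℕ} {es : List ℕ} (h : ∀ e ∈ es, env e = env' e) :
    xorAll env es = xorAll env' es := by
  induction es with
  | nil => rfl
  | cons a l ih =>
    have h1 : ∀ env, xorAll env (a :: l) = Nat.xor (env a) (xorAll env l) := fun _ => rfl
    rw [h1, h1, h a (by simp), ih fun e he => h e (by simp [he])]

/-- The smallest element of the list is `k`. -/
def isLeast (k : ℕ) (es : List ℕ) : Bool := es.all (fun e => k.ble e) && es.any (fun e => k.beq e)

theorem isLeast_iff {k : ℕ} {es : List ℕ} : isLeast k es = true ↔ (∀ e ∈ es, k ≤ e) ∧ k ∈ es := by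
  simp [isLeast]

/-- The assignment of colors `env` with the color of the edge `k` changed to `z`. -/
def update (env : ℕ → ℕ) (k z e : ℕ) : ℕ := Bool.rec (env e) z (e.beq k)

theorem update_eq (env : ℕ → ℕ) (k z e : ℕ) : update env k z e = if e = k then z else env e := by
  unfold update
  by_cases h : e = k
  · rw [if_pos h, h, Nat.beq_refl]
  · rw [if_neg h]
    cases h' : e.beq k
    · rfl
    · exact absurd (Nat.eq_of_beq_eq_true h') h

/-- The number of ways to color the edges `0`, …, `k - 1`, when the larger edges have been
colored, such that the sums modulo two over certain lists of edges are as prescribed. -/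
def countColorings (w : ℕ → Bool) (cons : List (List ℕ × ℕ)) : ℕ → (ℕ → ℕ) → ℕ :=
  Nat.rec (fun _ => 1) fun k ih env =>
    sumOf (fun z => allOf (fun q => (xorAll (update env k z) q.1).beq q.2)
      (cons.filter fun q => isLeast k q.1)) (fun z => ih (update env k z)) (masks (w k))

/-- The colors of all edges, when those below `k` are given by `l`. -/
def overlay {k : ℕ} (l : Fin k → Color) (env : ℕ → ℕ) (e : ℕ) : ℕ :=
  if h : e < k then mask (l ⟨e, h⟩) else env e

theorem overlay_snoc {k : ℕ} (z : Color) (l : Fin k → Color) (env : ℕ → ℕ) :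
    overlay (Fin.snoc (α := fun _ => Color) l z) env = overlay l (update env k (mask z)) := by
  funext e
  unfold overlay
  rcases lt_trichotomy e k with h | rfl | h
  · rw [dif_pos h, dif_pos (by omega)]
    exact congrArg mask (Fin.snoc_castSucc (α := fun _ => Color) z l ⟨e, h⟩)
  · rw [dif_pos (by omega), dif_neg (by omega), update_eq, if_pos rfl]
    exact congrArg mask (Fin.snoc_last (α := fun _ => Color) z l)
  · rw [dif_neg (by omega), dif_neg (by omega), update_eq, if_neg (by omega)]

open Classical in
/-- The recursion counts the solutions of the equations: edges are colored in decreasing order,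
and an equation is tested as soon as its least edge has a color. -/
theorem countColorings_eq (w : ℕ → Bool) (cons : List (List ℕ × ℕ)) (k : ℕ) (env : ℕ → ℕ) :
    countColorings w cons k env = ∑ l : Fin k → Color,
      if (∀ j, (l j).card = if w j then 2 else 1) ∧ ∀ q ∈ cons, (∃ j < k, isLeast j q.1 = true) →
        xorAll (overlay l env) q.1 = q.2 then 1 else 0 := by
  induction k generalizing env with
  | zero =>
    rw [Fintype.sum_unique, if_pos ⟨fun j => j.elim0, fun q _ ⟨j, hj, _⟩ => absurd hj (by omega)⟩]
    rfl
  | succ k ih =>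
    have h1 : countColorings w cons (k + 1) env =
        sumOf (fun z => allOf (fun q => (xorAll (update env k z) q.1).beq q.2)
          (cons.filter fun q => isLeast k q.1))
          (fun z => countColorings w cons k (update env k z)) (masks (w k)) := rfl
    rw [h1, sumOf_eq, ← sum_masks, ← (Fin.snocEquiv fun _ : Fin (k + 1) => Color).sum_comp,
      Fintype.sum_prod_type]
    refine Finset.sum_congr rfl fun z _ => ?_
    have hcheck : allOf (fun q => (xorAll (update env k (mask z)) q.1).beq q.2)
        (cons.filter fun q => isLeast k q.1) = true ↔
        ∀ q ∈ cons, isLeast k q.1 = true → xorAll (update env k (mask z)) q.1 = q.2 := by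
      simp [allOf_eq, List.mem_filter]
    have hl : ∀ l : Fin k → Color,
        ((∀ j, ((Fin.snocEquiv fun _ : Fin (k + 1) => Color) (z, l) j).card =
          if w j then 2 else 1) ∧ ∀ q ∈ cons, (∃ j < k + 1, isLeast j q.1 = true) →
            xorAll (overlay ((Fin.snocEquiv fun _ : Fin (k + 1) => Color) (z, l)) env) q.1 = q.2) ↔
        (z.card = (if w k then 2 else 1) ∧
          ∀ q ∈ cons, isLeast k q.1 = true → xorAll (update env k (mask z)) q.1 = q.2) ∧
        (∀ j, (l j).card = if w j then 2 else 1) ∧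
          ∀ q ∈ cons, (∃ j < k, isLeast j q.1 = true) →
            xorAll (overlay l (update env k (mask z))) q.1 = q.2 := fun l => by
      have e1 : overlay ((Fin.snocEquiv fun _ : Fin (k + 1) => Color) (z, l)) env =
        overlay l (update env k (mask z)) := overlay_snoc z l env
      have e2 : ∀ q : List ℕ × ℕ, isLeast k q.1 = true →
          xorAll (overlay l (update env k (mask z))) q.1 = xorAll (update env k (mask z)) q.1 :=
        fun q hq => xorAll_congr fun e he => by
          have := (isLeast_iff.1 hq).1 e he
          rw [overlay, dif_neg (by omega)]
      have e3 : ∀ j : Fin k, (Fin.snocEquiv fun _ : Fin (k + 1) => Color) (z, l) j.castSucc = l j :=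
        fun j => Fin.snoc_castSucc (α := fun _ => Color) z l j
      have e4 : (Fin.snocEquiv fun _ : Fin (k + 1) => Color) (z, l) (Fin.last k) = z :=
        Fin.snoc_last (α := fun _ => Color) z l
      rw [Fin.forall_fin_succ', e1, e4]
      simp only [e3, Fin.val_castSucc, Fin.val_last]
      constructor
      · rintro ⟨⟨a1, a2⟩, a3⟩
        exact ⟨⟨a2, fun q hq hk => (e2 q hk).symm.trans (a3 q hq ⟨k, by omega, hk⟩)⟩, a1,
          fun q hq ⟨j, hj, h⟩ => a3 q hq ⟨j, by omega, h⟩⟩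
      · rintro ⟨⟨a2, a3⟩, a1, a4⟩
        refine ⟨⟨a1, a2⟩, fun q hq ⟨j, hj, h⟩ => ?_⟩
        rcases Nat.lt_succ_iff_lt_or_eq.1 hj with hj | rfl
        · exact a4 q hq ⟨j, hj, h⟩
        · exact (e2 q h).trans (a3 q hq h)
    simp only [hl, hcheck, ih, ite_and]
    split_ifs <;> simp

section Code

variable {t n b : ℕ} {bd : Fin n → Bool} {tri : Fin t → Fin 3 → ℕ}
    {dfc : Fin b → Fin 2 → ℕ} {leg : Fin n → ℕ} {thickEdges : List ℕ}
    {h : ∀ x, ∃! y, y ≠ x ∧ codeEdge tri dfc leg y = codeEdge tri dfc leg x}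
    {hbd : ∀ i, decide (leg i ∈ thickEdges) = bd i}
    {hv : ∀ d, IsWebVertex (codeRot t b)
      (fun d => decide (codeEdge tri dfc leg (Sum.inl d) ∈ thickEdges)) (codeDefect t b) d}

/-- The equations for the colors of the edges of a code with `E` edges.  The edges are numbered
backwards, so that the legs are colored first. -/
def codeEquations (E : ℕ) (tri : Fin t → Fin 3 → ℕ) (dfc : Fin b → Fin 2 → ℕ) (leg : Fin n → ℕ)
    (β : Fin n → ℕ) : List (List ℕ × ℕ) :=
  (List.ofFn fun i => ([E - 1 - leg i], β i)) ++
    (List.ofFn fun v => (List.ofFn fun j => E - 1 - tri v j, 0)) ++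
    List.ofFn fun v => (List.ofFn fun j => E - 1 - dfc v j, 15)

/-- The number of colorings of the edges of a code with the colors `β` at the ends of the legs. -/
def codeCount (E : ℕ) (tri : Fin t → Fin 3 → ℕ) (dfc : Fin b → Fin 2 → ℕ) (leg : Fin n → ℕ)
    (thickEdges : List ℕ) (β : Fin n → ℕ) : ℕ :=
  countColorings (fun k => decide (E - 1 - k ∈ thickEdges)) (codeEquations E tri dfc leg β) E
    fun _ => 0

theorem Tangle.codeEdge_opp (x : CodeDart t b ⊕ Fin n) :
    codeEdge tri dfc leg ((Tangle.ofCode bd tri dfc leg thickEdges h hbd hv).opp x) =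
      codeEdge tri dfc leg x := (partner_spec _ h x).2

theorem xor_eq_zero_iff_symmDiff (a b c : Color) :
    mask a ^^^ (mask b ^^^ mask c) = 0 ↔ c = symmDiff a b := by
  rw [← mask_injective.eq_iff, mask_symmDiff, ← Nat.xor_assoc, Nat.xor_eq_zero_iff, eq_comm]

theorem xor_eq_iff_compl (a b : Color) : mask a ^^^ mask b = 15 ↔ b = aᶜ := by
  rw [← mask_injective.eq_iff, mask_compl]
  constructor
  · intro h
    rw [← h, ← Nat.xor_assoc, Nat.xor_self, Nat.zero_xor]
  · intro h
    rw [h, ← Nat.xor_assoc, Nat.xor_self, Nat.zero_xor]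

theorem isLeast_exists {es : List ℕ} (h : es ≠ []) {E : ℕ} (hE : ∀ e ∈ es, e < E) :
    ∃ j < E, isLeast j es = true := by
  obtain ⟨j, hj⟩ : ∃ j, j ∈ es.toFinset ∧ ∀ e ∈ es.toFinset, j ≤ e :=
    Finset.exists_min_image es.toFinset id (by simpa [List.toFinset_nonempty_iff] using h)
  simp only [List.mem_toFinset] at hj
  exact ⟨j, hE j hj.1, isLeast_iff.2 ⟨hj.2, hj.1⟩⟩

/-- Colorings of a tangle given by a code amount to colorings of its edges.  The edges may
be renamed. -/
theorem Tangle.ofCode_state_of_rename (E : ℕ) (tri' : Fin t → Fin 3 → ℕ) (dfc' : Fin b → Fin 2 → ℕ)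
    (leg' : Fin n → ℕ) (thickEdges' : List ℕ) (hr : ∀ x y, codeEdge tri' dfc' leg' x =
      codeEdge tri' dfc' leg' y ↔ codeEdge tri dfc leg x = codeEdge tri dfc leg y)
    (ht : ∀ x, decide (codeEdge tri' dfc' leg' x ∈ thickEdges') =
      decide (codeEdge tri dfc leg x ∈ thickEdges))
    (hE : ∀ x, codeEdge tri' dfc' leg' x < E)
    (hs : ∀ j : Fin E, ∃ x, codeEdge tri' dfc' leg' x = j) (β : Fin n → Color) :
    (ofCode bd tri dfc leg thickEdges h hbd hv).state β =
      codeCount E tri' dfc' leg' thickEdges' fun i => mask (β i) := by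
  classical
  let A := ofCode bd tri dfc leg thickEdges h hbd hv
  -- the numbering is reversed, since the recursion starts with the largest edge
  let p : CodeDart t b ⊕ Fin n → Fin E := fun x => Fin.rev ⟨codeEdge tri' dfc' leg' x, hE x⟩
  have hp : ∀ {x y}, p x = p y ↔ codeEdge tri dfc leg x = codeEdge tri dfc leg y := fun {x y} => by
    rw [Fin.rev_inj, Fin.mk.injEq, hr]
  have hsurj : Function.Surjective p := fun j => by
    obtain ⟨x, hx⟩ := hs j.rev
    exact ⟨x, by rw [← Fin.rev_inj, Fin.rev_rev]; exact Fin.ext hx⟩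
  have hpv : ∀ x, ((p x : Fin E) : ℕ) = E - 1 - codeEdge tri' dfc' leg' x := fun x => by
    have := hE x
    rw [Fin.val_rev]
    simp only
    omega
  have hthick : ∀ x : CodeDart t b ⊕ Fin n, A.thick x = decide (E - 1 - (p x : ℕ) ∈ thickEdges') := fun x => by
    have := hE x
    have e : E - 1 - (p x : ℕ) = codeEdge tri' dfc' leg' x := by rw [hpv]; omega
    exact (ht x).symm.trans (congrArg (fun k => decide (k ∈ thickEdges')) e.symm)
  have hov : ∀ (l : Fin E → Color) x, overlay l (fun _ => 0) (E - 1 - codeEdge tri' dfc' leg' x) =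
      mask (l (p x)) := fun l x => by
    rw [← hpv, overlay, dif_pos (p x).2]
  have hx1 : ∀ (env : ℕ → ℕ) a, xorAll env [a] = env a := fun env a => Nat.xor_zero _
  have hx2 : ∀ (env : ℕ → ℕ) a b, xorAll env [a, b] = env a ^^^ env b := fun env a b =>
    congrArg (env a ^^^ ·) (hx1 env b)
  have hx3 : ∀ (env : ℕ → ℕ) a b c, xorAll env [a, b, c] = env a ^^^ (env b ^^^ env c) :=
    fun env a b c => congrArg (env a ^^^ ·) (hx2 env b c)
  have htri : ∀ d, IsTrivalent (codeRot t b) (.inl d) := fun ⟨v, j⟩ =>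
    ⟨by revert j; simp [codeRot], by
      have : ∀ j : Fin 3, j + 1 + 1 + 1 = j := by decide
      exact congrArg (fun j => Sum.inl (v, j)) (this j)⟩
  have hbiv : ∀ d, IsBivalent (codeRot t b) (.inr d) := fun ⟨v, j⟩ =>
    ⟨by revert j; simp [codeRot], by
      have : ∀ j : Fin 2, j + 1 + 1 = j := by decide
      exact congrArg (fun j => Sum.inr (v, j)) (this j)⟩
  -- the conditions on thickness, at the vertices and on the boundary are compared separately
  have key : ∀ l : Fin E → Color, (A.IsColoring (fun x => l (p x)) ∧ (fun i => l (p (.inr i))) = β) ↔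
      (∀ j : Fin E, (l j).card = if decide (E - 1 - (j : ℕ) ∈ thickEdges') = true then 2 else 1) ∧
      ∀ q ∈ codeEquations E tri' dfc' leg' fun i => mask (β i), (∃ j < E, isLeast j q.1 = true) →
        xorAll (overlay l fun _ => 0) q.1 = q.2 := fun l => by
    have c1 : (∀ x : CodeDart t b ⊕ Fin n, (l (p x)).card = if A.thick x = true then 2 else 1) ↔
        ∀ j : Fin E, (l j).card = if decide (E - 1 - (j : ℕ) ∈ thickEdges') = true then 2 else 1 :=
      (forall_congr' fun x => iff_of_eq (congrArg (fun s : Bool => (l (p x)).card =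
        if s = true then 2 else 1) (hthick x))).trans (hsurj.forall (p := fun j => (l j).card =
          if decide (E - 1 - (j : ℕ) ∈ thickEdges') = true then 2 else 1)).symm
    have c2 : (∀ d, IsColoredVertex (codeRot t b) (codeDefect t b) (fun d => l (p (.inl d))) d) ↔
        (∀ v, xorAll (overlay l fun _ => 0) (List.ofFn fun j => E - 1 - tri' v j) = 0) ∧
        ∀ v, xorAll (overlay l fun _ => 0) (List.ofFn fun j => E - 1 - dfc' v j) = 15 := by
      have e1 : ∀ v, xorAll (overlay l fun _ => 0) (List.ofFn fun j => E - 1 - tri' v j) = 0 ↔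
          l (p (.inl (.inl (v, 2)))) =
            symmDiff (l (p (.inl (.inl (v, 0))))) (l (p (.inl (.inl (v, 1))))) := fun v => by
        rw [← xor_eq_zero_iff_symmDiff, ← hov, ← hov, ← hov]
        exact iff_of_eq (congrArg (· = 0) (hx3 _ _ _ _))
      have e2 : ∀ v, xorAll (overlay l fun _ => 0) (List.ofFn fun j => E - 1 - dfc' v j) = 15 ↔
          l (p (.inl (.inr (v, 1)))) = (l (p (.inl (.inr (v, 0)))))ᶜ := fun v => by
        rw [← xor_eq_iff_compl, ← hov, ← hov]
        exact iff_of_eq (congrArg (· = 15) (hx2 _ _ _))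
      simp only [e1, e2]
      constructor
      · exact fun H => ⟨fun v => (H (.inl (v, 0))).2 (htri _), fun v => (H (.inr (v, 0))).1 (hbiv _)⟩
      · rintro ⟨H1, H2⟩ (⟨v, j⟩ | ⟨v, j⟩)
        · refine ⟨fun h => absurd h (htri _).not_isBivalent, fun _ => ?_⟩
          have a1 := H1 v
          have a2 := WebDiagram.symmDiff_rot _ _ _ a1
          fin_cases j
          exacts [a1, a2, WebDiagram.symmDiff_rot _ _ _ a2]
        · refine ⟨fun _ => ?_, fun h => absurd (hbiv _) h.not_isBivalent⟩
          have a1 := H2 v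
          fin_cases j
          exacts [a1, (compl_compl _).symm.trans (congrArg _ a1.symm)]
    have c3 : (fun i => l (p (.inr i))) = β ↔
        ∀ i, xorAll (overlay l fun _ => 0) [E - 1 - leg' i] = mask (β i) := by
      rw [funext_iff]
      refine forall_congr' fun i => ?_
      rw [hx1, ← mask_injective.eq_iff, ← hov]
      rfl
    have c4 : ∀ q ∈ codeEquations E tri' dfc' leg' fun i => mask (β i),
        ∃ j < E, isLeast j q.1 = true := fun q hq => by
      rcases Nat.eq_zero_or_pos E with rfl | hE0
      · simp only [codeEquations, List.mem_append, List.mem_ofFn] at hq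
        rcases hq with (⟨i, -⟩ | ⟨v, -⟩) | ⟨v, -⟩
        exacts [absurd (hE (.inr i)) (by omega), absurd (hE (.inl (.inl (v, 0)))) (by omega),
          absurd (hE (.inl (.inr (v, 0)))) (by omega)]
      · simp only [codeEquations, List.mem_append, List.mem_ofFn] at hq
        rcases hq with (⟨i, rfl⟩ | ⟨v, rfl⟩) | ⟨v, rfl⟩ <;> refine isLeast_exists (by simp) ?_ <;>
          simp only [List.mem_ofFn, List.mem_singleton] <;> rintro e he
        · omega
        all_goals obtain ⟨j, rfl⟩ := he; omega
    have c5 : (∀ q ∈ codeEquations E tri' dfc' leg' fun i => mask (β i),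
        (∃ j < E, isLeast j q.1 = true) → xorAll (overlay l fun _ => 0) q.1 = q.2) ↔
        (∀ i, xorAll (overlay l fun _ => 0) [E - 1 - leg' i] = mask (β i)) ∧
        (∀ v, xorAll (overlay l fun _ => 0) (List.ofFn fun j => E - 1 - tri' v j) = 0) ∧
        ∀ v, xorAll (overlay l fun _ => 0) (List.ofFn fun j => E - 1 - dfc' v j) = 15 := by
      constructor
      · intro H
        have H' := fun q hq => H q hq (c4 q hq)
        simp only [codeEquations, List.mem_append, List.mem_ofFn] at H'
        exact ⟨fun i => H' _ (Or.inl (Or.inl ⟨i, rfl⟩)), fun v => H' _ (Or.inl (Or.inr ⟨v, rfl⟩)),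
          fun v => H' _ (Or.inr ⟨v, rfl⟩)⟩
      · rintro ⟨H1, H2, H3⟩ q hq -
        simp only [codeEquations, List.mem_append, List.mem_ofFn] at hq
        rcases hq with (⟨i, rfl⟩ | ⟨v, rfl⟩) | ⟨v, rfl⟩
        exacts [H1 i, H2 v, H3 v]
    rw [← c1, c5, ← c2, ← c3]
    exact ⟨fun H => ⟨H.1.card, H.2, H.1.vertex⟩, fun H => ⟨⟨fun x => congrArg l
      (hp.2 (Tangle.codeEdge_opp x)), H.1, H.2.2⟩, H.2.1⟩⟩
  have hfactor : ∀ c : CodeDart t b ⊕ Fin n → Color, (∀ x, c (A.opp x) = c x) →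
      (fun x => c (Function.surjInv hsurj (p x))) = c := fun c hc => funext fun x => by
    by_cases hne : Function.surjInv hsurj (p x) = x
    · rw [hne]
    · have : A.opp x = Function.surjInv hsurj (p x) :=
        Tangle.ofCode_opp_eq hne (hp.1 (Function.surjInv_eq hsurj (p x)))
      exact (congrArg c this.symm).trans (hc x)
  rw [codeCount, countColorings_eq, ← Finset.card_filter, ← Fintype.card_subtype,
    ← Nat.card_eq_fintype_card]
  refine (Nat.card_congr
    { toFun := fun l => ⟨fun x => l.1 (p x), (key l.1).2 l.2⟩
      invFun := fun c => ⟨fun j => c.1 (Function.surjInv hsurj j), (key _).1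
        ⟨(hfactor c.1 c.2.1.edge).symm ▸ c.2.1,
          (funext fun i => congrFun (hfactor c.1 c.2.1.edge) (.inr i)).trans c.2.2⟩⟩
      left_inv := fun l => Subtype.ext (funext fun j => ?_)
      right_inv := fun c => Subtype.ext (hfactor c.1 c.2.1.edge) }).symm
  exact congrArg l.1 (Function.surjInv_eq hsurj j)

theorem Tangle.ofCode_state (E : ℕ) (hE : ∀ x, codeEdge tri dfc leg x < E)
    (hs : ∀ j : Fin E, ∃ x, codeEdge tri dfc leg x = j) (β : Fin n → Color) :
    (ofCode bd tri dfc leg thickEdges h hbd hv).state β =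
      codeCount E tri dfc leg thickEdges fun i => mask (β i) :=
  ofCode_state_of_rename E _ _ _ _ (fun _ _ => Iff.rfl) (fun _ => rfl) hE hs β

end Code

/-- A tangle together with a formula for the number of its colorings. -/
structure CountedTangle {n : ℕ} (bd : Fin n → Bool) where
  tangle : Tangle bd
  eval : (Fin n → ℕ) → ℕ
  state_eq : ∀ b, tangle.state b = eval fun i => mask (b i)

/-- The entries of a list, continued by zeros. -/
def nthOf (l : List ℕ) : ℕ → ℕ :=
  List.rec (fun _ => 0) (fun a _ ih e => Nat.rec a (fun e' _ => ih e') e) l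

theorem nthOf_ofFn {n : ℕ} (β : Fin n → ℕ) (i : Fin n) : nthOf (List.ofFn β) i = β i := by
  induction n with
  | zero => exact i.elim0
  | succ n ih =>
    rw [List.ofFn_succ]
    refine Fin.cases rfl (fun j => ?_) i
    exact ih (fun i => β i.succ) j

/-- Test all lists of codes of colors of edges of given thickness. -/
def testAll (ws : List Bool) : (List ℕ → Bool) → Bool :=
  List.rec (fun P => P []) (fun w _ ih P => allOf (fun z => ih fun l => P (z :: l)) (masks w)) ws

theorem testAll_ofFn {n : ℕ} {ws : Fin n → Bool} {P : List ℕ → Bool}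
    (h : testAll (List.ofFn ws) P = true) {β : Fin n → ℕ} (hβ : ∀ i, β i ∈ masks (ws i)) :
    P (List.ofFn β) = true := by
  induction n generalizing P with
  | zero => exact h
  | succ n ih =>
    rw [List.ofFn_succ] at h ⊢
    exact ih (P := fun l => P (β 0 :: l)) (allOf_eq _ _ |>.1 h _ (hβ 0)) fun i => hβ i.succ

section

variable {n : ℕ} {bd : Fin (n + 1) → Bool}

/-- A linear combination of the state sums of tangles, for the colors on the boundary with the
codes `l`. -/
def evalSum (L : List (ℕ × CountedTangle bd)) (l : List ℕ) : ℕ :=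
  List.rec 0 (fun q _ r => Nat.add (Nat.mul q.1 (q.2.eval fun i => nthOf l i)) r) L

theorem evalSum_ofFn (L : List (ℕ × CountedTangle bd)) (b : Fin (n + 1) → Color) :
    evalSum L (List.ofFn fun i => mask (b i)) = (L.map fun q => q.1 * q.2.tangle.state b).sum := by
  induction L with
  | nil => rfl
  | cons q L ih =>
    rw [List.map_cons, List.sum_cons, ← ih, q.2.state_eq]
    simp only [evalSum, nthOf_ofFn]
    rfl

/-- The two sides of a relation have the same colorings for all colors on the boundary.  By
symmetry, the first color is given. -/
def testRelation (L R : List (ℕ × CountedTangle bd)) : Bool :=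
  testAll (List.ofFn fun i => bd i.succ) fun l =>
    (evalSum L (Bool.rec 1 3 (bd 0) :: l)).beq (evalSum R (Bool.rec 1 3 (bd 0) :: l))

theorem exists_perm_mask : ∀ (w : Bool) (a : Color), a.card = (if w then 2 else 1) →
    ∃ σ : Perm (Fin 4), mask (a.map σ.toEmbedding) = Bool.rec 1 3 w := by decide +kernel

theorem OuterTangle.sum_t4_glue (O : OuterTangle bd) (L : List (ℕ × CountedTangle bd)) :
    (L.map fun q => q.1 * (O.glue q.2.tangle).t4).sum =
      ∑ b, O.toTangle.state b * (L.map fun q => q.1 * q.2.tangle.state b).sum := by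
  induction L with
  | nil => simp
  | cons q L ih =>
    simp only [List.map_cons, List.sum_cons, ih, mul_add, Finset.sum_add_distrib]
    rw [OuterTangle.t4_glue, Finset.mul_sum]
    simp only [mul_left_comm]

/-- A linear relation between numbers of colorings that holds for all colors on the boundary of a
disc gives a relation between the Tait numbers of the webs that agree outside the disc. -/
theorem OuterTangle.t4_relation (O : OuterTangle bd) (L R : List (ℕ × CountedTangle bd))
    (h : testRelation L R = true) : (L.map fun q => q.1 * (O.glue q.2.tangle).t4).sum =
      (R.map fun q => q.1 * (O.glue q.2.tangle).t4).sum := by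
  rw [O.sum_t4_glue, O.sum_t4_glue]
  refine Finset.sum_congr rfl fun b _ => ?_
  by_cases hb : ∀ i, (b i).card = if bd i then 2 else 1
  · congr 1
    -- a permutation of the pigments takes the first color to the one that is tested
    obtain ⟨σ, hσ⟩ := exists_perm_mask (bd 0) (b 0) (hb 0)
    have h1 : ∀ L : List (ℕ × CountedTangle bd), (L.map fun q => q.1 * q.2.tangle.state b).sum =
        evalSum L (Bool.rec 1 3 (bd 0) :: List.ofFn fun i : Fin n =>
          mask ((b i.succ).map σ.toEmbedding)) := fun L => by
      rw [← hσ, ← List.ofFn_succ (f := fun i => mask ((b i).map σ.toEmbedding)), evalSum_ofFn]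
      simp only [Tangle.state_map]
    rw [h1, h1]
    exact Nat.eq_of_beq_eq_true (testAll_ofFn h fun i =>
      mask_mem_masks _ _ (by rw [Finset.card_map, hb]))
  · rw [Tangle.state_eq_zero _ hb, zero_mul, zero_mul]

end

namespace CountedTangle

set_option maxRecDepth 100000

/-! The tangles of the relations, with their numbers of edges.  In the codes of
`Tangle.vertical21v12DefectBottom` and `Tangle.horizontal21v12DefectBottom` the edges are not
numbered consecutively, so they are renamed. -/

def edge1 : CountedTangle ![false, false] :=
  ⟨.edge1, _, Tangle.ofCode_state 1 (by decide) (by decide)⟩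

def edge2 : CountedTangle ![true, true] :=
  ⟨.edge2, _, Tangle.ofCode_state 1 (by decide) (by decide)⟩

def edge2TwoDefects : CountedTangle ![true, true] :=
  ⟨.edge2TwoDefects, _, Tangle.ofCode_state 3 (by decide) (by decide)⟩

def lollipop : CountedTangle ![true] :=
  ⟨.lollipop, _, Tangle.ofCode_state 2 (by decide) (by decide)⟩

def digon11 : CountedTangle ![true, true] :=
  ⟨.digon11, _, Tangle.ofCode_state 4 (by decide) (by decide)⟩

def digon22 : CountedTangle ![true, true] :=
  ⟨.digon22, _, Tangle.ofCode_state 4 (by decide) (by decide)⟩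

def digon12 : CountedTangle ![false, false] :=
  ⟨.digon12, _, Tangle.ofCode_state 4 (by decide) (by decide)⟩

def digon12Defect : CountedTangle ![false, false] :=
  ⟨.digon12Defect, _, Tangle.ofCode_state 5 (by decide) (by decide)⟩

def vertex222 : CountedTangle ![true, true, true] :=
  ⟨.vertex222, _, Tangle.ofCode_state 3 (by decide) (by decide)⟩

def vertex222Defect0 : CountedTangle ![true, true, true] :=
  ⟨.vertex222Defect0, _, Tangle.ofCode_state 4 (by decide) (by decide)⟩

def vertex222Defect1 : CountedTangle ![true, true, true] :=
  ⟨.vertex222Defect1, _, Tangle.ofCode_state 4 (by decide) (by decide)⟩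

def vertex112 : CountedTangle ![true, false, false] :=
  ⟨.vertex112, _, Tangle.ofCode_state 3 (by decide) (by decide)⟩

def triangle111 : CountedTangle ![true, true, true] :=
  ⟨.triangle111, _, Tangle.ofCode_state 6 (by decide) (by decide)⟩

def triangle222 : CountedTangle ![true, true, true] :=
  ⟨.triangle222, _, Tangle.ofCode_state 6 (by decide) (by decide)⟩

def triangle112 : CountedTangle ![true, false, false] :=
  ⟨.triangle112, _, Tangle.ofCode_state 6 (by decide) (by decide)⟩

def triangle221 : CountedTangle ![true, false, false] :=
  ⟨.triangle221, _, Tangle.ofCode_state 6 (by decide) (by decide)⟩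

def vertical11 : CountedTangle ![false, false, false, false] :=
  ⟨.vertical11, _, Tangle.ofCode_state 2 (by decide) (by decide)⟩

def horizontal11 : CountedTangle ![false, false, false, false] :=
  ⟨.horizontal11, _, Tangle.ofCode_state 2 (by decide) (by decide)⟩

def verticalDumbbell : CountedTangle ![false, false, false, false] :=
  ⟨.verticalDumbbell, _, Tangle.ofCode_state 5 (by decide) (by decide)⟩

def horizontalDumbbell : CountedTangle ![false, false, false, false] :=
  ⟨.horizontalDumbbell, _, Tangle.ofCode_state 5 (by decide) (by decide)⟩

def verticalDumbbellDefect : CountedTangle ![false, false, false, false] :=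
  ⟨.verticalDumbbellDefect, _, Tangle.ofCode_state 6 (by decide) (by decide)⟩

def horizontalDumbbellDefect : CountedTangle ![false, false, false, false] :=
  ⟨.horizontalDumbbellDefect, _, Tangle.ofCode_state 6 (by decide) (by decide)⟩

def square1212 : CountedTangle ![false, false, false, false] :=
  ⟨.square1212, _, Tangle.ofCode_state 8 (by decide) (by decide)⟩

def vertical12 : CountedTangle ![false, false, true, true] :=
  ⟨.vertical12, _, Tangle.ofCode_state 2 (by decide) (by decide)⟩

def square2111 : CountedTangle ![false, false, true, true] :=
  ⟨.square2111, _, Tangle.ofCode_state 8 (by decide) (by decide)⟩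

def square1222 : CountedTangle ![false, false, true, true] :=
  ⟨.square1222, _, Tangle.ofCode_state 8 (by decide) (by decide)⟩

def vertical12v12 : CountedTangle ![false, false, true, true] :=
  ⟨.vertical12v12, _, Tangle.ofCode_state 5 (by decide) (by decide)⟩

def vertical12v12Defects : CountedTangle ![false, false, true, true] :=
  ⟨.vertical12v12Defects, _, Tangle.ofCode_state 7 (by decide) (by decide)⟩

def horizontal11v22 : CountedTangle ![false, false, true, true] :=
  ⟨.horizontal11v22, _, Tangle.ofCode_state 5 (by decide) (by decide)⟩

def square1221 : CountedTangle ![true, false, true, false] :=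
  ⟨.square1221, _, Tangle.ofCode_state 8 (by decide) (by decide)⟩

def vertical21v12Defects : CountedTangle ![true, false, true, false] :=
  ⟨.vertical21v12Defects, _, Tangle.ofCode_state 7 (by decide) (by decide)⟩

def vertical21v12DefectTop : CountedTangle ![true, false, true, false] :=
  ⟨.vertical21v12DefectTop, _, Tangle.ofCode_state 6 (by decide) (by decide)⟩

def vertical21v12DefectBottom : CountedTangle ![true, false, true, false] :=
  ⟨.vertical21v12DefectBottom, _, Tangle.ofCode_state_of_rename 6 ![![0, 4, 3], ![1, 5, 4]] ![![2, 5]]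
    ![0, 1, 2, 3] [0, 2, 5] (by decide) (by decide) (by decide) (by decide)⟩

def horizontal21v12Defects : CountedTangle ![true, false, true, false] :=
  ⟨.horizontal21v12Defects, _, Tangle.ofCode_state 7 (by decide) (by decide)⟩

def horizontal21v12DefectTop : CountedTangle ![true, false, true, false] :=
  ⟨.horizontal21v12DefectTop, _, Tangle.ofCode_state 6 (by decide) (by decide)⟩

def horizontal21v12DefectBottom : CountedTangle ![true, false, true, false] :=
  ⟨.horizontal21v12DefectBottom, _, Tangle.ofCode_state_of_rename 6 ![![0, 1, 4], ![5, 3, 4]]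
    ![![2, 5]] ![0, 1, 2, 3] [0, 2, 5] (by decide) (by decide) (by decide) (by decide)⟩

def square2222 : CountedTangle ![true, true, true, true] :=
  ⟨.square2222, _, Tangle.ofCode_state 8 (by decide) (by decide)⟩

def vertical22 : CountedTangle ![true, true, true, true] :=
  ⟨.vertical22, _, Tangle.ofCode_state 2 (by decide) (by decide)⟩

def horizontal22 : CountedTangle ![true, true, true, true] :=
  ⟨.horizontal22, _, Tangle.ofCode_state 2 (by decide) (by decide)⟩

def vertical22Defects : CountedTangle ![true, true, true, true] :=
  ⟨.vertical22Defects, _, Tangle.ofCode_state 4 (by decide) (by decide)⟩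

def horizontal22Defects : CountedTangle ![true, true, true, true] :=
  ⟨.horizontal22Defects, _, Tangle.ofCode_state 4 (by decide) (by decide)⟩

end CountedTangle

/-! ### The relations for the Tait number -/

namespace WebDiagram

theorem isWebInvariant_t4 : IsWebInvariant fun Γ => (Γ.t4 : ℤ) where
  isomorphic _ _ _ _ h := congrArg Nat.cast h.t4_eq
  subdivide Γ d _ := congrArg Nat.cast (Γ.t4_subdivide d)

theorem satisfiesWebRelations_t4 : SatisfiesWebRelations fun Γ => (Γ.t4 : ℤ) where
  empty := congrArg Nat.cast t4_empty
  disjoint_union Γ S hrot hopp _ := by rw [Γ.t4_restrict S hrot hopp, Nat.cast_mul]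
  circle1 := by
    rw [t4_circle, Nat.card_eq_fintype_card]; exact congrArg Nat.cast (by decide +kernel : _ = 4)
  circle2 := by
    rw [t4_circle, Nat.card_eq_fintype_card]; exact congrArg Nat.cast (by decide +kernel : _ = 6)
  circle2Defect := by
    rw [t4_circle, Nat.card_eq_fintype_card]; exact congrArg Nat.cast (by decide +kernel : _ = 0)
  lollipop O _ := by
    have := O.t4_relation [(1, .lollipop)]
      [] (by decide +kernel)
    simp only [List.map_cons, List.map_nil, List.sum_cons, List.sum_nil, one_mul, add_zero] at this
    exact_mod_cast this
  defects_cancel O _ := by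
    have := O.t4_relation [(1, .edge2TwoDefects)]
      [(1, .edge2)] (by decide +kernel)
    simp only [List.map_cons, List.map_nil, List.sum_cons, List.sum_nil, one_mul, add_zero] at this
    exact_mod_cast this
  defect_moves O _ := by
    have := O.t4_relation [(1, .vertex222Defect0)]
      [(1, .vertex222Defect1)] (by decide +kernel)
    simp only [List.map_cons, List.map_nil, List.sum_cons, List.sum_nil, one_mul, add_zero] at this
    exact_mod_cast this
  digon11 O _ := by
    have := O.t4_relation [(1, .digon11)]
      [(2, .edge2)] (by decide +kernel)
    simp only [List.map_cons, List.map_nil, List.sum_cons, List.sum_nil, one_mul, add_zero] at this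
    exact_mod_cast this
  digon22 O _ := by
    have := O.t4_relation [(1, .digon22)]
      [(4, .edge2)] (by decide +kernel)
    simp only [List.map_cons, List.map_nil, List.sum_cons, List.sum_nil, one_mul, add_zero] at this
    exact_mod_cast this
  digon12 O _ := by
    have := O.t4_relation [(1, .digon12)]
      [(3, .edge1)] (by decide +kernel)
    simp only [List.map_cons, List.map_nil, List.sum_cons, List.sum_nil, one_mul, add_zero] at this
    exact_mod_cast this
  digon12Defect O _ := by
    have := O.t4_relation [(1, .digon12Defect)]
      [] (by decide +kernel)
    simp only [List.map_cons, List.map_nil, List.sum_cons, List.sum_nil, one_mul, add_zero] at this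
    exact_mod_cast this
  crossing O _ := by
    have := O.t4_relation [(1, .verticalDumbbellDefect)]
      [(1, .horizontalDumbbellDefect)] (by decide +kernel)
    simp only [List.map_cons, List.map_nil, List.sum_cons, List.sum_nil, one_mul, add_zero] at this
    exact_mod_cast this
  triangle111 O _ := by
    have := O.t4_relation [(1, .triangle111)]
      [(1, .vertex222)] (by decide +kernel)
    simp only [List.map_cons, List.map_nil, List.sum_cons, List.sum_nil, one_mul, add_zero] at this
    exact_mod_cast this
  triangle222 O _ := by
    have := O.t4_relation [(1, .triangle222)]
      [(2, .vertex222)] (by decide +kernel)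
    simp only [List.map_cons, List.map_nil, List.sum_cons, List.sum_nil, one_mul, add_zero] at this
    exact_mod_cast this
  triangle112 O _ := by
    have := O.t4_relation [(1, .triangle112)]
      [(1, .vertex112)] (by decide +kernel)
    simp only [List.map_cons, List.map_nil, List.sum_cons, List.sum_nil, one_mul, add_zero] at this
    exact_mod_cast this
  triangle221 O _ := by
    have := O.t4_relation [(1, .triangle221)]
      [(2, .vertex112)] (by decide +kernel)
    simp only [List.map_cons, List.map_nil, List.sum_cons, List.sum_nil, one_mul, add_zero] at this
    exact_mod_cast this
  square2111 O _ := by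
    have := O.t4_relation [(1, .square2111)]
      [(1, .vertical12v12Defects), (1, .vertical12)] (by decide +kernel)
    simp only [List.map_cons, List.map_nil, List.sum_cons, List.sum_nil, one_mul, add_zero] at this
    exact_mod_cast this
  square1222 O _ := by
    have := O.t4_relation [(1, .square1222)]
      [(1, .square2111), (1, .vertical12v12)] (by decide +kernel)
    simp only [List.map_cons, List.map_nil, List.sum_cons, List.sum_nil, one_mul, add_zero] at this
    exact_mod_cast this
  square1212 O _ := by
    have := O.t4_relation [(1, .square1212)]
      [(1, .vertical11), (2, .horizontal11)] (by decide +kernel)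
    simp only [List.map_cons, List.map_nil, List.sum_cons, List.sum_nil, one_mul, add_zero] at this
    exact_mod_cast this
  square1221 O _ := by
    have := O.t4_relation [(1, .square1221)]
      [(1, .horizontal21v12Defects), (1, .vertical21v12Defects)] (by decide +kernel)
    simp only [List.map_cons, List.map_nil, List.sum_cons, List.sum_nil, one_mul, add_zero] at this
    exact_mod_cast this
  square2222 O _ := by
    have := O.t4_relation [(1, .square2222)]
      [(2, .vertical22), (2, .horizontal22), (2, .vertical22Defects), (2, .horizontal22Defects)] (by decide +kernel)
    simp only [List.map_cons, List.map_nil, List.sum_cons, List.sum_nil, one_mul, add_zero] at this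
    simp only [mul_add, add_assoc]
    exact_mod_cast this

theorem satisfiesTutteRelations_t4 : SatisfiesTutteRelations fun Γ => (Γ.t4 : ℤ) where
  tutte1 O _ := by
    have := O.t4_relation [(1, .verticalDumbbell), (1, .horizontal11)]
      [(1, .horizontalDumbbell), (1, .vertical11)] (by decide +kernel)
    simp only [List.map_cons, List.map_nil, List.sum_cons, List.sum_nil, one_mul, add_zero] at this
    exact_mod_cast this
  tutte2 O _ := by
    have := O.t4_relation [(1, .vertical12v12), (1, .vertical12v12Defects)]
      [(1, .vertical12), (1, .horizontal11v22)] (by decide +kernel)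
    simp only [List.map_cons, List.map_nil, List.sum_cons, List.sum_nil, one_mul, add_zero] at this
    exact_mod_cast this
  tutte3 O _ := by
    have := O.t4_relation [(1, .horizontal21v12DefectTop), (1, .horizontal21v12DefectBottom)]
      [(1, .vertical21v12DefectTop), (1, .vertical21v12DefectBottom)] (by decide +kernel)
    simp only [List.map_cons, List.map_nil, List.sum_cons, List.sum_nil, one_mul, add_zero] at this
    exact_mod_cast this

end WebDiagram

theorem mainTheorem7 :
    (IsWebInvariant (fun Γ => (Γ.t4 : ℤ)) ∧ SatisfiesWebRelations (fun Γ => (Γ.t4 : ℤ)) ∧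
      SatisfiesTutteRelations (fun Γ => (Γ.t4 : ℤ))) ∧
    ∀ f : WebDiagram → ℤ,
      IsWebInvariant f → SatisfiesWebRelations f → SatisfiesTutteRelations f →
        ∀ Γ : WebDiagram, Γ.IsPlane → f Γ = Γ.t4 :=
  ⟨⟨WebDiagram.isWebInvariant_t4, WebDiagram.satisfiesWebRelations_t4,
    WebDiagram.satisfiesTutteRelations_t4⟩, fun _ h1 h2 h3 _ H =>
    WebDiagram.value_eq ⟨h1, h2, h3⟩ ⟨WebDiagram.isWebInvariant_t4,
      WebDiagram.satisfiesWebRelations_t4, WebDiagram.satisfiesTutteRelations_t4⟩ H⟩
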